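/- Let $-\infty\le a<b\le\infty$ and let $V:(a,b)\to\mathbb R$ be continuous and either convex or concave; if $a=-\infty$, assume also $V(x)\to\infty$ as $x\to-\infty$. For $t\in(a,b]$ put $$\lambda(t)=\inf\Big\{E_t(u)=\int_a^t \big(u_x^2+Vu^2\big)\,dx \;:\; u\in H^1_0(a,t),\ Vu^2\in L^1(a,t),\ \|u\|_{L^2(a,t)}=1\Big\}\in[-\infty,\infty).$$ If $a>-\infty$ and $V$ is concave and not convex, assume moreover that $\lambda(t)>-\infty$ for all $t\in(a,b)$ (this is automatic if $V$ is bounded below near $a$). Let $D$ be the set of real $t\in(a,b]$ with $\lambda(t)>-\infty$, and let $T$ be the interval $(a,b)$, together with the point $b$ if $b<\infty$ and $V$ is integrable near $b$. Then: 1. $(a,b)\subset T\subset D$; if $V$ is convex, $D$ contains every real $t\in(a,b]$. The function $\lambda$ is real-valued on $D$. For every real $t\in(a,b]$ such that $V$ is bounded below on $(a,t)$ (which is automatic if $V$ is convex, or if $a=-\infty$ and $t<b$), there is a unique (up to null sets) positive minimizer $u$ of $E_t$ among the functions above, so $\lambda(t)=E_t(u)$. 2. The map $t\mapsto\lambda(t)$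 is twice differentiable on $T$ (one-sidedly at $b$ if $b\in T$). 3. The map $t\mapsto\lambda(t)$ is strictly decreasing on $(a,b]$ (as a map into $[-\infty,\infty)$, the point $t=b$ being included also if $b=\infty$), and $\lim_{t\to a}\lambda(t)=\infty$. 4. If $V$ is convex, then $\lambda$ is convex on $D$. If $V$ is convex, $a>-\infty$, and $V$ is not affine on $(a,b)$, then $\lambda$ is strictly convex on $D$. If $V$ is convex and $a=-\infty$, then $\lambda$ is strictly convex on the interval of all $t\in D$ such that $V$ is not affine on $(-\infty,t)$. 5. If $a=-\infty$ and $V$ is concave, then $\lambda$ is concave on $D$, and strictly concave on the interval of all $t\in D$ such that $V$ is not affine on $(-\infty,t)$. -/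

import Mathlib

open Set Filter Topology MeasureTheory
open scoped ContDiff

namespace GroundState

/-- The open interval `(a, t)` of real numbers, with endpoints in `[-∞, ∞]`. -/
def interval (a t : EReal) : Set ℝ := {x : ℝ | a < (x : EReal) ∧ (x : EReal) < t}

/-- `u ∈ H¹₀(Ω)` with weak derivative `g`: the pair `(u, g)` lies in `L²(Ω) × L²(Ω)` and is the
limit there of `(φₙ, φₙ')` for smooth functions `φₙ` with compact support in `Ω`, that is, `u` is
in the `H¹`-closure of `C_c^∞(Ω)`. -/
def MemH10 (Ω : Set ℝ) (u g : ℝ → ℝ) : Prop :=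
  MemLp u 2 (volume.restrict Ω) ∧ MemLp g 2 (volume.restrict Ω) ∧
    ∃ φ : ℕ → ℝ → ℝ,
      (∀ n, ContDiff ℝ ∞ (φ n) ∧ HasCompactSupport (φ n) ∧ tsupport (φ n) ⊆ Ω) ∧
      Tendsto (fun n => eLpNorm (fun x => φ n x - u x) 2 (volume.restrict Ω)) atTop (𝓝 0) ∧
      Tendsto (fun n => eLpNorm (fun x => deriv (φ n) x - g x) 2 (volume.restrict Ω)) atTop (𝓝 0)

/-- The competitors: `u ∈ H¹₀(a, t)` with weak derivative `g`, with `L²` norm one and with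
`V u²` integrable (so that the energy is a finite number). -/
def Admissible (V : ℝ → ℝ) (a t : EReal) (u g : ℝ → ℝ) : Prop :=
  MemH10 (interval a t) u g ∧
    IntegrableOn (fun x => V x * u x ^ 2) (interval a t) ∧
    ∫ x in interval a t, u x ^ 2 = 1

/-- The energy `E_t(u) = ∫_a^t u_x² + V u² dx`, where `g = u_x`. -/
noncomputable def energy (V : ℝ → ℝ) (a t : EReal) (u g : ℝ → ℝ) : ℝ :=
  ∫ x in interval a t, (g x ^ 2 + V x * u x ^ 2)

/-- The ground state energy `λ(t)` on `(a, t)`: the infimum, in `[-∞, ∞]`, of the energy over all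
competitors. -/
noncomputable def groundEnergy (V : ℝ → ℝ) (a t : EReal) : EReal :=
  sInf {e : EReal | ∃ u g : ℝ → ℝ, Admissible V a t u g ∧ e = (energy V a t u g : EReal)}

/-- `u` is a positive minimizer of the energy on `(a, t)`; in particular `λ(t) = E_t(u)`. -/
def IsPositiveMinimizer (V : ℝ → ℝ) (a t : EReal) (u : ℝ → ℝ) : Prop :=
  (∀ᵐ x ∂(volume.restrict (interval a t)), 0 < u x) ∧
    ∃ g : ℝ → ℝ, Admissible V a t u g ∧ (energy V a t u g : EReal) = groundEnergy V a t

/-- The real-valued function `t ↦ λ(t)`, meaningful where `λ(t)` is finite. -/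
noncomputable def lam (V : ℝ → ℝ) (a : EReal) (t : ℝ) : ℝ := (groundEnergy V a (t : EReal)).toReal

/-- The real `t ∈ (a, b]` with `λ(t) > -∞`. -/
def finiteDomain (V : ℝ → ℝ) (a b : EReal) : Set ℝ :=
  {t : ℝ | a < (t : EReal) ∧ (t : EReal) ≤ b ∧ groundEnergy V a (t : EReal) ≠ ⊥}

/-- The interval `(a, b)`, together with `b` if `b` is finite and `V` is integrable near `b`. -/
def regularDomain (V : ℝ → ℝ) (a b : EReal) : Set ℝ :=
  {t : ℝ | a < (t : EReal) ∧ ((t : EReal) < b ∨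
    ((t : EReal) = b ∧ ∃ c : ℝ, a < (c : EReal) ∧ c < t ∧ IntegrableOn V (Ioo c t)))}

/-- `V` is affine on the interval `(a, t)`. -/
def AffineBetween (V : ℝ → ℝ) (a t : EReal) : Prop :=
  ∃ p q : ℝ, ∀ x ∈ interval a t, V x = p * x + q

end GroundState

/-! ### Intervals, a Sobolev bound, and smooth truncations. -/

namespace GroundState

/-! The proof reads `λ(t)` off the equation `y'' = (V - E) y`. A positive solution on `(a, t)` gives
`E ≤ λ(t)`, by completing the square with `ψ = y'/y` (`jacobi_le`). A solution with zeros `x₁ < x₂`,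
positive between them, gives `λ(x₂) ≤ E` (`groundEnergy_le_of_zeros`). Hence, if `E < λ(s)` for all
`s < t`, a nontrivial solution has at most one zero in `(a, t)`, and the solutions vanishing at `s`
converge, as `s → a`, to a positive solution with `∫ y⁻² = ∞` at `a` (`exists_principal`). Being
principal in this sense replaces the Dirichlet condition at `a`, which may be infinite or a singular
point of `V`.

Regularity. Fix `t₁` and `E₁ < λ(t₁)`, and let `y` be the principal solution of energy `E₁`.
Solutions of energy `E₁ + μ` are sought as `y R`, where `R = 1 + μ K R` with `K f(x) = -∫_c^x y⁻²
∫_a^ξ y² f`. Convexity or concavity of `V` (at `-∞`, its growth) makes `y` decay at `a` in such a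
way that `K` is as small as desired in a weighted supremum norm, so `R` depends differentiably on
`μ`. For `λ(t) = E₁ + μ` the first zero of `R μ` is `t` (`Family.ground_state`). A Wronskian
identity then yields Hadamard's formula `λ'(t) = -f'(t)²` for the normalized ground state `f`
(`Family.hasDerivWithinAt_lam`), in a form whose right side can be differentiated once more. Strict
decrease and the limit at `a` come from the same family.

Minimizers. Let `f` be a positive solution at the energy `λ(t)`. Jacobi's inequality forces a
minimizing sequence `φ n` of test functions to satisfy `(φ n / f)' → 0` locally in `L²`, so it
subconverges to a multiple of `f`. A lower bound for `V`, with growth at `-∞`, prevents loss of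
mass, and the parallelogram law upgrades the convergence to the energy (`PositiveSolution.limit`).
Every minimizer is reached by such a sequence, which gives uniqueness.

Convexity. For `s < t` let `h` and `f` be the normalized ground states on `(a, s)` and `(a, t)`.
Since `λ(s) > λ(t)`, their Wronskian is positive and `f / h` increases, so `f² - h²` changes sign
exactly once. The identity `f'(t)² = [f'² - (V - E) f²](x) - ∫_x^t V' f²`, its analogue for `h`, and
Chebyshev's inequality for the monotone function `V'` compare `f'(t)²` with `h'(s)²`, that is,
`λ'(t)` with `λ'(s)`. The boundary terms at `a` are controlled by `ModePair.exists_remainder` and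
`Mode.frequently_neg_lt_virial`. -/

lemma isOpen_interval (a t : EReal) : IsOpen (interval a t) :=
  (isOpen_Ioo (a := a) (b := t)).preimage continuous_coe_real_ereal

lemma measurableSet_interval (a t : EReal) : MeasurableSet (interval a t) :=
  (isOpen_interval a t).measurableSet

lemma interval_mono {a t t' : EReal} (h : t ≤ t') : interval a t ⊆ interval a t' :=
  fun _ hx => ⟨hx.1, hx.2.trans_le h⟩

lemma ordConnected_interval (a t : EReal) : OrdConnected (interval a t) :=
  ⟨fun _ hx _ hy _ hz => ⟨hx.1.trans_le (EReal.coe_le_coe_iff.2 hz.1),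
    (EReal.coe_le_coe_iff.2 hz.2).trans_lt hy.2⟩⟩

lemma Icc_subset_interval {a t : EReal} {x y : ℝ} (hx : x ∈ interval a t) (hy : y ∈ interval a t) :
    Icc x y ⊆ interval a t := (ordConnected_interval a t).out hx hy

lemma convex_interval (a t : EReal) : Convex ℝ (interval a t) :=
  (ordConnected_interval a t).convex

/-- Smooth functions with compact support in `Ω`. -/
def IsTest (Ω : Set ℝ) (φ : ℝ → ℝ) : Prop :=
  ContDiff ℝ ∞ φ ∧ HasCompactSupport φ ∧ tsupport φ ⊆ Ω

lemma hasCompactSupport_sq {φ : ℝ → ℝ} (h : HasCompactSupport φ) :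
    HasCompactSupport (fun x => φ x ^ 2) := by
  simpa [Function.comp_def] using h.comp_left (g := fun s : ℝ => s ^ 2) (by simp)

/-- The one-dimensional Sobolev bound, from `φ(x)² = ∫_{-∞}^x 2 φ φ'`. It turns convergence in `H¹`
into uniform convergence. -/
lemma sq_le_integral_sq_add {φ : ℝ → ℝ} (h1 : ContDiff ℝ 1 φ) (h2 : HasCompactSupport φ) (x : ℝ) :
    φ x ^ 2 ≤ (∫ y, φ y ^ 2) + ∫ y, deriv φ y ^ 2 := by
  have hd : Continuous (deriv φ) := h1.continuous_deriv le_rfl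
  have i1 : Integrable (fun y => φ y ^ 2) :=
    (h1.continuous.pow 2).integrable_of_hasCompactSupport (hasCompactSupport_sq h2)
  have i2 : Integrable (fun y => deriv φ y ^ 2) :=
    (hd.pow 2).integrable_of_hasCompactSupport (hasCompactSupport_sq h2.deriv)
  have key := HasCompactSupport.integral_Iic_deriv_eq (h1.pow 2) (hasCompactSupport_sq h2) x
  have hder : ∀ y, deriv (φ ^ 2) y = 2 * φ y * deriv φ y := fun y => by
    have := ((h1.differentiable one_ne_zero).differentiableAt (x := y)).hasDerivAt.pow 2
    rw [this.deriv]; simp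
  have : φ x ^ 2 = ∫ y in Iic x, 2 * φ y * deriv φ y := by
    rw [← setIntegral_congr_fun measurableSet_Iic (fun y _ => hder y)]; exact key.symm
  rw [this, ← integral_add i1 i2]
  calc ∫ y in Iic x, 2 * φ y * deriv φ y
      ≤ ∫ y in Iic x, (φ y ^ 2 + deriv φ y ^ 2) := by
        refine setIntegral_mono ?_ (i1.add i2).integrableOn ?_
        · refine (Continuous.integrable_of_hasCompactSupport
            ((continuous_const.mul h1.continuous).mul hd) ?_).integrableOn
          exact h2.deriv.mul_left
        · intro y; nlinarith [sq_nonneg (φ y - deriv φ y)]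
    _ ≤ ∫ y, (φ y ^ 2 + deriv φ y ^ 2) :=
        setIntegral_le_integral (i1.add i2) (ae_of_all _ fun y => by positivity)

lemma setIntegral_eq_integral_of_tsupport {Ω : Set ℝ} {φ f : ℝ → ℝ} (h : tsupport φ ⊆ Ω)
    (hf : ∀ x, x ∉ tsupport φ → f x = 0) : ∫ x in Ω, f x = ∫ x, f x :=
  setIntegral_eq_integral_of_forall_compl_eq_zero fun x hx => hf x fun h' => hx (h h')

lemma deriv_eq_zero_of_notMem_tsupport {φ : ℝ → ℝ} {x : ℝ} (h : x ∉ tsupport φ) :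
    deriv φ x = 0 :=
  image_eq_zero_of_notMem_tsupport (fun h' => h (tsupport_deriv_subset h'))

lemma eLpNorm_two_eq {α : Type*} [MeasurableSpace α] {μ : Measure α} {f : α → ℝ}
    (hf : MemLp f 2 μ) : eLpNorm f 2 μ = ENNReal.ofReal (Real.sqrt (∫ x, f x ^ 2 ∂μ)) := by
  rw [hf.eLpNorm_eq_integral_rpow_norm (by norm_num) (by norm_num)]
  congr 1
  rw [Real.sqrt_eq_rpow]
  norm_num

lemma tendsto_eLpNorm_two_iff {α : Type*} [MeasurableSpace α] {μ : Measure α} {f : ℕ → α → ℝ}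
    (hf : ∀ n, MemLp (f n) 2 μ) :
    Tendsto (fun n => eLpNorm (f n) 2 μ) atTop (𝓝 0) ↔
      Tendsto (fun n => ∫ x, f n x ^ 2 ∂μ) atTop (𝓝 0) := by
  simp_rw [fun n => eLpNorm_two_eq (hf n)]
  constructor
  · intro h
    have h1 := (ENNReal.tendsto_toReal ENNReal.zero_ne_top).comp h
    have h2 : Tendsto (fun n => Real.sqrt (∫ x, f n x ^ 2 ∂μ)) atTop (𝓝 0) := by
      refine h1.congr fun n => ?_
      simp [ENNReal.toReal_ofReal (Real.sqrt_nonneg _)]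
    have h3 := h2.pow 2
    simp only [ne_eq, OfNat.ofNat_ne_zero, not_false_eq_true, zero_pow] at h3
    exact h3.congr fun n => Real.sq_sqrt (integral_nonneg fun x => sq_nonneg _)
  · intro h
    have h1 := (Real.continuous_sqrt.tendsto 0).comp h
    rw [Real.sqrt_zero] at h1
    simpa [Function.comp_def] using (ENNReal.continuous_ofReal.tendsto 0).comp h1

/-- `θ` is the primitive of a smooth cutoff `χ` that vanishes on `[-1, 1]` and equals one outside
`[-2, 2]`. The number 4 is the length of `[-2, 2]`, where `1 - χ` lives. -/
lemma exists_truncation : ∃ θ : ℝ → ℝ, ContDiff ℝ ∞ θ ∧ (∀ s, |deriv θ s| ≤ 1) ∧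
    (∀ s, |s| ≤ 1 → θ s = 0) ∧ (∀ s, |θ s| ≤ |s|) ∧ ∀ s, |θ s - s| ≤ 4 := by
  set χ : ℝ → ℝ := fun s => Real.smoothTransition (s ^ 2 - 1) with hχ
  have hχs : ContDiff ℝ ∞ χ :=
    Real.smoothTransition.contDiff.comp ((contDiff_id.pow 2).sub contDiff_const)
  have h0 : ∀ s, 0 ≤ χ s := fun s => Real.smoothTransition.nonneg _
  have h1 : ∀ s, χ s ≤ 1 := fun s => Real.smoothTransition.le_one _
  have hc : Continuous χ := hχs.continuous
  have hder : ∀ s, HasDerivAt (fun s => ∫ y in (0:ℝ)..s, χ y) (χ s) s := fun s =>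
    intervalIntegral.integral_hasDerivAt_right (hc.intervalIntegrable _ _)
      (hc.stronglyMeasurableAtFilter _ _) hc.continuousAt
  refine ⟨fun s => ∫ y in (0:ℝ)..s, χ y, ?_, ?_, ?_, ?_, ?_⟩
  · rw [contDiff_infty_iff_deriv]
    refine ⟨fun s => (hder s).differentiableAt, ?_⟩
    rw [show deriv (fun s => ∫ y in (0:ℝ)..s, χ y) = χ from funext fun s => (hder s).deriv]
    exact hχs
  · intro s
    rw [(hder s).deriv, abs_of_nonneg (h0 s)]; exact h1 s
  · intro s hs
    refine intervalIntegral.integral_zero_ae (ae_of_all _ fun y hy => ?_)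
    apply Real.smoothTransition.zero_of_nonpos
    have hy' : |y| ≤ 1 := by
      rcases le_total 0 s with h | h
      · rw [uIoc_of_le h] at hy; rw [abs_of_pos hy.1]; exact hy.2.trans ((le_abs_self s).trans hs)
      · rw [uIoc_of_ge h] at hy; rw [abs_of_nonpos hy.2]
        linarith [neg_abs_le s, hy.1]
    nlinarith [sq_abs y, abs_nonneg y]
  · intro s
    have := intervalIntegral.norm_integral_le_of_norm_le_const (a := 0) (b := s) (f := χ) (C := 1)
      (fun y _ => by rw [Real.norm_eq_abs, abs_of_nonneg (h0 y)]; exact h1 y)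
    simpa using this
  · intro s
    have e : (∫ y in (0:ℝ)..s, χ y) - s = -∫ y in (0:ℝ)..s, (1 - χ y) := by
      rw [intervalIntegral.integral_sub (by simp) (hc.intervalIntegrable _ _)]; simp
    rw [e, abs_neg]
    have hi : Integrable ((Icc (-2:ℝ) 2).indicator (fun _ => (1:ℝ))) :=
      (integrable_indicator_iff measurableSet_Icc).2 (by simp)
    calc |∫ y in (0:ℝ)..s, (1 - χ y)| ≤ ∫ y in uIoc 0 s, ‖1 - χ y‖ :=
          intervalIntegral.norm_integral_le_integral_norm_uIoc (f := fun y => 1 - χ y)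
      _ ≤ ∫ y in uIoc 0 s, (Icc (-2:ℝ) 2).indicator (fun _ => (1:ℝ)) y := by
          refine setIntegral_mono ?_ hi.integrableOn ?_
          · exact (((continuous_const.sub hc).norm.integrableOn_Icc (a := min 0 s)
              (b := max 0 s))).mono_set Ioc_subset_Icc_self
          · intro y
            by_cases hy : y ∈ Icc (-2:ℝ) 2
            · simp only [indicator_of_mem hy, Real.norm_eq_abs]
              rw [abs_le]; constructor <;> linarith [h0 y, h1 y]
            · simp only [indicator_of_notMem hy]
              have : χ y = 1 := by
                apply Real.smoothTransition.one_of_one_le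
                rw [mem_Icc, not_and_or] at hy
                rcases hy with hy | hy <;> nlinarith
              simp [this]
      _ ≤ ∫ y, (Icc (-2:ℝ) 2).indicator (fun _ => (1:ℝ)) y :=
          setIntegral_le_integral hi (ae_of_all _ fun y => indicator_nonneg (fun _ _ => zero_le_one) y)
      _ = 4 := by
          rw [integral_indicator measurableSet_Icc]; simp; norm_num

/-- A smooth truncation at height `ε`. -/
lemma exists_truncation_scale {ε : ℝ} (hε : 0 < ε) : ∃ θ : ℝ → ℝ, ContDiff ℝ ∞ θ ∧
    (∀ s, |deriv θ s| ≤ 1) ∧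
    (∀ s, |s| ≤ ε → θ s = 0) ∧ (∀ s, |θ s| ≤ |s|) ∧ ∀ s, |θ s - s| ≤ 4 * ε := by
  obtain ⟨θ, h1, h2, h3, h4, h5⟩ := exists_truncation
  refine ⟨fun s => ε * θ (s / ε), ?_, ?_, ?_, ?_, ?_⟩
  · exact contDiff_const.mul (h1.comp (contDiff_id.div_const ε))
  · intro s
    have := (((h1.differentiable (by simp)).differentiableAt (x := s / ε)).hasDerivAt.comp s
      ((hasDerivAt_id s).div_const ε)).const_mul ε
    have e : deriv (fun s => ε * θ (s / ε)) s = ε * (deriv θ (s / ε) * (1 / ε)) := this.deriv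
    rw [e]
    have : ε * (deriv θ (s / ε) * (1 / ε)) = deriv θ (s / ε) := by field_simp
    rw [this]; exact h2 _
  · intro s hs
    show ε * θ (s / ε) = 0
    rw [h3 (s / ε) (by rw [abs_div, abs_of_pos hε, div_le_one hε]; exact hs), mul_zero]
  · intro s
    rw [abs_mul, abs_of_pos hε]
    calc ε * |θ (s / ε)| ≤ ε * |s / ε| := mul_le_mul_of_nonneg_left (h4 _) hε.le
      _ = |s| := by rw [abs_div, abs_of_pos hε]; field_simp
  · intro s
    have : ε * θ (s / ε) - s = ε * (θ (s / ε) - s / ε) := by field_simp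
    rw [this, abs_mul, abs_of_pos hε, mul_comm]
    gcongr; exact h5 _

end GroundState

/-! ### Approximation of competitors by test functions. -/

namespace GroundState

lemma tendsto_integral_sq_of_tendsto_sub {α : Type*} [MeasurableSpace α] {μ : Measure α}
    {f : ℕ → α → ℝ} {u : α → ℝ} (hf : ∀ n, MemLp (f n) 2 μ) (hu : MemLp u 2 μ)
    (h : Tendsto (fun n => eLpNorm (fun x => f n x - u x) 2 μ) atTop (𝓝 0)) :
    Tendsto (fun n => ∫ x, f n x ^ 2 ∂μ) atTop (𝓝 (∫ x, u x ^ 2 ∂μ)) := by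
  have hs : ∀ n, MemLp (fun x => f n x - u x) 2 μ := fun n => (hf n).sub hu
  have h1 := (tendsto_eLpNorm_two_iff hs).1 h
  rw [tendsto_iff_norm_sub_tendsto_zero]
  set A := ∫ x, u x ^ 2 ∂μ
  have hb : ∀ n, ‖(∫ x, f n x ^ 2 ∂μ) - A‖ ≤
      (∫ x, (f n x - u x) ^ 2 ∂μ) + 2 * (Real.sqrt (∫ x, (f n x - u x) ^ 2 ∂μ) * Real.sqrt A) := by
    intro n
    have i1 := (hs n).integrable_sq
    have i3 : Integrable (fun x => u x * (f n x - u x)) μ := by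
      have := hu.integrable_mul (hs n); exact this
    have e : (∫ x, f n x ^ 2 ∂μ) - A =
        (∫ x, (f n x - u x) ^ 2 ∂μ) + 2 * ∫ x, u x * (f n x - u x) ∂μ := by
      rw [← integral_const_mul, ← integral_add i1 (i3.const_mul 2),
        ← integral_sub (hf n).integrable_sq hu.integrable_sq]
      congr 1; ext x; ring
    have cs : |∫ x, u x * (f n x - u x) ∂μ| ≤
        Real.sqrt (∫ x, (f n x - u x) ^ 2 ∂μ) * Real.sqrt A := by
      rw [← Real.sqrt_mul (integral_nonneg fun x => sq_nonneg _)]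
      apply Real.abs_le_sqrt
      -- Cauchy–Schwarz through the discriminant of the nonnegative quadratic `s ↦ ∫ (s (f - u) +
      -- u)²`.
      have hq : ∀ s : ℝ, 0 ≤ (∫ x, (f n x - u x) ^ 2 ∂μ) * (s * s) +
          (2 * ∫ x, u x * (f n x - u x) ∂μ) * s + A := by
        intro s
        have : (∫ x, (f n x - u x) ^ 2 ∂μ) * (s * s) +
          (2 * ∫ x, u x * (f n x - u x) ∂μ) * s + A = ∫ x, (s * (f n x - u x) + u x) ^ 2 ∂μ := by
          have e2 : (fun x => (s * (f n x - u x) + u x) ^ 2) = fun x =>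
            (s * s) * (f n x - u x) ^ 2 + (2 * s) * (u x * (f n x - u x)) + u x ^ 2 := by
            ext x; ring
          have j1 : Integrable (fun x => (s * s) * (f n x - u x) ^ 2) μ := i1.const_mul _
          have j2 : Integrable (fun x => (2 * s) * (u x * (f n x - u x))) μ := i3.const_mul _
          have j3 : Integrable (fun x => (s * s) * (f n x - u x) ^ 2 +
            (2 * s) * (u x * (f n x - u x))) μ := j1.add j2
          rw [e2, integral_add j3 hu.integrable_sq, integral_add j1 j2, integral_const_mul,
            integral_const_mul]
          ring
        rw [this]; exact integral_nonneg fun x => sq_nonneg _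
      have := discrim_le_zero hq
      rw [discrim] at this
      nlinarith
    rw [e, Real.norm_eq_abs]
    refine (abs_add_le _ _).trans ?_
    rw [abs_of_nonneg (integral_nonneg fun x => sq_nonneg _), abs_mul, abs_two]
    linarith
  refine squeeze_zero (fun n => norm_nonneg _) hb ?_
  have h2 := (Real.continuous_sqrt.tendsto 0).comp h1
  rw [Real.sqrt_zero] at h2
  have := h1.add ((h2.mul_const (Real.sqrt A)).const_mul 2)
  simpa using this

lemma integral_sq_sub_le {α : Type*} [MeasurableSpace α] {μ : Measure α}
    {f h u : α → ℝ} (hf : MemLp f 2 μ) (hh : MemLp h 2 μ) (hu : MemLp u 2 μ) :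
    ∫ x, (f x - h x) ^ 2 ∂μ ≤ 2 * (∫ x, (f x - u x) ^ 2 ∂μ) + 2 * ∫ x, (h x - u x) ^ 2 ∂μ := by
  have i1 : Integrable (fun x => 2 * (f x - u x) ^ 2) μ := (hf.sub hu).integrable_sq.const_mul 2
  have i2 : Integrable (fun x => 2 * (h x - u x) ^ 2) μ := (hh.sub hu).integrable_sq.const_mul 2
  rw [← integral_const_mul, ← integral_const_mul, ← integral_add i1 i2]
  refine integral_mono (hf.sub hh).integrable_sq (i1.add i2) fun y => ?_
  nlinarith [sq_nonneg (f y - u y + (h y - u y))]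

lemma IsTest.memLp {Ω : Set ℝ} {φ : ℝ → ℝ} (h : IsTest Ω φ) (S : Set ℝ) :
    MemLp φ 2 (volume.restrict S) :=
  (h.1.continuous.memLp_of_hasCompactSupport h.2.1).restrict S

lemma IsTest.continuous_deriv {Ω : Set ℝ} {φ : ℝ → ℝ} (h : IsTest Ω φ) : Continuous (deriv φ) :=
  h.1.continuous_deriv (by simp)

lemma IsTest.memLp_deriv {Ω : Set ℝ} {φ : ℝ → ℝ} (h : IsTest Ω φ) (S : Set ℝ) :
    MemLp (deriv φ) 2 (volume.restrict S) :=
  (h.continuous_deriv.memLp_of_hasCompactSupport h.2.1.deriv).restrict S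

lemma integrableOn_mul_of_tsupport {Ω : Set ℝ} {V φ f : ℝ → ℝ} (hV : ContinuousOn V Ω)
    (hΩ : MeasurableSet Ω)
    (hφ : HasCompactSupport φ) (hφΩ : tsupport φ ⊆ Ω) (hf : Continuous f)
    (h0 : ∀ x, x ∉ tsupport φ → f x = 0) : IntegrableOn (fun x => V x * f x) Ω := by
  have h1 : IntegrableOn (fun x => V x * f x) (tsupport φ) :=
    ((hV.mono hφΩ).mul hf.continuousOn).integrableOn_compact hφ
  refine h1.of_forall_sdiff_eq_zero hΩ fun x hx => ?_
  rw [h0 x hx.2, mul_zero]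

lemma sq_eq_zero_of_notMem_tsupport {φ : ℝ → ℝ} {x : ℝ} (h : x ∉ tsupport φ) : φ x ^ 2 = 0 := by
  rw [image_eq_zero_of_notMem_tsupport h]; simp

/-- Density of test functions in the energy, with one-sided control of the energy. -/
lemma exists_test_approx {Ω : Set ℝ} (hΩ : MeasurableSet Ω) {V u g : ℝ → ℝ}
    (hV : ContinuousOn V Ω) (hug : MemH10 Ω u g)
    (hVu : IntegrableOn (fun x => V x * u x ^ 2) Ω) :
    ∃ w : ℝ → ℝ, w =ᵐ[volume.restrict Ω] u ∧ ∀ δ > 0, ∃ φ, IsTest Ω φ ∧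
      (∀ x, |φ x - w x| ≤ δ) ∧
      (∫ x in Ω, (deriv φ x ^ 2 + V x * φ x ^ 2)) ≤ (∫ x in Ω, (g x ^ 2 + V x * u x ^ 2)) + δ ∧
      |(∫ x in Ω, φ x ^ 2) - ∫ x in Ω, u x ^ 2| ≤ δ := by
  obtain ⟨hu, hg, φ, hφ, hφu, hφg⟩ := hug
  have hT : ∀ n, IsTest Ω (φ n) := hφ
  -- uniform Cauchy property
  have hdu : Tendsto (fun n => ∫ x in Ω, (φ n x - u x) ^ 2) atTop (𝓝 0) :=
    (tendsto_eLpNorm_two_iff fun n => ((hT n).memLp Ω).sub hu).1 hφu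
  have hdg : Tendsto (fun n => ∫ x in Ω, (deriv (φ n) x - g x) ^ 2) atTop (𝓝 0) :=
    (tendsto_eLpNorm_two_iff fun n => ((hT n).memLp_deriv Ω).sub hg).1 hφg
  have hsup : ∀ n m x, |φ n x - φ m x| ^ 2 ≤
      2 * ((∫ x in Ω, (φ n x - u x) ^ 2) + ∫ x in Ω, (deriv (φ n) x - g x) ^ 2) +
      2 * ((∫ x in Ω, (φ m x - u x) ^ 2) + ∫ x in Ω, (deriv (φ m) x - g x) ^ 2) := by
    intro n m x
    have hc : ContDiff ℝ 1 (φ n - φ m) := ((hT n).1.sub (hT m).1).of_le (by simp)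
    have hs : HasCompactSupport (φ n - φ m) := (hT n).2.1.sub (hT m).2.1
    have hsub : tsupport (φ n - φ m) ⊆ Ω := by
      refine (closure_minimal ?_ ((isClosed_tsupport _).union (isClosed_tsupport _))).trans
        (union_subset (hT n).2.2 (hT m).2.2)
      intro y hy
      by_contra hcon
      rw [mem_union, not_or] at hcon
      apply hy
      simp [image_eq_zero_of_notMem_tsupport hcon.1, image_eq_zero_of_notMem_tsupport hcon.2]
    have h := sq_le_integral_sq_add hc hs x
    rw [← setIntegral_eq_integral_of_tsupport hsub (fun y hy => sq_eq_zero_of_notMem_tsupport hy),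
      ← setIntegral_eq_integral_of_tsupport hsub
        (fun y hy => by rw [deriv_eq_zero_of_notMem_tsupport hy]; simp)] at h
    have hder : ∀ y, deriv (φ n - φ m) y = deriv (φ n) y - deriv (φ m) y := fun y =>
      deriv_sub ((hT n).1.differentiable (by simp) y) ((hT m).1.differentiable (by simp) y)
    simp only [hder, Pi.sub_apply] at h
    rw [sq_abs]
    have k1 := integral_sq_sub_le ((hT n).memLp Ω) ((hT m).memLp Ω) hu
    have k2 := integral_sq_sub_le ((hT n).memLp_deriv Ω) ((hT m).memLp_deriv Ω) hg
    linarith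
  have hsum : Tendsto (fun n => (∫ x in Ω, (φ n x - u x) ^ 2) +
      ∫ x in Ω, (deriv (φ n) x - g x) ^ 2) atTop (𝓝 0) := by simpa using hdu.add hdg
  have hcau : ∀ ε > 0, ∃ N, ∀ n ≥ N, ∀ m ≥ N, ∀ x, |φ n x - φ m x| ≤ ε := by
    intro ε hε
    obtain ⟨N, hN⟩ := eventually_atTop.1 (hsum.eventually (gt_mem_nhds (show 0 < ε ^ 2 / 4 by positivity)))
    refine ⟨N, fun n hn m hm x => ?_⟩
    have h1 := hsup n m x
    have h2 := hN n hn
    have h3 := hN m hm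
    exact (pow_le_pow_iff_left₀ (abs_nonneg _) hε.le two_ne_zero).1 (by linarith)
  have hlim : ∀ x, ∃ y, Tendsto (fun n => φ n x) atTop (𝓝 y) := by
    intro x
    refine cauchySeq_tendsto_of_complete (Metric.cauchySeq_iff'.2 fun ε hε => ?_)
    obtain ⟨N, hN⟩ := hcau (ε / 2) (by positivity)
    refine ⟨N, fun n hn => ?_⟩
    rw [Real.dist_eq]
    linarith [hN n hn N le_rfl x]
  choose w hw using hlim
  have hunif : ∀ ε > 0, ∃ N, ∀ n ≥ N, ∀ x, |φ n x - w x| ≤ ε := by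
    intro ε hε
    obtain ⟨N, hN⟩ := hcau ε hε
    refine ⟨N, fun n hn x => ?_⟩
    refine le_of_tendsto ((tendsto_const_nhds.sub (hw x)).abs) ?_
    filter_upwards [eventually_ge_atTop N] with m hm using hN n hn m hm x
  have hwc : Continuous w := by
    have : TendstoUniformly φ w atTop := by
      rw [Metric.tendstoUniformly_iff]
      intro ε hε
      obtain ⟨N, hN⟩ := hunif (ε / 2) (by positivity)
      filter_upwards [eventually_ge_atTop N] with n hn x
      rw [Real.dist_eq, abs_sub_comm]
      linarith [hN n hn x]
    exact this.continuous (Frequently.of_forall fun n => (hT n).1.continuous)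
  have hwu : w =ᵐ[volume.restrict Ω] u := by
    have hm : TendstoInMeasure (volume.restrict Ω) φ atTop u :=
      tendstoInMeasure_of_tendsto_eLpNorm (by norm_num)
        (fun n => ((hT n).memLp Ω).aestronglyMeasurable) hu.aestronglyMeasurable hφu
    obtain ⟨ns, hns, hae⟩ := hm.exists_seq_tendsto_ae
    filter_upwards [hae] with x hx
    exact tendsto_nhds_unique ((hw x).comp hns.tendsto_atTop) hx
  have hVw : IntegrableOn (fun x => V x * w x ^ 2) Ω := hVu.congr (by
    filter_upwards [hwu] with x hx; rw [hx])
  have hwL : MemLp w 2 (volume.restrict Ω) := (memLp_congr_ae hwu).2 hu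
  refine ⟨w, hwu, fun δ hδ => ?_⟩
  -- truncations of `w` at small height
  have trunc : ∀ k : ℕ, ∃ θ : ℝ → ℝ, ContDiff ℝ ∞ θ ∧ (∀ s, |deriv θ s| ≤ 1) ∧
      (∀ s, |s| ≤ 1 / ((k : ℝ) + 1) → θ s = 0) ∧ (∀ s, |θ s| ≤ |s|) ∧
      ∀ s, |θ s - s| ≤ 4 * (1 / ((k : ℝ) + 1)) := fun k =>
    exists_truncation_scale (by positivity)
  choose θ hθ1 hθ2 hθ3 hθ4 hθ5 using trunc
  have hθlim : ∀ s, Tendsto (fun k => θ k s) atTop (𝓝 s) := by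
    intro s
    rw [tendsto_iff_norm_sub_tendsto_zero]
    refine squeeze_zero (fun k => norm_nonneg _) (fun k => hθ5 k s) ?_
    simpa using tendsto_one_div_add_atTop_nhds_zero_nat.const_mul (4:ℝ)
  -- `V` has no bound near the ends of `Ω`, so `∫ V φₙ²` need not converge. Truncating `w` first is
  -- harmless: `|θ k w| ≤ |w|`, and `V w²` is integrable by hypothesis.
  have l1 : Tendsto (fun k => ∫ x in Ω, V x * θ k (w x) ^ 2) atTop (𝓝 (∫ x in Ω, V x * w x ^ 2)) := by
    refine tendsto_integral_of_dominated_convergence (fun x => ‖V x * w x ^ 2‖) (fun k => ?_)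
      hVw.norm (fun k => ae_of_all _ fun x => ?_) (ae_of_all _ fun x => ?_)
    · exact (hV.aestronglyMeasurable hΩ).mul
        (((hθ1 k).continuous.comp hwc).pow 2).aestronglyMeasurable
    · rw [norm_mul, norm_mul]
      refine mul_le_mul_of_nonneg_left ?_ (norm_nonneg _)
      rw [norm_pow, norm_pow]
      exact pow_le_pow_left₀ (norm_nonneg _) (hθ4 k _) 2
    · exact ((hθlim _).pow 2).const_mul _
  have l2 : Tendsto (fun k => ∫ x in Ω, θ k (w x) ^ 2) atTop (𝓝 (∫ x in Ω, w x ^ 2)) := by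
    refine tendsto_integral_of_dominated_convergence (fun x => w x ^ 2) (fun k => ?_)
      hwL.integrable_sq (fun k => ae_of_all _ fun x => ?_) (ae_of_all _ fun x => ?_)
    · exact (((hθ1 k).continuous.comp hwc).pow 2).aestronglyMeasurable
    · rw [norm_pow, ← sq_abs (w x)]
      exact pow_le_pow_left₀ (norm_nonneg _) (hθ4 k _) 2
    · exact (hθlim _).pow 2
  have l3 : Tendsto (fun k : ℕ => 4 * (1 / ((k : ℝ) + 1))) atTop (𝓝 0) := by
    simpa using tendsto_one_div_add_atTop_nhds_zero_nat.const_mul (4:ℝ)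
  obtain ⟨k, ⟨hk1, hk2⟩, hk3⟩ := (((l1.eventually (Metric.ball_mem_nhds _ (half_pos hδ))).and
    (l2.eventually (Metric.ball_mem_nhds _ (half_pos hδ)))).and
    (l3.eventually (gt_mem_nhds (half_pos hδ)))).exists
  rw [Real.dist_eq] at hk1 hk2
  set ε : ℝ := 1 / ((k : ℝ) + 1) with hεd
  have hε : 0 < ε := by positivity
  -- truncations of the test functions have support in one compact set
  obtain ⟨N, hN⟩ := hcau (ε / 2) (by positivity)
  set K := tsupport (φ N) with hK
  have hKc : IsCompact K := (hT N).2.1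
  have hKΩ : K ⊆ Ω := (hT N).2.2
  have hsupp : ∀ n ≥ N, tsupport (fun x => θ k (φ n x)) ⊆ K := by
    intro n hn
    refine closure_minimal ?_ (isClosed_tsupport _)
    intro x hx
    by_contra hxK
    apply hx
    apply hθ3 k
    -- Where `φ N` vanishes, `|φ n| ≤ ε / 2` is below the truncation height. All truncated functions
    -- therefore live on the one compact set `K`, where `V` is bounded.
    have := hN n hn N le_rfl x
    rw [image_eq_zero_of_notMem_tsupport hxK, sub_zero] at this
    linarith
  have htest : ∀ n ≥ N, IsTest Ω (fun x => θ k (φ n x)) := fun n hn =>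
    ⟨(hθ1 k).comp (hT n).1, HasCompactSupport.of_support_subset_isCompact hKc
      ((subset_tsupport _).trans (hsupp n hn)), (hsupp n hn).trans hKΩ⟩
  obtain ⟨C, hC⟩ : ∃ C, ∀ x ∈ K, |w x| ≤ C :=
    hKc.exists_bound_of_continuousOn hwc.continuousOn
  have hw0 : ∀ x ∉ K, θ k (w x) = 0 := by
    intro x hx
    refine tendsto_nhds_unique
      (((hθ1 k).continuous.tendsto _).comp (hw x)) (tendsto_const_nhds.congr' ?_)
    filter_upwards [eventually_ge_atTop N] with n hn
    exact (image_eq_zero_of_notMem_tsupport (fun h => hx (hsupp n hn h))).symm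
  obtain ⟨N1, hN1⟩ := hunif 1 one_pos
  have hdom : ∀ f : ℝ → ℝ, ContinuousOn f Ω →
      Tendsto (fun n => ∫ x in Ω, f x * θ k (φ n x) ^ 2) atTop
        (𝓝 (∫ x in Ω, f x * θ k (w x) ^ 2)) := by
    intro f hf
    refine tendsto_integral_filter_of_dominated_convergence
      (fun x => K.indicator (fun x => ‖f x‖ * (C + 1) ^ 2) x) ?_ ?_ ?_ ?_
    · exact Eventually.of_forall fun n => (hf.aestronglyMeasurable hΩ).mul
        (((hθ1 k).continuous.comp (hT n).1.continuous).pow 2).aestronglyMeasurable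
    · filter_upwards [eventually_ge_atTop N, eventually_ge_atTop N1] with n hn hn1
      refine ae_of_all _ fun x => ?_
      by_cases hx : x ∈ K
      · rw [indicator_of_mem hx, norm_mul]
        refine mul_le_mul_of_nonneg_left ?_ (norm_nonneg _)
        rw [norm_pow]
        refine pow_le_pow_left₀ (norm_nonneg _) ((hθ4 k _).trans ?_) 2
        have h1 := hN1 n hn1 x
        have h2 := hC x hx
        rw [abs_le] at *; constructor <;> linarith
      · rw [indicator_of_notMem hx, image_eq_zero_of_notMem_tsupport
          (f := fun x => θ k (φ n x)) (fun h => hx (hsupp n hn h))]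
        simp
    · refine IntegrableOn.integrable ?_
      refine (integrable_indicator_iff hKc.measurableSet).2 ?_ |>.integrableOn
      exact ((hf.mono hKΩ).norm.mul continuousOn_const).integrableOn_compact hKc
    · exact ae_of_all _ fun x => (((((hθ1 k).continuous.tendsto _).comp (hw x)).pow 2).const_mul _)
  have m1 := hdom V hV
  have m2 : Tendsto (fun n => ∫ x in Ω, θ k (φ n x) ^ 2) atTop (𝓝 (∫ x in Ω, θ k (w x) ^ 2)) := by
    simpa using hdom (fun _ => 1) continuousOn_const
  have m3 : Tendsto (fun n => ∫ x in Ω, deriv (φ n) x ^ 2) atTop (𝓝 (∫ x in Ω, g x ^ 2)) :=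
    tendsto_integral_sq_of_tendsto_sub (fun n => (hT n).memLp_deriv Ω) hg hφg
  obtain ⟨N2, hN2⟩ := hunif (δ / 2) (half_pos hδ)
  obtain ⟨n, ⟨⟨⟨⟨hn1, hn2⟩, hn3⟩, hn4⟩, hn5⟩⟩ :=
    (((((m1.eventually (Metric.ball_mem_nhds _ (show 0 < δ / 4 by positivity))).and
    (m2.eventually (Metric.ball_mem_nhds _ (half_pos hδ)))).and
    (m3.eventually (Metric.ball_mem_nhds _ (show 0 < δ / 4 by positivity)))).and
    (eventually_ge_atTop N)).and (eventually_ge_atTop N2)).exists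
  rw [Real.dist_eq] at hn1 hn2 hn3
  refine ⟨fun x => θ k (φ n x), htest n hn4, fun x => ?_, ?_, ?_⟩
  · have h1 := hθ5 k (φ n x)
    have h2 := hN2 n hn5 x
    calc |θ k (φ n x) - w x| = |(θ k (φ n x) - φ n x) + (φ n x - w x)| := by ring_nf
      _ ≤ _ := abs_add_le _ _
      _ ≤ δ := by linarith
  -- Truncation can only lower the kinetic energy since `|θ'| ≤ 1`; this is why the energy is
  -- controlled from above only.
  · have hder : ∀ x, deriv (fun x => θ k (φ n x)) x ^ 2 ≤ deriv (φ n) x ^ 2 := by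
      intro x
      have := (((hθ1 k).differentiable (by simp) (φ n x)).hasDerivAt.comp x
        ((hT n).1.differentiable (by simp) x).hasDerivAt)
      have e : deriv (fun x => θ k (φ n x)) x = deriv (θ k) (φ n x) * deriv (φ n) x := this.deriv
      rw [e, mul_pow]
      have := hθ2 k (φ n x)
      have : deriv (θ k) (φ n x) ^ 2 ≤ 1 := by rw [sq_le_one_iff_abs_le_one]; exact this
      exact mul_le_of_le_one_left (sq_nonneg _) this
    have i1 := ((htest n hn4).memLp_deriv Ω).integrable_sq
    have i2 : IntegrableOn (fun x => V x * θ k (φ n x) ^ 2) Ω :=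
      integrableOn_mul_of_tsupport hV hΩ (htest n hn4).2.1 (htest n hn4).2.2
        (((hθ1 k).continuous.comp (hT n).1.continuous).pow 2)
        (fun x hx => sq_eq_zero_of_notMem_tsupport (φ := fun x => θ k (φ n x)) hx)
    rw [integral_add i1 i2, integral_add hg.integrable_sq hVu]
    have j1 : ∫ x in Ω, deriv (fun x => θ k (φ n x)) x ^ 2 ≤ ∫ x in Ω, deriv (φ n) x ^ 2 :=
      integral_mono i1 ((hT n).memLp_deriv Ω).integrable_sq hder
    have j2 : ∫ x in Ω, V x * w x ^ 2 = ∫ x in Ω, V x * u x ^ 2 :=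
      integral_congr_ae (by filter_upwards [hwu] with x hx; rw [hx])
    rw [← j2]
    rw [abs_lt] at *
    linarith [hn1.2, hn3.2, hk1.2]
  · have j2 : ∫ x in Ω, w x ^ 2 = ∫ x in Ω, u x ^ 2 :=
      integral_congr_ae (by filter_upwards [hwu] with x hx; rw [hx])
    rw [← j2]
    rw [abs_lt] at *
    rw [abs_le]
    constructor <;> linarith [hn2.1, hn2.2, hk2.1, hk2.2]

end GroundState

/-! ### Mollification, and the ground state energy as a quadratic form bound. -/

namespace GroundState

open ContinuousLinearMap in
open scoped Convolution in
lemma support_mollify_subset {f : ℝ → ℝ} (ρ : ContDiffBump (0 : ℝ)) {δ : ℝ} (h : ρ.rOut ≤ δ) :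
    Function.support (ρ.normed volume ⋆[lsmul ℝ ℝ, volume] f : ℝ → ℝ) ⊆
      Metric.cthickening δ (tsupport f) := by
  refine (support_convolution_subset (lsmul ℝ ℝ)).trans ?_
  rw [ρ.support_normed_eq]
  rintro x ⟨y, hy, z, hz, rfl⟩
  refine Metric.mem_cthickening_of_dist_le _ z _ _ (subset_tsupport _ hz) ?_
  rw [Metric.mem_ball, dist_zero_right] at hy
  simp only [dist_eq_norm, add_sub_cancel_right]
  exact hy.le.trans h

open ContinuousLinearMap in
open scoped Convolution in
lemma tendsto_integral_mollify {f : ℝ → ℝ} (hf : Continuous f) (hs : HasCompactSupport f)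
    (ρ : ℕ → ContDiffBump (0 : ℝ)) (hρ : Tendsto (fun n => (ρ n).rOut) atTop (𝓝 0)) {δ : ℝ}
    (hδ : ∀ n, (ρ n).rOut ≤ δ) :
    Tendsto (fun n => ∫ x, (((ρ n).normed volume ⋆[lsmul ℝ ℝ, volume] f : ℝ → ℝ) x - f x) ^ 2)
      atTop (𝓝 0) := by
  have hK : IsCompact (Metric.cthickening δ (tsupport f)) := IsCompact.cthickening hs
  obtain ⟨C, hC⟩ := hf.bounded_above_of_compact_support hs
  have hC0 : 0 ≤ C := (norm_nonneg _).trans (hC 0)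
  have h0 : ∀ n, Continuous ((ρ n).normed volume ⋆[lsmul ℝ ℝ, volume] f : ℝ → ℝ) := fun n =>
    HasCompactSupport.continuous_convolution_left _ (ρ n).hasCompactSupport_normed
      (ρ n).continuous_normed hf.locallyIntegrable
  suffices h : Tendsto (fun n => ∫ x, (((ρ n).normed volume ⋆[lsmul ℝ ℝ, volume] f : ℝ → ℝ) x -
      f x) ^ 2) atTop (𝓝 (∫ _ : ℝ, (0:ℝ))) by
    rwa [integral_zero] at h
  refine tendsto_integral_of_dominated_convergence
    ((Metric.cthickening δ (tsupport f)).indicator (fun _ => (2 * C) ^ 2)) (fun n => ?_) ?_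
    (fun n => ae_of_all _ fun x => ?_) (ae_of_all _ fun x => ?_)
  · exact (((h0 n).sub hf).pow 2).aestronglyMeasurable
  · exact (integrable_indicator_iff hK.measurableSet).2
      (continuousOn_const.integrableOn_compact hK)
  · by_cases hx : x ∈ Metric.cthickening δ (tsupport f)
    · rw [indicator_of_mem hx, norm_pow]
      refine pow_le_pow_left₀ (norm_nonneg _) ?_ 2
      rw [← dist_eq_norm]
      refine ContDiffBump.dist_normed_convolution_le hf.aestronglyMeasurable fun y _ => ?_
      rw [dist_eq_norm]
      calc ‖f y - f x‖ ≤ ‖f y‖ + ‖f x‖ := norm_sub_le _ _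
        _ ≤ 2 * C := by linarith [hC y, hC x]
    · rw [indicator_of_notMem hx, Function.notMem_support.1
        (fun h => hx (support_mollify_subset (ρ n) (hδ n) h)), image_eq_zero_of_notMem_tsupport
        (fun h => hx (Metric.self_subset_cthickening _ h))]
      simp
  · have h := ContDiffBump.convolution_tendsto_right_of_continuous (μ := volume) hρ hf x
    simpa using (h.sub_const (f x)).pow 2

open ContinuousLinearMap in
open scoped Convolution in
-- Truncated solutions of the differential equation are only `C¹`; mollifying `v` and `v'` together
-- makes such functions admissible.
lemma memH10_of_contDiff {Ω : Set ℝ} (hΩ : IsOpen Ω) {v : ℝ → ℝ} (hv : ContDiff ℝ 1 v)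
    (hs : HasCompactSupport v) (hsub : tsupport v ⊆ Ω) : MemH10 Ω v (deriv v) := by
  have hd : Continuous (deriv v) := hv.continuous_deriv le_rfl
  obtain ⟨δ, hδ, hδΩ⟩ := IsCompact.exists_cthickening_subset_open hs hΩ hsub
  let ρ : ℕ → ContDiffBump (0 : ℝ) := fun n =>
    ⟨δ / ((n : ℝ) + 1) / 2, δ / ((n : ℝ) + 1), by positivity, by
      have : 0 < δ / ((n : ℝ) + 1) := by positivity
      linarith⟩
  have hρδ : ∀ n, (ρ n).rOut ≤ δ := fun n => by
    show δ / ((n : ℝ) + 1) ≤ δ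
    rw [div_le_iff₀ (by positivity)]
    nlinarith [(Nat.cast_nonneg n : (0:ℝ) ≤ n)]
  have hρ : Tendsto (fun n => (ρ n).rOut) atTop (𝓝 0) := by
    have := tendsto_one_div_add_atTop_nhds_zero_nat.const_mul δ
    rw [mul_zero] at this
    refine this.congr fun n => ?_
    show δ * (1 / ((n : ℝ) + 1)) = δ / ((n : ℝ) + 1)
    ring
  set φ : ℕ → ℝ → ℝ := fun n => ((ρ n).normed volume ⋆[lsmul ℝ ℝ, volume] v : ℝ → ℝ) with hφ
  have hder : ∀ n, deriv (φ n) = ((ρ n).normed volume ⋆[lsmul ℝ ℝ, volume] deriv v : ℝ → ℝ) :=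
    fun n => funext fun x => (hs.hasDerivAt_convolution_right _
      ((ρ n).continuous_normed.locallyIntegrable) hv x).deriv
  have hsupp : ∀ n, tsupport (φ n) ⊆ Metric.cthickening δ (tsupport v) := fun n =>
    closure_minimal (support_mollify_subset (ρ n) (hρδ n)) Metric.isClosed_cthickening
  have hT : ∀ n, IsTest Ω (φ n) := fun n =>
    ⟨HasCompactSupport.contDiff_convolution_left _ (ρ n).hasCompactSupport_normed
      (ρ n).contDiff_normed hv.continuous.locallyIntegrable,
      HasCompactSupport.of_support_subset_isCompact (IsCompact.cthickening hs)
        ((subset_tsupport _).trans (hsupp n)), (hsupp n).trans hδΩ⟩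
  have m1 : MemLp v 2 (volume.restrict Ω) := (hv.continuous.memLp_of_hasCompactSupport hs).restrict Ω
  have m2 : MemLp (deriv v) 2 (volume.restrict Ω) :=
    (hd.memLp_of_hasCompactSupport hs.deriv).restrict Ω
  refine ⟨m1, m2, φ, hT, ?_, ?_⟩
  · refine (tendsto_eLpNorm_two_iff fun n => ((hT n).memLp Ω).sub m1).2 ?_
    refine squeeze_zero (fun n => integral_nonneg fun x => sq_nonneg _) (fun n => ?_)
      (tendsto_integral_mollify hv.continuous hs ρ hρ hρδ)
    refine setIntegral_le_integral ?_ (ae_of_all _ fun x => sq_nonneg _)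
    exact ((((hT n).1.continuous.memLp_of_hasCompactSupport (hT n).2.1)).sub
      (hv.continuous.memLp_of_hasCompactSupport hs)).integrable_sq
  · refine (tendsto_eLpNorm_two_iff fun n => ((hT n).memLp_deriv Ω).sub m2).2 ?_
    refine squeeze_zero (fun n => integral_nonneg fun x => sq_nonneg _) (fun n => ?_)
      (tendsto_integral_mollify hd hs.deriv ρ hρ hρδ)
    simp_rw [← hder]
    refine setIntegral_le_integral ?_ (ae_of_all _ fun x => sq_nonneg _)
    exact ((((hT n).continuous_deriv.memLp_of_hasCompactSupport (hT n).2.1.deriv)).sub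
      (hd.memLp_of_hasCompactSupport hs.deriv)).integrable_sq

lemma MemH10.const_mul {Ω : Set ℝ} {u g : ℝ → ℝ} (h : MemH10 Ω u g) (c : ℝ) :
    MemH10 Ω (fun x => c * u x) (fun x => c * g x) := by
  obtain ⟨hu, hg, φ, hφ, h1, h2⟩ := h
  refine ⟨hu.const_mul c, hg.const_mul c, fun n x => c * φ n x, fun n => ⟨?_, ?_, ?_⟩, ?_, ?_⟩
  · exact contDiff_const.mul (hφ n).1
  · exact (hφ n).2.1.mul_left
  · exact (tsupport_mul_subset_right).trans (hφ n).2.2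
  · have := ENNReal.Tendsto.const_mul (a := ‖c‖ₑ) h1 (Or.inr enorm_ne_top)
    rw [mul_zero] at this
    refine this.congr fun n => ?_
    rw [← eLpNorm_const_smul]
    congr 1; ext x; simp [mul_sub]
  · have := ENNReal.Tendsto.const_mul (a := ‖c‖ₑ) h2 (Or.inr enorm_ne_top)
    rw [mul_zero] at this
    refine this.congr fun n => ?_
    rw [← eLpNorm_const_smul]
    congr 1; ext x
    have : deriv (fun x => c * φ n x) x = c * deriv (φ n) x := by
      rw [deriv_const_mul]; exact ((hφ n).1.differentiable (by simp)) x
    simp [mul_sub, this]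

/-- Rescaling a function in `H¹₀` with integrable potential energy gives a competitor. -/
lemma groundEnergy_le_div {V : ℝ → ℝ} {a t : EReal} {u g : ℝ → ℝ}
    (h : MemH10 (interval a t) u g) (hV : IntegrableOn (fun x => V x * u x ^ 2) (interval a t))
    (hpos : 0 < ∫ x in interval a t, u x ^ 2) :
    groundEnergy V a t ≤
      (((∫ x in interval a t, (g x ^ 2 + V x * u x ^ 2)) / ∫ x in interval a t, u x ^ 2 : ℝ) :
        EReal) := by
  set N := ∫ x in interval a t, u x ^ 2
  set c := (Real.sqrt N)⁻¹
  have hc : c ^ 2 = N⁻¹ := by rw [inv_pow, Real.sq_sqrt hpos.le]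
  refine sInf_le ⟨fun x => c * u x, fun x => c * g x, ⟨h.const_mul c, ?_, ?_⟩, ?_⟩
  · refine (hV.const_mul (c ^ 2)).congr (ae_of_all _ fun x => ?_)
    simp only; ring
  · simp_rw [mul_pow]
    rw [integral_const_mul, hc]
    exact inv_mul_cancel₀ hpos.ne'
  · unfold energy
    congr 1
    rw [div_eq_inv_mul, ← hc, ← integral_const_mul]
    congr 1; ext x; ring

lemma groundEnergy_le_of_contDiff {V : ℝ → ℝ} {a t : EReal} {v : ℝ → ℝ}
    (hV : ContinuousOn V (interval a t)) (hv : ContDiff ℝ 1 v)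
    (hs : HasCompactSupport v) (hsub : tsupport v ⊆ interval a t)
    (hpos : 0 < ∫ x in interval a t, v x ^ 2) :
    groundEnergy V a t ≤
      (((∫ x in interval a t, (deriv v x ^ 2 + V x * v x ^ 2)) /
        ∫ x in interval a t, v x ^ 2 : ℝ) : EReal) :=
  groundEnergy_le_div (memH10_of_contDiff (isOpen_interval a t) hv hs hsub)
    (integrableOn_mul_of_tsupport hV (measurableSet_interval a t) hs hsub (hv.continuous.pow 2)
      fun _ hx => sq_eq_zero_of_notMem_tsupport hx) hpos

/-- The homogeneous form of a lower bound: normalization is dropped and `v = 0` is allowed, so that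
sums and differences of test functions may be inserted. -/
lemma mul_le_of_le_groundEnergy {V : ℝ → ℝ} {a t : EReal} {v : ℝ → ℝ} {E : ℝ}
    (hV : ContinuousOn V (interval a t)) (hE : (E : EReal) ≤ groundEnergy V a t)
    (hv : ContDiff ℝ 1 v) (hs : HasCompactSupport v) (hsub : tsupport v ⊆ interval a t) :
    E * ∫ x in interval a t, v x ^ 2 ≤ ∫ x in interval a t, (deriv v x ^ 2 + V x * v x ^ 2) := by
  have h0 : 0 ≤ ∫ x in interval a t, v x ^ 2 := integral_nonneg fun x => sq_nonneg _
  rcases h0.eq_or_lt with h | h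
  · have hv0 : v = 0 := by
      rw [setIntegral_eq_integral_of_tsupport hsub fun x hx => sq_eq_zero_of_notMem_tsupport hx] at h
      have := (hv.continuous.pow 2).ae_eq_iff_eq volume continuous_const |>.1
        ((integral_eq_zero_iff_of_nonneg (fun x => sq_nonneg _)
        ((hv.continuous.pow 2).integrable_of_hasCompactSupport (hasCompactSupport_sq hs))).1 h.symm)
      ext x
      have h2 : v x ^ 2 = 0 := congrFun this x
      exact pow_eq_zero_iff two_ne_zero |>.1 h2
    subst hv0
    simp
  · have := hE.trans (groundEnergy_le_of_contDiff hV hv hs hsub h)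
    rw [EReal.coe_le_coe_iff, le_div_iff₀ h] at this
    exact this

/-- Lower bounds of the ground state energy may be checked on test functions. -/
lemma le_groundEnergy {V : ℝ → ℝ} {a t : EReal} {E : ℝ} (hV : ContinuousOn V (interval a t))
    (h : ∀ φ, IsTest (interval a t) φ → E * ∫ x in interval a t, φ x ^ 2 ≤
      ∫ x in interval a t, (deriv φ x ^ 2 + V x * φ x ^ 2)) : (E : EReal) ≤ groundEnergy V a t := by
  refine le_sInf ?_
  rintro e ⟨u, g, ⟨hug, hVu, hn⟩, rfl⟩
  rw [EReal.coe_le_coe_iff]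
  obtain ⟨w, -, hw⟩ := exists_test_approx (measurableSet_interval a t) hV hug hVu
  refine le_of_forall_pos_le_add fun ε hε => ?_
  -- An error `δ` in the energy and in the norm costs `δ + |E| δ = ε` in total.
  set δ := ε / (1 + |E|)
  have hδ : 0 < δ := by positivity
  obtain ⟨φ, hφ, -, h1, h2⟩ := hw δ hδ
  have h3 := h φ hφ
  rw [hn] at h2
  have h4 : E * 1 - |E| * δ ≤ E * ∫ x in interval a t, φ x ^ 2 := by
    have : |E * ((∫ x in interval a t, φ x ^ 2) - 1)| ≤ |E| * δ := by
      rw [abs_mul]; gcongr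
    have := (abs_le.1 this).1
    linarith
  have h5 : δ + |E| * δ = ε := by simp only [δ]; field_simp
  unfold energy
  linarith

lemma exists_real_btw {a t : EReal} (h : a < t) : ∃ x : ℝ, x ∈ interval a t := by
  obtain ⟨x, h1, h2⟩ := EReal.lt_iff_exists_real_btwn.1 h
  exact ⟨x, h1, h2⟩

lemma groundEnergy_ne_top {V : ℝ → ℝ} {a t : EReal} (h : a < t)
    (hV : ContinuousOn V (interval a t)) : groundEnergy V a t ≠ ⊤ := by
  obtain ⟨x, hx⟩ := exists_real_btw h
  obtain ⟨ε, hε, hsub⟩ := Metric.isOpen_iff.1 (isOpen_interval a t) x hx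
  let ρ : ContDiffBump x := ⟨ε / 4, ε / 2, by positivity, by linarith⟩
  have hs : tsupport ρ ⊆ interval a t := by
    rw [ρ.tsupport_eq]
    exact (Metric.closedBall_subset_ball (by show ε / 2 < ε; linarith)).trans hsub
  refine ne_top_of_le_ne_top (EReal.coe_ne_top _)
    (groundEnergy_le_of_contDiff hV (ρ.contDiff) ρ.hasCompactSupport hs ?_)
  rw [setIntegral_eq_integral_of_tsupport hs fun x hx => sq_eq_zero_of_notMem_tsupport hx]
  rw [integral_pos_iff_support_of_nonneg (fun x => sq_nonneg _)
    ((ρ.continuous.pow 2).integrable_of_hasCompactSupport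
      (hasCompactSupport_sq ρ.hasCompactSupport))]
  have : Function.support (fun y => ρ y ^ 2) = Metric.ball x (ε / 2) := by
    rw [Function.support_pow _ two_ne_zero]; exact ρ.support_eq
  rw [this]
  exact Metric.measure_ball_pos _ _ (by positivity)

/-- If the support lies in a smaller interval, the energy integrals agree. -/
lemma setIntegral_interval_congr {a t t' : EReal} {φ f : ℝ → ℝ} (h : tsupport φ ⊆ interval a t)
    (h' : tsupport φ ⊆ interval a t') (hf : ∀ x, x ∉ tsupport φ → f x = 0) :
    ∫ x in interval a t, f x = ∫ x in interval a t', f x := by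
  rw [setIntegral_eq_integral_of_tsupport h hf, setIntegral_eq_integral_of_tsupport h' hf]

lemma energy_density_eq_zero {V φ : ℝ → ℝ} {x : ℝ} (hx : x ∉ tsupport φ) :
    deriv φ x ^ 2 + V x * φ x ^ 2 = 0 := by
  rw [deriv_eq_zero_of_notMem_tsupport hx, image_eq_zero_of_notMem_tsupport hx]; simp

/-- Compared through real lower bounds, since a test function on the smaller interval is one on the
larger. -/
lemma groundEnergy_anti {V : ℝ → ℝ} {a s t : EReal} (hst : s ≤ t)
    (hV : ContinuousOn V (interval a t)) : groundEnergy V a t ≤ groundEnergy V a s := by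
  refine EReal.le_of_forall_lt_iff_le.1 fun E hE => ?_
  by_contra hcon
  rw [not_le] at hcon
  have := le_groundEnergy (V := V) (a := a) (t := s) (E := E) (hV.mono (interval_mono hst))
    fun φ hφ => by
      have h2 := hφ.2.2.trans (interval_mono hst)
      rw [setIntegral_interval_congr hφ.2.2 h2 fun x hx => sq_eq_zero_of_notMem_tsupport hx,
        setIntegral_interval_congr hφ.2.2 h2 fun x hx => energy_density_eq_zero hx]
      exact mul_le_of_le_groundEnergy hV hcon.le (hφ.1.of_le (by simp)) hφ.2.1 h2
  exact absurd hE (not_lt.2 this)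

lemma exists_lt_of_compact_subset {a t : EReal} (hat : a < t) {K : Set ℝ} (hK : IsCompact K)
    (hsub : K ⊆ interval a t) : ∃ s : ℝ, s ∈ interval a t ∧ K ⊆ interval a s := by
  rcases K.eq_empty_or_nonempty with rfl | hne
  · obtain ⟨x, hx⟩ := exists_real_btw hat
    exact ⟨x, hx, by simp⟩
  · obtain ⟨m, hm, hmax⟩ := hK.exists_isGreatest hne
    obtain ⟨s, hs⟩ := exists_real_btw (hsub hm).2
    exact ⟨s, ⟨(hsub hm).1.trans hs.1, hs.2⟩, fun x hx => ⟨(hsub hx).1,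
      (EReal.coe_le_coe_iff.2 (hmax hx)).trans_lt hs.1⟩⟩

/-- A test function on `(a, t)` has compact support, so it already lives on some `(a, s)` with `s <
t`. This gives the left continuity of `λ` at `b`, where the differential equation is not available.
-/
lemma le_groundEnergy_of_forall_lt {V : ℝ → ℝ} {a t : EReal} (hat : a < t) {E : ℝ}
    (hV : ContinuousOn V (interval a t))
    (h : ∀ s : ℝ, s ∈ interval a t → (E : EReal) ≤ groundEnergy V a s) :
    (E : EReal) ≤ groundEnergy V a t := by
  refine le_groundEnergy hV fun φ hφ => ?_
  obtain ⟨s, hs, hsub⟩ := exists_lt_of_compact_subset hat hφ.2.1 hφ.2.2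
  rw [← setIntegral_interval_congr hsub hφ.2.2 fun x hx => sq_eq_zero_of_notMem_tsupport hx,
    ← setIntegral_interval_congr hsub hφ.2.2 fun x hx => energy_density_eq_zero hx]
  exact mul_le_of_le_groundEnergy (hV.mono (interval_mono hs.2.le)) (h s hs)
    (hφ.1.of_le (by simp)) hφ.2.1 hsub

end GroundState

/-! ### Energy bounds from solutions of the differential equation. -/

namespace GroundState

lemma exists_Icc_of_compact_subset {a t : EReal} (hat : a < t) {K : Set ℝ} (hK : IsCompact K)
    (hsub : K ⊆ interval a t) : ∃ α β : ℝ, α < β ∧ Icc α β ⊆ interval a t ∧ K ⊆ Ioo α β := by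
  obtain ⟨β', hβ', hKβ⟩ := exists_lt_of_compact_subset hat hK hsub
  obtain ⟨β, hβ⟩ := exists_real_btw hβ'.2
  rcases K.eq_empty_or_nonempty with rfl | hne
  · exact ⟨β', β, EReal.coe_lt_coe_iff.1 hβ.1,
      Icc_subset_interval hβ' ⟨hβ'.1.trans hβ.1, hβ.2⟩, by simp⟩
  · obtain ⟨m, hm, hmin⟩ := hK.exists_isLeast hne
    obtain ⟨α, hα⟩ := exists_real_btw (hsub hm).1
    have hαm := EReal.coe_lt_coe_iff.1 hα.2
    have hmβ := EReal.coe_lt_coe_iff.1 ((hKβ hm).2.trans hβ.1)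
    refine ⟨α, β, hαm.trans hmβ, Icc_subset_interval ⟨hα.1, hα.2.trans (hsub hm).2⟩
      ⟨hβ'.1.trans hβ.1, hβ.2⟩, fun x hx => ⟨hαm.trans_le (hmin hx), ?_⟩⟩
    exact (EReal.coe_lt_coe_iff.1 (hKβ hx).2).trans (EReal.coe_lt_coe_iff.1 hβ.1)

lemma setIntegral_interval_eq_intervalIntegral {a t : EReal} {φ f : ℝ → ℝ} {α β : ℝ}
    (hαβ : α < β) (hφ : tsupport φ ⊆ Ioo α β)
    (hsub : tsupport φ ⊆ interval a t) (hf : ∀ x, x ∉ tsupport φ → f x = 0) :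
    ∫ x in interval a t, f x = ∫ x in α..β, f x := by
  rw [setIntegral_eq_integral_of_tsupport hsub hf, intervalIntegral.integral_of_le hαβ.le,
    setIntegral_eq_integral_of_tsupport (hφ.trans Ioo_subset_Ioc_self) hf]

/-- **Jacobi's inequality**: a subsolution `ψ` of the Riccati equation bounds the energy below. -/
lemma jacobi_le {V ψ ψ' φ : ℝ → ℝ} {a t : EReal} (hat : a < t) {E : ℝ}
    (hV : ContinuousOn V (interval a t)) (hψ : ContinuousOn ψ (interval a t))
    (hd : ∀ x ∈ interval a t, HasDerivWithinAt ψ (ψ' x) (Ioi x) x)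
    (hle : ∀ x ∈ interval a t, ψ' x + ψ x ^ 2 + E ≤ V x)
    (hφ : ContDiff ℝ 1 φ) (hs : HasCompactSupport φ) (hsub : tsupport φ ⊆ interval a t) :
    ∫ x in interval a t, (deriv φ x - ψ x * φ x) ^ 2 ≤
      (∫ x in interval a t, (deriv φ x ^ 2 + V x * φ x ^ 2)) -
        E * ∫ x in interval a t, φ x ^ 2 := by
  obtain ⟨α, β, hαβ, hI, hK⟩ := exists_Icc_of_compact_subset hat hs hsub
  have z : ∀ x, x ∉ tsupport φ → φ x = 0 := fun x hx => image_eq_zero_of_notMem_tsupport hx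
  have z' : ∀ x, x ∉ tsupport φ → deriv φ x = 0 := fun x hx => deriv_eq_zero_of_notMem_tsupport hx
  rw [setIntegral_interval_eq_intervalIntegral hαβ hK hsub fun x hx => by simp [z x hx, z' x hx],
    setIntegral_interval_eq_intervalIntegral hαβ hK hsub fun x hx => energy_density_eq_zero hx,
    setIntegral_interval_eq_intervalIntegral hαβ hK hsub
      fun x hx => sq_eq_zero_of_notMem_tsupport hx]
  have cd : Continuous (deriv φ) := hφ.continuous_deriv le_rfl
  have cφ : Continuous φ := hφ.continuous
  have cV : ContinuousOn V (Icc α β) := hV.mono hI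
  have cψ : ContinuousOn ψ (Icc α β) := hψ.mono hI
  have c1 : ContinuousOn (fun x => (deriv φ x - ψ x * φ x) ^ 2) (Icc α β) :=
    (cd.continuousOn.sub (cψ.mul cφ.continuousOn)).pow 2
  have c2 : ContinuousOn (fun x => deriv φ x ^ 2 + V x * φ x ^ 2) (Icc α β) :=
    (cd.continuousOn.pow 2).add (cV.mul (cφ.continuousOn.pow 2))
  have c3 : ContinuousOn (fun x => φ x ^ 2) (Icc α β) := cφ.continuousOn.pow 2
  have i1 := c1.intervalIntegrable_of_Icc hαβ.le (μ := volume)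
  have i2 := c2.intervalIntegrable_of_Icc hαβ.le (μ := volume)
  have i3 := c3.intervalIntegrable_of_Icc hαβ.le (μ := volume)
  -- The function `ψ φ²` vanishes at both ends, and the Riccati inequality bounds its derivative by
  -- `φ'² + V φ² - E φ² - (φ' - ψ φ)²`. A right derivative of `ψ` suffices, so `ψ` may be glued from
  -- two pieces with a corner.
  have key := intervalIntegral.sub_le_integral_of_hasDeriv_right_of_le
    (g := fun x => ψ x * φ x ^ 2) (g' := fun x => ψ' x * φ x ^ 2 + ψ x * (2 * φ x * deriv φ x))
    (φ := fun x => (deriv φ x ^ 2 + V x * φ x ^ 2) - E * φ x ^ 2 - (deriv φ x - ψ x * φ x) ^ 2)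
    hαβ.le (cψ.mul c3) ?_ ?_ ?_
  · have e1 : φ α = 0 := z α fun h => lt_irrefl _ (hK h).1
    have e2 : φ β = 0 := z β fun h => lt_irrefl _ (hK h).2
    rw [intervalIntegral.integral_sub (i2.sub (i3.const_mul E)) i1,
      intervalIntegral.integral_sub i2 (i3.const_mul E),
      intervalIntegral.integral_const_mul] at key
    simp only [e1, e2] at key
    linarith
  · intro x hx
    have hxI := hI (Ioo_subset_Icc_self hx)
    have h2 : HasDerivAt (fun x => φ x ^ 2) (2 * φ x * deriv φ x) x := by
      have := ((hφ.differentiable one_ne_zero) x).hasDerivAt.pow 2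
      exact this.congr_deriv (by simp)
    exact (hd x hxI).mul h2.hasDerivWithinAt
  · exact ((c2.sub (continuousOn_const.mul c3)).sub c1).integrableOn_Icc
  · intro x hx
    have hxI := hI (Ioo_subset_Icc_self hx)
    have := mul_le_mul_of_nonneg_right (hle x hxI) (sq_nonneg (φ x))
    nlinarith

lemma le_groundEnergy_of_riccati {V ψ ψ' : ℝ → ℝ} {a t : EReal} (hat : a < t) {E : ℝ}
    (hV : ContinuousOn V (interval a t)) (hψ : ContinuousOn ψ (interval a t))
    (hd : ∀ x ∈ interval a t, HasDerivWithinAt ψ (ψ' x) (Ioi x) x)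
    (hle : ∀ x ∈ interval a t, ψ' x + ψ x ^ 2 + E ≤ V x) : (E : EReal) ≤ groundEnergy V a t := by
  refine le_groundEnergy hV fun φ hφ => ?_
  have h1 := jacobi_le hat hV hψ hd hle (hφ.1.of_le (by simp)) hφ.2.1 hφ.2.2
  have h2 : 0 ≤ ∫ x in interval a t, (deriv φ x - ψ x * φ x) ^ 2 :=
    integral_nonneg fun x => sq_nonneg _
  linarith

/-- Jacobi's inequality for the logarithmic derivative of a positive solution. -/
lemma jacobi_le_of_pos {V y v φ : ℝ → ℝ} {a t : EReal} (hat : a < t) {E : ℝ}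
    (hV : ContinuousOn V (interval a t)) (hy : ∀ x ∈ interval a t, HasDerivAt y (v x) x)
    (hv : ∀ x ∈ interval a t, HasDerivAt v ((V x - E) * y x) x)
    (hpos : ∀ x ∈ interval a t, 0 < y x)
    (hφ : ContDiff ℝ 1 φ) (hs : HasCompactSupport φ) (hsub : tsupport φ ⊆ interval a t) :
    ∫ x in interval a t, (deriv φ x - v x / y x * φ x) ^ 2 ≤
      (∫ x in interval a t, (deriv φ x ^ 2 + V x * φ x ^ 2)) -
        E * ∫ x in interval a t, φ x ^ 2 := by
  have hd : ∀ x ∈ interval a t, HasDerivAt (fun x => v x / y x)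
      (((V x - E) * y x * y x - v x * v x) / y x ^ 2) x := fun x hx =>
    (hv x hx).div (hy x hx) (hpos x hx).ne'
  refine jacobi_le hat hV (fun x hx => (hd x hx).continuousAt.continuousWithinAt)
    (fun x hx => (hd x hx).hasDerivWithinAt) (fun x hx => ?_) hφ hs hsub
  have := (hpos x hx).ne'
  apply le_of_eq
  field_simp
  ring

lemma le_groundEnergy_of_pos {V y v : ℝ → ℝ} {a t : EReal} (hat : a < t) {E : ℝ}
    (hV : ContinuousOn V (interval a t)) (hy : ∀ x ∈ interval a t, HasDerivAt y (v x) x)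
    (hv : ∀ x ∈ interval a t, HasDerivAt v ((V x - E) * y x) x)
    (hpos : ∀ x ∈ interval a t, 0 < y x) : (E : EReal) ≤ groundEnergy V a t := by
  refine le_groundEnergy hV fun φ hφ => ?_
  have h1 := jacobi_le_of_pos hat hV hy hv hpos (hφ.1.of_le (by simp)) hφ.2.1 hφ.2.2
  have h2 : 0 ≤ ∫ x in interval a t, (deriv φ x - v x / y x * φ x) ^ 2 :=
    integral_nonneg fun x => sq_nonneg _
  linarith

/-- A solution that vanishes at two points bounds the ground state energy above. -/
lemma groundEnergy_le_of_zeros {V y v : ℝ → ℝ} {a b : EReal} {E x₁ x₂ : ℝ}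
    (hV : ContinuousOn V (interval a b)) (hx₁ : x₁ ∈ interval a b) (hx₂ : x₂ ∈ interval a b)
    (hlt : x₁ < x₂) (hy : ∀ x ∈ Icc x₁ x₂, HasDerivAt y (v x) x)
    (hv : ∀ x ∈ Icc x₁ x₂, HasDerivAt v ((V x - E) * y x) x)
    (h₁ : y x₁ = 0) (h₂ : y x₂ = 0) (hpos : ∀ x ∈ Ioo x₁ x₂, 0 < y x) :
    groundEnergy V a x₂ ≤ E := by
  have hax₂ : a < (x₂ : EReal) := hx₂.1
  have hV2 : ContinuousOn V (interval a x₂) := hV.mono (interval_mono hx₂.2.le)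
  have hI : Icc x₁ x₂ ⊆ interval a b := Icc_subset_interval hx₁ hx₂
  have cy : ContinuousOn y (Icc x₁ x₂) := fun x hx => (hy x hx).continuousAt.continuousWithinAt
  have cv : ContinuousOn v (Icc x₁ x₂) := fun x hx => (hv x hx).continuousAt.continuousWithinAt
  have cV : ContinuousOn V (Icc x₁ x₂) := hV.mono hI
  -- comparison with truncations
  have main : ∀ E' : ℝ, (E' : EReal) ≤ groundEnergy V a x₂ → ∀ ε > 0, ∀ θ : ℝ → ℝ,
      ContDiff ℝ ∞ θ → (∀ s, |deriv θ s| ≤ 1) → (∀ s, |s| ≤ ε → θ s = 0) →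
      E' * ∫ x in x₁..x₂, θ (y x) ^ 2 ≤
        (∫ x in x₁..x₂, v x ^ 2) + ∫ x in x₁..x₂, V x * θ (y x) ^ 2 := by
    intro E' hE' ε hε θ hθ hθ1 hθ0
    -- Since `θ` kills small values and `y` vanishes at `x₁` and `x₂`, this extension by zero
    -- vanishes near both points; it is `C¹` with compact support inside `(x₁, x₂)`.
    set w : ℝ → ℝ := (Ioo x₁ x₂).indicator (fun x => θ (y x)) with hw
    have hin : ∀ x ∈ Ioo x₁ x₂, w =ᶠ[𝓝 x] fun x => θ (y x) := fun x hx => by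
      filter_upwards [isOpen_Ioo.mem_nhds hx] with z hz
      exact indicator_of_mem hz _
    have hθy : ∀ x ∈ Ioo x₁ x₂, HasDerivAt (fun x => θ (y x)) (deriv θ (y x) * v x) x :=
      fun x hx => ((hθ.differentiable (by simp)) (y x)).hasDerivAt.comp x
        (hy x (Ioo_subset_Icc_self hx))
    have hedge : ∀ x, y x = 0 → x ∈ Icc x₁ x₂ → w =ᶠ[𝓝 x] fun _ => 0 := by
      intro x h0 hx
      have hc := (hy x hx).continuousAt
      have : ∀ᶠ z in 𝓝 x, |y z| < ε := by
        have h := hc.abs.eventually (gt_mem_nhds (show |y x| < ε by rw [h0]; simpa using hε))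
        exact h
      filter_upwards [this] with z hz
      by_cases hzI : z ∈ Ioo x₁ x₂
      · rw [hw, indicator_of_mem hzI, hθ0 _ hz.le]
      · rw [hw, indicator_of_notMem hzI]
    have hout : ∀ x ∉ Ioo x₁ x₂, w =ᶠ[𝓝 x] fun _ => 0 := by
      intro x hx
      by_cases h1 : x = x₁
      · subst h1; exact hedge _ h₁ (left_mem_Icc.2 hlt.le)
      by_cases h2 : x = x₂
      · subst h2; exact hedge _ h₂ (right_mem_Icc.2 hlt.le)
      have : x ∈ (Icc x₁ x₂)ᶜ := by
        intro hI
        exact hx ⟨lt_of_le_of_ne hI.1 (Ne.symm h1), lt_of_le_of_ne hI.2 h2⟩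
      filter_upwards [isClosed_Icc.isOpen_compl.mem_nhds this] with z hz
      exact indicator_of_notMem (fun h => hz (Ioo_subset_Icc_self h)) _
    have hwd : ∀ x, HasDerivAt w ((Ioo x₁ x₂).indicator (fun x => deriv θ (y x) * v x) x) x := by
      intro x
      by_cases hx : x ∈ Ioo x₁ x₂
      · rw [indicator_of_mem hx]; exact (hθy x hx).congr_of_eventuallyEq (hin x hx)
      · rw [indicator_of_notMem hx]
        exact (hasDerivAt_const x (0:ℝ)).congr_of_eventuallyEq (hout x hx)
    have hwd' : deriv w = (Ioo x₁ x₂).indicator (fun x => deriv θ (y x) * v x) :=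
      funext fun x => (hwd x).deriv
    have hsuppw : tsupport w ⊆ Ioo x₁ x₂ := by
      intro x hx
      by_contra hcon
      exact (notMem_tsupport_iff_eventuallyEq.2 (hout x hcon)) hx
    have hwc : ContDiff ℝ 1 w := by
      rw [contDiff_one_iff_deriv]
      refine ⟨fun x => (hwd x).differentiableAt, continuous_iff_continuousAt.2 fun x => ?_⟩
      by_cases hx : x ∈ Ioo x₁ x₂
      · have : deriv w =ᶠ[𝓝 x] fun x => deriv θ (y x) * v x := by
          filter_upwards [isOpen_Ioo.mem_nhds hx] with z hz
          rw [hwd', indicator_of_mem hz]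
        refine ContinuousAt.congr ?_ this.symm
        exact ((hθ.continuous_deriv (by simp)).continuousAt.comp
          (hy x (Ioo_subset_Icc_self hx)).continuousAt).mul
          (hv x (Ioo_subset_Icc_self hx)).continuousAt
      · have : deriv w =ᶠ[𝓝 x] fun _ => 0 := by
          have := (hout x hx).deriv
          simpa using this
        exact continuousAt_const.congr this.symm
    have hwcs : HasCompactSupport w :=
      HasCompactSupport.of_support_subset_isCompact isCompact_Icc
        ((subset_tsupport _).trans (hsuppw.trans Ioo_subset_Icc_self))
    have hsub : tsupport w ⊆ interval a x₂ := fun x hx =>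
      ⟨hx₁.1.trans (EReal.coe_lt_coe_iff.2 (hsuppw hx).1), EReal.coe_lt_coe_iff.2 (hsuppw hx).2⟩
    have := mul_le_of_le_groundEnergy hV2 hE' hwc hwcs hsub
    rw [setIntegral_interval_eq_intervalIntegral hlt hsuppw hsub
      fun x hx => energy_density_eq_zero hx,
      setIntegral_interval_eq_intervalIntegral hlt hsuppw hsub
      fun x hx => sq_eq_zero_of_notMem_tsupport hx] at this
    have cθ : ContinuousOn (fun x => θ (y x)) (Icc x₁ x₂) := hθ.continuous.comp_continuousOn cy
    have e1 : ∫ x in x₁..x₂, w x ^ 2 = ∫ x in x₁..x₂, θ (y x) ^ 2 := by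
      rw [intervalIntegral.integral_of_le hlt.le, intervalIntegral.integral_of_le hlt.le,
        integral_Ioc_eq_integral_Ioo, integral_Ioc_eq_integral_Ioo]
      refine setIntegral_congr_fun measurableSet_Ioo fun x hx => ?_
      simp only [hw, indicator_of_mem hx]
    rw [e1] at this
    refine this.trans ?_
    have i1 : IntervalIntegrable (fun x => v x ^ 2) volume x₁ x₂ :=
      (cv.pow 2).intervalIntegrable_of_Icc hlt.le
    have i2 : IntervalIntegrable (fun x => V x * θ (y x) ^ 2) volume x₁ x₂ :=
      (cV.mul (cθ.pow 2)).intervalIntegrable_of_Icc hlt.le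
    rw [← intervalIntegral.integral_add i1 i2]
    have c3 : ContinuousOn (fun x => deriv w x ^ 2 + V x * w x ^ 2) (Icc x₁ x₂) :=
      ((hwc.continuous_deriv le_rfl).continuousOn.pow 2).add
        (cV.mul (hwc.continuous.continuousOn.pow 2))
    refine intervalIntegral.integral_mono_on_of_le_Ioo hlt.le
      (c3.intervalIntegrable_of_Icc hlt.le) (i1.add i2) fun x hx => ?_
    have hd1 : deriv w x ^ 2 ≤ v x ^ 2 := by
      rw [hwd', indicator_of_mem hx, mul_pow]
      exact mul_le_of_le_one_left (sq_nonneg _) (sq_le_one_iff_abs_le_one _ |>.2 (hθ1 _))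
    have : w x = θ (y x) := indicator_of_mem hx _
    rw [this]
    linarith
  -- With `E < E' < λ(x₂)`, the inequality `main` survives as the truncation height tends to zero
  -- and contradicts the integrated equation `∫ (v² + V y²) = E ∫ y²`.
  by_contra hcon
  rw [not_le] at hcon
  obtain ⟨E', hE1, hE2⟩ := EReal.lt_iff_exists_real_btwn.1 hcon
  rw [EReal.coe_lt_coe_iff] at hE1
  have trunc : ∀ k : ℕ, ∃ θ : ℝ → ℝ, ContDiff ℝ ∞ θ ∧ (∀ s, |deriv θ s| ≤ 1) ∧
      (∀ s, |s| ≤ 1 / ((k : ℝ) + 1) → θ s = 0) ∧ (∀ s, |θ s| ≤ |s|) ∧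
      ∀ s, |θ s - s| ≤ 4 * (1 / ((k : ℝ) + 1)) := fun k =>
    exists_truncation_scale (by positivity)
  choose θ hθ1 hθ2 hθ3 hθ4 hθ5 using trunc
  have hθlim : ∀ s, Tendsto (fun k => θ k s) atTop (𝓝 s) := by
    intro s
    rw [tendsto_iff_norm_sub_tendsto_zero]
    refine squeeze_zero (fun k => norm_nonneg _) (fun k => hθ5 k s) ?_
    simpa using tendsto_one_div_add_atTop_nhds_zero_nat.const_mul (4:ℝ)
  have hlim : ∀ f : ℝ → ℝ, ContinuousOn f (Icc x₁ x₂) →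
      Tendsto (fun k => ∫ x in x₁..x₂, f x * θ k (y x) ^ 2) atTop
        (𝓝 (∫ x in x₁..x₂, f x * y x ^ 2)) := by
    intro f hf
    refine intervalIntegral.tendsto_integral_filter_of_dominated_convergence
      (fun x => ‖f x * y x ^ 2‖) (Eventually.of_forall fun k => ?_)
      (Eventually.of_forall fun k => ae_of_all _ fun x hx => ?_) ?_ (ae_of_all _ fun x hx => ?_)
    · rw [uIoc_of_le hlt.le]
      exact ((hf.mul (((hθ1 k).continuous.comp_continuousOn cy).pow 2)).mono
        Ioc_subset_Icc_self).aestronglyMeasurable measurableSet_Ioc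
    · rw [norm_mul, norm_mul]
      refine mul_le_mul_of_nonneg_left ?_ (norm_nonneg _)
      rw [norm_pow, norm_pow]
      exact pow_le_pow_left₀ (norm_nonneg _) (hθ4 k _) 2
    · exact ((hf.mul (cy.pow 2)).norm).intervalIntegrable_of_Icc hlt.le
    · exact ((hθlim _).pow 2).const_mul _
  have l1 := hlim V cV
  have l2 := hlim (fun _ => 1) continuousOn_const
  simp only [one_mul] at l2
  have hle : E' * ∫ x in x₁..x₂, y x ^ 2 ≤
      (∫ x in x₁..x₂, v x ^ 2) + ∫ x in x₁..x₂, V x * y x ^ 2 :=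
    le_of_tendsto_of_tendsto (l2.const_mul E') (l1.const_add _) (Eventually.of_forall fun k =>
      main E' hE2.le _ (by positivity) (θ k) (hθ1 k) (hθ2 k) (hθ3 k))
  have i1 : IntervalIntegrable (fun x => v x ^ 2) volume x₁ x₂ :=
    (cv.pow 2).intervalIntegrable_of_Icc hlt.le
  have i2 : IntervalIntegrable (fun x => V x * y x ^ 2) volume x₁ x₂ :=
    (cV.mul (cy.pow 2)).intervalIntegrable_of_Icc hlt.le
  have i3 : IntervalIntegrable (fun x => y x ^ 2) volume x₁ x₂ :=
    (cy.pow 2).intervalIntegrable_of_Icc hlt.le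
  -- The integrand is `(y v)'`, and `y` vanishes at both ends.
  have parts : ∫ x in x₁..x₂, (v x ^ 2 + V x * y x ^ 2 - E * y x ^ 2) = 0 := by
    rw [intervalIntegral.integral_eq_sub_of_hasDerivAt (f := fun x => y x * v x) ?_
      ((i1.add i2).sub (i3.const_mul E))]
    · simp [h₁, h₂]
    · intro x hx
      rw [uIcc_of_le hlt.le] at hx
      refine ((hy x hx).mul (hv x hx)).congr_deriv ?_
      ring
  rw [intervalIntegral.integral_sub (i1.add i2) (i3.const_mul E),
    intervalIntegral.integral_add i1 i2, intervalIntegral.integral_const_mul] at parts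
  have hp : 0 < ∫ x in x₁..x₂, y x ^ 2 :=
    intervalIntegral.intervalIntegral_pos_of_pos_on i3 (fun x hx => pow_pos (hpos x hx) 2) hlt
  nlinarith

end GroundState

/-! ### Resolvents in weighted spaces, and the initial value problem. -/

namespace GroundState

open Classical in
/-- Extension by zero of the weighted lift of a function on `J`. -/
noncomputable def lift {J : Set ℝ} (ϖ : ℝ → ℝ) (φ : J → ℝ) (y : ℝ) : ℝ :=
  if h : y ∈ J then ϖ y * φ ⟨y, h⟩ else 0

lemma lift_of_mem {J : Set ℝ} {ϖ : ℝ → ℝ} {φ : J → ℝ} {y : ℝ} (h : y ∈ J) :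
    lift ϖ φ y = ϖ y * φ ⟨y, h⟩ := dif_pos h

lemma continuousOn_lift {J : Set ℝ} {ϖ : ℝ → ℝ} (hϖ : ContinuousOn ϖ J) {φ : J → ℝ}
    (hφ : Continuous φ) : ContinuousOn (lift ϖ φ) J := by
  rw [continuousOn_iff_continuous_domRestrict]
  have : J.domRestrict (lift ϖ φ) = fun y : J => J.domRestrict ϖ y * φ y := by
    ext y; exact lift_of_mem y.2
  rw [this]
  exact (continuousOn_iff_continuous_domRestrict.1 hϖ).mul hφ

/-- `F μ = (1 - μ T)⁻¹ φ₀`: the inverse exists by the Neumann series, and inversion is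
differentiable at units of the algebra of operators. `Ring.inverse` is total, so `F` is defined for
all `μ`. -/
lemma exists_resolvent_banach {X : Type*} [NormedAddCommGroup X] [NormedSpace ℝ X]
    [CompleteSpace X] (T : X →L[ℝ] X) (φ₀ : X) : ∃ F : ℝ → X, ∀ μ : ℝ, |μ| * ‖T‖ < 1 →
      F μ = φ₀ + μ • T (F μ) ∧ DifferentiableAt ℝ F μ := by
  refine ⟨fun μ => Ring.inverse (1 - μ • T) φ₀, fun μ hμ => ?_⟩
  have hn : ‖μ • T‖ < 1 := by rw [norm_smul]; exact hμ
  have hu : IsUnit (1 - μ • T) := isUnit_one_sub_of_norm_lt_one hn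
  constructor
  · have h1 : (1 - μ • T) (Ring.inverse (1 - μ • T) φ₀) = φ₀ := by
      show ((1 - μ • T) * Ring.inverse (1 - μ • T)) φ₀ = φ₀
      rw [Ring.mul_inverse_cancel _ hu]; rfl
    have h2 : ∀ ψ, (1 - μ • T) ψ = ψ - μ • T ψ := fun ψ => rfl
    rw [h2] at h1
    exact (sub_eq_iff_eq_add.1 h1)
  · have h1 : DifferentiableAt ℝ (fun μ : ℝ => (1 : X →L[ℝ] X) - μ • T) μ :=
      (differentiableAt_const _).sub (differentiableAt_id.smul_const T)
    have h2 : DifferentiableAt ℝ Ring.inverse (1 - μ • T) := differentiableAt_inverse hu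
    have h3 : DifferentiableAt ℝ (fun μ : ℝ => Ring.inverse (1 - μ • T)) μ :=
      DifferentiableAt.comp (g := Ring.inverse) μ h2 h1
    exact h3.clm_apply (differentiableAt_const φ₀)

/-- The solution of `R = g + μ K R` for a contraction-like linear operator `K` in a weighted
supremum norm, together with its derivative `S` in the parameter `μ`. -/
lemma exists_resolvent {J : Set ℝ} {ϖ g : ℝ → ℝ} {K : (ℝ → ℝ) → ℝ → ℝ} {θ C₀ : ℝ} (hθ : 0 ≤ θ)
    (hϖ : ContinuousOn ϖ J) (hpos : ∀ x ∈ J, 0 < ϖ x)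
    (hK : ∀ f C, 0 ≤ C → ContinuousOn f J → (∀ x ∈ J, |f x| ≤ C * ϖ x) →
      ContinuousOn (K f) J ∧ ∀ x ∈ J, |K f x| ≤ θ * C * ϖ x)
    (hlin : ∀ f h r C, ContinuousOn f J → ContinuousOn h J → (∀ x ∈ J, |f x| ≤ C * ϖ x) →
      (∀ x ∈ J, |h x| ≤ C * ϖ x) → ∀ x ∈ J, K (fun y => f y + r * h y) x = K f x + r * K h x)
    (hcongr : ∀ f h, EqOn f h J → EqOn (K f) (K h) J)
    (hg : ContinuousOn g J) (hgb : ∀ x ∈ J, |g x| ≤ C₀ * ϖ x) :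
    ∃ R S : ℝ → ℝ → ℝ, ∀ μ, |μ| * θ < 1 → ContinuousOn (R μ) J ∧ ContinuousOn (S μ) J ∧
      (∃ C, 0 ≤ C ∧ ∀ x ∈ J, |R μ x| ≤ C * ϖ x ∧ |S μ x| ≤ C * ϖ x) ∧
      (∀ x ∈ J, R μ x = g x + μ * K (R μ) x) ∧
      ∀ ε > 0, ∀ᶠ ν in 𝓝 μ, ∀ x ∈ J,
        |R ν x - R μ x - (ν - μ) * S μ x| ≤ ε * |ν - μ| * ϖ x := by
  have hlb : ∀ (φ : BoundedContinuousFunction J ℝ), ∀ x ∈ J, |lift ϖ φ x| ≤ ‖φ‖ * ϖ x := by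
    intro φ x hx
    rw [lift_of_mem hx, abs_mul, abs_of_pos (hpos x hx), mul_comm]
    exact mul_le_mul_of_nonneg_right (φ.norm_coe_le_norm ⟨x, hx⟩) (hpos x hx).le
  have hKl : ∀ φ : BoundedContinuousFunction J ℝ, ContinuousOn (K (lift ϖ φ)) J ∧
      ∀ x ∈ J, |K (lift ϖ φ) x| ≤ θ * ‖φ‖ * ϖ x := fun φ =>
    hK _ _ (norm_nonneg φ) (continuousOn_lift hϖ φ.continuous) (hlb φ)
  have hTc : ∀ φ : BoundedContinuousFunction J ℝ,
      Continuous (fun x : J => K (lift ϖ φ) x / ϖ x) := fun φ =>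
    (continuousOn_iff_continuous_domRestrict.1 (hKl φ).1).div
      (continuousOn_iff_continuous_domRestrict.1 hϖ) fun x => (hpos x x.2).ne'
  have hTb : ∀ φ : BoundedContinuousFunction J ℝ, ∀ x : J,
      ‖K (lift ϖ φ) x / ϖ x‖ ≤ θ * ‖φ‖ := fun φ x => by
    rw [norm_div, Real.norm_eq_abs, Real.norm_eq_abs, abs_of_pos (hpos x x.2),
      div_le_iff₀ (hpos x x.2)]
    exact (hKl φ).2 x x.2
  -- Conjugation by the weight: `φ ↦ K (ϖ φ) / ϖ` acts on bounded continuous functions on `J` with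
  -- norm at most `θ`.
  let T₀ : BoundedContinuousFunction J ℝ → BoundedContinuousFunction J ℝ := fun φ =>
    BoundedContinuousFunction.ofNormedAddCommGroup _ (hTc φ) (θ * ‖φ‖) (hTb φ)
  have hT₀ : ∀ φ x, T₀ φ x = K (lift ϖ φ) x / ϖ x := fun φ x => rfl
  have key : ∀ (φ ψ : BoundedContinuousFunction J ℝ) (r : ℝ), T₀ (φ + r • ψ) = T₀ φ + r • T₀ ψ := by
    intro φ ψ r
    ext x
    have e : EqOn (lift ϖ (φ + r • ψ)) (fun y => lift ϖ φ y + r * lift ϖ ψ y) J := by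
      intro y hy
      simp only [lift_of_mem hy, BoundedContinuousFunction.coe_add,
        BoundedContinuousFunction.coe_smul, Pi.add_apply, smul_eq_mul]
      ring
    have h1 := hcongr _ _ e x.2
    have h2 := hlin (lift ϖ φ) (lift ϖ ψ) r (max ‖φ‖ ‖ψ‖) (continuousOn_lift hϖ φ.continuous)
      (continuousOn_lift hϖ ψ.continuous)
      (fun y hy => (hlb φ y hy).trans
        (mul_le_mul_of_nonneg_right (le_max_left _ _) (hpos y hy).le))
      (fun y hy => (hlb ψ y hy).trans
        (mul_le_mul_of_nonneg_right (le_max_right _ _) (hpos y hy).le)) x x.2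
    have h3 : K (lift ϖ (⇑(φ + r • ψ))) x = K (lift ϖ φ) x + r * K (lift ϖ ψ) x := by
      rw [← h2]; exact h1
    rw [BoundedContinuousFunction.add_apply, BoundedContinuousFunction.smul_apply, hT₀, hT₀, hT₀,
      h3, add_div, mul_div_assoc, smul_eq_mul]
  -- `key` with `r = -1` reads `T₀ 0 = T₀ 0 - T₀ 0`.
  have hT0 : T₀ 0 = 0 := by
    have := key 0 0 (-1)
    simpa using this
  let T : BoundedContinuousFunction J ℝ →L[ℝ] BoundedContinuousFunction J ℝ :=
    LinearMap.mkContinuous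
      { toFun := T₀
        map_add' := fun φ ψ => by simpa using key φ ψ 1
        map_smul' := fun r ψ => by simpa [hT0] using key 0 ψ r } θ fun φ =>
      BoundedContinuousFunction.norm_ofNormedAddCommGroup_le _
        (mul_nonneg hθ (norm_nonneg φ)) (hTb φ)
  have hT : ∀ φ, T φ = T₀ φ := fun φ => rfl
  have hTn : ‖T‖ ≤ θ := LinearMap.mkContinuous_norm_le _ hθ _
  have hC₀ : ∀ x : J, ‖g x / ϖ x‖ ≤ C₀ := fun x => by
    rw [norm_div, Real.norm_eq_abs, Real.norm_eq_abs, abs_of_pos (hpos x x.2),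
      div_le_iff₀ (hpos x x.2)]
    exact hgb x x.2
  let φ₀ : BoundedContinuousFunction J ℝ := BoundedContinuousFunction.ofNormedAddCommGroup
    (fun x : J => g x / ϖ x) ((continuousOn_iff_continuous_domRestrict.1 hg).div
      (continuousOn_iff_continuous_domRestrict.1 hϖ) fun x => (hpos x x.2).ne') C₀ hC₀
  have hφ₀ : ∀ x : J, φ₀ x = g x / ϖ x := fun x => rfl
  obtain ⟨F, hF'⟩ := exists_resolvent_banach T φ₀
  refine ⟨fun μ => lift ϖ (F μ), fun μ => lift ϖ (deriv F μ : BoundedContinuousFunction J ℝ),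
    fun μ hμ => ?_⟩
  obtain ⟨hF, hFd⟩ := hF' μ ((mul_le_mul_of_nonneg_left hTn (abs_nonneg μ)).trans_lt hμ)
  refine ⟨continuousOn_lift hϖ (F μ).continuous, continuousOn_lift hϖ (deriv F μ).continuous,
    ⟨max ‖F μ‖ ‖deriv F μ‖, (norm_nonneg _).trans (le_max_left _ _), fun x hx => ⟨?_, ?_⟩⟩, ?_, ?_⟩
  · exact (hlb _ x hx).trans (mul_le_mul_of_nonneg_right (le_max_left _ _) (hpos x hx).le)
  · exact (hlb _ x hx).trans (mul_le_mul_of_nonneg_right (le_max_right _ _) (hpos x hx).le)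
  · intro x hx
    have h1 : F μ ⟨x, hx⟩ = g x / ϖ x + μ * (K (lift ϖ (F μ)) x / ϖ x) := by
      have := congrArg (fun φ : BoundedContinuousFunction J ℝ => φ ⟨x, hx⟩) hF
      simpa [hT, hT₀, hφ₀] using this
    show lift ϖ (F μ) x = _
    rw [lift_of_mem hx, h1]
    have := (hpos x hx).ne'
    field_simp
  · intro ε hε
    have := Asymptotics.isLittleO_iff.1 (hasDerivAt_iff_isLittleO.1 hFd.hasDerivAt) hε
    filter_upwards [this] with ν hν x hx
    have h1 := (BoundedContinuousFunction.norm_coe_le_norm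
      (F ν - F μ - (ν - μ) • deriv F μ) ⟨x, hx⟩).trans hν
    rw [lift_of_mem hx, lift_of_mem hx, lift_of_mem hx]
    have h2 : ϖ x * F ν ⟨x, hx⟩ - ϖ x * F μ ⟨x, hx⟩ - (ν - μ) * (ϖ x * deriv F μ ⟨x, hx⟩) =
      (F ν - F μ - (ν - μ) • deriv F μ) ⟨x, hx⟩ * ϖ x := by
      simp; ring
    rw [h2, abs_mul, abs_of_pos (hpos x hx)]
    exact mul_le_mul_of_nonneg_right h1 (hpos x hx).le

/-- Since `S` may contain an endpoint, its points need not have neighbourhoods inside it. This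
provides compact intervals that are neighbourhoods relative to `S`, on which the fundamental theorem
applies. -/
lemma exists_Icc_mem_nhdsWithin {S : Set ℝ} {x : ℝ} (hx : x ∈ S) :
    ∃ y ∈ S, ∃ z ∈ S, x ∈ Icc y z ∧ Icc y z ∈ 𝓝[S] x := by
  obtain ⟨y, hyS, hyx, hy⟩ : ∃ y ∈ S, y ≤ x ∧ Ici y ∈ 𝓝[S] x := by
    by_cases h : ∃ y ∈ S, y < x
    · obtain ⟨y, hy, hyx⟩ := h
      exact ⟨y, hy, hyx.le, mem_nhdsWithin_of_mem_nhds (Ici_mem_nhds hyx)⟩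
    · push Not at h
      exact ⟨x, hx, le_rfl, mem_of_superset self_mem_nhdsWithin h⟩
  obtain ⟨z, hzS, hzx, hz⟩ : ∃ z ∈ S, x ≤ z ∧ Iic z ∈ 𝓝[S] x := by
    by_cases h : ∃ z ∈ S, x < z
    · obtain ⟨z, hz, hzx⟩ := h
      exact ⟨z, hz, hzx.le, mem_nhdsWithin_of_mem_nhds (Iic_mem_nhds hzx)⟩
    · push Not at h
      exact ⟨x, hx, le_rfl, mem_of_superset self_mem_nhdsWithin h⟩
  exact ⟨y, hyS, z, hzS, ⟨hyx, hzx⟩, inter_mem hy hz⟩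

lemma continuousOn_primitive {S : Set ℝ} {f : ℝ → ℝ} {c : ℝ} (hc : c ∈ S)
    (hf : ∀ x ∈ S, ∀ y ∈ S, IntervalIntegrable f volume x y) :
    ContinuousOn (fun x => ∫ t in c..x, f t) S := by
  intro x hx
  obtain ⟨y, hy, z, hz, hxI, hI⟩ := exists_Icc_mem_nhdsWithin hx
  have h1 : ContinuousOn (fun x => ∫ t in c..x, f t) (Icc (min c y) (max c z)) := by
    have hmin : min c y ∈ S := by rcases min_choice c y with h | h <;> rw [h] <;> assumption
    have hmax : max c z ∈ S := by rcases max_choice c z with h | h <;> rw [h] <;> assumption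
    have hle : min c y ≤ max c z := (min_le_left _ _).trans (le_max_left _ _)
    rw [← uIcc_of_le hle]
    exact intervalIntegral.continuousOn_primitive_interval' (hf _ hmin _ hmax)
      (by rw [uIcc_of_le hle]; exact ⟨min_le_left _ _, le_max_left _ _⟩)
  have h2 := (h1.mono (Icc_subset_Icc (min_le_right _ _) (le_max_right _ _))) x hxI
  exact h2.mono_of_mem_nhdsWithin hI

lemma intervalIntegrable_of_continuousOn {S : Set ℝ} (hS : OrdConnected S) {f : ℝ → ℝ}
    (hf : ContinuousOn f S) {x y : ℝ} (hx : x ∈ S) (hy : y ∈ S) :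
    IntervalIntegrable f volume x y :=
  (hf.mono (hS.uIcc_subset hx hy)).intervalIntegrable

lemma hasDerivWithinAt_primitive {S : Set ℝ} (hS : OrdConnected S) {f : ℝ → ℝ} {c x : ℝ}
    (hc : c ∈ S) (hx : x ∈ S) (hf : ContinuousOn f S) :
    HasDerivWithinAt (fun x => ∫ t in c..x, f t) (f x) S x := by
  obtain ⟨y, hy, z, hz, hxI, hI⟩ := exists_Icc_mem_nhdsWithin hx
  have hsub : Icc y z ⊆ S := hS.out hy hz
  have : Fact (x ∈ Icc y z) := ⟨hxI⟩
  have h := intervalIntegral.integral_hasDerivWithinAt_right (s := Icc y z) (t := Icc y z)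
    (intervalIntegrable_of_continuousOn hS hf hc hx)
    ((hf.mono hsub).stronglyMeasurableAtFilter_nhdsWithin measurableSet_Icc x)
    ((hf.mono hsub) x hxI)
  exact h.mono_of_mem_nhdsWithin hI

/-- `(y, v)` solves `y' = v`, `v' = q y` on `S`; the second equation is required in the interior. -/
structure IsSol (q : ℝ → ℝ) (S : Set ℝ) (y v : ℝ → ℝ) : Prop where
  cont : ContinuousOn v S
  deriv₁ : ∀ x ∈ S, HasDerivWithinAt y (v x) S x
  deriv₂ : ∀ x ∈ interior S, HasDerivAt v (q x * y x) x

namespace IsSol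

variable {q : ℝ → ℝ} {S : Set ℝ} {y v y' v' : ℝ → ℝ}

lemma continuousOn (h : IsSol q S y v) : ContinuousOn y S :=
  fun x hx => (h.deriv₁ x hx).continuousWithinAt

lemma hasDerivAt (h : IsSol q S y v) {x : ℝ} (hx : x ∈ interior S) : HasDerivAt y (v x) x :=
  (h.deriv₁ x (interior_subset hx)).hasDerivAt (mem_interior_iff_mem_nhds.1 hx)

lemma add_const_mul (h : IsSol q S y v) (h' : IsSol q S y' v') (r : ℝ) :
    IsSol q S (fun x => y x + r * y' x) (fun x => v x + r * v' x) where
  cont := h.cont.add (continuousOn_const.mul h'.cont)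
  deriv₁ x hx := (h.deriv₁ x hx).add ((h'.deriv₁ x hx).const_mul r)
  deriv₂ x hx := ((h.deriv₂ x hx).add ((h'.deriv₂ x hx).const_mul r)).congr_deriv (by ring)

lemma mono (h : IsSol q S y v) {S' : Set ℝ} (hS : S' ⊆ S) : IsSol q S' y v where
  cont := h.cont.mono hS
  deriv₁ x hx := (h.deriv₁ x (hS hx)).mono hS
  deriv₂ x hx := h.deriv₂ x (interior_mono hS hx)

end IsSol

lemma eq_of_deriv_eq_zero {S : Set ℝ} (hS : OrdConnected S) {f : ℝ → ℝ} (hf : ContinuousOn f S)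
    (hd : ∀ x ∈ interior S, HasDerivAt f 0 x) {x y : ℝ} (hx : x ∈ S) (hy : y ∈ S) : f x = f y := by
  wlog h : x < y generalizing x y
  · rcases (not_lt.1 h).eq_or_lt with h | h
    · rw [h]
    · exact (this hy hx h).symm
  have hI : Icc x y ⊆ S := hS.out hx hy
  have hI' : Ioo x y ⊆ interior S := interior_maximal (Ioo_subset_Icc_self.trans hI) isOpen_Ioo
  obtain ⟨c, hc, h1⟩ := exists_hasDerivAt_eq_slope f (fun _ => 0) h (hf.mono hI)
    fun z hz => hd z (hI' hz)
  rw [eq_comm, div_eq_zero_iff] at h1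
  rcases h1 with h1 | h1 <;> linarith

lemma IsSol.wronskian {q : ℝ → ℝ} {S : Set ℝ} {y v y' v' : ℝ → ℝ} (hS : OrdConnected S)
    (h : IsSol q S y v) (h' : IsSol q S y' v') {x z : ℝ} (hx : x ∈ S) (hz : z ∈ S) :
    y x * v' x - v x * y' x = y z * v' z - v z * y' z :=
  eq_of_deriv_eq_zero hS (f := fun x => y x * v' x - v x * y' x)
    ((h.continuousOn.mul h'.cont).sub (h.cont.mul h'.continuousOn))
    (fun w hw => (((h.hasDerivAt hw).mul (h'.deriv₂ w hw)).sub
      ((h.deriv₂ w hw).mul (h'.hasDerivAt hw))).congr_deriv (by ring)) hx hz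

/-- The initial value problem for `y'' = q y`, with `q` locally integrable on `S`. -/
lemma exists_isSol {q : ℝ → ℝ} {S : Set ℝ} (hS : OrdConnected S)
    (hq : ∀ x ∈ S, ∀ y ∈ S, IntervalIntegrable q volume x y)
    (hqc : ContinuousOn q (interior S)) {c : ℝ} (hc : c ∈ S) (α β : ℝ) :
    ∃ y v, IsSol q S y v ∧ y c = α ∧ v c = β := by
  -- The summand 1 lets `Q` dominate both integrations, the one against `q` and the plain one, as
  -- well as `|x - c|`.
  set Q : ℝ → ℝ := fun x => ∫ t in c..x, (1 + |q t|) with hQ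
  have hq1 : ∀ x ∈ S, ∀ y ∈ S, IntervalIntegrable (fun t => 1 + |q t|) volume x y :=
    fun x hx y hy => intervalIntegrable_const.add (hq x hx y hy).abs
  have hQc : ContinuousOn Q S := continuousOn_primitive hc hq1
  have hQd : ∀ x ∈ interior S, HasDerivAt Q (1 + |q x|) x := fun x hx => by
    have hca : ContinuousAt q x := hqc.continuousAt (isOpen_interior.mem_nhds hx)
    refine intervalIntegral.integral_hasDerivAt_right (hq1 c hc x (interior_subset hx)) ?_
      (continuousAt_const.add hca.abs)
    exact (continuousOn_const.add hqc.abs).stronglyMeasurableAtFilter isOpen_interior x hx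
  -- With this weight `∫_c^x (1 + |q|) ϖ = sinh (2 Q) / 2`, of modulus at most `ϖ / 2`. Two
  -- integrations give the factor `1 / 4`, so the value `μ = 1` of the resolvent is available. The
  -- even function `cosh` serves both sides of `c`.
  set ϖ : ℝ → ℝ := fun x => Real.cosh (2 * Q x) with hϖ
  have hϖc : ContinuousOn ϖ S := Real.continuous_cosh.comp_continuousOn (continuousOn_const.mul hQc)
  have hϖ1 : ∀ x, 1 ≤ ϖ x := fun x => Real.one_le_cosh _
  have hint : ∀ x ∈ S, IntervalIntegrable (fun t => (1 + |q t|) * ϖ t) volume c x := fun x hx =>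
    (hq1 c hc x hx).mul_continuousOn (hϖc.mono (hS.uIcc_subset hc hx))
  have hFTC : ∀ x ∈ S, ∫ t in c..x, (1 + |q t|) * ϖ t = Real.sinh (2 * Q x) / 2 := by
    intro x hx
    have hI := hS.uIcc_subset hc hx
    have hI' : Ioo (min c x) (max c x) ⊆ interior S :=
      interior_maximal (Ioo_subset_Icc_self.trans hI) isOpen_Ioo
    rw [intervalIntegral.integral_eq_sub_of_hasDeriv_right
      (f := fun t => Real.sinh (2 * Q t) / 2) ?_ ?_ (hint x hx)]
    · simp [hQ]
    · exact (Real.continuous_sinh.comp_continuousOn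
        (continuousOn_const.mul (hQc.mono hI))).div_const 2
    · intro t ht
      have h1 := (((Real.hasDerivAt_sinh (2 * Q t)).comp t
        ((hQd t (hI' ht)).const_mul 2)).div_const 2).hasDerivWithinAt (s := Ioi t)
      refine h1.congr_deriv ?_
      simp only [hϖ]; ring
  set K : (ℝ → ℝ) → ℝ → ℝ := fun f x => ∫ ξ in c..x, ∫ η in c..ξ, q η * f η with hK
  have hqf : ∀ f, ContinuousOn f S → ∀ x ∈ S, ∀ y ∈ S,
      IntervalIntegrable (fun η => q η * f η) volume x y := fun f hf x hx y hy =>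
    (hq x hx y hy).mul_continuousOn (hf.mono (hS.uIcc_subset hx hy))
  have hin : ∀ f, ContinuousOn f S → ContinuousOn (fun ξ => ∫ η in c..ξ, q η * f η) S :=
    fun f hf => continuousOn_primitive hc (hqf f hf)
  have hinner : ∀ f C, 0 ≤ C → ContinuousOn f S → (∀ x ∈ S, |f x| ≤ C * ϖ x) → ∀ ξ ∈ S,
      |∫ η in c..ξ, q η * f η| ≤ C / 2 * ϖ ξ := by
    intro f C hC hf hfb ξ hξ
    have h1 := intervalIntegral.norm_integral_le_abs_of_norm_le
      (f := fun η => q η * f η) (g := fun t => C * ((1 + |q t|) * ϖ t)) (μ := volume) (a := c)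
      (b := ξ) ?_ ((hint ξ hξ).const_mul C)
    · rw [intervalIntegral.integral_const_mul, hFTC ξ hξ, abs_mul, abs_of_nonneg hC] at h1
      refine h1.trans ?_
      have h2 : |Real.sinh (2 * Q ξ)| ≤ ϖ ξ :=
        abs_le_of_sq_le_sq' (by simp only [hϖ, Real.cosh_sq]; linarith) (zero_le_one.trans (hϖ1 ξ))
          |> abs_le.2
      rw [abs_div, abs_two]
      calc C * (|Real.sinh (2 * Q ξ)| / 2) ≤ C * (ϖ ξ / 2) := by gcongr
        _ = _ := by ring
    · refine (ae_restrict_iff' measurableSet_uIoc).2 (ae_of_all _ fun t ht => ?_)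
      have htS : t ∈ S := hS.uIcc_subset hc hξ (uIoc_subset_uIcc ht)
      rw [norm_mul, Real.norm_eq_abs, Real.norm_eq_abs]
      have h3 := hfb t htS
      have h4 : 0 ≤ C * ϖ t := (abs_nonneg _).trans h3
      nlinarith [abs_nonneg (q t), mul_le_mul_of_nonneg_left h3 (abs_nonneg (q t))]
  have hres := exists_resolvent (J := S) (ϖ := ϖ) (g := fun x =>
      (α + β * (x - c))) (K := K) (θ := 1 / 4) (C₀ := |α| + |β|)
    (by norm_num) hϖc (fun x _ => zero_lt_one.trans_le (hϖ1 x)) ?_ ?_ ?_ ?_ ?_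
  · obtain ⟨R, _, hR⟩ := hres
    obtain ⟨h1, -, -, h2, -⟩ := hR 1 (by norm_num)
    refine ⟨fun x => α + ∫ ξ in c..x, (β + ∫ η in c..ξ, q η * R 1 η),
      fun x => β + ∫ η in c..x, q η * R 1 η, ⟨?_, ?_, ?_⟩, by simp, by simp⟩
    · exact continuousOn_const.add (hin _ h1)
    · intro x hx
      exact (hasDerivWithinAt_primitive hS hc hx (continuousOn_const.add (hin _ h1))).const_add α
    · intro x hx
      have hxS := interior_subset hx
      have e : (α + ∫ ξ in c..x, (β + ∫ η in c..ξ, q η * R 1 η)) = R 1 x := by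
        rw [h2 x hxS, intervalIntegral.integral_add intervalIntegrable_const
          (intervalIntegrable_of_continuousOn hS (hin _ h1) hc hxS)]
        simp [hK]; ring
      rw [e]
      refine (intervalIntegral.integral_hasDerivAt_right (hqf _ h1 c hc x hxS) ?_ ?_).const_add β
      · exact ((hqc.mul (h1.mono interior_subset))).stronglyMeasurableAtFilter isOpen_interior x hx
      · exact (hqc.mul (h1.mono interior_subset)).continuousAt (isOpen_interior.mem_nhds hx)
  · intro f C hC hf hfb
    refine ⟨continuousOn_primitive hc fun x hx y hy =>
      intervalIntegrable_of_continuousOn hS (hin f hf) hx hy, fun x hx => ?_⟩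
    have h1 := intervalIntegral.norm_integral_le_abs_of_norm_le
      (f := fun ξ => ∫ η in c..ξ, q η * f η) (g := fun t => C / 2 * ((1 + |q t|) * ϖ t))
      (μ := volume) (a := c) (b := x) ?_ ((hint x hx).const_mul (C / 2))
    · rw [intervalIntegral.integral_const_mul, hFTC x hx, abs_mul,
        abs_of_nonneg (by positivity : 0 ≤ C / 2)] at h1
      refine h1.trans ?_
      have h2 : |Real.sinh (2 * Q x)| ≤ ϖ x :=
        abs_le_of_sq_le_sq' (by simp only [hϖ, Real.cosh_sq]; linarith) (zero_le_one.trans (hϖ1 x))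
          |> abs_le.2
      rw [abs_div, abs_two]
      calc C / 2 * (|Real.sinh (2 * Q x)| / 2) ≤ C / 2 * (ϖ x / 2) := by gcongr
        _ = _ := by ring
    · refine (ae_restrict_iff' measurableSet_uIoc).2 (ae_of_all _ fun t ht => ?_)
      have htS : t ∈ S := hS.uIcc_subset hc hx (uIoc_subset_uIcc ht)
      refine (hinner f C hC hf hfb t htS).trans ?_
      refine mul_le_mul_of_nonneg_left ?_ (by positivity)
      exact le_mul_of_one_le_left (zero_le_one.trans (hϖ1 t)) (by linarith [abs_nonneg (q t)])
  · intro f h r C hf hh _ _ x hx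
    have e : ∀ ξ ∈ S, ∫ η in c..ξ, q η * (f η + r * h η) =
        (∫ η in c..ξ, q η * f η) + r * ∫ η in c..ξ, q η * h η := fun ξ hξ => by
      rw [← intervalIntegral.integral_const_mul, ← intervalIntegral.integral_add
        (hqf f hf c hc ξ hξ) ((hqf h hh c hc ξ hξ).const_mul r)]
      congr 1; ext η; ring
    show ∫ ξ in c..x, ∫ η in c..ξ, q η * (f η + r * h η) = _
    rw [hK, ← intervalIntegral.integral_const_mul, ← intervalIntegral.integral_add
      (intervalIntegrable_of_continuousOn hS (hin f hf) hc hx)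
      ((intervalIntegrable_of_continuousOn hS (hin h hh) hc hx).const_mul r)]
    exact intervalIntegral.integral_congr fun ξ hξ => e ξ (hS.uIcc_subset hc hx hξ)
  · intro f h hfh x hx
    refine intervalIntegral.integral_congr fun ξ hξ => ?_
    have hξS := hS.uIcc_subset hc hx hξ
    refine intervalIntegral.integral_congr fun η hη => ?_
    simp only [hfh (hS.uIcc_subset hc hξS hη)]
  · exact (continuous_const.add (continuous_const.mul (continuous_id.sub continuous_const))).continuousOn
  · intro x hx
    have h1 : |x - c| ≤ |Q x| := by
      have := intervalIntegral.norm_integral_le_abs_of_norm_le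
        (f := fun _ => (1:ℝ)) (g := fun t => 1 + |q t|) (μ := volume) (a := c) (b := x)
        (ae_of_all _ fun t => by simp) (hq1 c hc x hx)
      simpa using this
    have h2 : |Q x| ≤ ϖ x := by
      have := Real.one_le_cosh (2 * Q x)
      have h3 : (2 * Q x) ≤ Real.exp (2 * Q x) := by linarith [Real.add_one_le_exp (2 * Q x)]
      have h4 : -(2 * Q x) ≤ Real.exp (-(2 * Q x)) := by linarith [Real.add_one_le_exp (-(2 * Q x))]
      have h5 := Real.exp_pos (2 * Q x)
      have h6 := Real.exp_pos (-(2 * Q x))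
      simp only [hϖ, Real.cosh_eq]
      rw [abs_le]; constructor <;> linarith
    calc |α + β * (x - c)| ≤ |α| + |β| * |x - c| := by
          rw [← abs_mul]; exact abs_add_le _ _
      _ ≤ |α| * ϖ x + |β| * ϖ x := by
          gcongr
          · exact le_mul_of_one_le_right (abs_nonneg _) (hϖ1 x)
          · exact h1.trans h2
      _ = _ := by ring

end GroundState

/-! ### Behaviour at the left endpoint, and principal solutions. -/

namespace GroundState

/-- The filter of real numbers tending to `a` from the right, for `a ∈ [-∞, ∞)`. -/
noncomputable def atLeft (a : EReal) : Filter ℝ := comap ((↑) : ℝ → EReal) (𝓝[>] a)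

lemma atLeft_basis {a b : EReal} (hab : a < b) :
    (atLeft a).HasBasis (fun x₀ : ℝ => a < (x₀ : EReal)) fun x₀ => interval a x₀ := by
  have h : (𝓝[>] a).HasBasis (fun y => a < y) (Ioo a) := nhdsGT_basis_of_exists_gt ⟨b, hab⟩
  refine (h.comap ((↑) : ℝ → EReal)).to_hasBasis (fun y hy => ?_) fun x₀ hx₀ =>
    ⟨x₀, hx₀, fun x hx => hx⟩
  obtain ⟨x₀, hx₀⟩ := exists_real_btw hy
  exact ⟨x₀, hx₀.1, fun x hx => ⟨hx.1, hx.2.trans hx₀.2⟩⟩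

lemma eventually_atLeft {a b : EReal} (hab : a < b) {P : ℝ → Prop} :
    (∀ᶠ x in atLeft a, P x) ↔ ∃ x₀ : ℝ, a < (x₀ : EReal) ∧ ∀ x ∈ interval a x₀, P x :=
  (atLeft_basis hab).eventually_iff

lemma eventually_mem_interval {a t : EReal} (hat : a < t) : ∀ᶠ x in atLeft a, x ∈ interval a t := by
  obtain ⟨x₀, hx₀⟩ := exists_real_btw hat
  exact (eventually_atLeft hat).2 ⟨x₀, hx₀.1, fun x hx => ⟨hx.1, hx.2.trans hx₀.2⟩⟩

lemma atLeft_neBot {a b : EReal} (hab : a < b) : (atLeft a).NeBot :=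
  (atLeft_basis hab).neBot_iff.2 fun hx => exists_real_btw hx

section RegularDomain

variable {V : ℝ → ℝ} {a b : EReal}

lemma interval_subset_regularDomain : interval a b ⊆ regularDomain V a b :=
  fun _ hx => ⟨hx.1, Or.inl hx.2⟩

lemma le_of_mem_regularDomain {x : ℝ} (hx : x ∈ regularDomain V a b) : (x : EReal) ≤ b := by
  rcases hx.2 with h | h
  · exact h.le
  · exact h.1.le

lemma mem_interval_of_lt {x y : ℝ} (hx : a < (x : EReal)) (hy : y ∈ regularDomain V a b)
    (hxy : x < y) : x ∈ interval a b :=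
  ⟨hx, (EReal.coe_lt_coe_iff.2 hxy).trans_le (le_of_mem_regularDomain hy)⟩

lemma ordConnected_regularDomain : OrdConnected (regularDomain V a b) := by
  refine ⟨fun x hx y hy z hz => ?_⟩
  rcases hz.2.eq_or_lt with h | h
  · rw [h]; exact hy
  · exact interval_subset_regularDomain
      (mem_interval_of_lt (hx.1.trans_le (EReal.coe_le_coe_iff.2 hz.1)) hy h)

lemma interior_regularDomain : interior (regularDomain V a b) = interval a b := by
  refine Subset.antisymm (fun x hx => ?_)
    (interior_maximal interval_subset_regularDomain (isOpen_interval a b))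
  obtain ⟨ε, hε, hsub⟩ := Metric.isOpen_iff.1 isOpen_interior x hx
  have h2 : x + ε / 2 ∈ regularDomain V a b := interior_subset (hsub (by
    rw [Metric.mem_ball, Real.dist_eq, add_sub_cancel_left, abs_of_pos (by positivity)]; linarith))
  exact mem_interval_of_lt (interior_subset hx).1 h2 (by linarith)

/-- Integrability of `V` near `b` enters here: it allows the initial value problem, and all
solutions, to be continued up to `b`. -/
lemma intervalIntegrable_regularDomain (hV : ContinuousOn V (interval a b)) {x y : ℝ}
    (hx : x ∈ regularDomain V a b) (hy : y ∈ regularDomain V a b) :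
    IntervalIntegrable V volume x y := by
  wlog h : x < y generalizing x y
  · rcases (not_lt.1 h).eq_or_lt with h | h
    · rw [h]
    · exact (this hy hx h).symm
  have hxi := mem_interval_of_lt hx.1 hy h
  rcases hy.2 with hb | ⟨hb, c, hac, hcy, hint⟩
  · exact intervalIntegrable_of_continuousOn (ordConnected_interval a b) hV hxi ⟨hy.1, hb⟩
  · have hm : max c x ∈ interval a b := mem_interval_of_lt
      (hac.trans_le (EReal.coe_le_coe_iff.2 (le_max_left _ _))) hy (max_lt hcy h)
    refine (intervalIntegrable_of_continuousOn (ordConnected_interval a b) hV hxi hm).trans ?_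
    rw [intervalIntegrable_iff_integrableOn_Ioo_of_le (max_lt hcy h).le]
    exact hint.mono_set (Ioo_subset_Ioo_left (le_max_left _ _))

lemma exists_isSol_regularDomain (hV : ContinuousOn V (interval a b)) (E : ℝ) {c : ℝ}
    (hc : c ∈ regularDomain V a b) (α β : ℝ) :
    ∃ y v, IsSol (fun x => V x - E) (regularDomain V a b) y v ∧ y c = α ∧ v c = β :=
  exists_isSol ordConnected_regularDomain
    (fun x hx y hy => (intervalIntegrable_regularDomain hV hx hy).sub (by simp))
    (by rw [interior_regularDomain]; exact hV.sub continuousOn_const) hc α β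

end RegularDomain

lemma exists_first_zero {f : ℝ → ℝ} {c d : ℝ} (hcd : c ≤ d) (hf : ContinuousOn f (Icc c d))
    (hc : 0 < f c) (hd : f d ≤ 0) : ∃ x ∈ Ioc c d, f x = 0 ∧ ∀ z ∈ Ico c x, 0 < f z := by
  have hne : (Icc c d ∩ f ⁻¹' Iic 0).Nonempty := ⟨d, right_mem_Icc.2 hcd, hd⟩
  have hcl : IsCompact (Icc c d ∩ f ⁻¹' Iic 0) :=
    isCompact_Icc.of_isClosed_subset (hf.preimage_isClosed_of_isClosed isClosed_Icc isClosed_Iic)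
      inter_subset_left
  obtain ⟨x, hx, hmin⟩ := hcl.exists_isLeast hne
  have hpos : ∀ z ∈ Ico c x, 0 < f z := fun z hz => by
    by_contra h
    exact absurd (hmin ⟨⟨hz.1, hz.2.le.trans hx.1.2⟩, not_lt.1 h⟩) (not_le.2 hz.2)
  have hcx : c < x := lt_of_le_of_ne hx.1.1 fun h => by
    have := hx.2; rw [← h] at this; exact absurd hc (not_lt.2 this)
  refine ⟨x, ⟨hcx, hx.1.2⟩, le_antisymm hx.2 ?_, hpos⟩
  have h1 : Tendsto f (𝓝[Ioo c x] x) (𝓝 (f x)) :=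
    ((hf x hx.1).mono (Ioo_subset_Icc_self.trans (Icc_subset_Icc_right hx.1.2)))
  have : (𝓝[Ioo c x] x).NeBot := by
    rw [← mem_closure_iff_nhdsWithin_neBot, closure_Ioo hcx.ne]; exact right_mem_Icc.2 hcx.le
  exact ge_of_tendsto h1 (eventually_mem_nhdsWithin.mono fun z hz => (hpos z ⟨hz.1.le, hz.2⟩).le)

lemma exists_last_zero {f : ℝ → ℝ} {c d : ℝ} (hcd : c ≤ d) (hf : ContinuousOn f (Icc c d))
    (hc : f c ≤ 0) (hd : 0 < f d) : ∃ x ∈ Ico c d, f x = 0 ∧ ∀ z ∈ Ioc x d, 0 < f z := by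
  obtain ⟨x, hx, h0, hp⟩ := exists_first_zero (f := fun x => f (-x)) (c := -d) (d := -c)
    (neg_le_neg hcd) (hf.comp continuous_neg.continuousOn fun x hx =>
      ⟨by linarith [hx.2], by linarith [hx.1]⟩) (by simpa using hd) (by simpa using hc)
  refine ⟨-x, ⟨by linarith [hx.2], by linarith [hx.1]⟩, h0, fun z hz => ?_⟩
  simpa using hp (-z) ⟨by linarith [hz.2], by linarith [hz.1]⟩

section Principal

variable {V : ℝ → ℝ} {a b : EReal} {E : ℝ} {t : EReal} {y v : ℝ → ℝ}

lemma IsSol.hasDerivAt₁ (h : IsSol (fun x => V x - E) (regularDomain V a b) y v) {x : ℝ}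
    (hx : x ∈ interval a b) : HasDerivAt y (v x) x :=
  h.hasDerivAt (by rwa [interior_regularDomain])

lemma IsSol.hasDerivAt₂ (h : IsSol (fun x => V x - E) (regularDomain V a b) y v) {x : ℝ}
    (hx : x ∈ interval a b) : HasDerivAt v ((V x - E) * y x) x :=
  h.deriv₂ x (by rwa [interior_regularDomain])

/-- Disconjugacy: leaving `x₁` upwards and returning to zero at `x₂` would give `λ(x₂) ≤ E` by
`groundEnergy_le_of_zeros`. -/
lemma IsSol.pos_right (hV : ContinuousOn V (interval a b)) (htb : t ≤ b)
    (hE : ∀ s : ℝ, s ∈ interval a t → (E : EReal) < groundEnergy V a s)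
    (h : IsSol (fun x => V x - E) (regularDomain V a b) y v) {x₁ x : ℝ} (hx₁ : x₁ ∈ interval a t)
    (h₁ : y x₁ = 0) (hv : 0 < v x₁) (hx : x ∈ interval a t) (hlt : x₁ < x) : 0 < y x := by
  by_contra hcon
  rw [not_lt] at hcon
  have hsub := interval_mono (a := a) htb
  have hI : Icc x₁ x ⊆ interval a t := Icc_subset_interval hx₁ hx
  have hr : ∃ c, x₁ < c ∧ c < x ∧ ∀ z ∈ Ioc x₁ c, 0 < y z := by
    have hd := (h.hasDerivAt₁ (hsub hx₁)).hasDerivWithinAt (s := Ioi x₁)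
    have h2 : ∀ᶠ z in 𝓝[>] x₁, 0 < y z := by
      have := (hasDerivWithinAt_iff_tendsto_slope' (lt_irrefl x₁)).1 hd
      filter_upwards [this.eventually (lt_mem_nhds hv), self_mem_nhdsWithin] with z hz hz1
      rw [slope_def_field, h₁, sub_zero] at hz
      have h3 : 0 < z - x₁ := sub_pos.2 hz1
      have := mul_pos hz h3
      rwa [div_mul_cancel₀ _ h3.ne'] at this
    obtain ⟨d, hd1, hd2⟩ := mem_nhdsGT_iff_exists_Ioo_subset.1 h2
    refine ⟨min ((x₁ + d) / 2) ((x₁ + x) / 2), ?_, ?_, fun z hz => hd2 ⟨hz.1, ?_⟩⟩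
    · have : x₁ < d := hd1
      exact lt_min (by linarith) (by linarith)
    · exact (min_le_right _ _).trans_lt (by linarith)
    · have : x₁ < d := hd1
      exact (hz.2.trans (min_le_left _ _)).trans_lt (by linarith)
  obtain ⟨c, hc1, hc2, hc⟩ := hr
  obtain ⟨x₂, hx₂, hz, hp⟩ := exists_first_zero (f := y) hc2.le
    (h.continuousOn.mono (fun z hz => interval_subset_regularDomain
      (hsub (hI ⟨hc1.le.trans hz.1, hz.2⟩)))) (hc c ⟨hc1, le_rfl⟩) hcon
  have hx₂t : x₂ ∈ interval a t := hI ⟨(hc1.trans hx₂.1).le, hx₂.2⟩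
  refine absurd (groundEnergy_le_of_zeros hV (hsub hx₁) (hsub hx₂t) (hc1.trans hx₂.1)
    (fun z hz => h.hasDerivAt₁ (hsub (hI ⟨hz.1, hz.2.trans hx₂.2⟩)))
    (fun z hz => h.hasDerivAt₂ (hsub (hI ⟨hz.1, hz.2.trans hx₂.2⟩))) h₁ hz fun z hz => ?_)
    (not_le.2 (hE x₂ hx₂t))
  rcases le_or_gt z c with hzc | hzc
  · exact hc z ⟨hz.1, hzc⟩
  · exact hp z ⟨hzc.le, hz.2⟩

/-- The mirror image of `IsSol.pos_right`, with the second zero on the left. -/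
lemma IsSol.pos_left (hV : ContinuousOn V (interval a b)) (htb : t ≤ b)
    (hE : ∀ s : ℝ, s ∈ interval a t → (E : EReal) < groundEnergy V a s)
    (h : IsSol (fun x => V x - E) (regularDomain V a b) y v) {x₂ x : ℝ} (hx₂ : x₂ ∈ interval a t)
    (h₂ : y x₂ = 0) (hv : v x₂ < 0) (hx : x ∈ interval a t) (hlt : x < x₂) : 0 < y x := by
  by_contra hcon
  rw [not_lt] at hcon
  have hsub := interval_mono (a := a) htb
  have hI : Icc x x₂ ⊆ interval a t := Icc_subset_interval hx hx₂
  have hr : ∃ c, x < c ∧ c < x₂ ∧ ∀ z ∈ Ico c x₂, 0 < y z := by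
    have hd := (h.hasDerivAt₁ (hsub hx₂)).hasDerivWithinAt (s := Iio x₂)
    have h2 : ∀ᶠ z in 𝓝[<] x₂, 0 < y z := by
      have := (hasDerivWithinAt_iff_tendsto_slope' (by simp : x₂ ∉ Iio x₂)).1 hd
      filter_upwards [this.eventually (gt_mem_nhds hv), self_mem_nhdsWithin] with z hz hz1
      rw [slope_def_field, h₂, sub_zero] at hz
      have h3 : z - x₂ < 0 := sub_neg.2 hz1
      have := mul_pos_of_neg_of_neg hz h3
      rwa [div_mul_cancel₀ _ h3.ne] at this
    obtain ⟨d, hd1, hd2⟩ := mem_nhdsLT_iff_exists_Ioo_subset.1 h2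
    refine ⟨max ((x₂ + d) / 2) ((x₂ + x) / 2), ?_, ?_, fun z hz => hd2 ⟨?_, hz.2⟩⟩
    · exact lt_of_lt_of_le (by linarith) (le_max_right _ _)
    · have : d < x₂ := hd1
      exact max_lt (by linarith) (by linarith)
    · have : d < x₂ := hd1
      exact lt_of_lt_of_le (by linarith) ((le_max_left _ _).trans hz.1)
  obtain ⟨c, hc1, hc2, hc⟩ := hr
  obtain ⟨x₁, hx₁, hz, hp⟩ := exists_last_zero (f := y) hc1.le
    (h.continuousOn.mono (fun z hz => interval_subset_regularDomain
      (hsub (hI ⟨hz.1, hz.2.trans hc2.le⟩)))) hcon (hc c ⟨le_rfl, hc2⟩)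
  have hx₁t : x₁ ∈ interval a t := hI ⟨hx₁.1, (hx₁.2.trans hc2).le⟩
  refine absurd (groundEnergy_le_of_zeros hV (hsub hx₁t) (hsub hx₂) (hx₁.2.trans hc2)
    (fun z hz => h.hasDerivAt₁ (hsub (hI ⟨hx₁.1.trans hz.1, hz.2⟩)))
    (fun z hz => h.hasDerivAt₂ (hsub (hI ⟨hx₁.1.trans hz.1, hz.2⟩))) hz h₂ fun z hz => ?_)
    (not_le.2 (hE x₂ hx₂))
  rcases lt_or_ge z c with hzc | hzc
  · exact hp z ⟨hz.1, hzc.le⟩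
  · exact hc z ⟨hzc, hz.2⟩

/-- `y` is principal at `a`: the integral of `y⁻²` diverges there. -/
def IsPrincipal (a : EReal) (y : ℝ → ℝ) (c : ℝ) : Prop :=
  Tendsto (fun x => ∫ s in x..c, (y s ^ 2)⁻¹) (atLeft a) atTop

/-- Below the ground state energies there is a positive solution which is principal at `a`. -/
lemma exists_principal (hV : ContinuousOn V (interval a b)) (hat : a < t) (htb : t ≤ b)
    (hE : ∀ s : ℝ, s ∈ interval a t → (E : EReal) < groundEnergy V a s) :
    ∃ y v, IsSol (fun x => V x - E) (regularDomain V a b) y v ∧ (∀ x ∈ interval a t, 0 < y x) ∧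
      ∀ c ∈ interval a t, IsPrincipal a y c := by
  have hsub := interval_mono (a := a) htb
  have hT : interval a t ⊆ regularDomain V a b := hsub.trans interval_subset_regularDomain
  obtain ⟨c, hc⟩ := exists_real_btw hat
  obtain ⟨w, w', hw, hwc, hwc'⟩ := exists_isSol_regularDomain hV E (hT hc) 1 0
  obtain ⟨z, z', hz, hzc, hzc'⟩ := exists_isSol_regularDomain hV E (hT hc) 0 1
  have hW : ∀ x ∈ interval a t, w x * z' x - w' x * z x = 1 := fun x hx => by
    rw [IsSol.wronskian ordConnected_regularDomain hw hz (hT hx) (hT hc), hwc, hwc', hzc, hzc']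
    norm_num
  have hzr : ∀ x ∈ interval a t, c < x → 0 < z x := fun x hx hcx =>
    hz.pos_right hV htb hE hc hzc (by rw [hzc']; norm_num) hx hcx
  have hzl : ∀ x ∈ interval a t, x < c → z x < 0 := fun x hx hxc => by
    -- `z + (-2) z = -z` is a solution with slope `-1` at `c`.
    have h0 := hz.add_const_mul hz (-2)
    have := h0.pos_left hV htb hE hc (by rw [hzc]; norm_num) (by rw [hzc']; norm_num) hx hxc
    linarith
  set q : ℝ → ℝ := fun x => w x / z x with hq
  -- the solution vanishing at `s`
  have hright : ∀ s ∈ interval a t, c < s → ∀ x ∈ interval a t, x < s → 0 < w x - q s * z x := by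
    intro s hs hcs x hx hxs
    have hzs := hzr s hs hcs
    have h0 := hw.add_const_mul hz (-q s)
    have := h0.pos_left hV htb hE hs (by simp only [hq]; field_simp; ring) (by
      have := hW s hs
      have e : w' s + -q s * z' s = -1 / z s := by
        simp only [hq]; field_simp; linarith
      rw [e]; exact div_neg_of_neg_of_pos (by norm_num) hzs) hx hxs
    linarith
  have hleft : ∀ s ∈ interval a t, s < c → ∀ x ∈ interval a t, s < x → 0 < w x - q s * z x := by
    intro s hs hcs x hx hxs
    have hzs := hzl s hs hcs
    have h0 := hw.add_const_mul hz (-q s)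
    have := h0.pos_right hV htb hE hs (by simp only [hq]; field_simp [hzs.ne]; ring) (by
      have := hW s hs
      have e : w' s + -q s * z' s = -1 / z s := by
        have := hzs.ne
        simp only [hq]; field_simp; linarith
      rw [e]; exact div_pos_of_neg_of_neg (by norm_num) hzs) hx hxs
    linarith
  have hqlr : ∀ x ∈ interval a t, x < c → ∀ s ∈ interval a t, c < s → q x < q s := by
    intro x hx hxc s hs hcs
    have h1 := hright s hs hcs x hx (hxc.trans hcs)
    rw [hq]; simp only
    rw [div_lt_iff_of_neg (hzl x hx hxc)]; linarith
  obtain ⟨s₀, hs₀⟩ := exists_real_btw hc.2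
  have hs₀' : s₀ ∈ interval a t := ⟨hc.1.trans hs₀.1, hs₀.2⟩
  have hcs₀ : c < s₀ := EReal.coe_lt_coe_iff.1 hs₀.1
  obtain ⟨x₀, hx₀⟩ := exists_real_btw hc.1
  have hx₀' : x₀ ∈ interval a t := ⟨hx₀.1, hx₀.2.trans hc.2⟩
  have hx₀c : x₀ < c := EReal.coe_lt_coe_iff.1 hx₀.2
  -- On `(a, c)` the quotient `q` increases as its argument moves towards `a`, and it stays below
  -- its values to the right of `c`. Its supremum `κ` is thus its limit at `a`, and `w - κ z` is the
  -- limit of the solutions vanishing at `s` as `s → a`.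
  set A : Set ℝ := q '' interval a c with hA
  have hAne : A.Nonempty := ⟨q x₀, x₀, hx₀, rfl⟩
  have hlt : ∀ x : ℝ, x ∈ interval a c → x ∈ interval a t ∧ x < c := fun x hx =>
    ⟨⟨hx.1, hx.2.trans hc.2⟩, EReal.coe_lt_coe_iff.1 hx.2⟩
  have hAub : ∀ s ∈ interval a t, c < s → ∀ r ∈ A, r ≤ q s := by
    rintro s hs hcs r ⟨x, hx, rfl⟩
    exact (hqlr x (hlt x hx).1 (hlt x hx).2 s hs hcs).le
  have hAb : BddAbove A := ⟨q s₀, hAub s₀ hs₀' hcs₀⟩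
  set κ := sSup A with hκ
  have hκs : ∀ s ∈ interval a t, c < s → κ ≤ q s := fun s hs hcs =>
    csSup_le hAne (hAub s hs hcs)
  have hqdec : ∀ x' ∈ interval a c, ∀ x ∈ interval a c, x' < x → q x < q x' := by
    intro x' hx' x hx hlt'
    have h1 := hleft x' (hlt x' hx').1 (hlt x' hx').2 x (hlt x hx).1 hlt'
    rw [hq]; simp only
    rw [div_lt_iff_of_neg (hzl x (hlt x hx).1 (hlt x hx).2)]; linarith
  have hqκ : ∀ x ∈ interval a c, q x < κ := by
    intro x hx
    obtain ⟨x', hx'⟩ := exists_real_btw hx.1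
    have hx'c : x' ∈ interval a c := ⟨hx'.1, hx'.2.trans hx.2⟩
    exact (hqdec x' hx'c x hx (EReal.coe_lt_coe_iff.1 hx'.2)).trans_le
      (le_csSup hAb ⟨x', hx'c, rfl⟩)
  have hy := hw.add_const_mul hz (-κ)
  set y : ℝ → ℝ := fun x => w x + -κ * z x with hyd
  set v : ℝ → ℝ := fun x => w' x + -κ * z' x with hvd
  have hypos : ∀ x ∈ interval a t, 0 < y x := by
    intro x hx
    rcases lt_trichotomy x c with h | h | h
    · have h1 := hqκ x ⟨hx.1, EReal.coe_lt_coe_iff.2 h⟩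
      have h2 := hzl x hx h
      simp only [hq] at h1
      rw [div_lt_iff_of_neg h2] at h1
      simp only [hyd]; linarith
    · simp only [hyd]; rw [h, hwc, hzc]; norm_num
    · obtain ⟨s, hs⟩ := exists_real_btw hx.2
      have hst : s ∈ interval a t := ⟨hx.1.trans hs.1, hs.2⟩
      have hxs := EReal.coe_lt_coe_iff.1 hs.1
      have h1 := hright s hst (h.trans hxs) x hx hxs
      have h2 := mul_le_mul_of_nonneg_right (hκs s hst (h.trans hxs)) (hzr x hx h).le
      simp only [hyd]; linarith
  refine ⟨y, v, hy, hypos, fun d hd => ?_⟩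
  -- As the Wronskian of `y` and `z` is one, `z / y` is a primitive of `y⁻²`. To the left of `c` one
  -- has `y = -z (κ - q)`, so `-z / y = 1 / (κ - q)` tends to infinity at `a`.
  have hder : ∀ x ∈ interval a t, HasDerivAt (fun x => z x / y x) ((y x ^ 2)⁻¹) x := by
    intro x hx
    refine ((hz.hasDerivAt₁ (hsub hx)).div (hy.hasDerivAt₁ (hsub hx)) (hypos x hx).ne').congr_deriv ?_
    have h1 := hW x hx
    have h2 : z' x * y x - z x * v x = 1 := by simp only [hyd, hvd]; linear_combination h1
    change (z' x * y x - z x * v x) / y x ^ 2 = _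
    rw [h2, one_div]
  have hcy : ContinuousOn (fun x => (y x ^ 2)⁻¹) (interval a t) := fun x hx =>
    (((hy.hasDerivAt₁ (hsub hx)).continuousAt.pow 2).inv₀
      (pow_pos (hypos x hx) 2).ne').continuousWithinAt
  have hint : ∀ x ∈ interval a t, ∫ s in x..d, (y s ^ 2)⁻¹ = z d / y d - z x / y x := by
    intro x hx
    exact intervalIntegral.integral_eq_sub_of_hasDerivAt
      (fun s hs => hder s ((ordConnected_interval a t).uIcc_subset hx hd hs))
      (intervalIntegrable_of_continuousOn (ordConnected_interval a t) hcy hx hd)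
  refine tendsto_atTop.2 fun M => ?_
  obtain ⟨N, hN0, hN⟩ : ∃ N : ℝ, 0 < N ∧ M ≤ z d / y d + N :=
    ⟨max 1 (M - z d / y d), lt_max_of_lt_left one_pos, by linarith [le_max_right 1 (M - z d / y d)]⟩
  obtain ⟨_, ⟨x₁, hx₁, rfl⟩, hx₁κ⟩ := exists_lt_of_lt_csSup hAne
    (show κ - 1 / N < sSup A by rw [← hκ]; linarith [one_div_pos.2 hN0])
  refine (eventually_atLeft hat).2 ⟨x₁, hx₁.1, fun x hx => ?_⟩
  have hxc : x ∈ interval a c := ⟨hx.1, hx.2.trans hx₁.2⟩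
  have hxt := (hlt x hxc).1
  rw [hint x hxt]
  have h1 := hqdec x hxc x₁ hx₁ (EReal.coe_lt_coe_iff.1 hx.2)
  have h2 := hqκ x hxc
  have h3 := hzl x hxt (hlt x hxc).2
  have h4 := hypos x hxt
  have h5 : -(z x / y x) ≥ N := by
    rw [ge_iff_le, ← neg_div, le_div_iff₀ h4]
    have e : y x = -z x * (κ - q x) := by
      simp only [hyd, hq]; field_simp [h3.ne]; ring
    rw [e]
    have h6 : N * (κ - q x) ≤ 1 := by
      have : κ - q x ≤ 1 / N := by linarith
      calc N * (κ - q x) ≤ N * (1 / N) := by gcongr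
        _ = 1 := by field_simp
    nlinarith
  linarith

end Principal

end GroundState

/-! ### Ground states from principal solutions, and finiteness of `λ` at `b`. -/

namespace GroundState

/-- The half-open interval `(a, t]`. -/
def halfInterval (a : EReal) (t : ℝ) : Set ℝ := {x : ℝ | a < (x : EReal) ∧ x ≤ t}

section HalfInterval

variable {a b : EReal} {t : ℝ}

lemma interval_subset_halfInterval : interval a t ⊆ halfInterval a t :=
  fun _ hx => ⟨hx.1, (EReal.coe_lt_coe_iff.1 hx.2).le⟩

lemma ordConnected_halfInterval : OrdConnected (halfInterval a t) :=
  ⟨fun _ hx _ hy _ hz => ⟨hx.1.trans_le (EReal.coe_le_coe_iff.2 hz.1), hz.2.trans hy.2⟩⟩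

lemma interior_halfInterval : interior (halfInterval a t) = interval a t := by
  refine Subset.antisymm (fun x hx => ?_)
    (interior_maximal interval_subset_halfInterval (isOpen_interval a t))
  obtain ⟨ε, hε, hsub⟩ := Metric.isOpen_iff.1 isOpen_interior x hx
  have h2 : x + ε / 2 ∈ halfInterval a t := interior_subset (hsub (by
    rw [Metric.mem_ball, Real.dist_eq, add_sub_cancel_left, abs_of_pos (by positivity)]; linarith))
  exact ⟨(interior_subset hx).1, EReal.coe_lt_coe_iff.2 (by linarith [h2.2])⟩

lemma halfInterval_subset_regularDomain {V : ℝ → ℝ} (ht : t ∈ regularDomain V a b) :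
    halfInterval a t ⊆ regularDomain V a b := fun x hx => by
  rcases hx.2.eq_or_lt with h | h
  · rwa [h]
  · exact interval_subset_regularDomain (mem_interval_of_lt hx.1 ht h)

lemma interval_subset_of_mem_regularDomain {V : ℝ → ℝ} (ht : t ∈ regularDomain V a b) :
    interval a t ⊆ interval a b := interval_mono (le_of_mem_regularDomain ht)

end HalfInterval

variable {V : ℝ → ℝ} {a b : EReal}

lemma groundEnergy_anti_of_le (hV : ContinuousOn V (interval a b)) {s t : EReal} (hst : s ≤ t)
    (ht : t ≤ b) : groundEnergy V a t ≤ groundEnergy V a s :=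
  groundEnergy_anti hst (hV.mono (interval_mono ht))

/-- A principal solution which is positive before its zero at `t` is a ground state on `(a, t)`. -/
lemma groundEnergy_le_of_principal (hV : ContinuousOn V (interval a b)) {t E c : ℝ}
    (ht : t ∈ regularDomain V a b) {y v : ℝ → ℝ}
    (h : IsSol (fun x => V x - E) (halfInterval a t) y v) (hpos : ∀ x ∈ interval a t, 0 < y x)
    (h0 : y t = 0) (hc : c ∈ interval a t) (hp : IsPrincipal a y c) :
    groundEnergy V a t ≤ E := by
  by_contra hcon
  rw [not_le] at hcon
  obtain ⟨E', hE', hE'2⟩ := exists_real_btw hcon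
  have hEE' : E < E' := EReal.coe_lt_coe_iff.1 hE'
  have htb := le_of_mem_regularDomain ht
  -- If `E < E' < λ(t)`, there is a positive solution `F` of energy `E'`. The Wronskian `W = y F' -
  -- y' F` strictly decreases because `E < E'`, and `W t ≥ 0` because `y` vanishes at `t` from
  -- above; so `W` is positive and at least `W c` to the left of `c`.
  obtain ⟨F, G, hF, hFpos, -⟩ := exists_principal (E := E') hV ht.1 htb fun s hs =>
    hE'2.trans_le (groundEnergy_anti_of_le hV hs.2.le htb)
  replace hF := hF.mono (halfInterval_subset_regularDomain ht)
  have htm : t ∈ halfInterval a t := ⟨ht.1, le_rfl⟩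
  have hcm := interval_subset_halfInterval hc
  have hct : c < t := EReal.coe_lt_coe_iff.1 hc.2
  have hne : (𝓝[interval a t] t).NeBot := by
    rw [← mem_closure_iff_nhdsWithin_neBot]
    refine closure_mono (fun x hx => ?_) (by rw [closure_Ioo hct.ne]; exact right_mem_Icc.2 hct.le :
      t ∈ closure (Ioo c t))
    exact ⟨hc.1.trans (EReal.coe_lt_coe_iff.2 hx.1), EReal.coe_lt_coe_iff.2 hx.2⟩
  have hFt : 0 ≤ F t := ge_of_tendsto ((hF.continuousOn t htm).mono interval_subset_halfInterval)
    (eventually_mem_nhdsWithin.mono fun z hz => (hFpos z hz).le)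
  have hvt : v t ≤ 0 := by
    have := (hasDerivWithinAt_iff_tendsto_slope' (by
      intro hh; exact lt_irrefl _ hh.2)).1
      ((h.deriv₁ t htm).mono interval_subset_halfInterval)
    refine le_of_tendsto this (eventually_mem_nhdsWithin.mono fun z hz => ?_)
    rw [slope_def_field, h0, sub_zero]
    exact div_nonpos_of_nonneg_of_nonpos (hpos z hz).le
      (sub_nonpos.2 (EReal.coe_lt_coe_iff.1 hz.2).le)
  set W : ℝ → ℝ := fun x => y x * G x - v x * F x with hW
  have hWc : ContinuousOn W (halfInterval a t) :=
    (h.continuousOn.mul hF.cont).sub (h.cont.mul hF.continuousOn)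
  have hint := interior_halfInterval (a := a) (t := t)
  have hWd : ∀ x ∈ interior (halfInterval a t), HasDerivAt W ((E - E') * (y x * F x)) x :=
    fun x hx => (((h.hasDerivAt hx).mul (hF.deriv₂ x hx)).sub
      ((h.deriv₂ x hx).mul (hF.hasDerivAt hx))).congr_deriv (by ring)
  have hanti : StrictAntiOn W (halfInterval a t) :=
    strictAntiOn_of_deriv_neg ordConnected_halfInterval.convex hWc fun x hx => by
      rw [(hWd x hx).deriv]
      rw [hint] at hx
      exact mul_neg_of_neg_of_pos (by linarith) (mul_pos (hpos x hx) (hFpos x hx))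
  have hWt : 0 ≤ W t := by
    simp only [hW, h0, zero_mul, zero_sub]; nlinarith
  have hWpos : 0 < W c := hWt.trans_lt (hanti hcm htm hct)
  -- `(F / y)' = W / y² ≥ W c / y²` and `F / y > 0` bound the integral of `y⁻²` near `a`, which
  -- contradicts principality.
  have hquot : ∀ x ∈ interval a c, W c * ∫ s in x..c, (y s ^ 2)⁻¹ ≤ F c / y c := by
    intro x hx
    have hxc := EReal.coe_lt_coe_iff.1 hx.2
    have hxt : x ∈ interval a t := ⟨hx.1, hx.2.trans hc.2⟩
    have hI : Icc x c ⊆ interval a t := Icc_subset_interval hxt hc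
    have hIu : ∀ s ∈ uIcc x c, s ∈ interval a t := fun s hs => hI (by rwa [uIcc_of_le hxc.le] at hs)
    have hd : ∀ s ∈ uIcc x c, HasDerivAt (fun x => F x / y x) (W s * (y s ^ 2)⁻¹) s := by
      intro s hs
      have hs' := hIu s hs
      rw [← hint] at hs'
      exact ((hF.hasDerivAt hs').div (h.hasDerivAt hs') (hpos s (hIu s hs)).ne').congr_deriv
        (by simp only [hW, div_eq_mul_inv]; ring)
    have hc1 : ContinuousOn (fun s => (y s ^ 2)⁻¹) (uIcc x c) :=
      (((h.continuousOn.mono interval_subset_halfInterval).mono hIu).pow 2).inv₀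
        fun s hs => (pow_pos (hpos s (hIu s hs)) 2).ne'
    have hc2 : ContinuousOn (fun s => W s * (y s ^ 2)⁻¹) (uIcc x c) :=
      ((hWc.mono interval_subset_halfInterval).mono hIu).mul hc1
    have h1 := intervalIntegral.integral_eq_sub_of_hasDerivAt hd hc2.intervalIntegrable
    have h2 : W c * ∫ s in x..c, (y s ^ 2)⁻¹ ≤ ∫ s in x..c, W s * (y s ^ 2)⁻¹ := by
      rw [← intervalIntegral.integral_const_mul]
      refine intervalIntegral.integral_mono_on hxc.le (hc1.intervalIntegrable.const_mul _)
        hc2.intervalIntegrable fun s hs => ?_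
      have : 0 < (y s ^ 2)⁻¹ := inv_pos.2 (pow_pos (hpos s (hI hs)) 2)
      exact mul_le_mul_of_nonneg_right
        (hanti.antitoneOn (interval_subset_halfInterval (hI hs)) hcm hs.2) this.le
    have h3 : 0 < F x / y x := div_pos (hFpos x hxt) (hpos x hxt)
    linarith
  have hmem := eventually_mem_interval (a := a) (t := c) hc.1
  have := atLeft_neBot hc.1
  obtain ⟨x, hx, hx'⟩ := (hmem.and (hp.eventually_gt_atTop (F c / y c / W c))).exists
  have h1 := hquot x hx
  rw [div_lt_iff₀ hWpos, mul_comm] at hx'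
  linarith

/-- Integrability of the potential near `b` keeps the ground state energy at `b` finite. -/
lemma groundEnergy_ne_bot_of_mem_regularDomain (hV : ContinuousOn V (interval a b))
    (hfin : ∀ t ∈ interval a b, groundEnergy V a (t : ℝ) ≠ ⊥) {t : ℝ}
    (ht : t ∈ regularDomain V a b) : groundEnergy V a t ≠ ⊥ := by
  rcases ht.2 with h | ⟨hb, -⟩
  · exact hfin t ⟨ht.1, h⟩
  obtain ⟨t₁, ht₁⟩ := exists_real_btw ht.1
  obtain ⟨t₀, ht₀⟩ := exists_real_btw ht₁.1
  have ht₁b : t₁ ∈ interval a b := by rw [← hb]; exact ht₁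
  have ht₀b : t₀ ∈ interval a b := ⟨ht₀.1, ht₀.2.trans ht₁b.2⟩
  have htt : t₀ < t := EReal.coe_lt_coe_iff.1 (ht₀.2.trans ht₁.2)
  obtain ⟨E₀, -, hE₀⟩ := exists_real_btw (bot_lt_iff_ne_bot.2 (hfin t₁ ht₁b))
  obtain ⟨y, v, hy, hpos, -⟩ := exists_principal (E := E₀) hV ht₁.1 ht₁b.2.le fun s hs =>
    hE₀.trans_le (groundEnergy_anti_of_le hV hs.2.le ht₁b.2.le)
  set P : ℝ → ℝ := fun x => ∫ s in t₀..x, V s with hP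
  have ht₀T := interval_subset_regularDomain (V := V) ht₀b
  have hPc : ContinuousOn P (regularDomain V a b) := continuousOn_primitive ht₀T
    fun x hx y hy => intervalIntegrable_regularDomain hV hx hy
  -- A Riccati subsolution glued at `t₀`: to the left it is the logarithmic derivative of a solution
  -- of energy `E₀`; to the right it is a constant plus a primitive of `V`. There `ψ' = V` and `|ψ|
  -- ≤ C`, so the energy `-C²` is admissible.
  set ψ : ℝ → ℝ := fun x => v (min x t₀) / y (min x t₀) + P (max x t₀) with hψ
  have hmin : ∀ x ∈ interval a t, min x t₀ ∈ interval a t₁ := fun x hx =>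
    ⟨by rcases min_choice x t₀ with h | h <;> rw [h]; exacts [hx.1, ht₀.1],
      lt_of_le_of_lt (EReal.coe_le_coe_iff.2 (min_le_right _ _)) ht₀.2⟩
  have hmax : ∀ x ∈ interval a t, max x t₀ ∈ Icc t₀ t := fun x hx =>
    ⟨le_max_right _ _, max_le (EReal.coe_lt_coe_iff.1 hx.2).le htt.le⟩
  have hIcc : Icc t₀ t ⊆ regularDomain V a b := ordConnected_regularDomain.out ht₀T ht
  have hsub₁ : interval a t₁ ⊆ interval a b := interval_mono ht₁b.2.le
  have hsub₁T := hsub₁.trans (interval_subset_regularDomain (V := V))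
  have hψc : ContinuousOn ψ (interval a t) := by
    refine ContinuousOn.add (ContinuousOn.div ?_ ?_ ?_) ?_
    · exact (hy.cont.mono hsub₁T).comp (continuous_id.min continuous_const).continuousOn hmin
    · exact (hy.continuousOn.mono hsub₁T).comp (continuous_id.min continuous_const).continuousOn hmin
    · exact fun x hx => (hpos _ (hmin x hx)).ne'
    · exact (hPc.mono hIcc).comp (continuous_id.max continuous_const).continuousOn hmax
  obtain ⟨C, hC⟩ := isCompact_Icc.exists_bound_of_continuousOn
    ((continuousOn_const (c := v t₀ / y t₀)).add (hPc.mono hIcc))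
  have hP0 : P t₀ = 0 := intervalIntegral.integral_same
  have hCx : ∀ x ∈ interval a t, t₀ ≤ x → ψ x ^ 2 ≤ C ^ 2 := fun x hx h => by
    have h1 := hC x ⟨h, (EReal.coe_lt_coe_iff.1 hx.2).le⟩
    rw [Real.norm_eq_abs] at h1
    have h2 : ψ x = v t₀ / y t₀ + P x := by
      simp only [hψ]; rw [min_eq_right h, max_eq_left h]
    rw [h2, ← sq_abs]
    exact pow_le_pow_left₀ (abs_nonneg _) h1 2
  have key : ((min E₀ (-C ^ 2) : ℝ) : EReal) ≤ groundEnergy V a t := by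
    refine le_groundEnergy_of_riccati ht.1 (hV.mono (by rw [hb])) hψc
      (ψ' := fun x => if x < t₀ then V x - E₀ - (v x / y x) ^ 2 else V x) (fun x hx => ?_)
      fun x hx => ?_
    · split_ifs with h
      · have hx1 : x ∈ interval a t₁ := ⟨hx.1, (EReal.coe_lt_coe_iff.2 h).trans ht₀.2⟩
        have h1 : HasDerivAt (fun x => v x / y x) (V x - E₀ - (v x / y x) ^ 2) x :=
          ((hy.hasDerivAt₂ (hsub₁ hx1)).div (hy.hasDerivAt₁ (hsub₁ hx1))
            (hpos x hx1).ne').congr_deriv (by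
              have := (hpos x hx1).ne'
              field_simp)
        refine (h1.congr_of_eventuallyEq ?_).hasDerivWithinAt
        filter_upwards [gt_mem_nhds h] with z hz
        simp only [hψ]; rw [min_eq_left hz.le, max_eq_right hz.le, hP0, add_zero]
      · rw [not_lt] at h
        have hxb : x ∈ interval a b := ⟨hx.1, hx.2.trans_le hb.le⟩
        have h1 : HasDerivAt P (V x) x := (hasDerivWithinAt_primitive (ordConnected_interval a b)
          ht₀b hxb hV).hasDerivAt ((isOpen_interval a b).mem_nhds hxb)
        have h2 := (h1.const_add (v t₀ / y t₀)).hasDerivWithinAt (s := Ioi x)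
        refine h2.congr (fun z hz => ?_) ?_
        · have hz : x < z := hz
          simp only [hψ]; rw [min_eq_right (h.trans hz.le), max_eq_left (h.trans hz.le)]
        · simp only [hψ]; rw [min_eq_right h, max_eq_left h]
    · split_ifs with h
      · have : ψ x = v x / y x := by
          simp only [hψ]; rw [min_eq_left h.le, max_eq_right h.le, hP0, add_zero]
        rw [this]; linarith [min_le_left E₀ (-C ^ 2)]
      · linarith [hCx x hx (not_lt.1 h), min_le_right E₀ (-C ^ 2)]
  exact ((EReal.bot_lt_coe _).trans_le key).ne'

end GroundState

/-! ### Decay of principal solutions at `a`. -/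

namespace GroundState

variable {V : ℝ → ℝ} {a b : EReal} {t : EReal} {E : ℝ} {y v : ℝ → ℝ}

lemma eventually_mem_or_notMem (hab : a < b) {S : Set ℝ} (hS : OrdConnected S) :
    (∀ᶠ x in atLeft a, x ∈ S) ∨ ∀ᶠ x in atLeft a, x ∉ S := by
  by_cases h : ∃ᶠ x in atLeft a, x ∈ S
  · left
    obtain ⟨s, hs, hsI⟩ := (h.and_eventually (eventually_mem_interval hab)).exists
    refine (eventually_atLeft hab).2 ⟨s, hsI.1, fun x hx => ?_⟩
    obtain ⟨z, hz, hzI⟩ := (h.and_eventually (eventually_mem_interval hx.1)).exists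
    exact hS.out hz hs ⟨(EReal.coe_lt_coe_iff.1 hzI.2).le, (EReal.coe_lt_coe_iff.1 hx.2).le⟩
  · exact Or.inr (not_frequently.1 h)

/-- The sublevel sets of a convex function and the superlevel sets of a concave one are intervals,
so each contains or misses a neighbourhood of `a`. The shape of `V` enters the analysis near `a`
through this dichotomy. -/
lemma eventually_ge_or_le (hab : a < b)
    (hVc : ConvexOn ℝ (interval a b) V ∨ ConcaveOn ℝ (interval a b) V) (E : ℝ) :
    (∀ᶠ x in atLeft a, E ≤ V x) ∨ ∀ᶠ x in atLeft a, V x ≤ E := by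
  have hI := eventually_mem_interval hab
  rcases hVc with h | h
  · rcases eventually_mem_or_notMem hab (h.convex_le E).ordConnected with h1 | h1
    · exact Or.inr (h1.mono fun x hx => hx.2)
    · refine Or.inl ((h1.and hI).mono fun x hx => ?_)
      by_contra h2
      exact hx.1 ⟨hx.2, (not_le.1 h2).le⟩
  · rcases eventually_mem_or_notMem hab (h.convex_ge E).ordConnected with h1 | h1
    · exact Or.inl (h1.mono fun x hx => hx.2)
    · refine Or.inr ((h1.and hI).mono fun x hx => ?_)
      by_contra h2
      exact hx.1 ⟨hx.2, (not_le.1 h2).le⟩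

/-- Where the potential is above the energy, a principal solution is increasing. -/
lemma deriv_nonneg_of_principal (hat : a < t)
    (hy : ∀ x ∈ interval a t, HasDerivAt y (v x) x)
    (hv : ∀ x ∈ interval a t, HasDerivAt v ((V x - E) * y x) x)
    (hpos : ∀ x ∈ interval a t, 0 < y x) (hp : ∀ c ∈ interval a t, IsPrincipal a y c)
    (hE : ∀ x ∈ interval a t, E ≤ V x) : ∀ x ∈ interval a t, 0 ≤ v x := by
  intro x₀ hx₀
  by_contra hneg
  rw [not_le] at hneg
  have hmono : MonotoneOn v (interval a t) := by
    refine monotoneOn_of_deriv_nonneg (convex_interval a t)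
      (fun x hx => (hv x hx).continuousAt.continuousWithinAt)
      (fun x hx => (hv x (interior_subset hx)).differentiableAt.differentiableWithinAt)
      fun x hx => ?_
    rw [(hv x (interior_subset hx)).deriv]
    exact mul_nonneg (sub_nonneg.2 (hE x (interior_subset hx))) (hpos x (interior_subset hx)).le
  -- As `v` increases, `(1 / y)' = -v / y² ≥ -v(x₀) / y²` to the left of `x₀`. If `v(x₀) < 0`,
  -- positivity of `1 / y` bounds the integral of `y⁻²`, against principality.
  have hbd : ∀ x ∈ interval a x₀, -v x₀ * ∫ s in x..x₀, (y s ^ 2)⁻¹ ≤ (y x₀)⁻¹ := by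
    intro x hx
    have hxx := EReal.coe_lt_coe_iff.1 hx.2
    have hxt : x ∈ interval a t := ⟨hx.1, hx.2.trans hx₀.2⟩
    have hI : Icc x x₀ ⊆ interval a t := Icc_subset_interval hxt hx₀
    have hIu : ∀ s ∈ uIcc x x₀, s ∈ interval a t :=
      fun s hs => hI (by rwa [uIcc_of_le hxx.le] at hs)
    have hd : ∀ s ∈ uIcc x x₀, HasDerivAt (fun x => (y x)⁻¹) (-v s * (y s ^ 2)⁻¹) s := fun s hs =>
      ((hy s (hIu s hs)).inv (hpos s (hIu s hs)).ne').congr_deriv (by rw [div_eq_mul_inv])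
    have hc1 : ContinuousOn (fun s => (y s ^ 2)⁻¹) (uIcc x x₀) := fun s hs =>
      (((hy s (hIu s hs)).continuousAt.pow 2).inv₀
        (pow_pos (hpos s (hIu s hs)) 2).ne').continuousWithinAt
    have hc2 : ContinuousOn (fun s => -v s * (y s ^ 2)⁻¹) (uIcc x x₀) := ContinuousOn.mul
      (fun s hs => (hv s (hIu s hs)).continuousAt.neg.continuousWithinAt) hc1
    have h1 := intervalIntegral.integral_eq_sub_of_hasDerivAt hd hc2.intervalIntegrable
    have h2 : -v x₀ * ∫ s in x..x₀, (y s ^ 2)⁻¹ ≤ ∫ s in x..x₀, -v s * (y s ^ 2)⁻¹ := by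
      rw [← intervalIntegral.integral_const_mul]
      refine intervalIntegral.integral_mono_on hxx.le (hc1.intervalIntegrable.const_mul _)
        hc2.intervalIntegrable fun s hs => ?_
      have : 0 < (y s ^ 2)⁻¹ := inv_pos.2 (pow_pos (hpos s (hI hs)) 2)
      exact mul_le_mul_of_nonneg_right (neg_le_neg (hmono (hI hs) hx₀ hs.2)) this.le
    have h3 : 0 < (y x)⁻¹ := inv_pos.2 (hpos x hxt)
    linarith
  have := atLeft_neBot hat
  obtain ⟨x, hx, hx'⟩ := ((eventually_mem_interval hx₀.1).and
    ((hp x₀ hx₀).eventually_gt_atTop ((y x₀)⁻¹ / -v x₀))).exists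
  rw [div_lt_iff₀ (by linarith), mul_comm] at hx'
  linarith [hbd x hx]

/-- Near a finite endpoint, a principal solution is increasing up to a factor. -/
lemma eventually_le_two_mul {α : ℝ} (hαb : (α : EReal) < b) (hαt : (α : EReal) < t)
    (hVc : ConvexOn ℝ (interval α b) V ∨ ConcaveOn ℝ (interval α b) V)
    (hy : ∀ x ∈ interval α t, HasDerivAt y (v x) x)
    (hv : ∀ x ∈ interval α t, HasDerivAt v ((V x - E) * y x) x)
    (hpos : ∀ x ∈ interval α t, 0 < y x) (hp : ∀ c ∈ interval α t, IsPrincipal α y c) :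
    ∃ c₀ ∈ interval α t, ∀ η ξ, α < η → η ≤ ξ → ξ ≤ c₀ → y η ≤ 2 * y ξ := by
  rcases eventually_ge_or_le hαb hVc E with h | h
  · obtain ⟨d, hd, hdE⟩ := (eventually_atLeft hαb).1 h
    obtain ⟨c₀, hc₀⟩ := exists_real_btw (lt_min hd hαt)
    have hc₀' : c₀ ∈ interval α t := ⟨hc₀.1, hc₀.2.trans_le (min_le_right _ _)⟩
    obtain ⟨d', hd'⟩ := exists_real_btw hc₀.2
    have hsub : interval α (d' : ℝ) ⊆ interval α t := fun x hx =>
      ⟨hx.1, (hx.2.trans hd'.2).trans_le (min_le_right _ _)⟩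
    have hn := deriv_nonneg_of_principal (hc₀.1.trans hd'.1) (fun x hx => hy x (hsub hx))
      (fun x hx => hv x (hsub hx)) (fun x hx => hpos x (hsub hx)) (fun c hc => hp c (hsub hc))
      (fun x hx => hdE x ⟨hx.1, (hx.2.trans hd'.2).trans_le (min_le_left _ _)⟩)
    refine ⟨c₀, hc₀', fun η ξ h1 h2 h3 => ?_⟩
    have hm : MonotoneOn y (interval α (d' : ℝ)) := by
      refine monotoneOn_of_deriv_nonneg (convex_interval _ _)
        (fun x hx => (hy x (hsub hx)).continuousAt.continuousWithinAt)
        (fun x hx => (hy x (hsub (interior_subset hx))).differentiableAt.differentiableWithinAt)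
        fun x hx => ?_
      rw [(hy x (hsub (interior_subset hx))).deriv]
      exact hn x (interior_subset hx)
    have hξ : ξ ∈ interval α (d' : ℝ) := ⟨EReal.coe_lt_coe_iff.2 (h1.trans_le h2),
      lt_of_le_of_lt (EReal.coe_le_coe_iff.2 h3) hd'.1⟩
    have hη : η ∈ interval α (d' : ℝ) := ⟨EReal.coe_lt_coe_iff.2 h1,
      lt_of_le_of_lt (EReal.coe_le_coe_iff.2 h2) hξ.2⟩
    linarith [hm hη hξ h2, hpos ξ (hsub hξ)]
  · obtain ⟨d, hd, hdE⟩ := (eventually_atLeft hαb).1 h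
    obtain ⟨d', hd'⟩ := exists_real_btw (lt_min hd hαt)
    have hαd : α < d' := EReal.coe_lt_coe_iff.1 hd'.1
    have hsub : ∀ x, α < x → x ≤ d' → x ∈ interval α t := fun x h1 h2 =>
      ⟨EReal.coe_lt_coe_iff.2 h1,
        (lt_of_le_of_lt (EReal.coe_le_coe_iff.2 h2) hd'.2).trans_le (min_le_right _ _)⟩
    have hconc : ConcaveOn ℝ (Ioc α d') y := by
      refine AntitoneOn.concaveOn_of_deriv (convex_Ioc _ _)
        (fun x hx => (hy x (hsub x hx.1 hx.2)).continuousAt.continuousWithinAt)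
        (fun x hx => (hy x (hsub x (interior_subset hx).1
          (interior_subset hx).2)).differentiableAt.differentiableWithinAt) ?_
      rw [interior_Ioc]
      have hsub' : Ioo α d' ⊆ interval α t := fun x hx => hsub x hx.1 hx.2.le
      have hanti : AntitoneOn v (Ioo α d') := by
        refine antitoneOn_of_deriv_nonpos (convex_Ioo _ _)
          (fun x hx => (hv x (hsub' hx)).continuousAt.continuousWithinAt)
          (fun x hx => (hv x (hsub' (interior_subset hx))).differentiableAt.differentiableWithinAt)
          fun x hx => ?_
        have hx' := interior_subset hx
        rw [(hv x (hsub' hx')).deriv]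
        exact mul_nonpos_of_nonpos_of_nonneg (sub_nonpos.2 (hdE x ⟨(hsub' hx').1,
          ((EReal.coe_lt_coe_iff.2 hx'.2).trans hd'.2).trans_le (min_le_left _ _)⟩))
          (hpos x (hsub' hx')).le
      exact hanti.congr fun x hx => (hy x (hsub' hx)).deriv.symm
    -- Up to the midpoint the fraction `(ξ - η) / (d' - η)` is at most `1 / 2`, so concavity between
    -- `η` and `d'` leaves at least half of `y η` at `ξ`.
    refine ⟨(α + d') / 2, hsub _ (by linarith) (by linarith), fun η ξ h1 h2 h3 => ?_⟩
    have hθ : 0 < d' - η := by linarith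
    have h5 : (ξ - η) / (d' - η) ≤ 1 / 2 := by
      rw [div_le_div_iff₀ hθ two_pos]; linarith
    have h6 := hconc.2 (⟨h1, by linarith⟩ : η ∈ Ioc α d') (⟨hαd, le_rfl⟩ : d' ∈ Ioc α d')
      (by linarith : 0 ≤ 1 - (ξ - η) / (d' - η))
      (div_nonneg (by linarith) hθ.le : 0 ≤ (ξ - η) / (d' - η)) (by ring)
    have e : (1 - (ξ - η) / (d' - η)) • η + ((ξ - η) / (d' - η)) • d' = ξ := by
      simp only [smul_eq_mul]; field_simp; ring
    rw [e, smul_eq_mul, smul_eq_mul] at h6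
    have h7 := hpos η (hsub η h1 (by linarith))
    have h8 := mul_nonneg (div_nonneg (by linarith) hθ.le : 0 ≤ (ξ - η) / (d' - η))
      (hpos d' (hsub d' hαd le_rfl)).le
    nlinarith

/-- At `-∞` a principal solution decays exponentially where the potential is large. -/
lemma mul_le_deriv_of_principal {κ : ℝ} (hκ : 0 < κ) (hat : (⊥ : EReal) < t)
    (hy : ∀ x ∈ interval ⊥ t, HasDerivAt y (v x) x)
    (hv : ∀ x ∈ interval ⊥ t, HasDerivAt v ((V x - E) * y x) x)
    (hpos : ∀ x ∈ interval ⊥ t, 0 < y x) (hp : ∀ c ∈ interval ⊥ t, IsPrincipal ⊥ y c)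
    (hE : ∀ x ∈ interval ⊥ t, κ ^ 2 ≤ V x - E) :
    ∀ x ∈ interval ⊥ t, κ * y x ≤ v x := by
  have hv0 := deriv_nonneg_of_principal hat hy hv hpos hp
    (fun x hx => by nlinarith [hE x hx, sq_nonneg κ])
  intro x₀ hx₀
  have hlt : ∀ x ≤ x₀, x ∈ interval ⊥ t := fun x hx =>
    ⟨EReal.bot_lt_coe x, lt_of_le_of_lt (EReal.coe_le_coe_iff.2 hx) hx₀.2⟩
  have hmv : MonotoneOn v (interval ⊥ t) := by
    refine monotoneOn_of_deriv_nonneg (convex_interval _ _)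
      (fun x hx => (hv x hx).continuousAt.continuousWithinAt)
      (fun x hx => (hv x (interior_subset hx)).differentiableAt.differentiableWithinAt)
      fun x hx => ?_
    rw [(hv x (interior_subset hx)).deriv]
    exact mul_nonneg (by nlinarith [hE x (interior_subset hx), sq_nonneg κ])
      (hpos x (interior_subset hx)).le
  have hmy : MonotoneOn y (interval ⊥ t) := by
    refine monotoneOn_of_deriv_nonneg (convex_interval _ _)
      (fun x hx => (hy x hx).continuousAt.continuousWithinAt)
      (fun x hx => (hy x (interior_subset hx)).differentiableAt.differentiableWithinAt)
      fun x hx => ?_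
    rw [(hy x (interior_subset hx)).deriv]
    exact hv0 x (interior_subset hx)
  -- The integrating factor makes the derivative `e^{κ x} (V - E - κ²) y ≥ 0`. The function is
  -- therefore increasing, and its lower bound `-κ y(x₀) e^{κ x}` tends to zero at `-∞`.
  have hd : ∀ x ∈ interval ⊥ t, HasDerivAt (fun x => Real.exp (κ * x) * (v x - κ * y x))
      (Real.exp (κ * x) * ((V x - E - κ ^ 2) * y x)) x := fun x hx =>
    ((((hasDerivAt_id x).const_mul κ).exp).mul ((hv x hx).sub ((hy x hx).const_mul κ))).congr_deriv
      (by simp; ring)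
  have hmz : MonotoneOn (fun x => Real.exp (κ * x) * (v x - κ * y x)) (interval ⊥ t) := by
    refine monotoneOn_of_deriv_nonneg (convex_interval _ _)
      (fun x hx => (hd x hx).continuousAt.continuousWithinAt)
      (fun x hx => (hd x (interior_subset hx)).differentiableAt.differentiableWithinAt)
      fun x hx => ?_
    rw [(hd x (interior_subset hx)).deriv]
    exact mul_nonneg (Real.exp_pos _).le (mul_nonneg (by linarith [hE x (interior_subset hx)])
      (hpos x (interior_subset hx)).le)
  have hlim : Tendsto (fun x => Real.exp (κ * x) * (-(κ * y x₀))) atBot (𝓝 0) := by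
    have := (Real.tendsto_exp_atBot.comp (tendsto_id.const_mul_atBot hκ)).mul_const (-(κ * y x₀))
    simpa using this
  have h0 : 0 ≤ Real.exp (κ * x₀) * (v x₀ - κ * y x₀) := by
    refine le_of_tendsto hlim ?_
    filter_upwards [eventually_le_atBot x₀] with x hx
    refine le_trans ?_ (hmz (hlt x hx) hx₀ hx)
    refine mul_le_mul_of_nonneg_left ?_ (Real.exp_pos _).le
    have := mul_le_mul_of_nonneg_left (hmy (hlt x hx) hx₀ hx) hκ.le
    linarith [hv0 x (hlt x hx)]
  nlinarith [Real.exp_pos (κ * x₀), nonneg_of_mul_nonneg_right h0 (Real.exp_pos (κ * x₀))]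

lemma atLeft_bot : atLeft ⊥ = atBot := by
  refine (atLeft_basis (b := ⊤) bot_lt_top).eq_of_same_basis ?_
  refine (atBot_basis_Iio (α := ℝ)).to_hasBasis (fun x _ => ⟨x, EReal.bot_lt_coe x, fun z hz =>
    EReal.coe_lt_coe_iff.1 hz.2⟩) fun x _ => ⟨x, trivial, fun z hz =>
      ⟨EReal.bot_lt_coe z, EReal.coe_lt_coe_iff.2 hz⟩⟩

lemma atLeft_coe (α : ℝ) : atLeft α = 𝓝[>] α := by
  refine (atLeft_basis (b := ⊤) (EReal.coe_lt_top α)).eq_of_same_basis ?_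
  refine (nhdsGT_basis α).to_hasBasis (fun x hx => ⟨x, EReal.coe_lt_coe_iff.2 hx, fun z hz =>
    ⟨EReal.coe_lt_coe_iff.1 hz.1, EReal.coe_lt_coe_iff.1 hz.2⟩⟩) fun x hx =>
      ⟨x, EReal.coe_lt_coe_iff.1 hx, fun z hz =>
      ⟨EReal.coe_lt_coe_iff.2 hz.1, EReal.coe_lt_coe_iff.2 hz.2⟩⟩

/-- Decay of a principal solution at `a`, with a rate which is as large as desired. -/
structure Decay (a : EReal) (y : ℝ → ℝ) (c κ C : ℝ) : Prop where
  rate_pos : 0 < κ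
  le : ∀ η ξ : ℝ, a < (η : EReal) → η ≤ ξ → ξ ≤ c → y η ≤ C * y ξ * Real.exp (-(κ * (ξ - η)))
  tendsto : Tendsto (fun x => y x * Real.exp (-(κ / 2 * x))) (atLeft a) (𝓝 0)
  principal : IsPrincipal a (fun x => y x * Real.exp (-(κ / 2 * x))) c

lemma IsPrincipal.of_le {c B : ℝ} {z : ℝ → ℝ} (hc : a < (c : EReal)) (hB : 0 < B)
    (h : IsPrincipal a y c)
    (hyc : ∀ x : ℝ, a < (x : EReal) → x ≤ c → ContinuousAt y x ∧ ContinuousAt z x ∧ y x ≠ 0 ∧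
      z x ≠ 0 ∧ |z x| ≤ B * |y x|) : IsPrincipal a z c := by
  refine tendsto_atTop_mono' _ ?_ (h.const_mul_atTop (inv_pos.2 (pow_pos hB 2)))
  filter_upwards [eventually_mem_interval hc] with x hx
  have hxc := EReal.coe_lt_coe_iff.1 hx.2
  rw [← intervalIntegral.integral_const_mul]
  have hI : ∀ s ∈ Icc x c, a < (s : EReal) ∧ s ≤ c := fun s hs =>
    ⟨hx.1.trans_le (EReal.coe_le_coe_iff.2 hs.1), hs.2⟩
  refine intervalIntegral.integral_mono_on hxc.le ?_ ?_ fun s hs => ?_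
  · refine ContinuousOn.intervalIntegrable fun s hs => ?_
    rw [uIcc_of_le hxc.le] at hs
    obtain ⟨h1, h2, h3, h4, h5⟩ := hyc s (hI s hs).1 (hI s hs).2
    exact (continuousAt_const.mul ((h1.pow 2).inv₀ (pow_ne_zero 2 h3))).continuousWithinAt
  · refine ContinuousOn.intervalIntegrable fun s hs => ?_
    rw [uIcc_of_le hxc.le] at hs
    obtain ⟨h1, h2, h3, h4, h5⟩ := hyc s (hI s hs).1 (hI s hs).2
    exact ((h2.pow 2).inv₀ (pow_ne_zero 2 h4)).continuousWithinAt
  · obtain ⟨h1, h2, h3, h4, h5⟩ := hyc s (hI s hs).1 (hI s hs).2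
    rw [← mul_inv, ← mul_pow]
    refine inv_anti₀ (by positivity) ?_
    rw [← sq_abs (z s), ← sq_abs (B * y s), abs_mul, abs_of_pos hB]
    exact pow_le_pow_left₀ (abs_nonneg _) h5 2

/-- At a finite endpoint the exponential is artificial: with `κ = 1 / (c - α)` it loses at most a
factor `e` on `(α, c]`, so almost-monotonicity with factor 2 gives `C = 2 e` for every `c`. As `c →
α` the rate `κ` grows while `C` stays fixed. -/
lemma exists_decay_coe {α : ℝ} (hαb : (α : EReal) < b) (hαt : (α : EReal) < t)
    (hVc : ConvexOn ℝ (interval α b) V ∨ ConcaveOn ℝ (interval α b) V)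
    (hy : ∀ x ∈ interval α t, HasDerivAt y (v x) x)
    (hv : ∀ x ∈ interval α t, HasDerivAt v ((V x - E) * y x) x)
    (hpos : ∀ x ∈ interval α t, 0 < y x) (hp : ∀ c ∈ interval α t, IsPrincipal α y c) (M : ℝ) :
    ∃ c ∈ interval α t, ∃ κ C, Decay α y c κ C ∧ M * (4 / 3 * C ^ 2 / κ ^ 2) < 1 := by
  obtain ⟨c₀, hc₀, hle⟩ := eventually_le_two_mul hαb hαt hVc hy hv hpos hp
  have hαc₀ : α < c₀ := EReal.coe_lt_coe_iff.1 hc₀.1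
  have hlt : ∀ x, α < x → x ≤ c₀ → x ∈ interval α t := fun x h1 h2 =>
    ⟨EReal.coe_lt_coe_iff.2 h1, lt_of_le_of_lt (EReal.coe_le_coe_iff.2 h2) hc₀.2⟩
  -- Otherwise `y ≥ ε` at points arbitrarily close to `α`, hence `y ≥ ε / 2` on `(α, c₀]`, and `∫
  -- y⁻²` would be bounded on this bounded interval.
  have hy0 : Tendsto y (𝓝[>] α) (𝓝 0) := by
    rw [Metric.tendsto_nhds]
    intro ε hε
    have h1 : ∀ᶠ x in 𝓝[>] α, y x < ε := by
      by_contra hcon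
      have hfr : ∃ᶠ x in 𝓝[>] α, ¬ y x < ε := not_eventually.1 hcon
      have hge : ∀ ξ, α < ξ → ξ ≤ c₀ → ε / 2 ≤ y ξ := by
        intro ξ h1 h2
        obtain ⟨x, hx, hxI⟩ := (hfr.and_eventually (Ioo_mem_nhdsGT h1)).exists
        linarith [not_lt.1 hx, hle x ξ hxI.1 hxI.2.le h2]
      have hp' := hp c₀ hc₀
      rw [IsPrincipal, atLeft_coe] at hp'
      obtain ⟨x, hxI, hx⟩ := ((show ∀ᶠ x in 𝓝[>] α, x ∈ Ioo α c₀ from Ioo_mem_nhdsGT hαc₀).and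
        (hp'.eventually_gt_atTop (((ε / 2) ^ 2)⁻¹ * (c₀ - α)))).exists
      have h2 : ∫ s in x..c₀, (y s ^ 2)⁻¹ ≤ ∫ s in x..c₀, ((ε / 2) ^ 2)⁻¹ := by
        have hI : ∀ s ∈ Icc x c₀, α < s ∧ s ≤ c₀ := fun s hs => ⟨hxI.1.trans_le hs.1, hs.2⟩
        refine intervalIntegral.integral_mono_on hxI.2.le (ContinuousOn.intervalIntegrable
          fun s hs => ?_) (by simp) fun s hs => ?_
        · rw [uIcc_of_le hxI.2.le] at hs
          have hs' := hlt s (hI s hs).1 (hI s hs).2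
          exact (((hy s hs').continuousAt.pow 2).inv₀
            (pow_pos (hpos s hs') 2).ne').continuousWithinAt
        · exact inv_anti₀ (by positivity)
            (pow_le_pow_left₀ (by positivity) (hge s (hI s hs).1 (hI s hs).2) 2)
      rw [intervalIntegral.integral_const, smul_eq_mul, mul_comm] at h2
      have h3 : ((ε / 2) ^ 2)⁻¹ * (c₀ - x) ≤ ((ε / 2) ^ 2)⁻¹ * (c₀ - α) :=
        mul_le_mul_of_nonneg_left (by linarith [hxI.1]) (by positivity)
      linarith
    filter_upwards [h1, Ioo_mem_nhdsGT hαc₀] with x hx hxI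
    rw [Real.dist_eq, sub_zero, abs_of_pos (hpos x (hlt x hxI.1 hxI.2.le))]
    exact hx
  have hsmall : ∀ᶠ c in 𝓝[>] α, M * (4 / 3 * (2 * Real.exp 1) ^ 2 * (c - α) ^ 2) < 1 := by
    have : ContinuousAt (fun c => M * (4 / 3 * (2 * Real.exp 1) ^ 2 * (c - α) ^ 2)) α := by fun_prop
    exact nhdsWithin_le_nhds (this.eventually_lt_const (by simp))
  obtain ⟨c, hc, hcI⟩ := (hsmall.and (Ioo_mem_nhdsGT hαc₀)).exists
  have hcα : 0 < c - α := sub_pos.2 hcI.1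
  refine ⟨c, hlt c hcI.1 hcI.2.le, (c - α)⁻¹, 2 * Real.exp 1, ⟨inv_pos.2 hcα, ?_, ?_, ?_⟩, ?_⟩
  · intro η ξ h1 h2 h3
    have h1' := EReal.coe_lt_coe_iff.1 h1
    refine (hle η ξ h1' h2 (h3.trans hcI.2.le)).trans ?_
    have h4 : (c - α)⁻¹ * (ξ - η) ≤ 1 := by
      rw [inv_mul_le_iff₀ hcα]; linarith
    have h5 : 1 ≤ Real.exp 1 * Real.exp (-((c - α)⁻¹ * (ξ - η))) := by
      rw [← Real.exp_add]; exact Real.one_le_exp (by linarith)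
    have h6 := hpos ξ (hlt ξ (h1'.trans_le h2) (h3.trans hcI.2.le))
    nlinarith
  · rw [atLeft_coe]
    have h1 : Tendsto (fun x => Real.exp (-((c - α)⁻¹ / 2 * x))) (𝓝[>] α)
        (𝓝 (Real.exp (-((c - α)⁻¹ / 2 * α)))) :=
      (Continuous.tendsto (by fun_prop) α).mono_left nhdsWithin_le_nhds
    simpa using hy0.mul h1
  · refine (hp c (hlt c hcI.1 hcI.2.le)).of_le (EReal.coe_lt_coe_iff.2 hcI.1)
      (Real.exp_pos (-((c - α)⁻¹ / 2 * α))) fun x h1 h2 => ?_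
    have h1' := EReal.coe_lt_coe_iff.1 h1
    have hx := hlt x h1' (h2.trans hcI.2.le)
    have hcx := (hy x hx).continuousAt
    refine ⟨hcx, hcx.mul (by fun_prop), (hpos x hx).ne', mul_ne_zero (hpos x hx).ne'
      (Real.exp_pos _).ne', ?_⟩
    rw [abs_mul, mul_comm, abs_of_pos (Real.exp_pos _)]
    refine mul_le_mul_of_nonneg_right (Real.exp_le_exp.2 (neg_le_neg ?_)) (abs_nonneg _)
    have : 0 < (c - α)⁻¹ := inv_pos.2 hcα
    gcongr
  · rw [inv_pow, div_inv_eq_mul]; exact hc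

/-- At `-∞` the decay is genuine, with `C = 1`: any rate `κ` is reached far enough to the left
because `V → ∞`. -/
lemma exists_decay_bot (hVlim : Tendsto V atBot atTop) (hbt : (⊥ : EReal) < t)
    (hy : ∀ x ∈ interval ⊥ t, HasDerivAt y (v x) x)
    (hv : ∀ x ∈ interval ⊥ t, HasDerivAt v ((V x - E) * y x) x)
    (hpos : ∀ x ∈ interval ⊥ t, 0 < y x) (hp : ∀ c ∈ interval ⊥ t, IsPrincipal ⊥ y c) (M : ℝ) :
    ∃ c ∈ interval ⊥ t, ∃ κ C, Decay ⊥ y c κ C ∧ M * (4 / 3 * C ^ 2 / κ ^ 2) < 1 := by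
  obtain ⟨κ, hκ, hκM⟩ : ∃ κ : ℝ, 0 < κ ∧ M * (4 / 3 * 1 ^ 2 / κ ^ 2) < 1 := by
    refine ⟨2 * (|M| + 1), by positivity, ?_⟩
    have h0 : 0 ≤ |M| := abs_nonneg M
    rw [← mul_div_assoc, div_lt_one (by positivity)]
    nlinarith [le_abs_self M]
  obtain ⟨d, hd⟩ := eventually_atBot.1 (hVlim.eventually_ge_atTop (κ ^ 2 + E))
  obtain ⟨d', hd'⟩ := exists_real_btw (lt_min (EReal.bot_lt_coe d) hbt)
  obtain ⟨c, hc⟩ := exists_real_btw (EReal.bot_lt_coe d')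
  have hsub : interval ⊥ (d' : ℝ) ⊆ interval ⊥ t := fun x hx =>
    ⟨hx.1, (hx.2.trans hd'.2).trans_le (min_le_right _ _)⟩
  have hk := mul_le_deriv_of_principal hκ (EReal.bot_lt_coe d') (fun x hx => hy x (hsub hx))
    (fun x hx => hv x (hsub hx)) (fun x hx => hpos x (hsub hx)) (fun c hc => hp c (hsub hc))
    fun x hx => by
      have := hd x (EReal.coe_le_coe_iff.1 ((hx.2.trans hd'.2).trans_le (min_le_left _ _)).le)
      linarith
  have hlt : ∀ x ≤ c, x ∈ interval ⊥ (d' : ℝ) := fun x hx =>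
    ⟨EReal.bot_lt_coe x, lt_of_le_of_lt (EReal.coe_le_coe_iff.2 hx) hc.2⟩
  have hle : ∀ η ξ : ℝ, η ≤ ξ → ξ ≤ c → y η ≤ y ξ * Real.exp (-(κ * (ξ - η))) := by
    intro η ξ h2 h3
    have hd : ∀ x ∈ interval ⊥ (d' : ℝ), HasDerivAt (fun x => y x * Real.exp (-(κ * x)))
        (Real.exp (-(κ * x)) * (v x - κ * y x)) x := fun x hx =>
      ((hy x (hsub hx)).mul (((hasDerivAt_id x).const_mul κ).neg.exp)).congr_deriv (by simp; ring)
    have hm : MonotoneOn (fun x => y x * Real.exp (-(κ * x))) (interval ⊥ (d' : ℝ)) := by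
      refine monotoneOn_of_deriv_nonneg (convex_interval _ _)
        (fun x hx => (hd x hx).continuousAt.continuousWithinAt)
        (fun x hx => (hd x (interior_subset hx)).differentiableAt.differentiableWithinAt)
        fun x hx => ?_
      rw [(hd x (interior_subset hx)).deriv]
      exact mul_nonneg (Real.exp_pos _).le (sub_nonneg.2 (hk x (interior_subset hx)))
    have h4 := mul_le_mul_of_nonneg_right (hm (hlt η (h2.trans h3)) (hlt ξ h3) h2)
      (Real.exp_pos (κ * η)).le
    simp only [mul_assoc, ← Real.exp_add] at h4
    rw [neg_add_cancel, Real.exp_zero, mul_one] at h4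
    rwa [show -(κ * (ξ - η)) = -(κ * ξ) + κ * η by ring]
  have hexp : ∀ x ≤ c, y x * Real.exp (-(κ / 2 * x)) ≤
      y c * Real.exp (-(κ * c)) * Real.exp (κ / 2 * x) := fun x hx => by
    have h1 := mul_le_mul_of_nonneg_right (hle x c hx le_rfl) (Real.exp_pos (-(κ / 2 * x))).le
    rw [mul_assoc, ← Real.exp_add] at h1
    rw [mul_assoc, ← Real.exp_add]
    rwa [show -(κ * c) + κ / 2 * x = -(κ * (c - x)) + -(κ / 2 * x) by ring]
  refine ⟨c, hsub hc, κ, 1, ⟨hκ, fun η ξ _ h2 h3 => by rw [one_mul]; exact hle η ξ h2 h3, ?_, ?_⟩,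
    hκM⟩
  · rw [atLeft_bot]
    have h1 : Tendsto (fun x => y c * Real.exp (-(κ * c)) * Real.exp (κ / 2 * x)) atBot (𝓝 0) := by
      simpa using (Real.tendsto_exp_atBot.comp (tendsto_id.const_mul_atBot
        (half_pos hκ))).const_mul (y c * Real.exp (-(κ * c)))
    refine tendsto_of_tendsto_of_tendsto_of_le_of_le' tendsto_const_nhds h1 ?_ ?_
    · filter_upwards [eventually_le_atBot c] with x hx
      exact mul_nonneg (hpos x (hsub (hlt x hx))).le (Real.exp_pos _).le
    · filter_upwards [eventually_le_atBot c] with x hx using hexp x hx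
  · rw [IsPrincipal, atLeft_bot]
    -- `D` bounds `y e^{-κ x / 2}` on `(-∞, c]`, so the integral to be shown divergent is at least
    -- `(c - x) / D²`.
    set D := y c * Real.exp (-(κ * c)) * Real.exp (κ / 2 * c) with hD
    have hD0 : 0 < D := mul_pos (mul_pos (hpos c (hsub hc)) (Real.exp_pos _)) (Real.exp_pos _)
    have h1 : Tendsto (fun x => (D ^ 2)⁻¹ * (c - x)) atBot atTop :=
      (tendsto_atTop_add_const_left _ c tendsto_neg_atBot_atTop).const_mul_atTop
        (by positivity)
    refine tendsto_atTop_mono' _ ?_ h1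
    filter_upwards [eventually_le_atBot c] with x hx
    have h2 : ∫ s in x..c, (D ^ 2)⁻¹ ≤ ∫ s in x..c, ((y s * Real.exp (-(κ / 2 * s))) ^ 2)⁻¹ := by
      refine intervalIntegral.integral_mono_on hx (by simp) (ContinuousOn.intervalIntegrable
          fun s hs => ?_) fun s hs => ?_
      · rw [uIcc_of_le hx] at hs
        have hs' := hsub (hlt s hs.2)
        have hcx : ContinuousAt (fun s => y s * Real.exp (-(κ / 2 * s))) s :=
          (hy s hs').continuousAt.mul (by fun_prop)
        exact ((hcx.pow 2).inv₀ (pow_pos (mul_pos (hpos s hs') (Real.exp_pos _))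
          2).ne').continuousWithinAt
      · have hs' := hpos s (hsub (hlt s hs.2))
        refine inv_anti₀ (by positivity) (pow_le_pow_left₀ (by positivity) ?_ 2)
        refine (hexp s hs.2).trans ?_
        have h3 := hpos c (hsub hc)
        rw [hD]
        gcongr
        exact hs.2
    rw [intervalIntegral.integral_const, smul_eq_mul, mul_comm] at h2
    exact h2

lemma exists_decay (hab : a < b) (hat : a < t) (hbot : a = ⊥ → Tendsto V atBot atTop)
    (hVc : ConvexOn ℝ (interval a b) V ∨ ConcaveOn ℝ (interval a b) V)
    (hy : ∀ x ∈ interval a t, HasDerivAt y (v x) x)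
    (hv : ∀ x ∈ interval a t, HasDerivAt v ((V x - E) * y x) x)
    (hpos : ∀ x ∈ interval a t, 0 < y x) (hp : ∀ c ∈ interval a t, IsPrincipal a y c) (M : ℝ) :
    ∃ c ∈ interval a t, ∃ κ C, Decay a y c κ C ∧ M * (4 / 3 * C ^ 2 / κ ^ 2) < 1 := by
  induction a with
  | bot => exact exists_decay_bot (hbot rfl) hat hy hv hpos hp M
  | coe α => exact exists_decay_coe hab hat hVc hy hv hpos hp M
  | top => exact absurd hat not_top_lt

end GroundState

/-! ### Weights that make the integral operator small. -/

namespace GroundState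

variable {a : EReal} {t₁ : ℝ}

lemma halfInterval_subset {x : ℝ} (hx : x ≤ t₁) : halfInterval a x ⊆ halfInterval a t₁ :=
  fun _ hz => ⟨hz.1, hz.2.trans hx⟩

lemma interval_subset_of_le {x z : ℝ} (h : x ≤ z) : interval a x ⊆ interval a z :=
  interval_mono (EReal.coe_le_coe_iff.2 h)

lemma setIntegral_interval_add {g : ℝ → ℝ} (hg : IntegrableOn g (interval a t₁)) {x z : ℝ}
    (hx : x ∈ halfInterval a t₁) (hz : z ∈ halfInterval a t₁) :
    ∫ s in interval a z, g s = (∫ s in interval a x, g s) + ∫ s in x..z, g s := by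
  wlog h : x ≤ z generalizing x z
  · rw [this hz hx (not_le.1 h).le, intervalIntegral.integral_symm x z]; ring
  have hu : interval a z = interval a x ∪ Ico x z := by
    ext s
    constructor
    · intro hs
      rcases lt_or_ge s x with h1 | h1
      · exact Or.inl ⟨hs.1, EReal.coe_lt_coe_iff.2 h1⟩
      · exact Or.inr ⟨h1, EReal.coe_lt_coe_iff.1 hs.2⟩
    · rintro (hs | hs)
      · exact interval_subset_of_le h hs
      · exact ⟨hx.1.trans_le (EReal.coe_le_coe_iff.2 hs.1), EReal.coe_lt_coe_iff.2 hs.2⟩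
  have hgz := hg.mono_set (interval_subset_of_le hz.2)
  have hd : Disjoint (interval a x) (Ico x z) := by
    rw [Set.disjoint_left]
    exact fun s h1 h2 => absurd (EReal.coe_lt_coe_iff.1 h1.2) (not_lt.2 h2.1)
  rw [hu] at hgz ⊢
  rw [setIntegral_union hd measurableSet_Ico (hgz.mono_set subset_union_left)
    (hgz.mono_set subset_union_right), intervalIntegral.integral_of_le h,
    integral_Ico_eq_integral_Ioo, integral_Ioc_eq_integral_Ioo]

lemma hasDerivWithinAt_setIntegral_interval {g : ℝ → ℝ} (hg : IntegrableOn g (interval a t₁))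
    (hc : ContinuousOn g (halfInterval a t₁)) {x : ℝ} (hx : x ∈ halfInterval a t₁) :
    HasDerivWithinAt (fun x : ℝ => ∫ s in interval a x, g s) (g x) (halfInterval a t₁) x := by
  refine ((hasDerivWithinAt_primitive ordConnected_halfInterval hx hx hc).const_add
    (∫ s in interval a x, g s)).congr (fun z hz => ?_) ?_
  · exact setIntegral_interval_add hg hx hz
  · exact setIntegral_interval_add hg hx hx

lemma continuousOn_setIntegral_interval {g : ℝ → ℝ} (hg : IntegrableOn g (interval a t₁))
    (hc : ContinuousOn g (halfInterval a t₁)) :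
    ContinuousOn (fun x : ℝ => ∫ s in interval a x, g s) (halfInterval a t₁) :=
  fun _ hx => (hasDerivWithinAt_setIntegral_interval hg hc hx).continuousWithinAt

/-- A weight for which `f ↦ ∫_c^x y⁻² ∫_a^ξ y² f` is bounded by `θ` on weighted functions. -/
structure Weight (a : EReal) (t₁ : ℝ) (y ϖ : ℝ → ℝ) (c θ : ℝ) : Prop where
  cont : ContinuousOn ϖ (halfInterval a t₁)
  pos : ∀ x ∈ halfInterval a t₁, 0 < ϖ x
  one_le : ∃ C₀, ∀ x ∈ halfInterval a t₁, 1 ≤ C₀ * ϖ x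
  integrable : IntegrableOn (fun x => y x ^ 2 * ϖ x) (interval a t₁)
  integrable_sq : IntegrableOn (fun x => y x ^ 2 * ϖ x ^ 2) (interval a t₁)
  bound : ∀ x ∈ halfInterval a t₁,
    |∫ ξ in c..x, (y ξ ^ 2)⁻¹ * ∫ η in interval a ξ, y η ^ 2 * ϖ η| ≤ θ * ϖ x
  tendsto : Tendsto (fun x => y x * ϖ x) (atLeft a) (𝓝 0)
  tendsto_int : Tendsto (fun x => ϖ x * ∫ η in interval a x, y η ^ 2 * ϖ η) (atLeft a) (𝓝 0)
  principal : IsPrincipal a (fun x => y x * ϖ x) c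

lemma integrableOn_interval_of_le_exp {g : ℝ → ℝ} {c k D : ℝ} (hk : 0 < k)
    (hc : c ∈ interval a t₁) (hg : ContinuousOn g (halfInterval a t₁))
    (hle : ∀ x ∈ interval a c, |g x| ≤ D * Real.exp (k * x)) :
    IntegrableOn g (interval a t₁) := by
  have h1 : IntegrableOn g (interval a c) := by
    refine Integrable.mono' (g := fun x => D * Real.exp (k * x)) ?_ ?_ ?_
    · exact IntegrableOn.mono_set ((integrableOn_exp_mul_Iic hk c).const_mul D)
        fun x hx => (EReal.coe_lt_coe_iff.1 hx.2).le
    · exact (hg.mono fun x hx => interval_subset_halfInterval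
        ⟨hx.1, hx.2.trans hc.2⟩).aestronglyMeasurable (measurableSet_interval _ _)
    · exact (ae_restrict_iff' (measurableSet_interval _ _)).2 (Eventually.of_forall hle)
  have h2 : IntegrableOn g (Icc c t₁) := (hg.mono fun x hx =>
    ⟨hc.1.trans_le (EReal.coe_le_coe_iff.2 hx.1), hx.2⟩).integrableOn_Icc
  refine (h1.union h2).mono_set fun x hx => ?_
  rcases lt_or_ge x c with h | h
  · exact Or.inl ⟨hx.1, EReal.coe_lt_coe_iff.2 h⟩
  · exact Or.inr ⟨h, (EReal.coe_lt_coe_iff.1 hx.2).le⟩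

/-- The weight is `e^{-κ x / 2}` to the left of `c` and grows like `e^{L (x - c)}` to the right. On
the left, squaring the decay bound gives `∫_a^ξ y² ϖ ≤ C² y(ξ)² (2 / (3 κ)) e^{-κ ξ / 2}`; the
factor `y⁻²` cancels `y²`, and the outer integration contributes `2 / κ`. The product is `4 C² / (3
κ²)`. -/
lemma Decay.exists_weight {y : ℝ → ℝ} {c κ C : ℝ} (h : Decay a y c κ C) (hc : c ∈ interval a t₁)
    (hy : ContinuousOn y (halfInterval a t₁)) (hpos : ∀ x ∈ halfInterval a t₁, 0 < y x) :
    ∃ ϖ, Weight a t₁ y ϖ c (4 / 3 * C ^ 2 / κ ^ 2) := by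
  have hκ := h.rate_pos
  have hcJ : c ∈ halfInterval a t₁ := interval_subset_halfInterval hc
  have hct : c < t₁ := EReal.coe_lt_coe_iff.1 hc.2
  have hC : 1 ≤ C := by
    have h1 := h.le c c hc.1 le_rfl le_rfl
    rw [sub_self, mul_zero, neg_zero, Real.exp_zero, mul_one] at h1
    exact le_of_mul_le_mul_right (by linarith) (hpos c hcJ)
  have hθ : 0 < 4 / 3 * C ^ 2 / κ ^ 2 := by positivity
  set θ := 4 / 3 * C ^ 2 / κ ^ 2 with hθd
  have hIJ : Icc c t₁ ⊆ halfInterval a t₁ := fun x hx =>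
    ⟨hc.1.trans_le (EReal.coe_le_coe_iff.2 hx.1), hx.2⟩
  obtain ⟨Y, hY⟩ := isCompact_Icc.exists_bound_of_continuousOn ((hy.mono hIJ).pow 2)
  obtain ⟨Z, hZ⟩ := isCompact_Icc.exists_bound_of_continuousOn
    (((hy.mono hIJ).pow 2).inv₀ fun x hx => (pow_pos (hpos x (hIJ hx)) 2).ne')
  have hY' : ∀ x ∈ Icc c t₁, y x ^ 2 ≤ Y := fun x hx => (le_abs_self _).trans (hY x hx)
  have hZ' : ∀ x ∈ Icc c t₁, (y x ^ 2)⁻¹ ≤ Z := fun x hx => (le_abs_self _).trans (hZ x hx)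
  have hY0 : 0 ≤ Y := (sq_nonneg _).trans (hY' c ⟨le_rfl, hct.le⟩)
  have hZ0 : 0 ≤ Z := (inv_nonneg.2 (sq_nonneg _)).trans (hZ' c ⟨le_rfl, hct.le⟩)
  set P₀ := ∫ η in interval a c, y η ^ 2 * Real.exp (-(κ / 2 * η)) with hP₀
  have hP₀0 : 0 ≤ P₀ := integral_nonneg fun η => by positivity
  set e₀ := Real.exp (-(κ / 2 * c)) with he₀
  have he₀0 : 0 < e₀ := Real.exp_pos _
  set B₀ := P₀ + Y * e₀ * (t₁ - c) with hB₀
  have hB₀0 : 0 ≤ B₀ := add_nonneg hP₀0 (mul_nonneg (by positivity) (by linarith))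
  -- To the right of `c` the integrand is at most `Z B₀ e^{L (ξ - c)}`, where neither `Z` nor `B₀`
  -- involves `L`. The integration divides by `L`, so a large `L` yields the same constant `θ`
  -- there.
  set L := Z * B₀ / (θ * e₀) + 1 with hL
  have hL0 : 0 < L := by positivity
  have hLZ : Z * B₀ ≤ θ * e₀ * L := by
    have : Z * B₀ / (θ * e₀) ≤ L := by linarith
    rwa [div_le_iff₀' (by positivity)] at this
  set ϖ : ℝ → ℝ := fun x => Real.exp (-(κ / 2 * min x c) + L * max (x - c) 0) with hϖ
  have hϖl : ∀ x ≤ c, ϖ x = Real.exp (-(κ / 2 * x)) := fun x hx => by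
    simp only [hϖ]; rw [min_eq_left hx, max_eq_right (by linarith), mul_zero, add_zero]
  have hϖr : ∀ x, c ≤ x → ϖ x = e₀ * Real.exp (L * (x - c)) := fun x hx => by
    simp only [hϖ, he₀]; rw [min_eq_right hx, max_eq_left (by linarith), Real.exp_add]
  have hϖc : Continuous ϖ := by fun_prop
  have hϖ0 : ∀ x, 0 < ϖ x := fun x => Real.exp_pos _
  have hpw : ∀ ξ ≤ c, ∀ η ∈ interval a ξ, y η ^ 2 * ϖ η ≤
      C ^ 2 * y ξ ^ 2 * Real.exp (-(2 * κ * ξ)) * Real.exp (3 / 2 * κ * η) := by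
    intro ξ hξ η hη
    have hηξ := (EReal.coe_lt_coe_iff.1 hη.2).le
    have h1 := h.le η ξ hη.1 hηξ hξ
    have h0 := hpos η ⟨hη.1, hηξ.trans (hξ.trans hct.le)⟩
    have h2 := pow_le_pow_left₀ h0.le h1 2
    rw [hϖl η (hηξ.trans hξ)]
    refine (mul_le_mul_of_nonneg_right h2 (Real.exp_pos _).le).trans_eq ?_
    rw [mul_pow, mul_pow, ← Real.exp_nat_mul, mul_assoc, mul_assoc (_ * _), ← Real.exp_add,
      ← Real.exp_add]
    congr 2
    push_cast; ring
  have hpc : ContinuousOn (fun x => y x ^ 2 * ϖ x) (halfInterval a t₁) :=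
    (hy.pow 2).mul hϖc.continuousOn
  have hpcs : ContinuousOn (fun x => y x ^ 2 * ϖ x ^ 2) (halfInterval a t₁) :=
    (hy.pow 2).mul (hϖc.pow 2).continuousOn
  have hi1 : IntegrableOn (fun x => y x ^ 2 * ϖ x) (interval a t₁) := by
    refine integrableOn_interval_of_le_exp (k := 3 / 2 * κ)
      (D := C ^ 2 * y c ^ 2 * Real.exp (-(2 * κ * c))) (by positivity) hc hpc fun x hx => ?_
    rw [abs_of_nonneg (mul_nonneg (sq_nonneg _) (hϖ0 x).le)]
    exact hpw c le_rfl x hx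
  have hi2 : IntegrableOn (fun x => y x ^ 2 * ϖ x ^ 2) (interval a t₁) := by
    refine integrableOn_interval_of_le_exp (k := κ)
      (D := C ^ 2 * y c ^ 2 * Real.exp (-(2 * κ * c))) (by positivity) hc hpcs fun x hx => ?_
    rw [abs_of_nonneg (by positivity), pow_two (ϖ x), ← mul_assoc]
    refine (mul_le_mul_of_nonneg_right (hpw c le_rfl x hx) (hϖ0 x).le).trans_eq ?_
    rw [hϖl x (EReal.coe_lt_coe_iff.1 hx.2).le, mul_assoc, ← Real.exp_add]
    congr 2
    ring
  set P : ℝ → ℝ := fun ξ => ∫ η in interval a ξ, y η ^ 2 * ϖ η with hP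
  have hP0 : ∀ ξ, 0 ≤ P ξ := fun ξ => integral_nonneg fun η => by
    have := hϖ0 η; positivity
  have hPl : ∀ ξ : ℝ, a < (ξ : EReal) → ξ ≤ c →
      P ξ ≤ C ^ 2 * (2 / (3 * κ)) * y ξ ^ 2 * Real.exp (-(κ / 2 * ξ)) := by
    intro ξ haξ hξ
    have hk : 0 < 3 / 2 * κ := by positivity
    have hie : IntegrableOn (fun η => C ^ 2 * y ξ ^ 2 * Real.exp (-(2 * κ * ξ)) *
        Real.exp (3 / 2 * κ * η)) (Iic ξ) := (integrableOn_exp_mul_Iic hk ξ).const_mul _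
    have hss : interval a (ξ : ℝ) ⊆ Iic ξ := fun x hx => (EReal.coe_lt_coe_iff.1 hx.2).le
    calc P ξ ≤ ∫ η in interval a ξ, C ^ 2 * y ξ ^ 2 * Real.exp (-(2 * κ * ξ)) *
          Real.exp (3 / 2 * κ * η) :=
          setIntegral_mono_on (hi1.mono_set (interval_subset_of_le (hξ.trans hct.le)))
            (hie.mono_set hss) (measurableSet_interval _ _) (hpw ξ hξ)
      _ ≤ ∫ η in Iic ξ, C ^ 2 * y ξ ^ 2 * Real.exp (-(2 * κ * ξ)) * Real.exp (3 / 2 * κ * η) :=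
          setIntegral_mono_set hie (Eventually.of_forall fun x => by positivity)
            hss.eventuallyLE
      _ = _ := by
          rw [integral_const_mul, integral_exp_mul_Iic hk]
          have e : Real.exp (-(κ / 2 * ξ)) = Real.exp (-(2 * κ * ξ)) * Real.exp (3 / 2 * κ * ξ) := by
            rw [← Real.exp_add]; congr 1; ring
          rw [e]; field_simp
  have hPr : ∀ ξ, c ≤ ξ → ξ ≤ t₁ → P ξ ≤ B₀ * Real.exp (L * (ξ - c)) := by
    intro ξ h1 h2
    have e1 : P ξ = P₀ + ∫ s in c..ξ, y s ^ 2 * ϖ s := by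
      simp only [hP, hP₀]
      rw [setIntegral_interval_add hi1 hcJ (hIJ ⟨h1, h2⟩)]
      congr 1
      refine setIntegral_congr_fun (measurableSet_interval _ _) fun η hη => ?_
      rw [hϖl η (EReal.coe_lt_coe_iff.1 hη.2).le]
    have e2 : ∫ s in c..ξ, y s ^ 2 * ϖ s ≤ ∫ s in c..ξ, Y * (e₀ * Real.exp (L * (ξ - c))) := by
      refine intervalIntegral.integral_mono_on h1 ?_ (by simp) fun s hs => ?_
      · exact (hpc.mono fun s hs => hIJ (Icc_subset_Icc_right h2
          (by rwa [uIcc_of_le h1] at hs))).intervalIntegrable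
      · rw [hϖr s hs.1]
        have h3 := hY' s ⟨hs.1, hs.2.trans h2⟩
        have h4 : Real.exp (L * (s - c)) ≤ Real.exp (L * (ξ - c)) := by
          have := hs.2; gcongr
        gcongr
    rw [intervalIntegral.integral_const, smul_eq_mul] at e2
    have e3 : 1 ≤ Real.exp (L * (ξ - c)) := Real.one_le_exp (mul_nonneg hL0.le (by linarith))
    have e4 : (ξ - c) * (Y * (e₀ * Real.exp (L * (ξ - c)))) ≤
        (t₁ - c) * (Y * (e₀ * Real.exp (L * (ξ - c)))) :=
      mul_le_mul_of_nonneg_right (by linarith) (by positivity)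
    rw [e1, hB₀]
    nlinarith
  have hqc : ContinuousOn (fun ξ => (y ξ ^ 2)⁻¹ * P ξ) (halfInterval a t₁) :=
    ((hy.pow 2).inv₀ fun x hx => (pow_pos (hpos x hx) 2).ne').mul
      (continuousOn_setIntegral_interval hi1 hpc)
  refine ⟨ϖ, ⟨hϖc.continuousOn, fun x _ => hϖ0 x, ⟨e₀⁻¹, fun x _ => ?_⟩, hi1, hi2, fun x hx => ?_,
    ?_, ?_, ?_⟩⟩
  · rw [inv_mul_eq_div, one_le_div he₀0]
    exact Real.exp_le_exp.2 (by
      have := mul_le_mul_of_nonneg_left (min_le_right x c) (half_pos hκ).le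
      have := mul_nonneg hL0.le (le_max_right (x - c) 0)
      linarith)
  · rcases le_total x c with hxc | hxc
    · rw [intervalIntegral.integral_symm, abs_neg, abs_of_nonneg
        (intervalIntegral.integral_nonneg hxc fun s _ => mul_nonneg (inv_nonneg.2 (sq_nonneg _))
          (hP0 s))]
      have hI : ∀ s ∈ Icc x c, a < (s : EReal) ∧ s ≤ c := fun s hs =>
        ⟨hx.1.trans_le (EReal.coe_le_coe_iff.2 hs.1), hs.2⟩
      have h1 : ∫ ξ in x..c, (y ξ ^ 2)⁻¹ * P ξ ≤
          ∫ ξ in x..c, C ^ 2 * (2 / (3 * κ)) * Real.exp (-(κ / 2 * ξ)) := by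
        refine intervalIntegral.integral_mono_on hxc ?_
          (Continuous.intervalIntegrable (by fun_prop) _ _) fun s hs => ?_
        · exact intervalIntegrable_of_continuousOn ordConnected_halfInterval hqc hx hcJ
        · have h2 := hPl s (hI s hs).1 (hI s hs).2
          have h3 := hpos s ⟨(hI s hs).1, (hI s hs).2.trans hct.le⟩
          rw [inv_mul_le_iff₀ (by positivity)]
          linarith
      have h2 : ∫ ξ in x..c, C ^ 2 * (2 / (3 * κ)) * Real.exp (-(κ / 2 * ξ)) =
          -(θ * Real.exp (-(κ / 2 * c))) - -(θ * Real.exp (-(κ / 2 * x))) := by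
        refine intervalIntegral.integral_eq_sub_of_hasDerivAt
          (f := fun x => -(θ * Real.exp (-(κ / 2 * x)))) (fun s _ => ?_)
          (Continuous.intervalIntegrable (by fun_prop) _ _)
        refine ((((hasDerivAt_id s).const_mul (κ / 2)).neg.exp.const_mul θ).neg).congr_deriv ?_
        simp only [hθd, id, Pi.neg_apply]; field_simp; ring
      rw [hϖl x hxc]
      have := mul_pos hθ (Real.exp_pos (-(κ / 2 * c)))
      linarith
    · rw [abs_of_nonneg (intervalIntegral.integral_nonneg hxc fun s _ =>
        mul_nonneg (inv_nonneg.2 (sq_nonneg _)) (hP0 s))]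
      have h1 : ∫ ξ in c..x, (y ξ ^ 2)⁻¹ * P ξ ≤
          ∫ ξ in c..x, θ * e₀ * (L * Real.exp (L * (ξ - c))) := by
        refine intervalIntegral.integral_mono_on hxc ?_
          (Continuous.intervalIntegrable (by fun_prop) _ _) fun s hs => ?_
        · exact intervalIntegrable_of_continuousOn ordConnected_halfInterval hqc hcJ hx
        · have h2 := hPr s hs.1 (hs.2.trans hx.2)
          have h3 := hZ' s ⟨hs.1, hs.2.trans hx.2⟩
          calc (y s ^ 2)⁻¹ * P s ≤ Z * (B₀ * Real.exp (L * (s - c))) :=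
                mul_le_mul h3 h2 (hP0 s) hZ0
            _ = Z * B₀ * Real.exp (L * (s - c)) := by ring
            _ ≤ θ * e₀ * L * Real.exp (L * (s - c)) :=
                mul_le_mul_of_nonneg_right hLZ (Real.exp_pos _).le
            _ = _ := by ring
      have h2 : ∫ ξ in c..x, θ * e₀ * (L * Real.exp (L * (ξ - c))) =
          θ * e₀ * Real.exp (L * (x - c)) - θ * e₀ * Real.exp (L * (c - c)) := by
        refine intervalIntegral.integral_eq_sub_of_hasDerivAt
          (f := fun x => θ * e₀ * Real.exp (L * (x - c))) (fun s _ => ?_)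
          (Continuous.intervalIntegrable (by fun_prop) _ _)
        refine (((((hasDerivAt_id s).sub_const c).const_mul L).exp).const_mul (θ * e₀)).congr_deriv ?_
        simp only [id]; ring
      rw [hϖr x hxc]
      have : 0 < θ * e₀ * Real.exp (L * (c - c)) := by positivity
      linarith
  · refine h.tendsto.congr' ?_
    filter_upwards [eventually_mem_interval hc.1] with x hx
    rw [hϖl x (EReal.coe_lt_coe_iff.1 hx.2).le]
  · have h1 : Tendsto (fun x => C ^ 2 * (2 / (3 * κ)) * (y x * Real.exp (-(κ / 2 * x))) ^ 2)
        (atLeft a) (𝓝 0) := by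
      simpa using (h.tendsto.pow 2).const_mul (C ^ 2 * (2 / (3 * κ)))
    refine tendsto_of_tendsto_of_tendsto_of_le_of_le' tendsto_const_nhds h1
      (Eventually.of_forall fun x => mul_nonneg (hϖ0 x).le (hP0 x)) ?_
    filter_upwards [eventually_mem_interval hc.1] with x hx
    have hxc := (EReal.coe_lt_coe_iff.1 hx.2).le
    rw [hϖl x hxc]
    refine (mul_le_mul_of_nonneg_left (hPl x hx.1 hxc) (Real.exp_pos _).le).trans_eq ?_
    ring
  · refine h.principal.congr' ?_
    filter_upwards [eventually_mem_interval hc.1] with x hx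
    refine intervalIntegral.integral_congr fun s hs => ?_
    rw [uIcc_of_le (EReal.coe_lt_coe_iff.1 hx.2).le] at hs
    rw [hϖl s hs.2]

end GroundState

/-! ### Solutions depending on the spectral parameter. -/

namespace GroundState

variable {V : ℝ → ℝ} {a b : EReal} {t₁ E₁ c θ : ℝ} {y v ϖ : ℝ → ℝ} {R S : ℝ → ℝ → ℝ}

lemma integrableOn_mul_of_le {g w : ℝ → ℝ} {f : ℝ → ℝ} {C : ℝ}
    (hg : ContinuousOn g (halfInterval a t₁)) (hg0 : ∀ x ∈ halfInterval a t₁, 0 ≤ g x)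
    (hf : ContinuousOn f (halfInterval a t₁))
    (hw : IntegrableOn (fun x => g x * w x) (interval a t₁))
    (hle : ∀ x ∈ halfInterval a t₁, |f x| ≤ C * w x) :
    IntegrableOn (fun x => g x * f x) (interval a t₁) := by
  refine Integrable.mono' (hw.const_mul C) (((hg.mul hf).mono
    interval_subset_halfInterval).aestronglyMeasurable (measurableSet_interval _ _)) ?_
  refine (ae_restrict_iff' (measurableSet_interval _ _)).2 (Eventually.of_forall fun x hx => ?_)
  have hx' := interval_subset_halfInterval hx
  rw [Real.norm_eq_abs, abs_mul, abs_of_nonneg (hg0 x hx')]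
  calc g x * |f x| ≤ g x * (C * w x) := mul_le_mul_of_nonneg_left (hle x hx') (hg0 x hx')
    _ = C * (g x * w x) := by ring

lemma tendsto_setIntegral_interval_zero {g : ℝ → ℝ} {t : EReal} (hat : a < t)
    (hg : IntegrableOn g (interval a t)) :
    Tendsto (fun z : ℝ => ∫ s in interval a z, g s) (atLeft a) (𝓝 0) := by
  have : (atLeft a).IsCountablyGenerated := by unfold atLeft; infer_instance
  have h1 : Tendsto (fun z : ℝ => ∫ s in interval a t, (interval a (z : EReal)).indicator g s)
      (atLeft a) (𝓝 (∫ s in interval a t, 0)) := by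
    refine tendsto_integral_filter_of_dominated_convergence (fun s => ‖g s‖)
      (Eventually.of_forall fun z => hg.1.indicator (measurableSet_interval _ _))
      (Eventually.of_forall fun z => Eventually.of_forall fun s => norm_indicator_le_norm_self g s)
      hg.norm ?_
    refine (ae_restrict_iff' (measurableSet_interval _ _)).2 (Eventually.of_forall fun s hs => ?_)
    refine tendsto_const_nhds.congr' ?_
    filter_upwards [eventually_mem_interval hs.1] with z hz
    exact (indicator_of_notMem (fun h => lt_asymm hz.2 h.2) g).symm
  rw [integral_zero] at h1
  refine h1.congr' ?_
  filter_upwards [eventually_mem_interval hat] with z hz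
  rw [setIntegral_indicator (measurableSet_interval _ _),
    inter_eq_right.2 (interval_mono hz.2.le)]

/-- The solutions `y * R μ` of `f'' = (V - E₁ - μ) f` which are square integrable at `a`, together
with the derivative `S` of `R` with respect to the spectral parameter. -/
structure Family (V : ℝ → ℝ) (a : EReal) (t₁ E₁ c θ : ℝ) (y v ϖ : ℝ → ℝ) (R S : ℝ → ℝ → ℝ) :
    Prop where
  mem : c ∈ interval a t₁
  sol : IsSol (fun x => V x - E₁) (halfInterval a t₁) y v
  pos : ∀ x ∈ halfInterval a t₁, 0 < y x
  weight : Weight a t₁ y ϖ c θ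
  cont : ∀ μ, |μ| * θ < 1 → ContinuousOn (R μ) (halfInterval a t₁)
  contS : ∀ μ, |μ| * θ < 1 → ContinuousOn (S μ) (halfInterval a t₁)
  bound : ∀ μ, |μ| * θ < 1 → ∃ C, 0 ≤ C ∧
    ∀ x ∈ halfInterval a t₁, |R μ x| ≤ C * ϖ x ∧ |S μ x| ≤ C * ϖ x
  eq : ∀ μ, |μ| * θ < 1 → ∀ x ∈ halfInterval a t₁, R μ x = 1 + μ *
    -∫ ξ in c..x, (y ξ ^ 2)⁻¹ * ∫ η in interval a ξ, y η ^ 2 * R μ η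
  expansion : ∀ μ, |μ| * θ < 1 → ∀ ε > 0, ∀ᶠ ν in 𝓝 μ, ∀ x ∈ halfInterval a t₁,
    |R ν x - R μ x - (ν - μ) * S μ x| ≤ ε * |ν - μ| * ϖ x

/-- For `y R` to have energy `E₁ + μ` one needs `(y² R')' = -μ y² R`. Integrating with zero flux `y²
R'` at `a` and `R c = 1` gives the fixed point equation to which `exists_resolvent` is applied with
`g = 1`. -/
lemma Weight.exists_family (hw : Weight a t₁ y ϖ c θ) (hθ : 0 ≤ θ) (hc : c ∈ interval a t₁)
    (hy : IsSol (fun x => V x - E₁) (halfInterval a t₁) y v)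
    (hpos : ∀ x ∈ halfInterval a t₁, 0 < y x) : ∃ R S, Family V a t₁ E₁ c θ y v ϖ R S := by
  have hyc := hy.continuousOn
  have hpc : ContinuousOn (fun x => y x ^ 2) (halfInterval a t₁) := hyc.pow 2
  have hp0 : ∀ x ∈ halfInterval a t₁, 0 ≤ y x ^ 2 := fun x _ => sq_nonneg _
  have hcJ := interval_subset_halfInterval hc
  have hint : ∀ f C, ContinuousOn f (halfInterval a t₁) →
      (∀ x ∈ halfInterval a t₁, |f x| ≤ C * ϖ x) →
      IntegrableOn (fun x => y x ^ 2 * f x) (interval a t₁) := fun f C hf hle =>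
    integrableOn_mul_of_le hpc hp0 hf hw.integrable hle
  have hq : ∀ f C, ContinuousOn f (halfInterval a t₁) →
      (∀ x ∈ halfInterval a t₁, |f x| ≤ C * ϖ x) → ContinuousOn
      (fun ξ : ℝ => (y ξ ^ 2)⁻¹ * ∫ η in interval a ξ, y η ^ 2 * f η) (halfInterval a t₁) :=
    fun f C hf hle => (hpc.inv₀ fun x hx => (pow_pos (hpos x hx) 2).ne').mul
      (continuousOn_setIntegral_interval (hint f C hf hle) (hpc.mul hf))
  have hqw := hq ϖ 1 hw.cont fun x hx => by rw [abs_of_pos (hw.pos x hx), one_mul]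
  obtain ⟨C₀, hC₀⟩ := hw.one_le
  have key := exists_resolvent (J := halfInterval a t₁) (ϖ := ϖ) (g := fun _ => 1)
    (K := fun f x => -∫ ξ in c..x, (y ξ ^ 2)⁻¹ * ∫ η in interval a ξ, y η ^ 2 * f η) (θ := θ)
    (C₀ := C₀) hθ hw.cont hw.pos ?_ ?_ ?_ continuousOn_const (fun x hx => by simpa using hC₀ x hx)
  · obtain ⟨R, S, hRS⟩ := key
    exact ⟨R, S, hc, hy, hpos, hw, fun μ h => (hRS μ h).1, fun μ h => (hRS μ h).2.1,
      fun μ h => (hRS μ h).2.2.1, fun μ h => (hRS μ h).2.2.2.1, fun μ h => (hRS μ h).2.2.2.2⟩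
  · intro f C hC hf hle
    refine ⟨(continuousOn_primitive hcJ fun x hx z hz => intervalIntegrable_of_continuousOn
      ordConnected_halfInterval (hq f C hf hle) hx hz).neg, fun x hx => ?_⟩
    rw [abs_neg]
    have h1 : |∫ ξ in c..x, (y ξ ^ 2)⁻¹ * ∫ η in interval a ξ, y η ^ 2 * f η| ≤
        |∫ ξ in c..x, C * ((y ξ ^ 2)⁻¹ * ∫ η in interval a ξ, y η ^ 2 * ϖ η)| := by
      rw [← Real.norm_eq_abs]
      refine intervalIntegral.norm_integral_le_abs_of_norm_le ?_
        ((intervalIntegrable_of_continuousOn ordConnected_halfInterval hqw hcJ hx).const_mul C)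
      refine (ae_restrict_iff' measurableSet_uIoc).2 (Eventually.of_forall fun s hs => ?_)
      have hs' : s ∈ halfInterval a t₁ :=
        ordConnected_halfInterval.uIcc_subset hcJ hx (uIoc_subset_uIcc hs)
      have hsub := interval_subset_of_le (a := a) hs'.2
      rw [Real.norm_eq_abs, abs_mul, abs_of_pos (inv_pos.2 (pow_pos (hpos s hs') 2)),
        mul_left_comm, ← integral_const_mul]
      refine mul_le_mul_of_nonneg_left ?_ (inv_nonneg.2 (sq_nonneg _))
      rw [← Real.norm_eq_abs]
      refine norm_integral_le_of_norm_le ((hw.integrable.mono_set hsub).const_mul C) ?_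
      refine (ae_restrict_iff' (measurableSet_interval _ _)).2 (Eventually.of_forall fun η hη => ?_)
      rw [Real.norm_eq_abs, abs_mul, abs_of_nonneg (sq_nonneg _), mul_left_comm]
      exact mul_le_mul_of_nonneg_left (hle η (interval_subset_halfInterval (hsub hη))) (sq_nonneg _)
    rw [intervalIntegral.integral_const_mul, abs_mul, abs_of_nonneg hC] at h1
    calc _ ≤ _ := h1
      _ ≤ C * (θ * ϖ x) := mul_le_mul_of_nonneg_left (hw.bound x hx) hC
      _ = θ * C * ϖ x := by ring
  · intro f h r C hf hh hfl hhl x hx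
    have e : ∀ s ∈ uIcc c x, (y s ^ 2)⁻¹ * ∫ η in interval a s, y η ^ 2 * (f η + r * h η) =
        ((y s ^ 2)⁻¹ * ∫ η in interval a s, y η ^ 2 * f η) +
        r * ((y s ^ 2)⁻¹ * ∫ η in interval a s, y η ^ 2 * h η) := by
      intro s hs
      have hs' : s ∈ halfInterval a t₁ := ordConnected_halfInterval.uIcc_subset hcJ hx hs
      have hsub := interval_subset_of_le (a := a) hs'.2
      have e1 : ∀ η, y η ^ 2 * (f η + r * h η) = y η ^ 2 * f η + r * (y η ^ 2 * h η) :=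
        fun η => by ring
      simp only [e1]
      rw [integral_add ((hint f C hf hfl).mono_set hsub)
        (((hint h C hh hhl).mono_set hsub).const_mul r), integral_const_mul]
      ring
    simp only
    rw [intervalIntegral.integral_congr e, intervalIntegral.integral_add
      (intervalIntegrable_of_continuousOn ordConnected_halfInterval (hq f C hf hfl) hcJ hx)
      ((intervalIntegrable_of_continuousOn ordConnected_halfInterval
        (hq h C hh hhl) hcJ hx).const_mul r), intervalIntegral.integral_const_mul]
    ring
  · intro f h hfh x hx
    simp only [neg_inj]
    refine intervalIntegral.integral_congr fun s hs => ?_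
    have hs' : s ∈ halfInterval a t₁ := ordConnected_halfInterval.uIcc_subset hcJ hx hs
    congr 1
    refine setIntegral_congr_fun (measurableSet_interval _ _) fun η hη => ?_
    rw [hfh (interval_subset_halfInterval (interval_subset_of_le hs'.2 hη))]

namespace Family

lemma mem_half (h : Family V a t₁ E₁ c θ y v ϖ R S) : c ∈ halfInterval a t₁ :=
  interval_subset_halfInterval h.mem

lemma continuousOn_sq (h : Family V a t₁ E₁ c θ y v ϖ R S) :
    ContinuousOn (fun x => y x ^ 2) (halfInterval a t₁) := h.sol.continuousOn.pow 2

lemma integrableOn (h : Family V a t₁ E₁ c θ y v ϖ R S) {μ : ℝ} (hμ : |μ| * θ < 1) :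
    IntegrableOn (fun x => y x ^ 2 * R μ x) (interval a t₁) := by
  obtain ⟨C, -, hC⟩ := h.bound μ hμ
  exact integrableOn_mul_of_le h.continuousOn_sq (fun x _ => sq_nonneg _) (h.cont μ hμ)
    h.weight.integrable fun x hx => (hC x hx).1

lemma continuousOn_integrand (h : Family V a t₁ E₁ c θ y v ϖ R S) {μ : ℝ} (hμ : |μ| * θ < 1) :
    ContinuousOn (fun x => y x ^ 2 * R μ x) (halfInterval a t₁) :=
  h.continuousOn_sq.mul (h.cont μ hμ)

lemma continuousOn_inv_mul (h : Family V a t₁ E₁ c θ y v ϖ R S) {g : ℝ → ℝ}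
    (hg : IntegrableOn g (interval a t₁)) (hgc : ContinuousOn g (halfInterval a t₁)) :
    ContinuousOn (fun x : ℝ => (y x ^ 2)⁻¹ * ∫ η in interval a x, g η) (halfInterval a t₁) :=
  (h.continuousOn_sq.inv₀ fun x hx => (pow_pos (h.pos x hx) 2).ne').mul
    (continuousOn_setIntegral_interval hg hgc)

/-- The flux `y² (R μ)'`. -/
noncomputable def flux (a : EReal) (y : ℝ → ℝ) (R : ℝ → ℝ → ℝ) (μ x : ℝ) : ℝ :=
  -μ * ∫ η in interval a x, y η ^ 2 * R μ η

lemma hasDerivWithinAt (h : Family V a t₁ E₁ c θ y v ϖ R S) {μ : ℝ} (hμ : |μ| * θ < 1) {x : ℝ}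
    (hx : x ∈ halfInterval a t₁) :
    HasDerivWithinAt (R μ) ((y x ^ 2)⁻¹ * flux a y R μ x) (halfInterval a t₁) x := by
  have h1 := hasDerivWithinAt_primitive ordConnected_halfInterval h.mem_half hx
    (h.continuousOn_inv_mul (h.integrableOn hμ) (h.continuousOn_integrand hμ))
  exact (((h1.neg.const_mul μ).const_add 1).congr_deriv (by unfold flux; ring)).congr
    (fun z hz => h.eq μ hμ z hz) (h.eq μ hμ x hx)

lemma flux_hasDerivWithinAt (h : Family V a t₁ E₁ c θ y v ϖ R S) {μ : ℝ} (hμ : |μ| * θ < 1)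
    {x : ℝ} (hx : x ∈ halfInterval a t₁) :
    HasDerivWithinAt (flux a y R μ) (-μ * (y x ^ 2 * R μ x)) (halfInterval a t₁) x :=
  (hasDerivWithinAt_setIntegral_interval (h.integrableOn hμ)
    (h.continuousOn_integrand hμ) hx).const_mul (-μ)

/-- To the left of `c` the equation reads `R = 1 + μ ∫_x^c y⁻² ∫_a^ξ y² R`, so `R ≥ 0` there would
give `R ≥ 1`. Nonnegativity follows by iterating `step`. In consequence the zeros of `R μ` lie to
the right of `c`, where compactness arguments apply. -/
lemma one_le (h : Family V a t₁ E₁ c θ y v ϖ R S) {μ : ℝ} (h0 : 0 ≤ μ) (hμ : |μ| * θ < 1) {x : ℝ}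
    (hx : a < (x : EReal)) (hxc : x ≤ c) : 1 ≤ R μ x := by
  have hct : c < t₁ := EReal.coe_lt_coe_iff.1 h.mem.2
  have hJ : ∀ s : ℝ, a < (s : EReal) → s ≤ c → s ∈ halfInterval a t₁ :=
    fun s h1 h2 => ⟨h1, h2.trans hct.le⟩
  have hp0 : ∀ x ∈ halfInterval a t₁, 0 < (y x ^ 2)⁻¹ := fun x hx =>
    inv_pos.2 (pow_pos (h.pos x hx) 2)
  -- A lower bound `-D ϖ` improves to `-μ θ D ϖ`, and `μ θ < 1`; iteration drives `D` to zero.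
  have step : ∀ D, 0 ≤ D → (∀ s : ℝ, a < (s : EReal) → s ≤ c → -(D * ϖ s) ≤ R μ s) →
      ∀ s : ℝ, a < (s : EReal) → s ≤ c → 1 - μ * (θ * D * ϖ s) ≤ R μ s := by
    intro D hD hle s hs hsc
    have hsJ := hJ s hs hsc
    have hcw : ContinuousOn (fun x => y x ^ 2 * ϖ x) (halfInterval a t₁) :=
      h.continuousOn_sq.mul h.weight.cont
    have h1 : ∫ ξ in s..c, -D * ((y ξ ^ 2)⁻¹ * ∫ η in interval a ξ, y η ^ 2 * ϖ η) ≤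
        ∫ ξ in s..c, (y ξ ^ 2)⁻¹ * ∫ η in interval a ξ, y η ^ 2 * R μ η := by
      refine intervalIntegral.integral_mono_on hsc ?_ ?_ fun ξ hξ => ?_
      · exact (intervalIntegrable_of_continuousOn ordConnected_halfInterval
          (h.continuousOn_inv_mul h.weight.integrable hcw) hsJ h.mem_half).const_mul _
      · exact intervalIntegrable_of_continuousOn ordConnected_halfInterval
          (h.continuousOn_inv_mul (h.integrableOn hμ) (h.continuousOn_integrand hμ)) hsJ h.mem_half
      · have hξJ := ordConnected_halfInterval.out hsJ h.mem_half hξ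
        have hsub := interval_subset_of_le (a := a) hξJ.2
        rw [mul_left_comm, ← integral_const_mul]
        refine mul_le_mul_of_nonneg_left ?_ (hp0 ξ hξJ).le
        refine setIntegral_mono_on ((h.weight.integrable.mono_set hsub).const_mul _)
          ((h.integrableOn hμ).mono_set hsub) (measurableSet_interval _ _) fun η hη => ?_
        have := hle η hη.1 ((EReal.coe_lt_coe_iff.1 hη.2).le.trans hξ.2)
        have := mul_le_mul_of_nonneg_left this (sq_nonneg (y η))
        linarith
    have h2 := h.weight.bound s hsJ
    rw [intervalIntegral.integral_symm, abs_neg] at h2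
    rw [intervalIntegral.integral_const_mul] at h1
    have h3 := le_abs_self (∫ ξ in s..c, (y ξ ^ 2)⁻¹ * ∫ η in interval a ξ, y η ^ 2 * ϖ η)
    rw [h.eq μ hμ s hsJ, intervalIntegral.integral_symm, neg_neg]
    have h4 : -(θ * D * ϖ s) ≤ ∫ ξ in s..c, (y ξ ^ 2)⁻¹ * ∫ η in interval a ξ, y η ^ 2 * R μ η := by
      have := mul_le_mul_of_nonneg_left (h3.trans h2) hD
      linarith
    have := mul_le_mul_of_nonneg_left h4 h0
    linarith
  rw [abs_of_nonneg h0] at hμ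
  have hθ : 0 ≤ θ := by
    have h1 := (abs_nonneg _).trans (h.weight.bound c h.mem_half)
    exact nonneg_of_mul_nonneg_left h1 (h.weight.pos c h.mem_half)
  obtain ⟨C, hC0, hC⟩ := h.bound μ (by rwa [abs_of_nonneg h0])
  have hn : ∀ n : ℕ, ∀ s : ℝ, a < (s : EReal) → s ≤ c → -((C * (μ * θ) ^ n) * ϖ s) ≤ R μ s := by
    intro n
    induction n with
    | zero =>
      intro s hs hsc
      rw [pow_zero, mul_one]
      exact neg_le_of_abs_le (hC s (hJ s hs hsc)).1
    | succ n ih =>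
      intro s hs hsc
      have := step _ (mul_nonneg hC0 (pow_nonneg (mul_nonneg h0 hθ) n)) ih s hs hsc
      refine le_trans ?_ this
      rw [pow_succ]
      linarith
  have hnn : ∀ s : ℝ, a < (s : EReal) → s ≤ c → -((0 : ℝ) * ϖ s) ≤ R μ s := by
    intro s hs hsc
    have hl : Tendsto (fun n : ℕ => -((C * (μ * θ) ^ n) * ϖ s)) atTop (𝓝 (-((C * 0) * ϖ s))) :=
      (((tendsto_pow_atTop_nhds_zero_of_lt_one (mul_nonneg h0 hθ) hμ).const_mul C).mul_const _).neg
    rw [mul_zero] at hl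
    exact le_of_tendsto' hl fun n => hn n s hs hsc
  have := step 0 le_rfl hnn x hx hxc
  simpa using this

lemma isSol (h : Family V a t₁ E₁ c θ y v ϖ R S) {μ : ℝ} (hμ : |μ| * θ < 1) :
    IsSol (fun x => V x - (E₁ + μ)) (halfInterval a t₁) (fun x => y x * R μ x)
      (fun x => v x * R μ x + (y x)⁻¹ * flux a y R μ x) where
  cont := (h.sol.cont.mul (h.cont μ hμ)).add
    ((h.sol.continuousOn.inv₀ fun x hx => (h.pos x hx).ne').mul
      fun x hx => (h.flux_hasDerivWithinAt hμ hx).continuousWithinAt)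
  deriv₁ x hx := ((h.sol.deriv₁ x hx).mul (h.hasDerivWithinAt hμ hx)).congr_deriv (by
    have := (h.pos x hx).ne'
    field_simp)
  deriv₂ x hx := by
    have hxJ := interior_subset hx
    have hn := mem_interior_iff_mem_nhds.1 hx
    have := (h.pos x hxJ).ne'
    refine (((h.sol.deriv₂ x hx).mul ((h.hasDerivWithinAt hμ hxJ).hasDerivAt hn)).add
      (((h.sol.hasDerivAt hx).inv this).mul
        ((h.flux_hasDerivWithinAt hμ hxJ).hasDerivAt hn))).congr_deriv ?_
    simp only [Pi.inv_apply]
    field_simp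
    ring

lemma abs_integral_le (h : Family V a t₁ E₁ c θ y v ϖ R S) {μ C : ℝ}
    (hC : ∀ x ∈ halfInterval a t₁, |R μ x| ≤ C * ϖ x) {x : ℝ} (hx : x ∈ halfInterval a t₁) :
    |∫ η in interval a x, y η ^ 2 * R μ η| ≤ C * ∫ η in interval a x, y η ^ 2 * ϖ η := by
  have hsub := interval_subset_of_le (a := a) hx.2
  rw [← integral_const_mul]
  rw [← Real.norm_eq_abs]
  refine norm_integral_le_of_norm_le ((h.weight.integrable.mono_set hsub).const_mul C) ?_
  refine (ae_restrict_iff' (measurableSet_interval _ _)).2 (Eventually.of_forall fun η hη => ?_)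
  rw [Real.norm_eq_abs, abs_mul, abs_of_nonneg (sq_nonneg _), mul_left_comm]
  exact mul_le_mul_of_nonneg_left (hC η (interval_subset_halfInterval (hsub hη))) (sq_nonneg _)

lemma integrableOn_mul (h : Family V a t₁ E₁ c θ y v ϖ R S) {f g : ℝ → ℝ} {C D : ℝ}
    (hf : ContinuousOn f (halfInterval a t₁)) (hg : ContinuousOn g (halfInterval a t₁))
    (hC : ∀ x ∈ halfInterval a t₁, |f x| ≤ C * ϖ x)
    (hD : ∀ x ∈ halfInterval a t₁, |g x| ≤ D * ϖ x) :
    IntegrableOn (fun x => y x ^ 2 * (f x * g x)) (interval a t₁) := by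
  refine integrableOn_mul_of_le (C := C * D) h.continuousOn_sq (fun x _ => sq_nonneg _)
    (hf.mul hg) h.weight.integrable_sq fun x hx => ?_
  rw [abs_mul]
  refine (mul_le_mul (hC x hx) (hD x hx) (abs_nonneg _)
    ((abs_nonneg _).trans (hC x hx))).trans_eq ?_
  ring

/-- Both sides have the same derivative, and their difference tends to zero at `a`, since each
product of `R` and a flux is bounded by a multiple of `ϖ ∫_a^x y² ϖ`. This identity carries the
derivative of `λ`. -/
lemma wronskian (h : Family V a t₁ E₁ c θ y v ϖ R S) {μ ν : ℝ} (hμ : |μ| * θ < 1)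
    (hν : |ν| * θ < 1) {x : ℝ} (hx : x ∈ halfInterval a t₁) :
    R μ x * flux a y R ν x - flux a y R μ x * R ν x =
      (μ - ν) * ∫ η in interval a x, y η ^ 2 * (R μ η * R ν η) := by
  obtain ⟨C, hC0, hC⟩ := h.bound μ hμ
  obtain ⟨D, hD0, hD⟩ := h.bound ν hν
  have hi := h.integrableOn_mul (h.cont μ hμ) (h.cont ν hν) (fun x hx => (hC x hx).1)
    fun x hx => (hD x hx).1
  have hic : ContinuousOn (fun x => y x ^ 2 * (R μ x * R ν x)) (halfInterval a t₁) :=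
    h.continuousOn_sq.mul ((h.cont μ hμ).mul (h.cont ν hν))
  have hat : a < (t₁ : EReal) := h.mem.1.trans h.mem.2
  have := atLeft_neBot hat
  set F : ℝ → ℝ := fun x => R μ x * flux a y R ν x - flux a y R μ x * R ν x -
      (μ - ν) * ∫ η in interval a x, y η ^ 2 * (R μ η * R ν η) with hF
  have hFd : ∀ x ∈ halfInterval a t₁, HasDerivWithinAt F 0 (halfInterval a t₁) x := by
    intro x hx
    refine ((((h.hasDerivWithinAt hμ hx).mul (h.flux_hasDerivWithinAt hν hx)).sub
      ((h.flux_hasDerivWithinAt hμ hx).mul (h.hasDerivWithinAt hν hx))).sub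
      ((hasDerivWithinAt_setIntegral_interval hi hic hx).const_mul (μ - ν))).congr_deriv ?_
    ring
  have hFc : ∀ z ∈ halfInterval a t₁, F z = F x := fun z hz =>
    eq_of_deriv_eq_zero ordConnected_halfInterval (fun x hx => (hFd x hx).continuousWithinAt)
      (fun x hx => (hFd x (interior_subset hx)).hasDerivAt (mem_interior_iff_mem_nhds.1 hx)) hz hx
  have hlim : Tendsto F (atLeft a) (𝓝 0) := by
    have h1 : Tendsto (fun z => (|ν| * C * D + |μ| * C * D) *
        (ϖ z * ∫ η in interval a z, y η ^ 2 * ϖ η)) (atLeft a) (𝓝 0) := by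
      simpa using h.weight.tendsto_int.const_mul (|ν| * C * D + |μ| * C * D)
    have h2 : Tendsto (fun z : ℝ => R μ z * flux a y R ν z - flux a y R μ z * R ν z) (atLeft a)
        (𝓝 0) := by
      refine squeeze_zero_norm' ?_ h1
      filter_upwards [eventually_mem_interval hat] with z hz
      have hz' := interval_subset_halfInterval hz
      have e1 := (hC z hz').1
      have e2 := (hD z hz').1
      have e3 := h.abs_integral_le (fun x hx => (hC x hx).1) hz'
      have e4 := h.abs_integral_le (fun x hx => (hD x hx).1) hz'
      have e5 : 0 ≤ C * ϖ z := (abs_nonneg _).trans e1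
      have e6 : 0 ≤ D * ϖ z := (abs_nonneg _).trans e2
      rw [Real.norm_eq_abs]
      refine (abs_sub _ _).trans ?_
      unfold flux
      rw [abs_mul, abs_mul, abs_mul, abs_mul, abs_neg, abs_neg]
      have e7 := mul_le_mul e1 (mul_le_mul_of_nonneg_left e4 (abs_nonneg ν)) (by positivity) e5
      have e8 := mul_le_mul (mul_le_mul_of_nonneg_left e3 (abs_nonneg μ)) e2 (abs_nonneg _)
        (mul_nonneg (abs_nonneg _) ((abs_nonneg _).trans e3))
      linarith
    have h3 : Tendsto (fun z : ℝ => ∫ η in interval a z, y η ^ 2 * (R μ η * R ν η)) (atLeft a)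
        (𝓝 0) := by
      exact tendsto_setIntegral_interval_zero hat hi
    have := h2.sub (h3.const_mul (μ - ν))
    simpa [hF] using this
  have h5 : Tendsto F (atLeft a) (𝓝 (F x)) := by
    refine tendsto_const_nhds.congr' ?_
    filter_upwards [eventually_mem_interval hat] with z hz
    exact (hFc z (interval_subset_halfInterval hz)).symm
  have := tendsto_nhds_unique h5 hlim
  simp only [hF] at this
  linarith

end Family

end GroundState

/-! ### Characterization of `λ(t)` by the first zero of `R μ`. -/

namespace GroundState

variable {V : ℝ → ℝ} {a b : EReal} {t₁ E₁ c θ : ℝ} {y v ϖ : ℝ → ℝ} {R S : ℝ → ℝ → ℝ}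

lemma nhdsWithin_interval_neBot {t : ℝ} (hat : a < (t : EReal)) : (𝓝[interval a t] t).NeBot := by
  obtain ⟨c, hc⟩ := exists_real_btw hat
  have hct := EReal.coe_lt_coe_iff.1 hc.2
  rw [← mem_closure_iff_nhdsWithin_neBot]
  refine closure_mono (fun x hx => ?_) (by rw [closure_Ioo hct.ne]; exact right_mem_Icc.2 hct.le :
    t ∈ closure (Ioo c t))
  exact ⟨hc.1.trans (EReal.coe_lt_coe_iff.2 hx.1), EReal.coe_lt_coe_iff.2 hx.2⟩

lemma setIntegral_interval_pos {g : ℝ → ℝ} {t : ℝ} (hg : IntegrableOn g (interval a t₁))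
    (hc : ContinuousOn g (halfInterval a t₁)) (ht : t ∈ halfInterval a t₁)
    (hpos : ∀ x ∈ interval a t, 0 < g x) : 0 < ∫ s in interval a t, g s := by
  obtain ⟨x, hx⟩ := exists_real_btw ht.1
  have hxt := EReal.coe_lt_coe_iff.1 hx.2
  have hxJ : x ∈ halfInterval a t₁ := ⟨hx.1, hxt.le.trans ht.2⟩
  rw [setIntegral_interval_add hg hxJ ht]
  refine add_pos_of_nonneg_of_pos (setIntegral_nonneg (measurableSet_interval _ _) fun s hs =>
    (hpos s (interval_subset_of_le hxt.le hs)).le) ?_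
  exact intervalIntegral.intervalIntegral_pos_of_pos_on
    (intervalIntegrable_of_continuousOn ordConnected_halfInterval hc hxJ ht)
    (fun s hs => hpos s ⟨hx.1.trans (EReal.coe_lt_coe_iff.2 hs.1), EReal.coe_lt_coe_iff.2 hs.2⟩) hxt

/-- Choosing `M` beforehand makes the family cover any prescribed range `0 ≤ μ ≤ M` of energies
above `E₁`. -/
lemma exists_family (hab : a < b) (hV : ContinuousOn V (interval a b))
    (hbot : a = ⊥ → Tendsto V atBot atTop)
    (hVc : ConvexOn ℝ (interval a b) V ∨ ConcaveOn ℝ (interval a b) V)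
    (ht₁ : t₁ ∈ regularDomain V a b) (hE : (E₁ : EReal) < groundEnergy V a t₁) (M : ℝ) :
    ∃ c θ y v ϖ R S, Family V a t₁ E₁ c θ y v ϖ R S ∧ M * θ < 1 := by
  have htb := le_of_mem_regularDomain ht₁
  obtain ⟨y, v, hy, hpos, hp⟩ := exists_principal (E := E₁) hV ht₁.1 htb fun s hs =>
    hE.trans_le (groundEnergy_anti_of_le hV hs.2.le htb)
  have hyJ := hy.mono (halfInterval_subset_regularDomain ht₁)
  have ht₁J : t₁ ∈ halfInterval a t₁ := ⟨ht₁.1, le_rfl⟩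
  have hne := nhdsWithin_interval_neBot ht₁.1
  have h0 : 0 ≤ y t₁ := ge_of_tendsto ((hyJ.continuousOn t₁ ht₁J).mono interval_subset_halfInterval)
    (eventually_mem_nhdsWithin.mono fun z hz => (hpos z hz).le)
  obtain ⟨d, hd⟩ := exists_real_btw ht₁.1
  -- If the principal solution vanished at `t₁`, it would be a ground state and force `λ(t₁) ≤ E₁`.
  -- Positivity at the closed end keeps `y⁻²` bounded there.
  have hyt : 0 < y t₁ := h0.lt_of_ne fun h =>
    absurd (groundEnergy_le_of_principal hV ht₁ hyJ hpos h.symm hd (hp d hd)) (not_le.2 hE)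
  have hposJ : ∀ x ∈ halfInterval a t₁, 0 < y x := fun x hx => by
    rcases hx.2.eq_or_lt with h | h
    · rwa [h]
    · exact hpos x ⟨hx.1, EReal.coe_lt_coe_iff.2 h⟩
  have hsub := interval_subset_of_mem_regularDomain ht₁
  obtain ⟨c, hc, κ, C, hdec, hM⟩ := exists_decay hab ht₁.1 hbot hVc
    (fun x hx => hy.hasDerivAt₁ (hsub hx)) (fun x hx => hy.hasDerivAt₂ (hsub hx)) hpos hp M
  obtain ⟨ϖ, hw⟩ := hdec.exists_weight hc hyJ.continuousOn hposJ
  obtain ⟨R, S, hF⟩ := hw.exists_family (by positivity) hc hyJ hposJ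
  exact ⟨c, _, y, v, ϖ, R, S, hF, hM⟩

namespace Family

lemma theta_nonneg (h : Family V a t₁ E₁ c θ y v ϖ R S) : 0 ≤ θ :=
  nonneg_of_mul_nonneg_left ((abs_nonneg _).trans (h.weight.bound c h.mem_half))
    (h.weight.pos c h.mem_half)

lemma abs_mul_lt (h : Family V a t₁ E₁ c θ y v ϖ R S) {μ ν : ℝ} (h0 : 0 ≤ ν) (hν : ν ≤ μ)
    (hμ : μ * θ < 1) : |ν| * θ < 1 := by
  rw [abs_of_nonneg h0]
  exact (mul_le_mul_of_nonneg_right hν h.theta_nonneg).trans_lt hμ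

/-- `R μ` is at most a multiple of the weight, and `y ϖ` is still principal; this is why the weight
was required to grow slowly. -/
lemma isPrincipal (h : Family V a t₁ E₁ c θ y v ϖ R S) {μ : ℝ} (h0 : 0 ≤ μ) (hμ : |μ| * θ < 1) :
    IsPrincipal a (fun x => y x * R μ x) c := by
  obtain ⟨C, hC0, hC⟩ := h.bound μ hμ
  refine h.weight.principal.of_le h.mem.1 (B := C + 1) (by linarith) fun x hx hxc => ?_
  have hxI : x ∈ interval a t₁ := ⟨hx, lt_of_le_of_lt (EReal.coe_le_coe_iff.2 hxc) h.mem.2⟩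
  have hxJ := interval_subset_halfInterval hxI
  have hn : halfInterval a t₁ ∈ 𝓝 x :=
    mem_of_superset ((isOpen_interval a t₁).mem_nhds hxI) interval_subset_halfInterval
  have hyc := h.sol.continuousOn.continuousAt hn
  have hy0 := h.pos x hxJ
  have hw0 := h.weight.pos x hxJ
  have hR := h.one_le h0 hμ hx hxc
  refine ⟨hyc.mul (h.weight.cont.continuousAt hn), hyc.mul ((h.cont μ hμ).continuousAt hn),
    (mul_pos hy0 hw0).ne', (mul_pos hy0 (by linarith)).ne', ?_⟩
  rw [abs_mul, abs_mul, abs_of_pos hw0, mul_left_comm]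
  refine mul_le_mul_of_nonneg_left ((hC x hxJ).1.trans ?_) (abs_nonneg _)
  nlinarith

lemma le_groundEnergy (h : Family V a t₁ E₁ c θ y v ϖ R S) (hV : ContinuousOn V (interval a b))
    (ht₁ : t₁ ∈ regularDomain V a b) {μ t : ℝ} (hμ : |μ| * θ < 1) (ht : t ∈ halfInterval a t₁)
    (hpos : ∀ x ∈ interval a t, 0 < R μ x) : ((E₁ + μ : ℝ) : EReal) ≤ groundEnergy V a t := by
  have hsub : interval a t ⊆ interval a t₁ := interval_subset_of_le ht.2
  have hsol := h.isSol hμ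
  have hint := interior_halfInterval (a := a) (t := t₁)
  refine le_groundEnergy_of_pos (y := fun x => y x * R μ x) ht.1
    (hV.mono (hsub.trans (interval_subset_of_mem_regularDomain ht₁)))
    (fun x hx => hsol.hasDerivAt (by rw [hint]; exact hsub hx))
    (fun x hx => hsol.deriv₂ x (by rw [hint]; exact hsub hx)) fun x hx =>
      mul_pos (h.pos x (interval_subset_halfInterval (hsub hx))) (hpos x hx)

lemma groundEnergy_le (h : Family V a t₁ E₁ c θ y v ϖ R S) (hV : ContinuousOn V (interval a b))
    (ht₁ : t₁ ∈ regularDomain V a b) {μ t : ℝ} (h0 : 0 ≤ μ) (hμ : |μ| * θ < 1)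
    (ht : t ∈ halfInterval a t₁) (hpos : ∀ x ∈ interval a t, 0 < R μ x) (hz : R μ t = 0) :
    groundEnergy V a t ≤ ((E₁ + μ : ℝ) : EReal) := by
  have hct : c < t := by
    by_contra hcon
    have := h.one_le h0 hμ ht.1 (not_lt.1 hcon)
    linarith
  exact groundEnergy_le_of_principal hV (halfInterval_subset_regularDomain ht₁ ht)
    ((h.isSol hμ).mono (halfInterval_subset ht.2))
    (fun x hx => mul_pos (h.pos x (interval_subset_halfInterval (interval_subset_of_le ht.2 hx)))
      (hpos x hx)) (by simp only [hz, mul_zero]) ⟨h.mem.1, EReal.coe_lt_coe_iff.2 hct⟩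
    (h.isPrincipal h0 hμ)

lemma exists_zero (h : Family V a t₁ E₁ c θ y v ϖ R S) {μ x : ℝ} (h0 : 0 ≤ μ) (hμ : |μ| * θ < 1)
    (hx : x ∈ halfInterval a t₁) (hR : R μ x ≤ 0) :
    ∃ z ∈ halfInterval a t₁, z ≤ x ∧ R μ z = 0 ∧ ∀ s ∈ interval a z, 0 < R μ s := by
  have hcx : c < x := by
    by_contra hcon
    have := h.one_le h0 hμ hx.1 (not_lt.1 hcon)
    linarith
  have hI : Icc c x ⊆ halfInterval a t₁ := ordConnected_halfInterval.out h.mem_half hx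
  obtain ⟨z, hz, hz0, hzp⟩ := exists_first_zero hcx.le ((h.cont μ hμ).mono hI)
    (by linarith [h.one_le h0 hμ h.mem.1 le_rfl]) hR
  refine ⟨z, hI ⟨hz.1.le, hz.2⟩, hz.2, hz0, fun s hs => ?_⟩
  rcases le_total s c with hsc | hsc
  · linarith [h.one_le h0 hμ hs.1 hsc]
  · exact hzp s ⟨hsc, EReal.coe_lt_coe_iff.1 hs.2⟩

lemma groundEnergy_le_of_nonpos (h : Family V a t₁ E₁ c θ y v ϖ R S)
    (hV : ContinuousOn V (interval a b)) (ht₁ : t₁ ∈ regularDomain V a b) {μ x : ℝ} (h0 : 0 ≤ μ)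
    (hμ : |μ| * θ < 1) (hx : x ∈ halfInterval a t₁) (hR : R μ x ≤ 0) :
    groundEnergy V a x ≤ ((E₁ + μ : ℝ) : EReal) := by
  obtain ⟨z, hz, hzx, hz0, hp⟩ := h.exists_zero h0 hμ hx hR
  exact (groundEnergy_anti_of_le hV (EReal.coe_le_coe_iff.2 hzx) (le_of_mem_regularDomain
    (halfInterval_subset_regularDomain ht₁ hx))).trans (h.groundEnergy_le hV ht₁ h0 hμ hz hp hz0)

lemma eventually_abs_sub_le (h : Family V a t₁ E₁ c θ y v ϖ R S) {μ : ℝ} (hμ : |μ| * θ < 1) :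
    ∃ K, 0 < K ∧ ∀ᶠ ν in 𝓝 μ, ∀ x ∈ halfInterval a t₁, |R ν x - R μ x| ≤ K * |ν - μ| * ϖ x := by
  obtain ⟨C, hC0, hC⟩ := h.bound μ hμ
  refine ⟨C + 1, by linarith, (h.expansion μ hμ 1 one_pos).mono fun ν hν x hx => ?_⟩
  have h1 := hν x hx
  have h2 : |(ν - μ) * S μ x| ≤ |ν - μ| * (C * ϖ x) := by
    rw [abs_mul]; exact mul_le_mul_of_nonneg_left (hC x hx).2 (abs_nonneg _)
  have h3 := abs_add_le (R ν x - R μ x - (ν - μ) * S μ x) ((ν - μ) * S μ x)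
  rw [sub_add_cancel] at h3
  linarith

lemma eventually_abs_sub_lt (h : Family V a t₁ E₁ c θ y v ϖ R S) {μ : ℝ} (hμ : |μ| * θ < 1)
    {x : ℝ} (hx : x ∈ halfInterval a t₁) {δ : ℝ} (hδ : 0 < δ) :
    ∀ᶠ ν in 𝓝 μ, ∀ z ∈ Icc c x, |R ν z - R μ z| < δ := by
  rcases lt_or_ge x c with hcx | hcx
  · exact Eventually.of_forall fun ν z hz => absurd (hz.1.trans hz.2) (not_le.2 hcx)
  have hI : Icc c x ⊆ halfInterval a t₁ := ordConnected_halfInterval.out h.mem_half hx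
  obtain ⟨B, hB⟩ := isCompact_Icc.exists_bound_of_continuousOn (h.weight.cont.mono hI)
  obtain ⟨K, hK0, hK⟩ := h.eventually_abs_sub_le hμ
  have hlim : Tendsto (fun ν => K * |ν - μ| * B) (𝓝 μ) (𝓝 0) := by
    have : Continuous fun ν => K * |ν - μ| * B := by fun_prop
    simpa using this.tendsto μ
  filter_upwards [hK, hlim.eventually (gt_mem_nhds hδ)] with ν h1 h2 z hz
  refine (h1 z (hI hz)).trans_lt (lt_of_le_of_lt ?_ h2)
  exact mul_le_mul_of_nonneg_left ((le_abs_self _).trans (hB z hz)) (by positivity)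

/-- The flux at `t` is `-μ` times the integral of a positive function. At a first zero, `R μ`
therefore crosses with negative slope. -/
lemma flux_neg (h : Family V a t₁ E₁ c θ y v ϖ R S) {μ t : ℝ} (h0 : 0 < μ) (hμ : |μ| * θ < 1)
    (ht : t ∈ halfInterval a t₁) (hpos : ∀ x ∈ interval a t, 0 < R μ x) : flux a y R μ t < 0 := by
  have := setIntegral_interval_pos (h.integrableOn hμ) (h.continuousOn_integrand hμ) ht
    fun x hx => mul_pos (pow_pos (h.pos x (interval_subset_halfInterval
      (interval_subset_of_le ht.2 hx))) 2) (hpos x hx)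
  exact mul_neg_of_neg_of_pos (by linarith) this

/-- The solution of energy `λ(t)` is positive on `(a, t)` and vanishes at `t`. -/
lemma ground_state (h : Family V a t₁ E₁ c θ y v ϖ R S) (hV : ContinuousOn V (interval a b))
    (ht₁ : t₁ ∈ regularDomain V a b) {μ t : ℝ} (h0 : 0 < μ) (hμ : μ * θ < 1)
    (ht : t ∈ halfInterval a t₁) (hE : groundEnergy V a t = ((E₁ + μ : ℝ) : EReal)) :
    R μ t = 0 ∧ ∀ x ∈ interval a t, 0 < R μ x := by
  have hμ' : |μ| * θ < 1 := h.abs_mul_lt h0.le le_rfl hμ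
  have htT := halfInterval_subset_regularDomain ht₁ ht
  have hJ : ∀ x ∈ interval a t, x ∈ halfInterval a t₁ := fun x hx =>
    interval_subset_halfInterval (interval_subset_of_le ht.2 hx)
  -- A zero `z < t` would be crossed, so `R μ x₁ < 0` for some `x₁` in `(z, t)`. This persists for
  -- some `ν < μ`, whence `λ(t) ≤ λ(x₁) ≤ E₁ + ν < E₁ + μ`.
  have hA : ∀ x ∈ interval a t, 0 < R μ x := by
    intro x hx
    by_contra hcon
    obtain ⟨z, hz, hzx, hz0, hp⟩ := h.exists_zero h0.le hμ' (hJ x hx) (not_lt.1 hcon)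
    have hzt : z < t := hzx.trans_lt (EReal.coe_lt_coe_iff.1 hx.2)
    have hzI : z ∈ interval a t₁ := ⟨hz.1, EReal.coe_lt_coe_iff.2 (hzt.trans_le ht.2)⟩
    have hn : halfInterval a t₁ ∈ 𝓝 z :=
      mem_of_superset ((isOpen_interval a t₁).mem_nhds hzI) interval_subset_halfInterval
    have hd := ((h.hasDerivWithinAt hμ' hz).hasDerivAt hn).hasDerivWithinAt (s := Ioi z)
    have hneg : (y z ^ 2)⁻¹ * flux a y R μ z < 0 :=
      mul_neg_of_pos_of_neg (inv_pos.2 (pow_pos (h.pos z hz) 2)) (h.flux_neg h0 hμ' hz hp)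
    have hs := ((hasDerivWithinAt_iff_tendsto_slope' (by simp : z ∉ Ioi z)).1 hd).eventually
      (gt_mem_nhds hneg)
    obtain ⟨x₁, hx₁, hx₁I⟩ := (hs.and (Ioo_mem_nhdsGT hzt)).exists
    rw [slope_def_field, hz0, sub_zero, div_lt_iff₀ (sub_pos.2 hx₁I.1), zero_mul] at hx₁
    have hx₁t : x₁ ∈ interval a t :=
      ⟨hz.1.trans (EReal.coe_lt_coe_iff.2 hx₁I.1), EReal.coe_lt_coe_iff.2 hx₁I.2⟩
    have hcx₁ : c < x₁ := by
      by_contra hcon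
      have := h.one_le h0.le hμ' hx₁t.1 (not_lt.1 hcon)
      linarith
    have h1 := (h.eventually_abs_sub_lt hμ' (hJ x₁ hx₁t) (neg_pos.2 hx₁)).filter_mono
      (nhdsWithin_le_nhds (s := Iio μ))
    obtain ⟨ν, hν, hνI⟩ := (h1.and (Ioo_mem_nhdsLT h0)).exists
    have h2 := (abs_lt.1 (hν x₁ ⟨hcx₁.le, le_rfl⟩)).2
    have h3 := h.groundEnergy_le_of_nonpos hV ht₁ hνI.1.le (h.abs_mul_lt hνI.1.le hνI.2.le hμ)
      (hJ x₁ hx₁t) (by linarith)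
    have h4 := groundEnergy_anti_of_le hV hx₁t.2.le (le_of_mem_regularDomain htT)
    rw [hE] at h4
    have := EReal.coe_le_coe_iff.1 (h4.trans h3)
    linarith [hνI.2]
  refine ⟨le_antisymm ?_ ?_, hA⟩
  -- If `R μ t > 0`, then `R μ` has a positive minimum on `[c, t]`, so `R ν` stays positive on `(a,
  -- t)` for some `ν > μ` and `λ(t) ≥ E₁ + ν`.
  · by_contra hcon
    rw [not_le] at hcon
    have hJt : ∀ x : ℝ, a < (x : EReal) → x ≤ t → x ∈ halfInterval a t₁ :=
      fun x h1 h2 => ⟨h1, h2.trans ht.2⟩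
    have hposR : ∀ x ∈ Icc c t, 0 < R μ x := fun x hx => by
      rcases hx.2.eq_or_lt with h1 | h1
      · rwa [h1]
      · exact hA x ⟨h.mem.1.trans_le (EReal.coe_le_coe_iff.2 hx.1), EReal.coe_lt_coe_iff.2 h1⟩
    obtain ⟨δ, hδ, hδR⟩ : ∃ δ > 0, ∀ x ∈ Icc c t, δ ≤ R μ x := by
      rcases (Icc c t).eq_empty_or_nonempty with he | hne
      · exact ⟨1, one_pos, fun x hx => by rw [he] at hx; exact hx.elim⟩
      · obtain ⟨x, hx, hmin⟩ := isCompact_Icc.exists_isMinOn hne ((h.cont μ hμ').mono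
          (fun x hx => hJt x (h.mem.1.trans_le (EReal.coe_le_coe_iff.2 hx.1)) hx.2))
        exact ⟨R μ x, hposR x hx, fun z hz => hmin hz⟩
    have h1 := (h.eventually_abs_sub_lt hμ' ht hδ).filter_mono (nhdsWithin_le_nhds (s := Ioi μ))
    have h2 : ∀ᶠ ν in 𝓝[>] μ, ν * θ < 1 := by
      have : ContinuousAt (fun ν => ν * θ) μ := by fun_prop
      exact nhdsWithin_le_nhds (this.eventually_lt_const hμ)
    obtain ⟨ν, ⟨hν, hν1⟩, hνμ⟩ := ((h1.and h2).and self_mem_nhdsWithin).exists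
    have hνμ : μ < ν := hνμ
    have hν0 : 0 ≤ ν := (h0.trans hνμ).le
    have hν' := h.abs_mul_lt hν0 le_rfl hν1
    have h3 := h.le_groundEnergy hV ht₁ hν' ht fun x hx => by
      rcases le_total x c with hxc | hxc
      · linarith [h.one_le hν0 hν' hx.1 hxc]
      · have hxt : x ≤ t := (EReal.coe_lt_coe_iff.1 hx.2).le
        linarith [(abs_lt.1 (hν x ⟨hxc, hxt⟩)).1, hδR x ⟨hxc, hxt⟩]
    rw [hE] at h3
    linarith [EReal.coe_le_coe_iff.1 h3]
  · have := nhdsWithin_interval_neBot ht.1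
    exact ge_of_tendsto ((h.cont μ hμ' t ht).mono
      (interval_subset_halfInterval.trans (halfInterval_subset ht.2)))
      (eventually_mem_nhdsWithin.mono fun z hz => (hA z hz).le)

end Family

end GroundState

/-! ### Continuity of `λ` and Hadamard's formula. -/

namespace GroundState

variable {V : ℝ → ℝ} {a b : EReal} {t₁ E₁ c θ : ℝ} {y v ϖ : ℝ → ℝ} {R S : ℝ → ℝ → ℝ}

lemma coe_lam (hV : ContinuousOn V (interval a b)) {t : ℝ} (ht : t ∈ finiteDomain V a b) :
    ((lam V a t : ℝ) : EReal) = groundEnergy V a t :=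
  EReal.coe_toReal (groundEnergy_ne_top ht.1 (hV.mono (interval_mono ht.2.1))) ht.2.2

lemma abs_setIntegral_interval_le {g w : ℝ → ℝ} {D : ℝ} {s : ℝ} (hs : s ≤ t₁) (hD : 0 ≤ D)
    (hw : IntegrableOn w (interval a t₁)) (hw0 : ∀ x ∈ interval a t₁, 0 ≤ w x)
    (hle : ∀ x ∈ interval a t₁, |g x| ≤ D * w x) :
    |∫ x in interval a s, g x| ≤ D * ∫ x in interval a t₁, w x := by
  have hsub := interval_subset_of_le (a := a) hs
  have h1 : |∫ x in interval a s, g x| ≤ ∫ x in interval a s, D * w x := by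
    rw [← Real.norm_eq_abs]
    refine norm_integral_le_of_norm_le ((hw.mono_set hsub).const_mul D) ?_
    exact (ae_restrict_iff' (measurableSet_interval _ _)).2
      (Eventually.of_forall fun x hx => hle x (hsub hx))
  rw [integral_const_mul] at h1
  refine h1.trans (mul_le_mul_of_nonneg_left ?_ hD)
  exact setIntegral_mono_set hw ((ae_restrict_iff' (measurableSet_interval _ _)).2
    (Eventually.of_forall hw0)) hsub.eventuallyLE

/-- Continuity of `s ↦ ∫_a^s H (m s)` for a continuous family `H`. -/
lemma tendsto_setIntegral_family {H : ℝ → ℝ → ℝ} {m w : ℝ → ℝ} {t K : ℝ}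
    (ht : t ∈ halfInterval a t₁) (hK : 0 ≤ K)
    (hw : IntegrableOn w (interval a t₁)) (hw0 : ∀ x ∈ interval a t₁, 0 ≤ w x)
    (hm : Tendsto m (𝓝[halfInterval a t₁] t) (𝓝 (m t)))
    (hi : ∀ᶠ ν in 𝓝 (m t), IntegrableOn (H ν) (interval a t₁))
    (hc : ContinuousOn (H (m t)) (halfInterval a t₁))
    (hH : ∀ᶠ ν in 𝓝 (m t), ∀ x ∈ halfInterval a t₁, |H ν x - H (m t) x| ≤ K * |ν - m t| * w x) :
    Tendsto (fun s : ℝ => ∫ x in interval a s, H (m s) x) (𝓝[halfInterval a t₁] t)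
      (𝓝 (∫ x in interval a t, H (m t) x)) := by
  have h1 := (continuousOn_setIntegral_interval hi.self_of_nhds hc) t ht
  have h2 : Tendsto (fun s : ℝ => (∫ x in interval a s, H (m s) x) - ∫ x in interval a s, H (m t) x)
      (𝓝[halfInterval a t₁] t) (𝓝 0) := by
    have h3 : Tendsto (fun s => K * |m s - m t| * ∫ x in interval a t₁, w x)
        (𝓝[halfInterval a t₁] t) (𝓝 0) := by
      have : Tendsto (fun ν => K * |ν - m t| * ∫ x in interval a t₁, w x) (𝓝 (m t))
          (𝓝 (K * |m t - m t| * ∫ x in interval a t₁, w x)) :=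
        Continuous.tendsto (by fun_prop) _
      simpa [Function.comp_def] using this.comp hm
    refine squeeze_zero_norm' ?_ h3
    filter_upwards [hm.eventually hi, hm.eventually hH, self_mem_nhdsWithin] with s hs1 hs2 hs3
    have hsub := interval_subset_of_le (a := a) hs3.2
    rw [Real.norm_eq_abs, ← integral_sub (hs1.mono_set hsub) (hi.self_of_nhds.mono_set hsub)]
    exact abs_setIntegral_interval_le hs3.2 (by positivity) hw hw0
      fun x hx => hs2 x (interval_subset_halfInterval hx)
  have h4 := h2.add h1
  rw [zero_add] at h4
  exact h4.congr fun s => sub_add_cancel _ _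

/-- Differentiability of `s ↦ ∫_a^s H (m s)` for a differentiable family `H`. -/
lemma hasDerivWithinAt_setIntegral_family {H : ℝ → ℝ → ℝ} {G m w : ℝ → ℝ} {t m' : ℝ}
    (ht : t ∈ halfInterval a t₁)
    (hw : IntegrableOn w (interval a t₁)) (hw0 : ∀ x ∈ interval a t₁, 0 ≤ w x)
    (hm : HasDerivWithinAt m m' (halfInterval a t₁) t)
    (hi : ∀ᶠ ν in 𝓝 (m t), IntegrableOn (H ν) (interval a t₁))
    (hc : ContinuousOn (H (m t)) (halfInterval a t₁))
    (hG : IntegrableOn G (interval a t₁)) (hGc : ContinuousOn G (halfInterval a t₁))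
    (hH : ∀ ε > 0, ∀ᶠ ν in 𝓝 (m t), ∀ x ∈ halfInterval a t₁,
      |H ν x - H (m t) x - (ν - m t) * G x| ≤ ε * |ν - m t| * w x) :
    HasDerivWithinAt (fun s : ℝ => ∫ x in interval a s, H (m s) x)
      (H (m t) t + m' * ∫ x in interval a t, G x) (halfInterval a t₁) t := by
  have hmt : Tendsto m (𝓝[halfInterval a t₁] t) (𝓝 (m t)) := hm.continuousWithinAt
  have h1 := hasDerivWithinAt_setIntegral_interval hi.self_of_nhds hc ht
  have h2 := (hm.sub_const (m t)).mul (hasDerivWithinAt_setIntegral_interval hG hGc ht)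
  -- This remainder is `o(m s - m t)` by the uniform expansion, hence `o(s - t)` because `m` is
  -- differentiable. The other two terms are a primitive and a product.
  set r : ℝ → ℝ := fun s => (∫ x in interval a s, H (m s) x) - (∫ x in interval a s, H (m t) x) -
    (m s - m t) * ∫ x in interval a s, G x with hr
  have h3 : HasDerivWithinAt r 0 (halfInterval a t₁) t := by
    have ho : r =o[𝓝[halfInterval a t₁] t] fun s => m s - m t := by
      rw [Asymptotics.isLittleO_iff]
      intro ε hε
      set W := ∫ x in interval a t₁, w x with hW
      have hW0 : 0 ≤ W := setIntegral_nonneg (measurableSet_interval _ _) hw0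
      filter_upwards [hmt.eventually hi, hmt.eventually (hH (ε / (W + 1)) (by positivity)),
        self_mem_nhdsWithin] with s hs1 hs2 hs3
      have hsub := interval_subset_of_le (a := a) hs3.2
      have e : r s = ∫ x in interval a s, (H (m s) x - H (m t) x - (m s - m t) * G x) := by
        have hd : IntegrableOn (fun x => H (m s) x - H (m t) x) (interval a s) :=
          (hs1.mono_set hsub).sub (hi.self_of_nhds.mono_set hsub)
        rw [integral_sub hd
          ((hG.mono_set hsub).const_mul _), integral_sub (hs1.mono_set hsub)
          (hi.self_of_nhds.mono_set hsub), integral_const_mul]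
      rw [e, Real.norm_eq_abs, Real.norm_eq_abs]
      refine (abs_setIntegral_interval_le hs3.2 (by positivity) hw hw0
        fun x hx => hs2 x (interval_subset_halfInterval hx)).trans ?_
      rw [← hW, div_mul_eq_mul_div, div_mul_eq_mul_div, div_le_iff₀ (by positivity)]
      have := mul_nonneg hε.le (abs_nonneg (m s - m t))
      nlinarith
    rw [hasDerivWithinAt_iff_isLittleO]
    have hO : (fun s => m s - m t) =O[𝓝[halfInterval a t₁] t] fun s => s - t := by
      simpa using hm.hasFDerivWithinAt.isBigO_sub
    have hrt : r t = 0 := by simp only [hr]; ring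
    simpa [hrt] using ho.trans_isBigO hO
  refine ((h1.add h2).add h3).congr_deriv (by ring) |>.congr_of_eventuallyEq
    (Eventually.of_forall fun s => ?_) ?_
  · simp only [hr, Pi.add_apply, Pi.mul_apply]; ring
  · simp only [hr, Pi.add_apply, Pi.mul_apply]; ring

namespace Family

/-- From below: for `ν < λ(t) - E₁`, `R ν` is positive on `(a, t]` and, by continuity, slightly
beyond `t`, so `λ(s) ≥ E₁ + ν` for nearby `s`. From above: for `ν > λ(t) - E₁`, `R ν` is nonpositive
at some `x < t`, and `λ(s) ≤ λ(x) ≤ E₁ + ν` once `s > x`. -/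
lemma tendsto_lam (h : Family V a t₁ E₁ c θ y v ϖ R S) (hV : ContinuousOn V (interval a b))
    (ht₁ : t₁ ∈ regularDomain V a b) (hfin : regularDomain V a b ⊆ finiteDomain V a b)
    (hE : (E₁ : EReal) < groundEnergy V a t₁) {t : ℝ} (ht : t ∈ halfInterval a t₁)
    (hθ : (lam V a t - E₁) * θ < 1) :
    Tendsto (lam V a) (𝓝[halfInterval a t₁] t) (𝓝 (lam V a t)) := by
  have hJ := halfInterval_subset_regularDomain ht₁
  have hcoe : ∀ s ∈ halfInterval a t₁, ((lam V a s : ℝ) : EReal) = groundEnergy V a s :=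
    fun s hs => coe_lam hV (hfin (hJ hs))
  have hanti : ∀ s ∈ halfInterval a t₁, ∀ z ∈ halfInterval a t₁, s ≤ z → lam V a z ≤ lam V a s := by
    intro s hs z hz hsz
    rw [← EReal.coe_le_coe_iff, hcoe s hs, hcoe z hz]
    exact groundEnergy_anti_of_le hV (EReal.coe_le_coe_iff.2 hsz) (le_of_mem_regularDomain (hJ hz))
  have hpos : ∀ s ∈ halfInterval a t₁, 0 < lam V a s - E₁ := by
    intro s hs
    rw [sub_pos, ← EReal.coe_lt_coe_iff, hcoe s hs]
    exact hE.trans_le (groundEnergy_anti_of_le hV (EReal.coe_le_coe_iff.2 hs.2)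
      (le_of_mem_regularDomain ht₁))
  have hEt : groundEnergy V a t = ((E₁ + (lam V a t - E₁) : ℝ) : EReal) := by
    rw [← hcoe t ht, add_sub_cancel]
  rw [tendsto_order]
  constructor
  · intro l hl
    obtain ⟨ν, hν, hν2⟩ : ∃ ν, max 0 (l - E₁) < ν ∧ ν < lam V a t - E₁ :=
      exists_between (max_lt (hpos t ht) (by linarith))
    have hν0 : 0 ≤ ν := (le_max_left _ _).trans hν.le
    have hlν : l - E₁ < ν := (le_max_right _ _).trans_lt hν
    have hν' := h.abs_mul_lt hν0 hν2.le hθ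
    have hRp : ∀ z ∈ halfInterval a t₁, z ≤ t → 0 < R ν z := by
      intro z hz hzt
      by_contra hcon
      have h1 := h.groundEnergy_le_of_nonpos hV ht₁ hν0 hν' hz (not_lt.1 hcon)
      rw [← hcoe z hz, EReal.coe_le_coe_iff] at h1
      linarith [hanti z hz t ht hzt]
    have h2 : ∀ᶠ s in 𝓝[halfInterval a t₁] t, 0 < R ν s :=
      (h.cont ν hν' t ht).eventually (lt_mem_nhds (hRp t ht le_rfl))
    obtain ⟨ε, hε, hball⟩ := Metric.mem_nhdsWithin_iff.1 h2
    filter_upwards [self_mem_nhdsWithin, nhdsWithin_le_nhds (Metric.ball_mem_nhds t hε)] with s hs hsb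
    have h3 := h.le_groundEnergy hV ht₁ hν' hs fun x hx => by
      have hxJ := interval_subset_halfInterval (interval_subset_of_le hs.2 hx)
      rcases le_total x t with hxt | hxt
      · exact hRp x hxJ hxt
      · refine hball ⟨?_, hxJ⟩
        rw [Metric.mem_ball, Real.dist_eq] at hsb ⊢
        have := (EReal.coe_lt_coe_iff.1 hx.2)
        rw [abs_of_nonneg (by linarith)]
        linarith [le_abs_self (s - t)]
    rw [← hcoe s hs, EReal.coe_le_coe_iff] at h3
    linarith
  · intro l hl
    have hev : ∀ᶠ ν in 𝓝[>] (lam V a t - E₁), ν * θ < 1 := by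
      have : ContinuousAt (fun ν => ν * θ) (lam V a t - E₁) := by fun_prop
      exact nhdsWithin_le_nhds (this.eventually_lt_const hθ)
    obtain ⟨ν, hν, hνI⟩ := (hev.and (Ioo_mem_nhdsGT (sub_lt_sub_right hl E₁))).exists
    have hν0 : 0 ≤ ν := ((hpos t ht).trans hνI.1).le
    have hν' := h.abs_mul_lt hν0 le_rfl hν
    obtain ⟨x, hx, hRx⟩ : ∃ x ∈ interval a t, R ν x ≤ 0 := by
      by_contra hcon
      push Not at hcon
      have h1 := h.le_groundEnergy hV ht₁ hν' ht hcon
      rw [hEt, EReal.coe_le_coe_iff] at h1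
      linarith [hνI.1]
    have hxJ := interval_subset_halfInterval (interval_subset_of_le ht.2 hx)
    have h1 := h.groundEnergy_le_of_nonpos hV ht₁ hν0 hν' hxJ hRx
    rw [← hcoe x hxJ, EReal.coe_le_coe_iff] at h1
    have hxt := EReal.coe_lt_coe_iff.1 hx.2
    filter_upwards [self_mem_nhdsWithin, nhdsWithin_le_nhds (lt_mem_nhds hxt)] with s hs hxs
    linarith [hanti x hxJ s hs hxs.le, hνI.2]

/-- The squared weighted norm of the solution of energy `E₁ + μ` on `(a, x)`. -/
noncomputable def normSq (a : EReal) (y : ℝ → ℝ) (R : ℝ → ℝ → ℝ) (μ x : ℝ) : ℝ :=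
  ∫ η in interval a x, y η ^ 2 * (R μ η * R μ η)

lemma integrableOn_mul_self (h : Family V a t₁ E₁ c θ y v ϖ R S) {μ ν : ℝ} (hμ : |μ| * θ < 1)
    (hν : |ν| * θ < 1) :
    IntegrableOn (fun η => y η ^ 2 * (R μ η * R ν η)) (interval a t₁) := by
  obtain ⟨C, -, hC⟩ := h.bound μ hμ
  obtain ⟨D, -, hD⟩ := h.bound ν hν
  exact h.integrableOn_mul (h.cont μ hμ) (h.cont ν hν) (fun x hx => (hC x hx).1)
    fun x hx => (hD x hx).1

lemma continuousOn_mul_self (h : Family V a t₁ E₁ c θ y v ϖ R S) {μ ν : ℝ} (hμ : |μ| * θ < 1)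
    (hν : |ν| * θ < 1) :
    ContinuousOn (fun η => y η ^ 2 * (R μ η * R ν η)) (halfInterval a t₁) :=
  h.continuousOn_sq.mul ((h.cont μ hμ).mul (h.cont ν hν))

lemma normSq_pos (h : Family V a t₁ E₁ c θ y v ϖ R S) {μ t : ℝ} (hμ : |μ| * θ < 1)
    (ht : t ∈ halfInterval a t₁) (hpos : ∀ x ∈ interval a t, 0 < R μ x) : 0 < normSq a y R μ t :=
  setIntegral_interval_pos (h.integrableOn_mul_self hμ hμ) (h.continuousOn_mul_self hμ hμ) ht
    fun x hx => mul_pos (pow_pos (h.pos x (interval_subset_halfInterval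
      (interval_subset_of_le ht.2 hx))) 2) (mul_pos (hpos x hx) (hpos x hx))

lemma eventually_abs_mul_lt {μ : ℝ} (hμ : |μ| * θ < 1) : ∀ᶠ ν in 𝓝 μ, |ν| * θ < 1 := by
  have : ContinuousAt (fun ν => |ν| * θ) μ := by fun_prop
  exact this.eventually_lt_const hμ

lemma weight_nonneg (h : Family V a t₁ E₁ c θ y v ϖ R S) :
    ∀ x ∈ interval a t₁, 0 ≤ y x ^ 2 * ϖ x := fun x hx =>
  mul_nonneg (sq_nonneg _) (h.weight.pos x (interval_subset_halfInterval hx)).le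

lemma tendsto_flux (h : Family V a t₁ E₁ c θ y v ϖ R S) {m : ℝ → ℝ} {t : ℝ}
    (ht : t ∈ halfInterval a t₁) (hθ : |m t| * θ < 1)
    (hm : Tendsto m (𝓝[halfInterval a t₁] t) (𝓝 (m t))) :
    Tendsto (fun s => flux a y R (m s) s) (𝓝[halfInterval a t₁] t) (𝓝 (flux a y R (m t) t)) := by
  obtain ⟨K, hK, hKle⟩ := h.eventually_abs_sub_le hθ
  refine hm.neg.mul (tendsto_setIntegral_family (H := fun ν x => y x ^ 2 * R ν x) (K := K)
    (w := fun x => y x ^ 2 * ϖ x) ht hK.le h.weight.integrable h.weight_nonneg hm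
    ((eventually_abs_mul_lt hθ).mono fun ν hν => h.integrableOn hν) (h.continuousOn_integrand hθ)
    (hKle.mono fun ν hν x hx => ?_))
  rw [← mul_sub, abs_mul, abs_of_nonneg (sq_nonneg _), mul_left_comm]
  exact mul_le_mul_of_nonneg_left (hν x hx) (sq_nonneg _)

/-- Hadamard's formula. The Wronskian identity at `s` for the energies `λ(t)` and `λ(s)` expresses
the difference quotient of `λ` through that of `R (m t)`, since `R (m s) s = 0 = R (m t) t`. Only
continuity of `λ` is needed to pass to the limit. -/
lemma hasDerivWithinAt_lam (h : Family V a t₁ E₁ c θ y v ϖ R S)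
    (hV : ContinuousOn V (interval a b))
    (ht₁ : t₁ ∈ regularDomain V a b) (hfin : regularDomain V a b ⊆ finiteDomain V a b)
    (hE : (E₁ : EReal) < groundEnergy V a t₁) {t : ℝ} (ht : t ∈ halfInterval a t₁)
    (hθ : (lam V a t - E₁) * θ < 1) :
    HasDerivWithinAt (lam V a) (-(flux a y R (lam V a t - E₁) t ^ 2) /
      (y t ^ 2 * normSq a y R (lam V a t - E₁) t)) (halfInterval a t₁) t := by
  have hJ := halfInterval_subset_regularDomain ht₁
  have hcoe : ∀ s ∈ halfInterval a t₁, ((lam V a s : ℝ) : EReal) = groundEnergy V a s :=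
    fun s hs => coe_lam hV (hfin (hJ hs))
  have hpos : ∀ s ∈ halfInterval a t₁, 0 < lam V a s - E₁ := by
    intro s hs
    rw [sub_pos, ← EReal.coe_lt_coe_iff, hcoe s hs]
    exact hE.trans_le (groundEnergy_anti_of_le hV (EReal.coe_le_coe_iff.2 hs.2)
      (le_of_mem_regularDomain ht₁))
  have hEs : ∀ s ∈ halfInterval a t₁,
      groundEnergy V a s = ((E₁ + (lam V a s - E₁) : ℝ) : EReal) := fun s hs => by
    rw [← hcoe s hs, add_sub_cancel]
  have hm := (h.tendsto_lam hV ht₁ hfin hE ht hθ).sub_const E₁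
  set m : ℝ → ℝ := fun s => lam V a s - E₁ with hmd
  change Tendsto m _ (𝓝 (m t)) at hm
  change m t * θ < 1 at hθ
  have hθ' : |m t| * θ < 1 := h.abs_mul_lt (hpos t ht).le le_rfl hθ
  have hgs := h.ground_state hV ht₁ (hpos t ht) hθ ht (hEs t ht)
  have hN0 := h.normSq_pos hθ' ht hgs.2
  obtain ⟨C, hC0, hC⟩ := h.bound (m t) hθ'
  obtain ⟨K, hK, hKle⟩ := h.eventually_abs_sub_le hθ'
  have hI : Tendsto (fun s : ℝ => ∫ x in interval a s, y x ^ 2 * (R (m t) x * R (m s) x))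
      (𝓝[halfInterval a t₁] t) (𝓝 (normSq a y R (m t) t)) := by
    refine tendsto_setIntegral_family (H := fun ν x => y x ^ 2 * (R (m t) x * R ν x)) (K := K * C)
      (w := fun x => y x ^ 2 * ϖ x ^ 2) ht (by positivity) h.weight.integrable_sq
      (fun x hx => by positivity) hm
      ((eventually_abs_mul_lt hθ').mono fun ν hν => h.integrableOn_mul_self hθ' hν)
      (h.continuousOn_mul_self hθ' hθ') (hKle.mono fun ν hν x hx => ?_)
    rw [← mul_sub, ← mul_sub, abs_mul, abs_mul, abs_of_nonneg (sq_nonneg _)]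
    have h1 := mul_le_mul (hC x hx).1 (hν x hx) (abs_nonneg _) ((abs_nonneg _).trans (hC x hx).1)
    refine (mul_le_mul_of_nonneg_left h1 (sq_nonneg (y x))).trans_eq (by ring)
  have hsl := hasDerivWithinAt_iff_tendsto_slope.1 (h.hasDerivWithinAt hθ' ht)
  have hdiff : 𝓝[halfInterval a t₁ \ {t}] t ≤ 𝓝[halfInterval a t₁] t :=
    nhdsWithin_mono _ sdiff_subset
  rw [hasDerivWithinAt_iff_tendsto_slope]
  have hlim := (hsl.mul ((h.tendsto_flux ht hθ' hm).mono_left hdiff)).neg.mul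
    ((hI.mono_left hdiff).inv₀ hN0.ne')
  have hyt := h.pos t ht
  have e : -((y t ^ 2)⁻¹ * flux a y R (m t) t * flux a y R (m t) t) * (normSq a y R (m t) t)⁻¹ =
      -(flux a y R (m t) t ^ 2) / (y t ^ 2 * normSq a y R (m t) t) := by
    field_simp
  rw [e] at hlim
  refine hlim.congr' ?_
  have hmθ : ∀ᶠ s in 𝓝[halfInterval a t₁] t, m s * θ < 1 := by
    have : ContinuousAt (fun ν => ν * θ) (m t) := by fun_prop
    exact hm.eventually (this.eventually_lt_const hθ)
  filter_upwards [hdiff hmθ, hdiff (hI.eventually (lt_mem_nhds hN0)), self_mem_nhdsWithin]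
    with s hs1 hs2 hs3
  have hs3t : s - t ≠ 0 := sub_ne_zero.2 hs3.2
  have hs' := h.abs_mul_lt (hpos s hs3.1).le le_rfl hs1
  have hgs' := h.ground_state hV ht₁ (hpos s hs3.1) hs1 hs3.1 (hEs s hs3.1)
  have hW := h.wronskian hθ' hs' hs3.1
  rw [hgs'.1, mul_zero, sub_zero] at hW
  rw [slope_def_field, slope_def_field, hgs.1, sub_zero]
  have e2 : lam V a s - lam V a t = m s - m t := by simp only [hmd]; ring
  rw [e2]
  change R (m t) s * flux a y R (m s) s = (m t - m s) * _ at hW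
  set I := ∫ x in interval a s, y x ^ 2 * (R (m t) x * R (m s) x) with hId
  change _ = (m t - m s) * I at hW
  have hs2' := hs2.ne'
  field_simp
  linear_combination -hW

end Family

end GroundState

/-! ### The second derivative, strict decrease, and the limit at `a`. -/

namespace GroundState

variable {V : ℝ → ℝ} {a b : EReal}

namespace Family

variable {t₁ E₁ c θ : ℝ} {y v ϖ : ℝ → ℝ} {R S : ℝ → ℝ → ℝ}

lemma differentiableWithinAt_flux (h : Family V a t₁ E₁ c θ y v ϖ R S) {m : ℝ → ℝ} {t : ℝ}
    (ht : t ∈ halfInterval a t₁) (hθ : |m t| * θ < 1)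
    (hm : DifferentiableWithinAt ℝ m (halfInterval a t₁) t) :
    DifferentiableWithinAt ℝ (fun s => flux a y R (m s) s) (halfInterval a t₁) t := by
  refine hm.neg.mul (HasDerivWithinAt.differentiableWithinAt (hasDerivWithinAt_setIntegral_family
    (H := fun ν x => y x ^ 2 * R ν x) (G := fun x => y x ^ 2 * S (m t) x)
    (w := fun x => y x ^ 2 * ϖ x) ht h.weight.integrable h.weight_nonneg hm.hasDerivWithinAt
    ((eventually_abs_mul_lt hθ).mono fun ν hν => h.integrableOn hν) (h.continuousOn_integrand hθ)
    ?_ (h.continuousOn_sq.mul (h.contS _ hθ)) fun ε hε => ?_))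
  · obtain ⟨C, -, hC⟩ := h.bound _ hθ
    exact integrableOn_mul_of_le h.continuousOn_sq (fun x _ => sq_nonneg _) (h.contS _ hθ)
      h.weight.integrable fun x hx => (hC x hx).2
  · filter_upwards [h.expansion _ hθ ε hε] with ν hν x hx
    have e : y x ^ 2 * R ν x - y x ^ 2 * R (m t) x - (ν - m t) * (y x ^ 2 * S (m t) x) =
      y x ^ 2 * (R ν x - R (m t) x - (ν - m t) * S (m t) x) := by ring
    rw [e, abs_mul, abs_of_nonneg (sq_nonneg _)]
    exact (mul_le_mul_of_nonneg_left (hν x hx) (sq_nonneg (y x))).trans_eq (by ring)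

lemma differentiableWithinAt_normSq (h : Family V a t₁ E₁ c θ y v ϖ R S) {m : ℝ → ℝ} {t : ℝ}
    (ht : t ∈ halfInterval a t₁) (hθ : |m t| * θ < 1)
    (hm : DifferentiableWithinAt ℝ m (halfInterval a t₁) t) :
    DifferentiableWithinAt ℝ (fun s => normSq a y R (m s) s) (halfInterval a t₁) t := by
  obtain ⟨C, hC0, hC⟩ := h.bound _ hθ
  obtain ⟨K, hK, hKle⟩ := h.eventually_abs_sub_le hθ
  refine HasDerivWithinAt.differentiableWithinAt (hasDerivWithinAt_setIntegral_family
    (H := fun ν x => y x ^ 2 * (R ν x * R ν x))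
    (G := fun x => 2 * (y x ^ 2 * (R (m t) x * S (m t) x)))
    (w := fun x => y x ^ 2 * ϖ x ^ 2) ht h.weight.integrable_sq (fun x hx => by positivity)
    hm.hasDerivWithinAt
    ((eventually_abs_mul_lt hθ).mono fun ν hν => h.integrableOn_mul_self hν hν)
    (h.continuousOn_mul_self hθ hθ)
    ((h.integrableOn_mul (h.cont _ hθ) (h.contS _ hθ) (fun x hx => (hC x hx).1)
      fun x hx => (hC x hx).2).const_mul 2)
    (continuousOn_const.mul (h.continuousOn_sq.mul ((h.cont _ hθ).mul (h.contS _ hθ))))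
    fun ε hε => ?_)
  have hlim : ∀ᶠ ν in 𝓝 (m t), K ^ 2 * |ν - m t| < ε / 2 := by
    have : ContinuousAt (fun ν => K ^ 2 * |ν - m t|) (m t) := by fun_prop
    exact this.eventually_lt_const (by simpa using half_pos hε)
  -- The error splits into a cross term, at most `2 C · ε / (4 (C + 1)) ≤ ε / 2` times `|ν - m t|`,
  -- and the square of an increment, at most `K² |ν - m t|²`; `hlim` keeps the latter below `ε / 2`
  -- times `|ν - m t|`.
  filter_upwards [h.expansion _ hθ (ε / (4 * (C + 1))) (by positivity), hKle, hlim]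
    with ν hν1 hν2 hν3 x hx
  have hw := h.weight.pos x hx
  have h1 := hν1 x hx
  have h2 := hν2 x hx
  have h3 := (hC x hx).1
  have e : y x ^ 2 * (R ν x * R ν x) - y x ^ 2 * (R (m t) x * R (m t) x) -
      (ν - m t) * (2 * (y x ^ 2 * (R (m t) x * S (m t) x))) =
      y x ^ 2 * ((R ν x - R (m t) x) ^ 2 +
        2 * (R (m t) x * (R ν x - R (m t) x - (ν - m t) * S (m t) x))) := by ring
  rw [e, abs_mul, abs_of_nonneg (sq_nonneg _)]
  set d := |ν - m t| with hd
  have hd0 : 0 ≤ d := abs_nonneg _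
  have h4 : |(R ν x - R (m t) x) ^ 2| ≤ ε / 2 * d * ϖ x ^ 2 := by
    rw [abs_pow]
    calc |R ν x - R (m t) x| ^ 2 ≤ (K * d * ϖ x) ^ 2 := pow_le_pow_left₀ (abs_nonneg _) h2 2
      _ = K ^ 2 * d * d * ϖ x ^ 2 := by ring
      _ ≤ ε / 2 * d * ϖ x ^ 2 := by gcongr
  have h5 : |2 * (R (m t) x * (R ν x - R (m t) x - (ν - m t) * S (m t) x))| ≤
      ε / 2 * d * ϖ x ^ 2 := by
    rw [abs_mul, abs_mul, abs_two]
    have h6 := mul_le_mul h3 h1 (abs_nonneg _) ((abs_nonneg _).trans h3)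
    have h7 : 2 * (C * ϖ x * (ε / (4 * (C + 1)) * d * ϖ x)) ≤ ε / 2 * d * ϖ x ^ 2 := by
      have h8 : C * (ε / (4 * (C + 1))) ≤ ε / 4 := by
        rw [mul_div_assoc', div_le_div_iff₀ (by positivity) (by norm_num)]
        nlinarith
      have h9 := mul_le_mul_of_nonneg_right h8 (by positivity : 0 ≤ 2 * d * ϖ x ^ 2)
      nlinarith
    linarith
  have h10 := abs_add_le ((R ν x - R (m t) x) ^ 2)
    (2 * (R (m t) x * (R ν x - R (m t) x - (ν - m t) * S (m t) x)))
  calc y x ^ 2 * _ ≤ y x ^ 2 * (ε * d * ϖ x ^ 2) :=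
        mul_le_mul_of_nonneg_left (by linarith) (sq_nonneg _)
    _ = ε * d * (y x ^ 2 * ϖ x ^ 2) := by ring

end Family

/-- The standing assumptions on the potential. -/
structure Setting (V : ℝ → ℝ) (a b : EReal) : Prop where
  lt : a < b
  cont : ContinuousOn V (interval a b)
  bot : a = ⊥ → Tendsto V atBot atTop
  shape : ConvexOn ℝ (interval a b) V ∨ ConcaveOn ℝ (interval a b) V
  finite : regularDomain V a b ⊆ finiteDomain V a b

namespace Setting

lemma coe_lam (h : Setting V a b) {t : ℝ} (ht : t ∈ regularDomain V a b) :
    ((lam V a t : ℝ) : EReal) = groundEnergy V a t :=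
  GroundState.coe_lam h.cont (h.finite ht)

lemma exists_family (h : Setting V a b) {t₁ E₁ : ℝ} (ht₁ : t₁ ∈ regularDomain V a b)
    (hE : (E₁ : EReal) < groundEnergy V a t₁) (M : ℝ) :
    ∃ c θ y v ϖ R S, Family V a t₁ E₁ c θ y v ϖ R S ∧ M * θ < 1 :=
  GroundState.exists_family h.lt h.cont h.bot h.shape ht₁ hE M

lemma exists_lt_groundEnergy (h : Setting V a b) {t : ℝ} (ht : t ∈ regularDomain V a b) :
    ∃ E : ℝ, (E : EReal) < groundEnergy V a t := by
  obtain ⟨E, -, hE⟩ := exists_real_btw (bot_lt_iff_ne_bot.2 (h.finite ht).2.2)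
  exact ⟨E, hE⟩

lemma lam_sub_pos (h : Setting V a b) {t₁ E₁ : ℝ} (ht₁ : t₁ ∈ regularDomain V a b)
    (hE : (E₁ : EReal) < groundEnergy V a t₁) {t : ℝ} (ht : t ∈ halfInterval a t₁) :
    0 < lam V a t - E₁ := by
  rw [sub_pos, ← EReal.coe_lt_coe_iff, h.coe_lam (halfInterval_subset_regularDomain ht₁ ht)]
  exact hE.trans_le (groundEnergy_anti_of_le h.cont (EReal.coe_le_coe_iff.2 ht.2)
    (le_of_mem_regularDomain ht₁))

lemma ground_state (h : Setting V a b) {t₁ E₁ c θ : ℝ} {y v ϖ : ℝ → ℝ} {R S : ℝ → ℝ → ℝ}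
    (hF : Family V a t₁ E₁ c θ y v ϖ R S) (ht₁ : t₁ ∈ regularDomain V a b)
    (hE : (E₁ : EReal) < groundEnergy V a t₁) {t : ℝ} (ht : t ∈ halfInterval a t₁)
    (hθ : (lam V a t - E₁) * θ < 1) :
    R (lam V a t - E₁) t = 0 ∧ ∀ x ∈ interval a t, 0 < R (lam V a t - E₁) x :=
  hF.ground_state h.cont ht₁ (h.lam_sub_pos ht₁ hE ht) hθ ht (by
    rw [add_sub_cancel, h.coe_lam (halfInterval_subset_regularDomain ht₁ ht)])

/-- If `λ(s) = λ(t)`, the same function `R μ` would vanish at `s` and, being the ground state factor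
on `(a, t)`, be positive there. -/
lemma groundEnergy_lt (h : Setting V a b)
    {s t : ℝ} (ht : t ∈ regularDomain V a b) (has : a < (s : EReal))
    (hst : s < t) : groundEnergy V a t < groundEnergy V a s := by
  obtain ⟨E, hE⟩ := h.exists_lt_groundEnergy ht
  have hs : s ∈ halfInterval a t := ⟨has, hst.le⟩
  have hsT := halfInterval_subset_regularDomain ht hs
  obtain ⟨c, θ, y, v, ϖ, R, S, hF, hM⟩ := h.exists_family ht hE (lam V a s - E)
  refine lt_of_le_of_ne (groundEnergy_anti_of_le h.cont (EReal.coe_le_coe_iff.2 hst.le)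
    (le_of_mem_regularDomain ht)) fun heq => ?_
  have hlam : lam V a t = lam V a s := by
    rw [← EReal.coe_eq_coe_iff, h.coe_lam ht, h.coe_lam hsT, heq]
  have h1 := h.ground_state hF ht hE hs hM
  have h2 := h.ground_state hF ht hE ⟨ht.1, le_rfl⟩ (by rwa [hlam])
  rw [hlam] at h2
  exact (h2.2 s ⟨has, EReal.coe_lt_coe_iff.2 hst⟩).ne' h1.1

lemma strictAntiOn_groundEnergy (h : Setting V a b) :
    StrictAntiOn (groundEnergy V a) (Ioc a b) := by
  intro s hs t ht hst
  obtain ⟨s', rfl⟩ : ∃ s' : ℝ, (s' : EReal) = s := by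
    induction s with
    | bot => exact absurd hs.1 not_lt_bot
    | coe s => exact ⟨s, rfl⟩
    | top => exact absurd hst not_top_lt
  -- The upper point may be `b`, possibly infinite or singular. An intermediate real `t'` reduces
  -- strictness to the interior.
  obtain ⟨t', ht'⟩ := exists_real_btw hst
  have ht'b : t' ∈ interval a b := ⟨hs.1.trans ht'.1, ht'.2.trans_le ht.2⟩
  exact (groundEnergy_anti_of_le h.cont ht'.2.le ht.2).trans_lt
    (h.groundEnergy_lt (interval_subset_regularDomain ht'b) hs.1 (EReal.coe_lt_coe_iff.1 ht'.1))

/-- Given `M`, a family is chosen whose range of `μ` reaches beyond `M - E`. As `R μ ≥ 1` on `(a,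
c]`, the function `y R μ` is a positive solution and `λ(c) > M`. -/
lemma tendsto_groundEnergy (h : Setting V a b) : Tendsto (groundEnergy V a) (𝓝[>] a) (𝓝 ⊤) := by
  rw [EReal.tendsto_nhds_top_iff_real]
  intro M
  obtain ⟨t, ht⟩ := exists_real_btw h.lt
  have htT := interval_subset_regularDomain (V := V) ht
  obtain ⟨E, hE⟩ := h.exists_lt_groundEnergy htT
  have hμ0 : 0 ≤ max 0 (M - E) + 1 := by positivity
  obtain ⟨c, θ, y, v, ϖ, R, S, hF, hM⟩ := h.exists_family htT hE (max 0 (M - E) + 1)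
  have hθ := hF.abs_mul_lt hμ0 le_rfl hM
  have hc := hF.le_groundEnergy h.cont htT hθ hF.mem_half fun x hx =>
    lt_of_lt_of_le one_pos (hF.one_le hμ0 hθ hx.1 (EReal.coe_lt_coe_iff.1 hx.2).le)
  have hMc : (M : EReal) < groundEnergy V a c :=
    lt_of_lt_of_le (EReal.coe_lt_coe_iff.2 (by linarith [le_max_right 0 (M - E)])) hc
  filter_upwards [Ioo_mem_nhdsGT hF.mem.1] with s hs
  exact hMc.trans_le (groundEnergy_anti_of_le h.cont hs.2.le (hF.mem.2.le.trans
    (le_of_mem_regularDomain htT)))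

lemma exists_halfInterval_mem_nhdsWithin {t : ℝ} (ht : t ∈ regularDomain V a b) :
    ∃ t₁ ∈ regularDomain V a b, t ∈ halfInterval a t₁ ∧
      halfInterval a t₁ ∈ 𝓝[regularDomain V a b] t := by
  rcases ht.2 with hb | hb
  · obtain ⟨t₁, ht₁⟩ := exists_real_btw hb
    have htt := EReal.coe_lt_coe_iff.1 ht₁.1
    refine ⟨t₁, interval_subset_regularDomain ⟨ht.1.trans ht₁.1, ht₁.2⟩, ⟨ht.1, htt.le⟩, ?_⟩
    exact nhdsWithin_le_nhds (mem_of_superset ((isOpen_interval a t₁).mem_nhds ⟨ht.1, ht₁.1⟩)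
      interval_subset_halfInterval)
  · refine ⟨t, ht, ⟨ht.1, le_rfl⟩, mem_of_superset self_mem_nhdsWithin fun x hx => ⟨hx.1, ?_⟩⟩
    have := le_of_mem_regularDomain hx
    rw [← hb.1] at this
    exact EReal.coe_le_coe_iff.1 this

lemma twice_differentiable (h : Setting V a b) :
    DifferentiableOn ℝ (lam V a) (regularDomain V a b) ∧
    DifferentiableOn ℝ (derivWithin (lam V a) (regularDomain V a b)) (regularDomain V a b) := by
  have huniq : UniqueDiffOn ℝ (regularDomain V a b) := by
    refine uniqueDiffOn_convex ordConnected_regularDomain.convex ?_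
    rw [interior_regularDomain]
    exact exists_real_btw h.lt
  have key : ∀ t ∈ regularDomain V a b, DifferentiableWithinAt ℝ (lam V a) (regularDomain V a b) t ∧
      DifferentiableWithinAt ℝ (derivWithin (lam V a) (regularDomain V a b))
        (regularDomain V a b) t := by
    intro t ht
    obtain ⟨t₁, ht₁, htJ, hJ⟩ := exists_halfInterval_mem_nhdsWithin ht
    obtain ⟨E, hE⟩ := h.exists_lt_groundEnergy ht₁
    obtain ⟨c, θ, y, v, ϖ, R, S, hF, hM⟩ := h.exists_family ht₁ hE (lam V a t - E)
    have hder : ∀ s ∈ halfInterval a t₁, (lam V a s - E) * θ < 1 →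
        HasDerivWithinAt (lam V a) (-(Family.flux a y R (lam V a s - E) s ^ 2) /
      (y s ^ 2 * Family.normSq a y R (lam V a s - E) s)) (halfInterval a t₁) s := fun s hs hs' =>
      hF.hasDerivWithinAt_lam h.cont ht₁ h.finite hE hs hs'
    have hd := hder t htJ hM
    have hdT := hd.mono_of_mem_nhdsWithin hJ
    have hM' : |lam V a t - E| * θ < 1 :=
      hF.abs_mul_lt (h.lam_sub_pos ht₁ hE htJ).le le_rfl hM
    have hm : DifferentiableWithinAt ℝ (fun s => lam V a s - E) (halfInterval a t₁) t :=
      hd.differentiableWithinAt.sub_const E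
    refine ⟨hdT.differentiableWithinAt, ?_⟩
    have hN := hF.normSq_pos hM' htJ (h.ground_state hF ht₁ hE htJ hM).2
    have hD : DifferentiableWithinAt ℝ (fun s => -(Family.flux a y R (lam V a s - E) s ^ 2) /
        (y s ^ 2 * Family.normSq a y R (lam V a s - E) s)) (halfInterval a t₁) t := by
      refine ((hF.differentiableWithinAt_flux (m := fun s => lam V a s - E) htJ hM' hm).pow
        2).neg.div (((hF.sol.deriv₁ t htJ).differentiableWithinAt.pow 2).mul
          (hF.differentiableWithinAt_normSq (m := fun s => lam V a s - E) htJ hM' hm)) ?_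
      exact (mul_pos (pow_pos (hF.pos t htJ) 2) hN).ne'
    -- Near `t` one family represents `λ'` by Hadamard's formula, whose ingredients, including `λ`
    -- itself, are already known to be differentiable.
    refine (hD.mono_of_mem_nhdsWithin hJ).congr_of_eventuallyEq_of_mem ?_ ht
    have h1 : ∀ᶠ s in 𝓝[regularDomain V a b] t, (lam V a s - E) * θ < 1 := by
      have h2 : ContinuousWithinAt (fun s => (lam V a s - E) * θ) (regularDomain V a b) t :=
        (hdT.continuousWithinAt.sub continuousWithinAt_const).mul continuousWithinAt_const
      exact h2.eventually_lt_const hM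
    filter_upwards [h1, hJ, self_mem_nhdsWithin, eventually_eventually_nhdsWithin.2 hJ]
      with s hs1 hs2 hs3 hs4
    exact ((hder s hs2 hs1).mono_of_mem_nhdsWithin hs4).derivWithin (huniq s hs3)
  exact ⟨fun t ht => (key t ht).1, fun t ht => (key t ht).2⟩

end Setting

end GroundState

/-! ### Minimizing sequences and positive solutions. -/

namespace GroundState

/-- Fatou's lemma for real integrals. -/
lemma integrable_and_integral_le_of_tendsto {α : Type*} [MeasurableSpace α] {μ : Measure α}
    {F : ℕ → α → ℝ} {f : α → ℝ} {c : ℕ → ℝ} {C : ℝ} (hF : ∀ n, Integrable (F n) μ)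
    (h0 : ∀ n, 0 ≤ᵐ[μ] F n) (hf : ∀ᵐ x ∂μ, Tendsto (fun n => F n x) atTop (𝓝 (f x)))
    (hc : ∀ n, ∫ x, F n x ∂μ ≤ c n) (hC : Tendsto c atTop (𝓝 C)) :
    Integrable f μ ∧ ∫ x, f x ∂μ ≤ C := by
  have hm : AEStronglyMeasurable f μ := aestronglyMeasurable_of_tendsto_ae atTop
    (fun n => (hF n).1) hf
  have hf0 : 0 ≤ᵐ[μ] f := by
    filter_upwards [hf, ae_all_iff.2 h0] with x hx h0x
    exact ge_of_tendsto' hx h0x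
  have hC0 : 0 ≤ C := ge_of_tendsto' hC fun n => (integral_nonneg_of_ae (h0 n)).trans (hc n)
  have key : ∫⁻ x, ENNReal.ofReal (f x) ∂μ ≤ ENNReal.ofReal C := by
    calc ∫⁻ x, ENNReal.ofReal (f x) ∂μ
        = ∫⁻ x, liminf (fun n => ENNReal.ofReal (F n x)) atTop ∂μ := by
          refine lintegral_congr_ae (hf.mono fun x hx => ?_)
          exact ((ENNReal.continuous_ofReal.tendsto _).comp hx).liminf_eq.symm
      _ ≤ liminf (fun n => ∫⁻ x, ENNReal.ofReal (F n x) ∂μ) atTop :=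
          lintegral_liminf_le' fun n => (hF n).1.aemeasurable.ennreal_ofReal
      _ ≤ liminf (fun n => ENNReal.ofReal (c n)) atTop := by
          refine liminf_le_liminf (Eventually.of_forall fun n => ?_)
          rw [← ofReal_integral_eq_lintegral_ofReal (hF n) (h0 n)]
          exact ENNReal.ofReal_le_ofReal (hc n)
      _ = ENNReal.ofReal C := ((ENNReal.continuous_ofReal.tendsto _).comp hC).liminf_eq
  have hi : Integrable f μ := ⟨hm, (hasFiniteIntegral_iff_ofReal hf0).2
    (key.trans_lt ENNReal.ofReal_lt_top)⟩
  refine ⟨hi, ?_⟩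
  rw [integral_eq_lintegral_of_nonneg_ae hf0 hm]
  exact ENNReal.toReal_le_of_le_ofReal hC0 key

/-- Cauchy–Schwarz, from the nonnegativity of the variance of `g` about its mean. -/
lemma sq_intervalIntegral_le {g : ℝ → ℝ} {α β : ℝ} (hαβ : α < β) (hg : ContinuousOn g (Icc α β)) :
    (∫ x in α..β, g x) ^ 2 ≤ (β - α) * ∫ x in α..β, g x ^ 2 := by
  have hL : 0 < β - α := sub_pos.2 hαβ
  set I := ∫ x in α..β, g x with hI
  have hgu : ContinuousOn g (uIcc α β) := by rwa [uIcc_of_le hαβ.le]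
  have hi1 := hgu.intervalIntegrable (μ := volume)
  have hi2 : IntervalIntegrable (fun x => g x ^ 2) volume α β := (hgu.pow 2).intervalIntegrable
  have h0 : 0 ≤ ∫ x in α..β, (g x - I / (β - α)) ^ 2 :=
    intervalIntegral.integral_nonneg hαβ.le fun x _ => sq_nonneg _
  have e : ∫ x in α..β, (g x - I / (β - α)) ^ 2 =
      (∫ x in α..β, g x ^ 2) - 2 * (I / (β - α)) * I + (β - α) * (I / (β - α)) ^ 2 := by
    have : ∀ x, (g x - I / (β - α)) ^ 2 = g x ^ 2 - 2 * (I / (β - α)) * g x + (I / (β - α)) ^ 2 :=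
      fun x => by ring
    simp only [this]
    rw [intervalIntegral.integral_add (hi2.sub (hi1.const_mul _)) (intervalIntegrable_const),
      intervalIntegral.integral_sub hi2 (hi1.const_mul _), intervalIntegral.integral_const_mul,
      intervalIntegral.integral_const, smul_eq_mul]
  rw [e] at h0
  have e2 : (∫ x in α..β, g x ^ 2) - 2 * (I / (β - α)) * I + (β - α) * (I / (β - α)) ^ 2 =
      (∫ x in α..β, g x ^ 2) - I ^ 2 / (β - α) := by field_simp; ring
  rw [e2, sub_nonneg, div_le_iff₀ hL] at h0
  linarith

variable {V : ℝ → ℝ} {a t : EReal}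

namespace IsTest

variable {Ω : Set ℝ} {φ χ : ℝ → ℝ}

lemma contDiff_one (h : IsTest Ω φ) : ContDiff ℝ 1 φ := h.1.of_le (by simp)

lemma hasDerivAt (h : IsTest Ω φ) (x : ℝ) : HasDerivAt φ (deriv φ x) x :=
  (h.contDiff_one.differentiable (by norm_num) x).hasDerivAt

lemma add_const_mul (h : IsTest Ω φ) (h' : IsTest Ω χ) (r : ℝ) :
    IsTest Ω fun x => φ x + r * χ x :=
  ⟨h.1.add (contDiff_const.mul h'.1), h.2.1.add h'.2.1.mul_left,
    (tsupport_add φ fun x => r * χ x).trans (union_subset h.2.2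
      ((tsupport_mul_subset_right).trans h'.2.2))⟩

lemma deriv_add_const_mul (h : IsTest Ω φ) (h' : IsTest Ω χ) (r x : ℝ) :
    deriv (fun x => φ x + r * χ x) x = deriv φ x + r * deriv χ x :=
  ((h.hasDerivAt x).add ((h'.hasDerivAt x).const_mul r)).deriv

lemma integrableOn_mul (h : IsTest Ω φ) (hΩ : MeasurableSet Ω) {W f : ℝ → ℝ}
    (hW : ContinuousOn W Ω) (hf : Continuous f) (h0 : ∀ x, x ∉ tsupport φ → f x = 0) :
    IntegrableOn (fun x => W x * f x) Ω :=
  integrableOn_mul_of_tsupport hW hΩ h.2.1 h.2.2 hf h0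

lemma integrableOn_mul_sq (h : IsTest Ω φ) (hΩ : MeasurableSet Ω) {W : ℝ → ℝ}
    (hW : ContinuousOn W Ω) : IntegrableOn (fun x => W x * φ x ^ 2) Ω :=
  h.integrableOn_mul hΩ hW (h.1.continuous.pow 2) fun _ hx => sq_eq_zero_of_notMem_tsupport hx

lemma integrableOn_deriv_sq (h : IsTest Ω φ) : IntegrableOn (fun x => deriv φ x ^ 2) Ω :=
  (h.memLp_deriv Ω).integrable_sq

lemma integrableOn_sq (h : IsTest Ω φ) : IntegrableOn (fun x => φ x ^ 2) Ω :=
  (h.memLp Ω).integrable_sq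

lemma continuousOn_quotient (h : IsTest Ω φ) {f v : ℝ → ℝ} (hf : ContinuousOn f Ω)
    (hv : ContinuousOn v Ω) (hpos : ∀ x ∈ Ω, 0 < f x) :
    ContinuousOn (fun x => deriv φ x - v x / f x * φ x) Ω :=
  h.continuous_deriv.continuousOn.sub ((hv.div hf fun x hx => (hpos x hx).ne').mul
    h.1.continuous.continuousOn)

lemma memLp_quotient (h : IsTest Ω φ) (hΩ : MeasurableSet Ω) {f v : ℝ → ℝ} (hf : ContinuousOn f Ω)
    (hv : ContinuousOn v Ω) (hpos : ∀ x ∈ Ω, 0 < f x) :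
    MemLp (fun x => deriv φ x - v x / f x * φ x) 2 (volume.restrict Ω) := by
  refine (h.memLp_deriv Ω).sub ((memLp_two_iff_integrable_sq ?_).2 ?_)
  · exact ((hv.div hf fun x hx => (hpos x hx).ne').mul
      h.1.continuous.continuousOn).aestronglyMeasurable hΩ
  · simp only [mul_pow]
    exact h.integrableOn_mul_sq hΩ ((hv.div hf fun x hx => (hpos x hx).ne').pow 2)

end IsTest

/-- A minimizing sequence of test functions for the energy `E` on `(a, t)`. -/
structure IsMinimizing (V : ℝ → ℝ) (a t : EReal) (E : ℝ) (φ : ℕ → ℝ → ℝ) : Prop where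
  test : ∀ n, IsTest (interval a t) (φ n)
  energy : Tendsto (fun n => energy V a t (φ n) (deriv (φ n))) atTop (𝓝 E)
  norm : Tendsto (fun n => ∫ x in interval a t, φ n x ^ 2) atTop (𝓝 1)

lemma IsMinimizing.subseq {E : ℝ} {φ : ℕ → ℝ → ℝ} (h : IsMinimizing V a t E φ) {σ : ℕ → ℕ}
    (hσ : StrictMono σ) : IsMinimizing V a t E (fun n => φ (σ n)) :=
  ⟨fun _ => h.test _, h.energy.comp hσ.tendsto_atTop, h.norm.comp hσ.tendsto_atTop⟩

/-- A positive solution of energy at most the ground state energy. -/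
structure PositiveSolution (V : ℝ → ℝ) (a t : EReal) (E : ℝ) (f v : ℝ → ℝ) : Prop where
  lt : a < t
  cont : ContinuousOn V (interval a t)
  deriv₁ : ∀ x ∈ interval a t, HasDerivAt f (v x) x
  deriv₂ : ∀ x ∈ interval a t, HasDerivAt v ((V x - E) * f x) x
  pos : ∀ x ∈ interval a t, 0 < f x

namespace PositiveSolution

variable {E : ℝ} {f v : ℝ → ℝ} {φ : ℕ → ℝ → ℝ}

lemma continuousOn₁ (h : PositiveSolution V a t E f v) : ContinuousOn f (interval a t) :=
  fun x hx => (h.deriv₁ x hx).continuousAt.continuousWithinAt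

lemma continuousOn₂ (h : PositiveSolution V a t E f v) : ContinuousOn v (interval a t) :=
  fun x hx => (h.deriv₂ x hx).continuousAt.continuousWithinAt

lemma jacobi (h : PositiveSolution V a t E f v) {χ : ℝ → ℝ} (hχ : IsTest (interval a t) χ) :
    ∫ x in interval a t, (deriv χ x - v x / f x * χ x) ^ 2 ≤
      energy V a t χ (deriv χ) - E * ∫ x in interval a t, χ x ^ 2 :=
  jacobi_le_of_pos h.lt h.cont h.deriv₁ h.deriv₂ h.pos hχ.contDiff_one hχ.2.1 hχ.2.2

lemma tendsto_jacobi (h : PositiveSolution V a t E f v) (hφ : IsMinimizing V a t E φ) :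
    Tendsto (fun n => ∫ x in interval a t, (deriv (φ n) x - v x / f x * φ n x) ^ 2) atTop (𝓝 0) := by
  have h1 := hφ.energy.sub (hφ.norm.const_mul E)
  rw [mul_one, sub_self] at h1
  exact tendsto_of_tendsto_of_tendsto_of_le_of_le tendsto_const_nhds h1
    (fun n => integral_nonneg fun x => sq_nonneg _) fun n => h.jacobi (hφ.test n)

/-- `(φ / f)' = (φ' - (v / f) φ) / f`. On a compact interval `1 / f` is bounded, and the `L²` norm
of the numerator tends to zero by `tendsto_jacobi`, so `φ n / f` becomes constant. -/
lemma tendsto_quotient_sub (h : PositiveSolution V a t E f v) (hφ : IsMinimizing V a t E φ)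
    {x₀ x : ℝ} (hx₀ : x₀ ∈ interval a t) (hx : x ∈ interval a t) :
    Tendsto (fun n => φ n x / f x - φ n x₀ / f x₀) atTop (𝓝 0) := by
  wlog hlt : x₀ < x generalizing x₀ x
  · rcases (not_lt.1 hlt).eq_or_lt with h1 | h1
    · rw [h1]; simp
    · simpa using (this hx hx₀ h1).neg
  have hI : Icc x₀ x ⊆ interval a t := Icc_subset_interval hx₀ hx
  have hu : ∀ s ∈ uIcc x₀ x, s ∈ interval a t := fun s hs => hI (by rwa [uIcc_of_le hlt.le] at hs)
  have hfi : ContinuousOn (fun s => (f s ^ 2)⁻¹) (Icc x₀ x) :=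
    ((h.continuousOn₁.mono hI).pow 2).inv₀ fun s hs => (pow_pos (h.pos s (hI hs)) 2).ne'
  obtain ⟨C, hC⟩ := isCompact_Icc.exists_bound_of_continuousOn hfi
  have hC' : ∀ s ∈ Icc x₀ x, (f s ^ 2)⁻¹ ≤ C := fun s hs => (le_abs_self _).trans (hC s hs)
  have hC0 : 0 ≤ C := (inv_nonneg.2 (sq_nonneg _)).trans (hC' x₀ ⟨le_rfl, hlt.le⟩)
  have hlim := (h.tendsto_jacobi hφ).const_mul ((x - x₀) * C)
  rw [mul_zero] at hlim
  have hsq : Tendsto (fun n => (φ n x / f x - φ n x₀ / f x₀) ^ 2) atTop (𝓝 0) := by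
    refine tendsto_of_tendsto_of_tendsto_of_le_of_le tendsto_const_nhds hlim
      (fun n => sq_nonneg _) fun n => ?_
    have hn := hφ.test n
    set D : ℝ → ℝ := fun s => deriv (φ n) s - v s / f s * φ n s with hD
    have hDc : ContinuousOn D (interval a t) :=
      hn.continuousOn_quotient h.continuousOn₁ h.continuousOn₂ h.pos
    have hgc : ContinuousOn (fun s => D s / f s) (Icc x₀ x) :=
      (hDc.mono hI).div (h.continuousOn₁.mono hI) fun s hs => (h.pos s (hI hs)).ne'
    have hd : ∀ s ∈ uIcc x₀ x, HasDerivAt (fun s => φ n s / f s) (D s / f s) s := fun s hs => by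
      have hs0 := (h.pos s (hu s hs)).ne'
      refine ((hn.hasDerivAt s).div (h.deriv₁ s (hu s hs)) hs0).congr_deriv ?_
      simp only [hD]; field_simp
    rw [← intervalIntegral.integral_eq_sub_of_hasDerivAt hd
      (hgc.mono (by rw [uIcc_of_le hlt.le])).intervalIntegrable]
    refine (sq_intervalIntegral_le hlt hgc).trans ?_
    rw [mul_assoc]
    refine mul_le_mul_of_nonneg_left ?_ (by linarith)
    have hDi : IntegrableOn (fun s => D s ^ 2) (interval a t) :=
      (hn.memLp_quotient (measurableSet_interval a t) h.continuousOn₁ h.continuousOn₂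
        h.pos).integrable_sq
    calc ∫ s in x₀..x, (D s / f s) ^ 2 ≤ ∫ s in x₀..x, C * D s ^ 2 := by
          refine intervalIntegral.integral_mono_on hlt.le
            ((hgc.pow 2).mono (by rw [uIcc_of_le hlt.le])).intervalIntegrable
            ((((hDc.mono hI).pow 2).mono (by rw [uIcc_of_le hlt.le])).intervalIntegrable.const_mul
              C) fun s hs => ?_
          rw [div_pow, div_eq_inv_mul]
          exact mul_le_mul_of_nonneg_right (hC' s hs) (sq_nonneg _)
      _ ≤ C * ∫ s in interval a t, D s ^ 2 := by
          rw [intervalIntegral.integral_const_mul]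
          refine mul_le_mul_of_nonneg_left ?_ hC0
          rw [intervalIntegral.integral_of_le hlt.le]
          exact setIntegral_mono_set hDi (Eventually.of_forall fun s => sq_nonneg _)
            (Ioc_subset_Icc_self.trans hI).eventuallyLE
  have h2 := hsq.sqrt
  simp only [Real.sqrt_sq_eq_abs, Real.sqrt_zero] at h2
  exact (tendsto_zero_iff_abs_tendsto_zero _).2 h2

/-- A minimizing sequence which is bounded at each point subconverges to a multiple of the
solution. -/
lemma exists_subseq (h : PositiveSolution V a t E f v) (hφ : IsMinimizing V a t E φ) {C : ℝ}
    (hC : ∀ n x, φ n x ^ 2 ≤ C) :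
    ∃ γ : ℝ, ∃ σ : ℕ → ℕ, StrictMono σ ∧
      ∀ x ∈ interval a t, Tendsto (fun n => φ (σ n) x) atTop (𝓝 (γ * f x)) := by
  obtain ⟨x₀, hx₀⟩ := exists_real_btw h.lt
  have hf0 := h.pos x₀ hx₀
  have hb : ∀ n, φ n x₀ / f x₀ ∈ Icc (-(Real.sqrt C / f x₀)) (Real.sqrt C / f x₀) := fun n => by
    have h1 : |φ n x₀| ≤ Real.sqrt C := Real.abs_le_sqrt (hC n x₀)
    rw [mem_Icc, ← abs_le, abs_div, abs_of_pos hf0]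
    gcongr
  obtain ⟨γ, -, σ, hσ, hlim⟩ := isCompact_Icc.tendsto_subseq hb
  refine ⟨γ, σ, hσ, fun x hx => ?_⟩
  have h1 := (h.tendsto_quotient_sub (hφ.subseq hσ) hx₀ hx).add hlim
  rw [zero_add] at h1
  refine (h1.mul_const (f x)).congr fun n => ?_
  have := (h.pos x hx).ne'
  simp only [Function.comp]
  rw [sub_add_cancel, div_mul_cancel₀ _ this]

end PositiveSolution

end GroundState

/-! ### Existence and uniqueness of the positive minimizer. -/

namespace GroundState

variable {V W : ℝ → ℝ} {a t : EReal} {E B C γ : ℝ} {f v w : ℝ → ℝ} {φ : ℕ → ℝ → ℝ}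

/-- The parallelogram law for a weighted square. The factors `1` and `-1` match the form of
`IsTest.add_const_mul`. -/
lemma integral_add_sq_add_sub_sq {α : Type*} [MeasurableSpace α] {μ : Measure α} {f g W : α → ℝ}
    (hf : Integrable (fun x => W x * f x ^ 2) μ) (hg : Integrable (fun x => W x * g x ^ 2) μ)
    (hfg : Integrable (fun x => W x * (f x * g x)) μ) :
    (∫ x, W x * (f x + 1 * g x) ^ 2 ∂μ) + ∫ x, W x * (f x + -1 * g x) ^ 2 ∂μ =
      2 * (∫ x, W x * f x ^ 2 ∂μ) + 2 * ∫ x, W x * g x ^ 2 ∂μ := by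
  have e1 : ∀ x, W x * (f x + 1 * g x) ^ 2 =
    W x * f x ^ 2 + W x * g x ^ 2 + 2 * (W x * (f x * g x)) := fun x => by ring
  have e2 : ∀ x, W x * (f x + -1 * g x) ^ 2 =
    W x * f x ^ 2 + W x * g x ^ 2 - 2 * (W x * (f x * g x)) := fun x => by ring
  have hs : Integrable (fun x => W x * f x ^ 2 + W x * g x ^ 2) μ := hf.add hg
  simp only [e1, e2]
  rw [integral_add hs (hfg.const_mul 2), integral_sub hs (hfg.const_mul 2), integral_add hf hg]
  ring

lemma IsTest.integral_eq {χ : ℝ → ℝ} (h : IsTest (interval a t) χ)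
    (hV : ContinuousOn V (interval a t)) :
    energy V a t χ (deriv χ) =
      (∫ x in interval a t, deriv χ x ^ 2) + ∫ x in interval a t, V x * χ x ^ 2 :=
  integral_add h.integrableOn_deriv_sq (h.integrableOn_mul_sq (measurableSet_interval _ _) hV)

lemma IsTest.integral_shift {χ : ℝ → ℝ} (h : IsTest (interval a t) χ)
    (hV : ContinuousOn V (interval a t)) (r : ℝ) :
    ∫ x in interval a t, (V x + r) * χ x ^ 2 =
      (∫ x in interval a t, V x * χ x ^ 2) + r * ∫ x in interval a t, χ x ^ 2 := by
  simp only [add_mul]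
  rw [integral_add (h.integrableOn_mul_sq (measurableSet_interval _ _) hV)
    (h.integrableOn_sq.const_mul r), integral_const_mul]

lemma isMinimizing_of_le (hV : ContinuousOn V (interval a t))
    (hE : (E : EReal) ≤ groundEnergy V a t) (hφ : ∀ n, IsTest (interval a t) (φ n))
    {δ : ℕ → ℝ} (hδ : Tendsto δ atTop (𝓝 0))
    (h1 : ∀ n, energy V a t (φ n) (deriv (φ n)) ≤ E + δ n)
    (h2 : ∀ n, |(∫ x in interval a t, φ n x ^ 2) - 1| ≤ δ n) : IsMinimizing V a t E φ := by
  have hn : Tendsto (fun n => ∫ x in interval a t, φ n x ^ 2) atTop (𝓝 1) := by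
    have := squeeze_zero_norm (fun n => by rw [Real.norm_eq_abs]; exact h2 n) hδ
    simpa using this.add_const 1
  refine ⟨hφ, tendsto_of_tendsto_of_tendsto_of_le_of_le (g := fun n => E * ∫ x in interval a t,
    φ n x ^ 2) (h := fun n => E + δ n) ?_ ?_ (fun n => ?_) h1, hn⟩
  · simpa using hn.const_mul E
  · simpa using hδ.const_add E
  · exact mul_le_of_le_groundEnergy hV hE (hφ n).contDiff_one (hφ n).2.1 (hφ n).2.2

lemma exists_isMinimizing (hV : ContinuousOn V (interval a t))
    (hE : groundEnergy V a t = E) : ∃ φ, IsMinimizing V a t E φ := by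
  have key : ∀ n : ℕ, ∃ φ, IsTest (interval a t) φ ∧
      energy V a t φ (deriv φ) ≤ E + 2 / ((n : ℝ) + 1) ∧
      |(∫ x in interval a t, φ x ^ 2) - 1| ≤ 2 / ((n : ℝ) + 1) := by
    intro n
    have hn : 0 < 1 / ((n : ℝ) + 1) := by positivity
    have hlt : groundEnergy V a t < ((E + 1 / ((n : ℝ) + 1) : ℝ) : EReal) := by
      rw [hE, EReal.coe_lt_coe_iff]; linarith
    obtain ⟨e, ⟨u, g, hug, rfl⟩, he⟩ := sInf_lt_iff.1 hlt
    obtain ⟨w, -, hw⟩ := exists_test_approx (measurableSet_interval a t) hV hug.1 hug.2.1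
    obtain ⟨φ, hφ, -, h1, h2⟩ := hw _ hn
    rw [EReal.coe_lt_coe_iff] at he
    rw [hug.2.2] at h2
    have e2 : 2 / ((n : ℝ) + 1) = 1 / ((n : ℝ) + 1) + 1 / ((n : ℝ) + 1) := by ring
    refine ⟨φ, hφ, ?_, by linarith⟩
    unfold energy at he ⊢
    linarith
  choose φ hφ h1 h2 using key
  refine ⟨φ, isMinimizing_of_le hV hE.ge hφ (δ := fun n => 2 / ((n : ℝ) + 1)) ?_ h1 h2⟩
  have := (tendsto_one_div_add_atTop_nhds_zero_nat (𝕜 := ℝ)).const_mul 2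
  simpa [div_eq_mul_inv] using this

/-- This brings uniqueness within reach of the compactness argument: any minimizer is, up to a null
set, the pointwise limit of a minimizing sequence of test functions. -/
lemma exists_isMinimizing_of_admissible (hV : ContinuousOn V (interval a t))
    (hE : groundEnergy V a t = E) {u g : ℝ → ℝ} (hug : Admissible V a t u g)
    (he : (energy V a t u g : EReal) = groundEnergy V a t) :
    ∃ φ w, IsMinimizing V a t E φ ∧ w =ᵐ[volume.restrict (interval a t)] u ∧
      ∀ x, Tendsto (fun n => φ n x) atTop (𝓝 (w x)) := by
  obtain ⟨w, hwu, hw⟩ := exists_test_approx (measurableSet_interval a t) hV hug.1 hug.2.1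
  rw [hE, EReal.coe_eq_coe_iff] at he
  have hn : ∀ n : ℕ, 0 < 1 / ((n : ℝ) + 1) := fun n => by positivity
  choose φ hφ h0 h1 h2 using fun n => hw _ (hn n)
  have hδ := tendsto_one_div_add_atTop_nhds_zero_nat (𝕜 := ℝ)
  refine ⟨φ, w, isMinimizing_of_le hV hE.ge hφ hδ (fun n => ?_) (fun n => ?_), hwu, fun x => ?_⟩
  · rw [← he]; exact h1 n
  · have := h2 n
    rwa [hug.2.2] at this
  · have := squeeze_zero_norm (fun n => by rw [Real.norm_eq_abs]; exact h0 n x) hδ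
    simpa using this.add_const (w x)

/-- The shifted energy of a minimizing sequence is bounded. -/
lemma IsMinimizing.exists_bound (hφ : IsMinimizing V a t E φ) (hV : ContinuousOn V (interval a t))
    (hB : ∀ x ∈ interval a t, -B ≤ V x) :
    ∃ C, (∀ n, ∫ x in interval a t, (V x + (B + 1)) * φ n x ^ 2 ≤ C) ∧ ∀ n x, φ n x ^ 2 ≤ C := by
  have hlim := hφ.energy.add (hφ.norm.const_mul (B + 1))
  obtain ⟨C, hC⟩ := hlim.bddAbove_range
  have hC' : ∀ n, GroundState.energy V a t (φ n) (deriv (φ n)) +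
    (B + 1) * ∫ x in interval a t, φ n x ^ 2 ≤ C := fun n => hC ⟨n, rfl⟩
  have hms := measurableSet_interval a t
  have hle : ∀ n, ∫ x in interval a t, φ n x ^ 2 ≤
      ∫ x in interval a t, (V x + (B + 1)) * φ n x ^ 2 := fun n =>
    setIntegral_mono_on (hφ.test n).integrableOn_sq
      ((hφ.test n).integrableOn_mul_sq hms (hV.add continuousOn_const)) hms fun x hx => by
        nlinarith [hB x hx, sq_nonneg (φ n x)]
  have h0 : ∀ n, 0 ≤ ∫ x in interval a t, deriv (φ n) x ^ 2 := fun n =>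
    integral_nonneg fun x => sq_nonneg _
  refine ⟨C, fun n => ?_, fun n x => ?_⟩
  · have := hC' n
    rw [(hφ.test n).integral_eq hV] at this
    rw [(hφ.test n).integral_shift hV]
    linarith [h0 n]
  · have h1 := sq_le_integral_sq_add (hφ.test n).contDiff_one (hφ.test n).2.1 x
    rw [← setIntegral_eq_integral_of_tsupport (hφ.test n).2.2
      (fun x hx => sq_eq_zero_of_notMem_tsupport hx),
      ← setIntegral_eq_integral_of_tsupport (hφ.test n).2.2
      (fun x hx => by rw [deriv_eq_zero_of_notMem_tsupport hx]; norm_num)] at h1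
    have h2 := hle n
    rw [(hφ.test n).integral_shift hV] at h2
    have := hC' n
    rw [(hφ.test n).integral_eq hV] at this
    linarith

/-- A minimizing sequence with a pointwise limit converges in `L²`. -/
lemma IsMinimizing.tendsto_integral_sq {t : ℝ} (hφ : IsMinimizing V a t E φ)
    (hW : ContinuousOn W (interval a t)) (hW1 : ∀ x ∈ interval a t, 1 ≤ W x)
    (htail : ∀ K, ∃ r : ℝ, ∀ x ∈ interval a t, x < r → K ≤ W x)
    (hC : ∀ n, ∫ x in interval a t, W x * φ n x ^ 2 ≤ C) (hC' : ∀ n x, φ n x ^ 2 ≤ C)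
    (hw : ContinuousOn w (interval a t))
    (hlim : ∀ x ∈ interval a t, Tendsto (fun n => φ n x) atTop (𝓝 (w x))) :
    IntegrableOn (fun x => W x * w x ^ 2) (interval a t) ∧
      MemLp w 2 (volume.restrict (interval a t)) ∧
      Tendsto (fun n => ∫ x in interval a t, (φ n x - w x) ^ 2) atTop (𝓝 0) := by
  have hms := measurableSet_interval a (t : EReal)
  have hae : ∀ {p : ℝ → Prop}, (∀ x ∈ interval a t, p x) →
      ∀ᵐ x ∂(volume.restrict (interval a t)), p x :=
    fun hp => (ae_restrict_iff' hms).2 (Eventually.of_forall hp)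
  have hφi : ∀ n, IntegrableOn (fun x => W x * φ n x ^ 2) (interval a t) := fun n =>
    (hφ.test n).integrableOn_mul_sq hms hW
  obtain ⟨hWi, hWC⟩ := integrable_and_integral_le_of_tendsto hφi
    (fun n => hae fun x hx => mul_nonneg (by linarith [hW1 x hx]) (sq_nonneg _))
    (hae fun x hx => ((hlim x hx).pow 2).const_mul (W x)) hC tendsto_const_nhds
  have hwm : AEStronglyMeasurable w (volume.restrict (interval a t)) := hw.aestronglyMeasurable hms
  have hwL : MemLp w 2 (volume.restrict (interval a t)) := by
    refine (memLp_two_iff_integrable_sq hwm).2 (Integrable.mono' hWi (hwm.pow 2)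
      (hae fun x hx => ?_))
    rw [Real.norm_eq_abs, abs_of_nonneg (sq_nonneg _)]
    nlinarith [hW1 x hx, sq_nonneg (w x)]
  refine ⟨hWi, hwL, ?_⟩
  have hC0 : 0 ≤ C := (sq_nonneg _).trans (hC' 0 0)
  have hwC : ∀ x ∈ interval a t, w x ^ 2 ≤ C := fun x hx =>
    le_of_tendsto' ((hlim x hx).pow 2) fun n => hC' n x
  rw [Metric.tendsto_nhds]
  intro ε hε
  -- Where `W ≥ K` the inequality `(φ - w)² ≤ 2 φ² + 2 w²` bounds the tail by `(2 / K)(2 C) ≤ ε /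
  -- 2`.
  set K := 8 * (C + 1) / ε with hK
  have hK0 : 0 < K := by positivity
  obtain ⟨r, hr⟩ := htail K
  -- To the right of `r` the interval is bounded, and the uniform bound `C` on both squares gives
  -- the constant dominating function `4 C`.
  have hind : Tendsto (fun n => ∫ x in interval a t, (Ici r).indicator
      (fun x => (φ n x - w x) ^ 2) x) atTop (𝓝 (∫ x in interval a t, 0)) := by
    refine tendsto_integral_of_dominated_convergence ((Ici r).indicator fun _ => 4 * C)
      (fun n => (((hφ.test n).memLp _).1.sub hwm |>.pow 2).indicator measurableSet_Ici) ?_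
      (fun n => hae fun x hx => ?_) (hae fun x hx => ?_)
    · rw [integrable_indicator_iff measurableSet_Ici, IntegrableOn,
        Measure.restrict_restrict measurableSet_Ici]
      refine (integrableOn_const (s := Icc r t) (by simp) enorm_ne_top).mono_set fun x hx => ?_
      exact ⟨hx.1, (EReal.coe_lt_coe_iff.1 hx.2.2).le⟩
    · by_cases hxr : x ∈ Ici r
      · rw [indicator_of_mem hxr, indicator_of_mem hxr, Real.norm_eq_abs,
          abs_of_nonneg (sq_nonneg _)]
        nlinarith [hC' n x, hwC x hx, sq_nonneg (φ n x + w x)]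
      · rw [indicator_of_notMem hxr, indicator_of_notMem hxr, norm_zero]
    · by_cases hxr : x ∈ Ici r
      · simp only [indicator_of_mem hxr]
        have := ((hlim x hx).sub_const (w x)).pow 2
        simpa using this
      · simp only [indicator_of_notMem hxr, tendsto_const_nhds]
  rw [integral_zero] at hind
  filter_upwards [hind.eventually (gt_mem_nhds (half_pos hε))] with n hn
  rw [Real.dist_eq, sub_zero, abs_of_nonneg (integral_nonneg fun x => sq_nonneg _)]
  have hdL : MemLp (fun x => φ n x - w x) 2 (volume.restrict (interval a t)) :=
    ((hφ.test n).memLp _).sub hwL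
  have hsum : IntegrableOn (fun x => 2 / K * (W x * φ n x ^ 2 + W x * w x ^ 2)) (interval a t) :=
    ((hφi n).add hWi).const_mul _
  have hle : ∫ x in interval a t, (φ n x - w x) ^ 2 ≤ ∫ x in interval a t,
      (2 / K * (W x * φ n x ^ 2 + W x * w x ^ 2) +
        (Ici r).indicator (fun x => (φ n x - w x) ^ 2) x) := by
    refine setIntegral_mono_on hdL.integrable_sq
      (hsum.add (hdL.integrable_sq.indicator measurableSet_Ici)) hms fun x hx => ?_
    have hWx := hW1 x hx
    by_cases hxr : x ∈ Ici r
    · rw [indicator_of_mem hxr]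
      have : 0 ≤ 2 / K * (W x * φ n x ^ 2 + W x * w x ^ 2) := by
        have : 0 ≤ W x := by linarith
        positivity
      linarith
    · rw [indicator_of_notMem hxr, add_zero]
      have h1 := hr x hx (not_le.1 hxr)
      have h2 : K * (φ n x ^ 2 + w x ^ 2) ≤ W x * φ n x ^ 2 + W x * w x ^ 2 := by
        rw [← mul_add]; exact mul_le_mul_of_nonneg_right h1 (by positivity)
      have h3 : φ n x ^ 2 + w x ^ 2 ≤ (W x * φ n x ^ 2 + W x * w x ^ 2) / K := by
        rw [le_div_iff₀ hK0]; linarith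
      rw [div_mul_eq_mul_div, mul_div_assoc]
      nlinarith [sq_nonneg (φ n x + w x)]
  rw [integral_add hsum (hdL.integrable_sq.indicator measurableSet_Ici), integral_const_mul,
    integral_add (hφi n) hWi] at hle
  have h4 : 2 / K * ((∫ x in interval a t, W x * φ n x ^ 2) + ∫ x in interval a t, W x * w x ^ 2) ≤
      2 / K * (2 * C) := mul_le_mul_of_nonneg_left (by linarith [hC n]) (by positivity)
  have h5 : 2 / K * (2 * C) ≤ ε / 2 := by
    rw [hK]; field_simp; nlinarith
  linarith

namespace PositiveSolution

/-- The limit of a minimizing sequence is a minimizer. -/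
lemma limit {t : ℝ} (h : PositiveSolution V a t E f v) (hE : (E : EReal) ≤ groundEnergy V a t)
    (hφ : IsMinimizing V a t E φ) (hB : ∀ x ∈ interval a t, -B ≤ V x)
    (htail : ∀ K, ∃ r : ℝ, ∀ x ∈ interval a t, x < r → K ≤ V x)
    (hlim : ∀ x ∈ interval a t, Tendsto (fun n => φ n x) atTop (𝓝 (γ * f x))) :
    Admissible V a t (fun x => γ * f x) (fun x => γ * v x) ∧
      energy V a t (fun x => γ * f x) (fun x => γ * v x) = E := by
  have hms := measurableSet_interval a (t : EReal)
  have hae : ∀ {p : ℝ → Prop}, (∀ x ∈ interval a t, p x) →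
      ∀ᵐ x ∂(volume.restrict (interval a t)), p x :=
    fun hp => (ae_restrict_iff' hms).2 (Eventually.of_forall hp)
  obtain ⟨C, hC, hC'⟩ := hφ.exists_bound h.cont hB
  set W : ℝ → ℝ := fun x => V x + (B + 1) with hWd
  have hW : ContinuousOn W (interval a t) := h.cont.add continuousOn_const
  have hW1 : ∀ x ∈ interval a t, 1 ≤ W x := fun x hx => by simp only [hWd]; linarith [hB x hx]
  have htailW : ∀ K, ∃ r : ℝ, ∀ x ∈ interval a t, x < r → K ≤ W x := fun K => by
    obtain ⟨r, hr⟩ := htail (K - (B + 1))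
    exact ⟨r, fun x hx hxr => by simp only [hWd]; linarith [hr x hx hxr]⟩
  -- Along a subsequence `φ' - (v / f) φ → 0` almost everywhere; with `φ → γ f` this identifies the
  -- limit of the derivatives as `γ v`.
  obtain ⟨σ, hσ, hD⟩ : ∃ σ : ℕ → ℕ, StrictMono σ ∧ ∀ᵐ x ∂(volume.restrict (interval a t)),
      Tendsto (fun n => deriv (φ (σ n)) x - v x / f x * φ (σ n) x) atTop (𝓝 0) := by
    have hL := fun n => (hφ.test n).memLp_quotient hms h.continuousOn₁ h.continuousOn₂ h.pos
    refine TendstoInMeasure.exists_seq_tendsto_ae (tendstoInMeasure_of_tendsto_eLpNorm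
      (p := 2) (by norm_num) (fun n => (hL n).1) aestronglyMeasurable_const ?_)
    have := (tendsto_eLpNorm_two_iff hL).2 (h.tendsto_jacobi hφ)
    refine this.congr fun n => congrArg (fun g => eLpNorm g 2 _) ?_
    ext x; simp
  have hφσ := hφ.subseq hσ
  replace hlim : ∀ x ∈ interval a t, Tendsto (fun n => φ (σ n) x) atTop (𝓝 (γ * f x)) :=
    fun x hx => (hlim x hx).comp hσ.tendsto_atTop
  replace hC : ∀ n, ∫ x in interval a t, W x * φ (σ n) x ^ 2 ≤ C := fun n => hC _
  replace hC' : ∀ n x, φ (σ n) x ^ 2 ≤ C := fun n => hC' _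
  generalize hχ : (fun n => φ (σ n)) = χ at hφσ
  have hχn : ∀ n, φ (σ n) = χ n := fun n => congrFun hχ n
  simp only [hχn] at hD hlim hC hC'
  set w : ℝ → ℝ := fun x => γ * f x with hwd
  have hwc : ContinuousOn w (interval a t) := continuousOn_const.mul h.continuousOn₁
  obtain ⟨hWi, hwL, he⟩ := hφσ.tendsto_integral_sq hW hW1 htailW hC hC' hwc hlim
  have hder : ∀ᵐ x ∂(volume.restrict (interval a t)),
      Tendsto (fun n => deriv (χ n) x) atTop (𝓝 (γ * v x)) := by
    filter_upwards [hD, hae hlim, ae_restrict_mem hms] with x h1 h2 h3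
    have h4 := h1.add (h2.const_mul (v x / f x))
    have h5 := (h.pos x h3).ne'
    have e : 0 + v x / f x * w x = γ * v x := by simp only [hwd]; field_simp; ring
    rw [e] at h4
    exact h4.congr fun n => sub_add_cancel _ _
  have hdi : ∀ n m, IsTest (interval a t) fun x => χ n x + -1 * χ m x :=
    fun n m => (hφσ.test n).add_const_mul (hφσ.test m) (-1)
  have hsi : ∀ n m, IsTest (interval a t) fun x => χ n x + 1 * χ m x :=
    fun n m => (hφσ.test n).add_const_mul (hφσ.test m) 1
  have hsubL : ∀ n, MemLp (fun x => χ n x - w x) 2 (volume.restrict (interval a t)) :=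
    fun n => ((hφσ.test n).memLp _).sub hwL
  set e : ℕ → ℝ := fun n => ∫ x in interval a t, (χ n x - w x) ^ 2 with hed
  set q : ℕ → ℝ := fun n => energy V a t (χ n) (deriv (χ n)) - E * ∫ x in interval a t, χ n x ^ 2
    with hqd
  have hq0 : Tendsto q atTop (𝓝 0) := by
    have := hφσ.energy.sub (hφσ.norm.const_mul E)
    rwa [mul_one, sub_self] at this
  set D := |E + (B + 1)| with hDd
  set s : ℕ → ℝ := fun n => 2 * q n + 2 * D * e n with hsd
  have hs0 : Tendsto s atTop (𝓝 0) := by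
    simpa using (hq0.const_mul 2).add (he.const_mul (2 * D))
  -- the shifted energy of the differences
  have hN : ∀ n m, ∫ x in interval a t, (deriv (fun x => χ n x + -1 * χ m x) x ^ 2 +
      W x * (χ n x + -1 * χ m x) ^ 2) ≤ s n + s m := by
    intro n m
    have hn := hφσ.test n
    have hm := hφσ.test m
    have e0 : ∫ x in interval a t, (deriv (fun x => χ n x + -1 * χ m x) x ^ 2 +
        W x * (χ n x + -1 * χ m x) ^ 2) =
        energy V a t (fun x => χ n x + -1 * χ m x) (deriv fun x => χ n x + -1 * χ m x) +
        (B + 1) * ∫ x in interval a t, (χ n x + -1 * χ m x) ^ 2 := by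
      rw [integral_add (hdi n m).integrableOn_deriv_sq ((hdi n m).integrableOn_mul_sq hms hW),
        (hdi n m).integral_shift h.cont, (hdi n m).integral_eq h.cont]
      ring
    -- The parallelogram law writes the energy of the difference as twice the sum of the energies
    -- minus the energy of the sum. The latter is bounded below by `E` times its squared norm, which
    -- leaves only the defects `q n`, `q m` and `L²` errors.
    have hlow := mul_le_of_le_groundEnergy h.cont hE (hsi n m).contDiff_one (hsi n m).2.1
      (hsi n m).2.2
    change _ ≤ energy V a t (fun x => χ n x + 1 * χ m x) (deriv fun x => χ n x + 1 * χ m x) at hlow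
    have hp1 := integral_add_sq_add_sub_sq (μ := volume.restrict (interval a t)) (W := fun _ => 1)
      (f := deriv (χ n)) (g := deriv (χ m)) (by simp only [one_mul]; exact hn.integrableOn_deriv_sq)
      (by simp only [one_mul]; exact hm.integrableOn_deriv_sq)
      (by simp only [one_mul]; exact (hn.memLp_deriv _).integrable_mul (hm.memLp_deriv _))
    have hp2 := integral_add_sq_add_sub_sq (μ := volume.restrict (interval a t)) (W := V)
      (f := χ n) (g := χ m) (hn.integrableOn_mul_sq hms h.cont) (hm.integrableOn_mul_sq hms h.cont)
      (hn.integrableOn_mul hms h.cont (hn.1.continuous.mul hm.1.continuous) fun x hx => by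
        rw [image_eq_zero_of_notMem_tsupport hx, zero_mul])
    have hp3 := integral_add_sq_add_sub_sq (μ := volume.restrict (interval a t)) (W := fun _ => 1)
      (f := χ n) (g := χ m) (by simp only [one_mul]; exact hn.integrableOn_sq)
      (by simp only [one_mul]; exact hm.integrableOn_sq)
      (by simp only [one_mul]; exact (hn.memLp _).integrable_mul (hm.memLp _))
    simp only [one_mul] at hp1 hp3
    have hd1 : ∫ x in interval a t, deriv (fun x => χ n x + 1 * χ m x) x ^ 2 =
        ∫ x in interval a t, (deriv (χ n) x + deriv (χ m) x) ^ 2 := by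
      simp only [hn.deriv_add_const_mul hm]
      simp only [one_mul]
    have hd2 : ∫ x in interval a t, deriv (fun x => χ n x + -1 * χ m x) x ^ 2 =
        ∫ x in interval a t, (deriv (χ n) x + -1 * deriv (χ m) x) ^ 2 := by
      simp only [hn.deriv_add_const_mul hm]
    rw [(hsi n m).integral_eq h.cont, hd1] at hlow
    rw [e0, (hdi n m).integral_eq h.cont, hd2]
    simp only [one_mul] at hlow hp2
    have hsq := integral_sq_sub_le (hn.memLp (interval a t)) (hm.memLp _) hwL
    have hsq' : ∫ x in interval a t, (χ n x + -1 * χ m x) ^ 2 ≤ 2 * e n + 2 * e m := by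
      refine le_trans (le_of_eq ?_) hsq
      refine integral_congr_ae (Eventually.of_forall fun x => ?_)
      simp only; ring
    have hI0 : 0 ≤ ∫ x in interval a t, (χ n x + -1 * χ m x) ^ 2 :=
      integral_nonneg fun x => sq_nonneg _
    have hDD : (E + (B + 1)) * ∫ x in interval a t, (χ n x + -1 * χ m x) ^ 2 ≤
        D * (2 * e n + 2 * e m) :=
      (mul_le_mul_of_nonneg_right (le_abs_self _) hI0).trans
        (mul_le_mul_of_nonneg_left hsq' (abs_nonneg _))
    simp only [hsd, hqd]
    rw [hn.integral_eq h.cont, hm.integral_eq h.cont]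
    linarith [congrArg (fun z => E * z) hp3]
  -- the shifted energy of the difference to the limit
  have hF : ∀ n, IntegrableOn (fun x => (deriv (χ n) x - γ * v x) ^ 2 + W x * (χ n x - w x) ^ 2)
      (interval a t) ∧ ∫ x in interval a t, ((deriv (χ n) x - γ * v x) ^ 2 +
        W x * (χ n x - w x) ^ 2) ≤ s n := by
    intro n
    -- Letting `m → ∞` in `hN` by Fatou compares `χ n` with the limit itself; both the kinetic and
    -- the weighted potential error are then at most `s n`.
    have hlims : Tendsto (fun m => s n + s m) atTop (𝓝 (s n)) := by simpa using hs0.const_add (s n)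
    refine integrable_and_integral_le_of_tendsto (F := fun m x =>
      deriv (fun x => χ n x + -1 * χ m x) x ^ 2 + W x * (χ n x + -1 * χ m x) ^ 2)
      (fun m => by
        exact Integrable.add (hdi n m).integrableOn_deriv_sq ((hdi n m).integrableOn_mul_sq hms hW))
      (fun m => hae fun x hx => ?_) ?_ (hN n) hlims
    · have := hW1 x hx
      have : 0 ≤ W x := by linarith
      simp only [Pi.zero_apply]; positivity
    · filter_upwards [hder, hae hlim] with x h1 h2
      simp only [(hφσ.test n).deriv_add_const_mul (hφσ.test _)]
      have h3 := (((h1.const_mul (-1)).const_add (deriv (χ n) x)).pow 2).add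
        ((((h2.const_mul (-1)).const_add (χ n x)).pow 2).const_mul (W x))
      convert h3 using 2
      ring
  have hgm : AEStronglyMeasurable (fun x => γ * v x) (volume.restrict (interval a t)) :=
    (continuousOn_const.mul h.continuousOn₂).aestronglyMeasurable hms
  have hWnn : ∀ x ∈ interval a t, 0 ≤ W x := fun x hx => by linarith [hW1 x hx]
  have hA : ∀ n, IntegrableOn (fun x => (deriv (χ n) x - γ * v x) ^ 2) (interval a t) ∧
      ∫ x in interval a t, (deriv (χ n) x - γ * v x) ^ 2 ≤ s n := by
    intro n
    have hi : IntegrableOn (fun x => (deriv (χ n) x - γ * v x) ^ 2) (interval a t) := by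
      refine Integrable.mono' (hF n).1 ((((hφσ.test n).memLp_deriv _).1.sub hgm).pow 2)
        (hae fun x hx => ?_)
      have := mul_nonneg (hWnn x hx) (sq_nonneg (χ n x - w x))
      rw [Real.norm_eq_abs, abs_of_nonneg (sq_nonneg _)]
      linarith
    refine ⟨hi, (setIntegral_mono_on hi (hF n).1 hms fun x hx => ?_).trans (hF n).2⟩
    linarith [mul_nonneg (hWnn x hx) (sq_nonneg (χ n x - w x))]
  have hBB : ∀ n, IntegrableOn (fun x => W x * (χ n x - w x) ^ 2) (interval a t) ∧
      ∫ x in interval a t, W x * (χ n x - w x) ^ 2 ≤ s n := by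
    intro n
    have hi : IntegrableOn (fun x => W x * (χ n x - w x) ^ 2) (interval a t) :=
      ((hF n).1.sub (hA n).1).congr (Eventually.of_forall fun x => by
        simp only [Pi.sub_apply]; ring)
    refine ⟨hi, (setIntegral_mono_on hi (hF n).1 hms fun x hx => ?_).trans (hF n).2⟩
    linarith [sq_nonneg (deriv (χ n) x - γ * v x)]
  have hdL : ∀ n, MemLp (fun x => deriv (χ n) x - γ * v x) 2 (volume.restrict (interval a t)) :=
    fun n => (memLp_two_iff_integrable_sq (((hφσ.test n).memLp_deriv _).1.sub hgm)).2 (hA n).1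
  have hgL : MemLp (fun x => γ * v x) 2 (volume.restrict (interval a t)) := by
    have := ((hφσ.test 0).memLp_deriv (interval a t)).sub (hdL 0)
    refine this.ae_eq (Eventually.of_forall fun x => ?_)
    simp
  have hdT : Tendsto (fun n => eLpNorm (fun x => deriv (χ n) x - γ * v x) 2
      (volume.restrict (interval a t))) atTop (𝓝 0) :=
    (tendsto_eLpNorm_two_iff hdL).2 (tendsto_of_tendsto_of_tendsto_of_le_of_le tendsto_const_nhds
      hs0 (fun n => integral_nonneg fun x => sq_nonneg _) fun n => (hA n).2)
  have huT : Tendsto (fun n => eLpNorm (fun x => χ n x - w x) 2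
      (volume.restrict (interval a t))) atTop (𝓝 0) := (tendsto_eLpNorm_two_iff hsubL).2 he
  have hn1 : ∫ x in interval a t, w x ^ 2 = 1 := tendsto_nhds_unique
    (tendsto_integral_sq_of_tendsto_sub (fun n => (hφσ.test n).memLp _) hwL huT) hφσ.norm
  have hn2 := tendsto_integral_sq_of_tendsto_sub (fun n => (hφσ.test n).memLp_deriv (interval a t))
    hgL hdT
  -- the potential part
  have hsqrt : ∀ x ∈ interval a t, ∀ z : ℝ, (Real.sqrt (W x) * z) ^ 2 = W x * z ^ 2 :=
    fun x hx z => by rw [mul_pow, Real.sq_sqrt (hWnn x hx)]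
  have hsm : ∀ z : ℝ → ℝ, AEStronglyMeasurable z (volume.restrict (interval a t)) →
      IntegrableOn (fun x => W x * z x ^ 2) (interval a t) →
      MemLp (fun x => Real.sqrt (W x) * z x) 2 (volume.restrict (interval a t)) := by
    intro z hz hzi
    refine (memLp_two_iff_integrable_sq ((hW.sqrt.aestronglyMeasurable hms).mul hz)).2 ?_
    exact hzi.congr (hae fun x hx => (hsqrt x hx (z x)).symm)
  have hn3 : Tendsto (fun n => ∫ x in interval a t, W x * χ n x ^ 2) atTop
      (𝓝 (∫ x in interval a t, W x * w x ^ 2)) := by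
    have hl := tendsto_integral_sq_of_tendsto_sub
      (fun n => hsm (χ n) ((hφσ.test n).memLp _).1 ((hφσ.test n).integrableOn_mul_sq hms hW))
      (hsm w hwL.1 hWi) (by
        simp only [← mul_sub]
        refine (tendsto_eLpNorm_two_iff fun n => hsm _ (hsubL n).1 (hBB n).1).2 ?_
        refine tendsto_of_tendsto_of_tendsto_of_le_of_le tendsto_const_nhds
          hs0 (fun n => integral_nonneg fun x => sq_nonneg _) fun n => ?_
        refine le_trans (le_of_eq (setIntegral_congr_fun hms fun x hx => ?_)) (hBB n).2
        exact hsqrt x hx _)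
    rw [setIntegral_congr_fun hms fun x hx => hsqrt x hx (w x)] at hl
    refine hl.congr fun n => ?_
    rw [setIntegral_congr_fun hms fun x hx => hsqrt x hx (χ n x)]
  have hVi : IntegrableOn (fun x => V x * w x ^ 2) (interval a t) := by
    refine (hWi.sub (hwL.integrable_sq.const_mul (B + 1))).congr (Eventually.of_forall fun x => ?_)
    simp only [hWd, Pi.sub_apply]; ring
  have hWV : ∫ x in interval a t, W x * w x ^ 2 =
      (∫ x in interval a t, V x * w x ^ 2) + (B + 1) := by
    have : ∀ x, W x * w x ^ 2 = V x * w x ^ 2 + (B + 1) * w x ^ 2 := fun x => by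
      simp only [hWd]; ring
    simp only [this]
    rw [integral_add hVi (hwL.integrable_sq.const_mul _), integral_const_mul, hn1, mul_one]
  refine ⟨⟨⟨hwL, hgL, χ, fun n => hφσ.test n, huT, hdT⟩, hVi, hn1⟩, ?_⟩
  have hen : energy V a t w (fun x => γ * v x) =
      (∫ x in interval a t, (γ * v x) ^ 2) + ∫ x in interval a t, V x * w x ^ 2 :=
    integral_add hgL.integrable_sq hVi
  have hlimE : Tendsto (fun n => energy V a t (χ n) (deriv (χ n))) atTop
      (𝓝 ((∫ x in interval a t, (γ * v x) ^ 2) + (∫ x in interval a t, V x * w x ^ 2))) := by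
    have h6 := (hn2.add hn3).sub (hφσ.norm.const_mul (B + 1))
    rw [hWV] at h6
    have e7 : (∫ x in interval a t, (γ * v x) ^ 2) +
        ((∫ x in interval a t, V x * w x ^ 2) + (B + 1)) - (B + 1) * 1 =
        (∫ x in interval a t, (γ * v x) ^ 2) + ∫ x in interval a t, V x * w x ^ 2 := by ring
    rw [e7] at h6
    refine h6.congr fun n => ?_
    rw [(hφσ.test n).integral_eq h.cont, (hφσ.test n).integral_shift h.cont]
    ring
  rw [hen]
  exact tendsto_nhds_unique hlimE hφσ.energy

/-- There is exactly one positive minimizer. -/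
lemma exists_unique_minimizer {t : ℝ} (h : PositiveSolution V a t E f v)
    (hE : groundEnergy V a t = E) (hB : ∀ x ∈ interval a t, -B ≤ V x)
    (htail : ∀ K, ∃ r : ℝ, ∀ x ∈ interval a t, x < r → K ≤ V x) :
    ∃ u, IsPositiveMinimizer V a t u ∧ ∀ z, IsPositiveMinimizer V a t z →
      z =ᵐ[volume.restrict (interval a t)] u := by
  have hms := measurableSet_interval a (t : EReal)
  have hae : ∀ {p : ℝ → Prop}, (∀ x ∈ interval a t, p x) →
      ∀ᵐ x ∂(volume.restrict (interval a t)), p x :=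
    fun hp => (ae_restrict_iff' hms).2 (Eventually.of_forall hp)
  obtain ⟨φ, hφ⟩ := exists_isMinimizing h.cont hE
  obtain ⟨C, -, hC⟩ := hφ.exists_bound h.cont hB
  obtain ⟨γ, σ, hσ, hlim⟩ := h.exists_subseq hφ hC
  obtain ⟨hadm, hen⟩ := h.limit hE.ge (hφ.subseq hσ) hB htail hlim
  have hγ2 : ∀ γ' : ℝ, ∫ x in interval a t, (γ' * f x) ^ 2 =
      γ' ^ 2 * ∫ x in interval a t, f x ^ 2 := fun γ' => by
    simp only [mul_pow]; rw [integral_const_mul]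
  have hone := hadm.2.2
  rw [hγ2] at hone
  have hγ0 : γ ≠ 0 := by rintro rfl; norm_num at hone
  -- The limit is `γ f` with `γ` of unknown sign; multiplying by the sign makes it positive without
  -- changing norm or energy.
  have hs : (SignType.sign γ : ℝ) * γ = |γ| := sign_mul_self γ
  have hs2 : (SignType.sign γ : ℝ) ^ 2 = 1 := by
    rcases hγ0.lt_or_gt with h1 | h1
    · rw [sign_neg h1]; norm_num
    · rw [sign_pos h1]; norm_num
  set s : ℝ := (SignType.sign γ : ℝ) with hsd
  have e1 : ∀ x, |γ| * f x = s * (γ * f x) := fun x => by rw [← hs]; ring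
  refine ⟨fun x => |γ| * f x, ⟨hae fun x hx => mul_pos (abs_pos.2 hγ0) (h.pos x hx),
    fun x => s * (γ * v x), ⟨?_, ?_, ?_⟩, ?_⟩, fun z hz => ?_⟩
  · simp only [e1]; exact hadm.1.const_mul s
  · refine hadm.2.1.congr (Eventually.of_forall fun x => ?_)
    simp only [mul_pow, sq_abs]
  · rw [hγ2, sq_abs]; exact hone
  · rw [hE, EReal.coe_eq_coe_iff, ← hen]
    unfold energy
    refine integral_congr_ae (Eventually.of_forall fun x => ?_)
    simp only [e1, mul_pow]
    rw [hs2]; ring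
  · obtain ⟨hz0, g, hzg, hzE⟩ := hz
    obtain ⟨χ, w, hχ, hwz, hχw⟩ := exists_isMinimizing_of_admissible h.cont hE hzg hzE
    obtain ⟨C', -, hC'⟩ := hχ.exists_bound h.cont hB
    obtain ⟨γ', τ, hτ, hlim'⟩ := h.exists_subseq hχ hC'
    have hwf : ∀ x ∈ interval a t, w x = γ' * f x := fun x hx =>
      tendsto_nhds_unique ((hχw x).comp hτ.tendsto_atTop) (hlim' x hx)
    have hzf : z =ᵐ[volume.restrict (interval a t)] fun x => γ' * f x :=
      hwz.symm.trans (hae hwf)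
    have hn := hzg.2.2
    have hzf2 : (fun x => z x ^ 2) =ᵐ[volume.restrict (interval a t)]
        fun x => (γ' * f x) ^ 2 := hzf.mono fun x hx => by simp only [hx]
    rw [integral_congr_ae hzf2, hγ2] at hn
    have hF : ∫ x in interval a t, f x ^ 2 ≠ 0 := fun h0 => by rw [h0] at hn; simp at hn
    have hsq : γ' ^ 2 = γ ^ 2 := mul_right_cancel₀ hF (hn.trans hone.symm)
    -- Almost everywhere statements must hold at some actual point, where the sign of `γ'` can be
    -- read off.
    have hvol : (ae (volume.restrict (interval a t))).NeBot := by
      rw [ae_neBot, Ne, Measure.restrict_eq_zero]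
      exact ((isOpen_interval a t).measure_pos volume (exists_real_btw h.lt)).ne'
    obtain ⟨x, h1, h2, h3⟩ := (hz0.and (hzf.and (ae_restrict_mem hms))).exists
    have hγ' : 0 < γ' := by
      rw [h2] at h1
      exact (pos_iff_pos_of_mul_pos h1).2 (h.pos x h3)
    have : γ' = |γ| := by
      rw [← abs_of_pos hγ']; exact (sq_eq_sq_iff_abs_eq_abs _ _).1 hsq
    rw [this] at hzf
    exact hzf

end PositiveSolution

end GroundState

/-! ### Normalized ground states and their behaviour at `a`. -/

namespace GroundState

variable {V : ℝ → ℝ} {a b : EReal}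

/-- A normalized positive solution of `f'' = (V - E) f` on `(a, t)` with `f = 0` at the endpoints
(and `g = f'`). -/
structure Mode (V : ℝ → ℝ) (a : EReal) (t E : ℝ) (f g : ℝ → ℝ) : Prop where
  lt : a < (t : EReal)
  sol : IsSol (fun x => V x - E) (halfInterval a t) f g
  pos : ∀ x ∈ interval a t, 0 < f x
  zero : f t = 0
  tendsto : Tendsto f (atLeft a) (𝓝 0)
  integrable : IntegrableOn (fun x => f x ^ 2) (interval a t)
  norm : ∫ x in interval a t, f x ^ 2 = 1

/-- Normalizing `y R` at the energy `λ(t)` turns Hadamard's quotient into the square of the boundary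
derivative: at `t` the term with `R` vanishes and `g t` is a multiple of `flux / y`. -/
lemma Setting.exists_mode (h : Setting V a b) {t : ℝ} (ht : t ∈ interval a b) :
    ∃ f g, Mode V a t (lam V a t) f g ∧ HasDerivAt (lam V a) (-(g t ^ 2)) t := by
  obtain ⟨t₁, htt, ht₁b⟩ := exists_real_btw ht.2
  have htt' := EReal.coe_lt_coe_iff.1 htt
  have ht₁ : t₁ ∈ regularDomain V a b := interval_subset_regularDomain ⟨ht.1.trans htt, ht₁b⟩
  have htJ : t ∈ halfInterval a t₁ := ⟨ht.1, htt'.le⟩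
  have hJ : halfInterval a t₁ ∈ 𝓝 t := mem_of_superset
    ((isOpen_interval a t₁).mem_nhds ⟨ht.1, htt⟩) interval_subset_halfInterval
  obtain ⟨E, hE⟩ := h.exists_lt_groundEnergy ht₁
  obtain ⟨c, θ, y, v, ϖ, R, S, hF, hM⟩ := h.exists_family ht₁ hE (lam V a t - E)
  have hM' : |lam V a t - E| * θ < 1 := hF.abs_mul_lt (h.lam_sub_pos ht₁ hE htJ).le le_rfl hM
  have hgs := h.ground_state hF ht₁ hE htJ hM
  have hder := (hF.hasDerivWithinAt_lam h.cont ht₁ h.finite hE htJ hM).hasDerivAt hJ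
  have hN := hF.normSq_pos hM' htJ hgs.2
  have hsol := hF.isSol hM'
  rw [add_sub_cancel] at hsol
  set m := lam V a t - E with hm
  set N := Family.normSq a y R m t with hNd
  set α := (Real.sqrt N)⁻¹ with hα
  have hα0 : 0 < α := inv_pos.2 (Real.sqrt_pos.2 hN)
  have hα2 : α ^ 2 * N = 1 := by
    rw [hα, inv_pow, Real.sq_sqrt hN.le, inv_mul_cancel₀ hN.ne']
  have hsub : halfInterval a t ⊆ halfInterval a t₁ := halfInterval_subset htt'.le
  have hsq : ∀ x, (α * (y x * R m x)) ^ 2 = α ^ 2 * (y x ^ 2 * (R m x * R m x)) := fun x => by ring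
  refine ⟨fun x => α * (y x * R m x), fun x => α * (v x * R m x +
    (y x)⁻¹ * Family.flux a y R m x), ⟨ht.1, ⟨?_, fun x hx => ?_, fun x hx => ?_⟩, fun x hx => ?_,
      ?_, ?_, ?_, ?_⟩, ?_⟩
  · exact continuousOn_const.mul (hsol.cont.mono hsub)
  · exact ((hsol.mono hsub).deriv₁ x hx).const_mul α
  · exact (((hsol.mono hsub).deriv₂ x hx).const_mul α).congr_deriv (by ring)
  · exact mul_pos hα0 (mul_pos (hF.pos x (hsub (interval_subset_halfInterval hx))) (hgs.2 x hx))
  · simp only [hgs.1, mul_zero]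
  · obtain ⟨C, hC0, hC⟩ := hF.bound m hM'
    have hl := (hF.weight.tendsto.const_mul C).const_mul α
    rw [mul_zero, mul_zero] at hl
    refine squeeze_zero_norm' ?_ hl
    filter_upwards [eventually_mem_interval ht₁.1] with x hx
    have hxJ := interval_subset_halfInterval hx
    have hy := hF.pos x hxJ
    rw [Real.norm_eq_abs, abs_mul, abs_mul, abs_of_pos hα0, abs_of_pos hy]
    refine mul_le_mul_of_nonneg_left ?_ hα0.le
    linarith [mul_le_mul_of_nonneg_left (hC x hxJ).1 hy.le]
  · simp only [hsq]
    exact ((hF.integrableOn_mul_self hM' hM').mono_set (interval_mono htt.le)).const_mul _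
  · simp only [hsq]
    rw [integral_const_mul]
    exact hα2
  · refine hder.congr_deriv ?_
    have hy := (hF.pos t htJ).ne'
    simp only [hgs.1, mul_zero, zero_add]
    rw [mul_pow, eq_div_of_mul_eq hN.ne' hα2]
    field_simp

namespace Mode

variable {t E : ℝ} {f g : ℝ → ℝ}

lemma hasDerivAt (h : Mode V a t E f g) {x : ℝ} (hx : x ∈ interval a t) : HasDerivAt f (g x) x :=
  h.sol.hasDerivAt (by rwa [interior_halfInterval])

lemma hasDerivAt₂ (h : Mode V a t E f g)
    {x : ℝ} (hx : x ∈ interval a t) : HasDerivAt g ((V x - E) * f x) x :=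
  h.sol.deriv₂ x (by rwa [interior_halfInterval])

lemma continuousOn (h : Mode V a t E f g) : ContinuousOn f (halfInterval a t) := h.sol.continuousOn

lemma exists_slope (h : Mode V a t E f g)
    {z x : ℝ} (hz : z ∈ interval a t) (hx : x ∈ interval a t) (hzx : z < x) :
    ∃ ξ ∈ Ioo z x, g ξ = (f x - f z) / (x - z) :=
  exists_hasDerivAt_eq_slope f g hzx (fun _ hs => (h.hasDerivAt
    (Icc_subset_interval hz hx hs)).continuousAt.continuousWithinAt) fun _ hs => h.hasDerivAt
      (Icc_subset_interval hz hx (Ioo_subset_Icc_self hs))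

lemma exists_deriv_pos (h : Mode V a t E f g)
    {x : ℝ} (hx : x ∈ interval a t) : ∃ ξ ∈ interval a x, 0 < g ξ := by
  have := atLeft_neBot h.lt
  obtain ⟨z, h1, h2⟩ := ((h.tendsto.eventually (gt_mem_nhds (h.pos x hx))).and
    (eventually_mem_interval hx.1)).exists
  have hzx := EReal.coe_lt_coe_iff.1 h2.2
  obtain ⟨ξ, hξ, he⟩ := h.exists_slope ⟨h2.1, h2.2.trans hx.2⟩ hx hzx
  exact ⟨ξ, ⟨h2.1.trans (EReal.coe_lt_coe_iff.2 hξ.1), EReal.coe_lt_coe_iff.2 hξ.2⟩, by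
    rw [he]; exact div_pos (by linarith) (by linarith)⟩

lemma monotoneOn_deriv_add (h : Mode V a t E f g) {B : ℝ} {x₀ : EReal} (hx₀ : x₀ ≤ t)
    (hB : ∀ x ∈ interval a x₀, 0 ≤ (V x - E) * f x + B) :
    MonotoneOn (fun x => g x + B * x) (interval a x₀) := by
  have hsub := interval_mono (a := a) hx₀
  have hd : ∀ x ∈ interval a x₀, HasDerivAt (fun x => g x + B * x) ((V x - E) * f x + B) x :=
    fun x hx => ((h.hasDerivAt₂ (hsub hx)).add ((hasDerivAt_id x).const_mul B)).congr_deriv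
      (by ring)
  refine monotoneOn_of_deriv_nonneg (convex_interval a x₀)
    (fun x hx => (hd x hx).continuousAt.continuousWithinAt)
    (fun x hx => (hd x (interior_subset hx)).differentiableAt.differentiableWithinAt) fun x hx => ?_
  rw [(hd x (interior_subset hx)).deriv]
  exact hB x (interior_subset hx)

/-- The part of the mode near `a`, where a property holds eventually. -/
lemma exists_forall (h : Mode V a t E f g) {P : ℝ → Prop} (hP : ∀ᶠ x in atLeft a, P x) :
    ∃ x₀ : ℝ, x₀ ∈ interval a t ∧ ∀ x ∈ interval a x₀, P x := by
  obtain ⟨x₁, h1, h2⟩ := (eventually_atLeft h.lt).1 hP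
  obtain ⟨x₀, h3, h4⟩ := exists_real_btw (lt_min h1 h.lt)
  exact ⟨x₀, ⟨h3, h4.trans_le (min_le_right _ _)⟩, fun x hx =>
    h2 x ⟨hx.1, hx.2.trans (h4.trans_le (min_le_left _ _))⟩⟩

/-- As `f > 0` tends to zero at `a`, its derivative is positive at points arbitrarily near `a`.
Where `V ≥ E` the derivative increases, so positivity spreads to the right from these points; where
`V ≤ E` it decreases, so positivity at one point spreads to the left. -/
lemma eventually_deriv_pos (h : Mode V a t E f g)
    (hV : (∀ᶠ x in atLeft a, E ≤ V x) ∨ ∀ᶠ x in atLeft a, V x ≤ E) :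
    ∀ᶠ x in atLeft a, 0 < g x := by
  rcases hV with hV | hV
  · obtain ⟨x₀, hx₀, h₀⟩ := h.exists_forall hV
    have hm := h.monotoneOn_deriv_add (B := 0) (x₀ := x₀) hx₀.2.le fun x hx => by
      have := h.pos x ⟨hx.1, hx.2.trans hx₀.2⟩
      have := h₀ x hx
      rw [add_zero]
      exact mul_nonneg (by linarith) (by linarith)
    filter_upwards [eventually_mem_interval hx₀.1] with x hx
    obtain ⟨ξ, hξ, hp⟩ := h.exists_deriv_pos ⟨hx.1, hx.2.trans hx₀.2⟩
    have := hm ⟨hξ.1, hξ.2.trans hx.2⟩ hx (EReal.coe_lt_coe_iff.1 hξ.2).le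
    simp only [zero_mul, add_zero] at this
    linarith
  · obtain ⟨x₀, hx₀, h₀⟩ := h.exists_forall hV
    obtain ⟨ξ, hξ, hp⟩ := h.exists_deriv_pos hx₀
    have hd : ∀ x ∈ interval a x₀, HasDerivAt g ((V x - E) * f x) x := fun x hx =>
      h.hasDerivAt₂ ⟨hx.1, hx.2.trans hx₀.2⟩
    have hanti : AntitoneOn g (interval a x₀) := by
      refine antitoneOn_of_deriv_nonpos (convex_interval _ _)
        (fun x hx => (hd x hx).continuousAt.continuousWithinAt)
        (fun x hx => (hd x (interior_subset hx)).differentiableAt.differentiableWithinAt)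
        fun x hx => ?_
      have hx := interior_subset hx
      rw [(hd x hx).deriv]
      have := h.pos x ⟨hx.1, hx.2.trans hx₀.2⟩
      exact mul_nonpos_of_nonpos_of_nonneg (by linarith [h₀ x hx]) this.le
    filter_upwards [eventually_mem_interval hξ.1] with x hx
    exact hp.trans_le (hanti ⟨hx.1, hx.2.trans hξ.2⟩ hξ (EReal.coe_lt_coe_iff.1 hx.2).le)

/-- Near `a` one has `f ≤ 1`, so `g + B x` is increasing and `g x ≤ g x₁ + B (x₁ - x)`. This is
bounded when `a` is finite or when `B = 0`. -/
lemma eventually_deriv_le (h : Mode V a t E f g)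
    {B : ℝ} (hB0 : 0 ≤ B) (hB : ∀ᶠ x in atLeft a, E - B ≤ V x)
    (hbot : a = ⊥ → B = 0) : ∃ L, 0 < L ∧ ∀ᶠ x in atLeft a, g x ≤ L := by
  obtain ⟨x₀, hx₀, h₀⟩ := h.exists_forall
    (hB.and (h.tendsto.eventually (gt_mem_nhds one_pos)))
  have hm := h.monotoneOn_deriv_add (B := B) (x₀ := x₀) hx₀.2.le fun x hx => by
    have h1 := h.pos x ⟨hx.1, hx.2.trans hx₀.2⟩
    have h2 := h₀ x hx
    nlinarith [mul_nonneg (by linarith [h2.1] : 0 ≤ V x - E + B) h1.le]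
  obtain ⟨x₁, hx₁⟩ := exists_real_btw hx₀.1
  have key : ∀ x ∈ interval a x₁, g x ≤ g x₁ + B * (x₁ - x) := fun x hx => by
    have := hm ⟨hx.1, hx.2.trans hx₁.2⟩ hx₁ (EReal.coe_lt_coe_iff.1 hx.2).le
    simp only at this
    linarith
  have hI := eventually_mem_interval hx₁.1
  induction a with
  | bot =>
    refine ⟨|g x₁| + 1, by positivity, hI.mono fun x hx => ?_⟩
    have := key x hx
    rw [hbot rfl, zero_mul, add_zero] at this
    linarith [le_abs_self (g x₁)]
  | coe α =>
    refine ⟨|g x₁| + B * |x₁ - α| + 1, by positivity, hI.mono fun x hx => ?_⟩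
    have h1 := EReal.coe_lt_coe_iff.1 hx.1
    have h2 := key x hx
    have h3 := mul_le_mul_of_nonneg_left (by linarith [le_abs_self (x₁ - α)] :
      x₁ - x ≤ |x₁ - α|) hB0
    linarith [le_abs_self (g x₁)]
  | top => exact absurd h.lt not_top_lt

end Mode

/-- Since `g` increases near `-∞`, `g x` is at most a mean slope over `[x, x + 1]`, hence at most `f
(x + 1)`. -/
lemma Mode.tendsto_deriv_zero {t E : ℝ} {f g : ℝ → ℝ} (h : Mode V ⊥ t E f g)
    (hV : ∀ᶠ x in atLeft ⊥, E ≤ V x) : Tendsto g (atLeft ⊥) (𝓝 0) := by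
  obtain ⟨x₀, hx₀, h₀⟩ := h.exists_forall hV
  have hm := h.monotoneOn_deriv_add (B := 0) (x₀ := x₀) hx₀.2.le fun x hx => by
    have := h.pos x ⟨hx.1, hx.2.trans hx₀.2⟩
    have := h₀ x hx
    rw [add_zero]
    exact mul_nonneg (by linarith) (by linarith)
  simp only [zero_mul, add_zero] at hm
  have hlim : Tendsto (fun x => f (x + 1)) (atLeft ⊥) (𝓝 0) := by
    have h1 := h.tendsto
    rw [atLeft_bot] at h1 ⊢
    exact h1.comp (tendsto_atBot_add_const_right _ 1 tendsto_id)
  refine squeeze_zero' ((h.eventually_deriv_pos (Or.inl hV)).mono fun x hx => hx.le) ?_ hlim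
  filter_upwards [eventually_mem_interval (EReal.bot_lt_coe (x₀ - 1))] with x hx
  have hx0 : x + 1 < x₀ := by linarith [EReal.coe_lt_coe_iff.1 hx.2]
  have m1 : x + 1 ∈ interval ⊥ x₀ := ⟨EReal.bot_lt_coe _, EReal.coe_lt_coe_iff.2 hx0⟩
  have m0 : x ∈ interval ⊥ x₀ := ⟨EReal.bot_lt_coe _, EReal.coe_lt_coe_iff.2 (by linarith)⟩
  have hsub := interval_mono (a := ⊥) hx₀.2.le
  obtain ⟨ξ, hξ, he⟩ := h.exists_slope (hsub m0) (hsub m1) (by linarith)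
  have h2 := hm m0 (Icc_subset_interval m0 m1 (Ioo_subset_Icc_self hξ)) hξ.1.le
  simp only [he] at h2
  have h3 := h.pos x (hsub m0)
  have e : x + 1 - x = 1 := by ring
  rw [e, div_one] at h2
  linarith

end GroundState

/-! ### Comparison of two ground states. -/

namespace GroundState

variable {V : ℝ → ℝ} {a b : EReal} {s t D E : ℝ} {h k f g : ℝ → ℝ}

/-- Two modes on `(a, s) ⊂ (a, t)`, with derivatives which are controlled at `a`. -/
structure ModePair (V : ℝ → ℝ) (a : EReal) (s t D E : ℝ) (h k f g : ℝ → ℝ) : Prop where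
  fst : Mode V a s D h k
  snd : Mode V a t E f g
  lt : s < t
  energy_lt : E < D
  bound : ∃ L, 0 < L ∧ ∀ᶠ x in atLeft a, (0 < k x ∧ k x ≤ L) ∧ 0 < g x ∧ g x ≤ L
  tendsto : a = ⊥ → Tendsto k (atLeft a) (𝓝 0) ∧ Tendsto g (atLeft a) (𝓝 0)

namespace ModePair

lemma interval_subset (P : ModePair V a s t D E h k f g) :
    interval a s ⊆ interval a t := interval_subset_of_le P.lt.le

lemma mem (P : ModePair V a s t D E h k f g) :
    s ∈ interval a t := ⟨P.fst.lt, EReal.coe_lt_coe_iff.2 P.lt⟩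

lemma tendsto_wronskian (P : ModePair V a s t D E h k f g) :
    Tendsto (fun x => h x * g x - k x * f x) (atLeft a) (𝓝 0) := by
  obtain ⟨L, hL, hb⟩ := P.bound
  have hl := (P.fst.tendsto.add P.snd.tendsto).const_mul L
  rw [add_zero, mul_zero] at hl
  refine squeeze_zero_norm' ?_ hl
  filter_upwards [hb, eventually_mem_interval P.fst.lt] with x hx hI
  have h1 := P.fst.pos x hI
  have h2 := P.snd.pos x (P.interval_subset hI)
  rw [Real.norm_eq_abs, abs_le]
  have := mul_nonneg h1.le hx.2.1.le
  have := mul_nonneg hx.1.1.le h2.le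
  have := mul_le_mul_of_nonneg_left hx.2.2 h1.le
  have := mul_le_mul_of_nonneg_left hx.1.2 h2.le
  have := mul_pos hL h1
  have := mul_pos hL h2
  constructor <;> linarith

lemma hasDerivAt_wronskian (P : ModePair V a s t D E h k f g) {x : ℝ} (hx : x ∈ interval a s) :
    HasDerivAt (fun x => h x * g x - k x * f x) ((D - E) * (h x * f x)) x :=
  (((P.fst.hasDerivAt hx).mul (P.snd.hasDerivAt₂ (P.interval_subset hx))).sub
    ((P.fst.hasDerivAt₂ hx).mul (P.snd.hasDerivAt (P.interval_subset hx)))).congr_deriv (by ring)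

/-- The Wronskian starts from the limit zero at `a` and increases, its derivative being `(D - E) h f
> 0`. -/
lemma wronskian_pos (P : ModePair V a s t D E h k f g)
    {x : ℝ} (hx : x ∈ interval a s) : 0 < h x * g x - k x * f x := by
  have := atLeft_neBot P.fst.lt
  have hm : StrictMonoOn (fun x => h x * g x - k x * f x) (interval a s) := by
    refine strictMonoOn_of_deriv_pos (convex_interval _ _)
      (fun x hx => (P.hasDerivAt_wronskian hx).continuousAt.continuousWithinAt) fun x hx => ?_
    have hx := interior_subset hx
    rw [(P.hasDerivAt_wronskian hx).deriv]
    exact mul_pos (sub_pos.2 P.energy_lt)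
      (mul_pos (P.fst.pos x hx) (P.snd.pos x (P.interval_subset hx)))
  obtain ⟨z, hz⟩ := exists_real_btw hx.1
  have hzI : z ∈ interval a s := ⟨hz.1, hz.2.trans hx.2⟩
  refine lt_of_le_of_lt (le_of_tendsto P.tendsto_wronskian ?_)
    (hm hzI hx (EReal.coe_lt_coe_iff.1 hz.2))
  filter_upwards [eventually_mem_interval hz.1] with w hw
  exact (hm ⟨hw.1, hw.2.trans hzI.2⟩ hzI (EReal.coe_lt_coe_iff.1 hw.2)).le

lemma strictMonoOn_ratio (P : ModePair V a s t D E h k f g) :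
    StrictMonoOn (fun x => f x / h x) (interval a s) := by
  have hd : ∀ x ∈ interval a s,
      HasDerivAt (fun x => f x / h x) ((h x * g x - k x * f x) / h x ^ 2) x := fun x hx =>
    ((P.snd.hasDerivAt (P.interval_subset hx)).div (P.fst.hasDerivAt hx)
      (P.fst.pos x hx).ne').congr_deriv (by ring)
  refine strictMonoOn_of_deriv_pos (convex_interval _ _)
    (fun x hx => (hd x hx).continuousAt.continuousWithinAt) fun x hx => ?_
  have hx := interior_subset hx
  rw [(hd x hx).deriv]
  exact div_pos (P.wronskian_pos hx) (pow_pos (P.fst.pos x hx) 2)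

/-- This allows `g` to be replaced by `(f / h) k` near `a` with an error tending to zero. At `-∞`
the quotient is at most `g`, which vanishes in the limit. At a finite endpoint `h` increases and `f
≤ r h` near `a`, so integrating the derivative `(D - E) h f` bounds the Wronskian by a multiple of
`h²`. -/
lemma tendsto_wronskian_div (P : ModePair V a s t D E h k f g) :
    Tendsto (fun x => (h x * g x - k x * f x) / h x) (atLeft a) (𝓝 0) := by
  have hnn : ∀ᶠ x in atLeft a, 0 ≤ (h x * g x - k x * f x) / h x := by
    filter_upwards [eventually_mem_interval P.fst.lt] with x hx
    exact div_nonneg (P.wronskian_pos hx).le (P.fst.pos x hx).le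
  have hpk : ∀ᶠ x in atLeft a, 0 < k x := by
    obtain ⟨L, hL, hb⟩ := P.bound
    exact hb.mono fun x hx => hx.1.1
  by_cases hab : a = ⊥
  · refine squeeze_zero' hnn ?_ (P.tendsto hab).2
    filter_upwards [eventually_mem_interval P.fst.lt, hpk] with x hx hk
    have h1 := P.fst.pos x hx
    rw [div_le_iff₀ h1]
    linarith [mul_pos hk (P.snd.pos x (P.interval_subset hx))]
  obtain ⟨x₀, hx₀, h₀⟩ := P.fst.exists_forall hpk
  obtain ⟨x₁, hx₁⟩ := exists_real_btw hx₀.1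
  have hsub : interval a x₀ ⊆ interval a s := interval_mono hx₀.2.le
  have hmono : MonotoneOn h (interval a x₀) := by
    refine monotoneOn_of_deriv_nonneg (convex_interval _ _)
      (fun x hx => (P.fst.hasDerivAt (hsub hx)).continuousAt.continuousWithinAt)
      (fun x hx => (P.fst.hasDerivAt
        (hsub (interior_subset hx))).differentiableAt.differentiableWithinAt) fun x hx => ?_
    rw [(P.fst.hasDerivAt (hsub (interior_subset hx))).deriv]
    exact (h₀ x (interior_subset hx)).le
  obtain ⟨α, hα⟩ : ∃ α : ℝ, (α : EReal) = a := by
    induction a with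
    | bot => exact absurd rfl hab
    | coe α => exact ⟨α, rfl⟩
    | top => exact absurd P.fst.lt not_top_lt
  set r := f x₁ / h x₁ with hr
  have hrp : 0 < r := div_pos (P.snd.pos _ (P.interval_subset (hsub hx₁))) (P.fst.pos _ (hsub hx₁))
  have hbd : ∀ x ∈ interval a x₁, h x * g x - k x * f x ≤
      (D - E) * (r * h x ^ 2) * (x - α) := by
    intro x hx
    have hx' : x ∈ interval a x₀ := ⟨hx.1, hx.2.trans hx₁.2⟩
    have := atLeft_neBot hx.1
    have hC : 0 ≤ (D - E) * (r * h x ^ 2) :=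
      mul_nonneg (sub_nonneg.2 P.energy_lt.le) (mul_nonneg hrp.le (sq_nonneg _))
    have hl : Tendsto (fun z => (D - E) * (r * h x ^ 2) * (x - α) + (h z * g z - k z * f z))
        (atLeft a) (𝓝 ((D - E) * (r * h x ^ 2) * (x - α))) := by
      simpa using P.tendsto_wronskian.const_add ((D - E) * (r * h x ^ 2) * (x - α))
    refine ge_of_tendsto hl ?_
    filter_upwards [eventually_mem_interval hx.1] with z hz
    have hz' : z ∈ interval a x₀ := ⟨hz.1, hz.2.trans hx'.2⟩
    have hzx := EReal.coe_lt_coe_iff.1 hz.2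
    have hI := Icc_subset_interval hz' hx'
    obtain ⟨ξ, hξ, he⟩ := exists_hasDerivAt_eq_slope (fun x => h x * g x - k x * f x)
      (fun x => (D - E) * (h x * f x)) hzx
      (fun w hw => (P.hasDerivAt_wronskian (hsub (hI hw))).continuousAt.continuousWithinAt)
      fun w hw => P.hasDerivAt_wronskian (hsub (hI (Ioo_subset_Icc_self hw)))
    have hξI := hI (Ioo_subset_Icc_self hξ)
    have hh := P.fst.pos ξ (hsub hξI)
    have h1 : f ξ ≤ r * h ξ := by
      have := P.strictMonoOn_ratio.monotoneOn (hsub hξI) (hsub hx₁)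
        (hξ.2.le.trans (EReal.coe_lt_coe_iff.1 hx.2).le)
      exact (div_le_iff₀ hh).1 this
    have h2 : h ξ ≤ h x := hmono hξI hx' hξ.2.le
    have h3 : h ξ * f ξ ≤ r * h x ^ 2 := by
      calc h ξ * f ξ ≤ h ξ * (r * h ξ) := mul_le_mul_of_nonneg_left h1 hh.le
        _ = r * h ξ ^ 2 := by ring
        _ ≤ r * h x ^ 2 := mul_le_mul_of_nonneg_left (pow_le_pow_left₀ hh.le h2 2) hrp.le
    have h4 := mul_le_mul_of_nonneg_left h3 (sub_nonneg.2 P.energy_lt.le)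
    rw [he, div_le_iff₀ (by linarith)] at h4
    have h5 : α < z := by rw [← hα] at hz; exact EReal.coe_lt_coe_iff.1 hz.1
    have h6 := mul_le_mul_of_nonneg_left (by linarith : x - z ≤ x - α) hC
    linarith
  have hl := P.fst.tendsto.const_mul ((D - E) * r * (x₁ - α))
  rw [mul_zero] at hl
  refine squeeze_zero' hnn ?_ hl
  filter_upwards [eventually_mem_interval hx₁.1] with x hx
  have hh := P.fst.pos x (hsub ⟨hx.1, hx.2.trans hx₁.2⟩)
  rw [div_le_iff₀ hh]
  refine (hbd x hx).trans ?_
  have h5 : x - α ≤ x₁ - α := by linarith [EReal.coe_lt_coe_iff.1 hx.2]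
  have h6 : 0 ≤ (D - E) * (r * h x ^ 2) :=
      mul_nonneg (sub_nonneg.2 P.energy_lt.le) (mul_nonneg hrp.le (sq_nonneg _))
  nlinarith [mul_le_mul_of_nonneg_left h5 h6]

lemma intervalIntegrable_sq (P : ModePair V a s t D E h k f g)
    {x z : ℝ} (hx : x ∈ halfInterval a t) (hz : z ∈ halfInterval a t) :
    IntervalIntegrable (fun x => f x ^ 2) volume x z :=
  intervalIntegrable_of_continuousOn ordConnected_halfInterval (P.snd.continuousOn.pow 2) hx hz

/-- Both functions have norm one, but `f` has mass beyond `s`, so `f < h` somewhere; at `s` the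
order is reversed because `h s = 0`. Monotonicity of `f / h` makes the crossing unique. -/
lemma exists_crossing (P : ModePair V a s t D E h k f g) :
    ∃ p ∈ interval a s, (∀ x ∈ interval a p, f x < h x) ∧
    ∀ x, p < x → x < s → h x < f x := by
  have hsJ : s ∈ halfInterval a t := interval_subset_halfInterval P.mem
  have htJ : t ∈ halfInterval a t := ⟨P.snd.lt, le_rfl⟩
  obtain ⟨x₀, hx₀, hlt⟩ : ∃ x₀ ∈ interval a s, f x₀ < h x₀ := by
    by_contra! hcon
    have h1 := setIntegral_interval_add P.snd.integrable hsJ htJ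
    have h2 : 0 < ∫ x in s..t, f x ^ 2 := intervalIntegral.intervalIntegral_pos_of_pos_on
      (P.intervalIntegrable_sq hsJ htJ) (fun x hx => pow_pos (P.snd.pos x
        ⟨P.fst.lt.trans (EReal.coe_lt_coe_iff.2 hx.1), EReal.coe_lt_coe_iff.2 hx.2⟩) 2) P.lt
    have h3 : ∫ x in interval a s, h x ^ 2 ≤ ∫ x in interval a s, f x ^ 2 :=
      setIntegral_mono_on P.fst.integrable (P.snd.integrable.mono_set P.interval_subset)
        (measurableSet_interval _ _) fun x hx =>
          pow_le_pow_left₀ (P.fst.pos x hx).le (hcon x hx) 2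
    rw [P.snd.norm] at h1
    rw [P.fst.norm] at h3
    linarith
  have hx₀s : x₀ < s := EReal.coe_lt_coe_iff.1 hx₀.2
  have hfs := P.snd.pos s P.mem
  have hI : Icc x₀ s ⊆ halfInterval a s :=
    ordConnected_halfInterval.out (interval_subset_halfInterval hx₀) ⟨P.fst.lt, le_rfl⟩
  obtain ⟨p, hp, hp0⟩ : (0 : ℝ) ∈ (fun x => f x - h x) '' Ioo x₀ s := by
    refine intermediate_value_Ioo hx₀s.le ((P.snd.continuousOn.mono (hI.trans
      (halfInterval_subset P.lt.le))).sub (P.fst.continuousOn.mono hI)) ⟨?_, ?_⟩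
    · simp only [Pi.sub_apply]; linarith
    · simp only [Pi.sub_apply, P.fst.zero]; linarith
  have hpI : p ∈ interval a s := ⟨hx₀.1.trans (EReal.coe_lt_coe_iff.2 hp.1),
    EReal.coe_lt_coe_iff.2 hp.2⟩
  have hr : f p / h p = 1 := by
    rw [div_eq_one_iff_eq (P.fst.pos p hpI).ne']
    simp only at hp0
    linarith
  refine ⟨p, hpI, fun x hx => ?_, fun x hpx hxs => ?_⟩
  · have hxI : x ∈ interval a s := ⟨hx.1, hx.2.trans hpI.2⟩
    have := P.strictMonoOn_ratio hxI hpI (EReal.coe_lt_coe_iff.1 hx.2)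
    simp only [hr] at this
    exact (div_lt_one (P.fst.pos x hxI)).1 this
  · have hxI : x ∈ interval a s := ⟨hpI.1.trans (EReal.coe_lt_coe_iff.2 hpx),
      EReal.coe_lt_coe_iff.2 hxs⟩
    have := P.strictMonoOn_ratio hpI hxI hpx
    simp only [hr] at this
    exact (one_lt_div (P.fst.pos x hxI)).1 this

end ModePair

end GroundState

/-! ### Chebyshev's inequality and the virial identity. -/

namespace GroundState

variable {V p : ℝ → ℝ} {a b : EReal} {s t D E : ℝ} {h k f g : ℝ → ℝ}

lemma affineBetween_of_rightDeriv {m : ℝ} {t : EReal} (hat : a < t)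
    (hV : ContinuousOn V (interval a t))
    (hd : ∀ x ∈ interval a t, HasDerivWithinAt V m (Ioi x) x) : AffineBetween V a t := by
  obtain ⟨c, hc⟩ := exists_real_btw hat
  have key : ∀ x ∈ interval a t, ∀ z ∈ interval a t, x ≤ z → V z - m * z = V x - m * x := by
    intro x hx z hz hxz
    have hI := Icc_subset_interval hx hz
    refine constant_of_has_deriv_right_zero (f := fun z => V z - m * z)
      ((hV.mono hI).sub (by fun_prop)) (fun w hw => ?_) z (right_mem_Icc.2 hxz)
    exact (((hd w (hI (Ico_subset_Icc_self hw))).Ici_of_Ioi).sub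
      ((hasDerivWithinAt_id w _).const_mul m)).congr_deriv (by ring)
  refine ⟨m, V c - m * c, fun x hx => ?_⟩
  rcases le_total c x with hcx | hcx
  · linarith [key c hc x hx hcx]
  · linarith [key x hx c hc hcx]

/-- Chebyshev's inequality for a monotone function against one that changes sign once. -/
lemma sub_mul_nonneg_of_crossing {φ : ℝ → ℝ} {q : ℝ} (hp : MonotoneOn p (interval a b))
    (htb : (t : EReal) < b) (hq : q ∈ interval a t)
    (hneg : ∀ x ∈ interval a q, φ x < 0) (hpos : ∀ x, q < x → x < t → 0 < φ x) (ht : φ t = 0)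
    {x : ℝ} (hx : x ∈ halfInterval a t) : 0 ≤ (p x - p q) * φ x := by
  have hqb : q ∈ interval a b := ⟨hq.1, hq.2.trans htb⟩
  have hxb : x ∈ interval a b := ⟨hx.1, (EReal.coe_le_coe_iff.2 hx.2).trans_lt htb⟩
  rcases lt_trichotomy x q with h | h | h
  · exact mul_nonneg_of_nonpos_of_nonpos (by linarith [hp hxb hqb h.le])
      (hneg x ⟨hx.1, EReal.coe_lt_coe_iff.2 h⟩).le
  · rw [h, sub_self, zero_mul]
  · refine mul_nonneg (by linarith [hp hqb hxb h.le]) ?_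
    rcases hx.2.lt_or_eq with h' | h'
    · exact (hpos x h h').le
    · rw [h', ht]

lemma intervalIntegrable_sub_mul {φ : ℝ → ℝ} {c x z : ℝ} (hp : MonotoneOn p (interval a b))
    (hφ : ContinuousOn φ (halfInterval a t)) (htb : (t : EReal) < b)
    (hx : x ∈ halfInterval a t) (hz : z ∈ halfInterval a t) :
    IntervalIntegrable (fun x => (p x - c) * φ x) volume x z := by
  have hI : uIcc x z ⊆ halfInterval a t := ordConnected_halfInterval.uIcc_subset hx hz
  have hpm : MonotoneOn p (uIcc x z) := hp.mono fun w hw =>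
    ⟨(hI hw).1, (EReal.coe_le_coe_iff.2 (hI hw).2).trans_lt htb⟩
  exact (hpm.intervalIntegrable.sub intervalIntegrable_const).mul_continuousOn (hφ.mono hI)

lemma integral_sub_mul_nonneg {φ : ℝ → ℝ} {q : ℝ} (hp : MonotoneOn p (interval a b))
    (htb : (t : EReal) < b) (hq : q ∈ interval a t)
    (hneg : ∀ x ∈ interval a q, φ x < 0) (hpos : ∀ x, q < x → x < t → 0 < φ x) (ht : φ t = 0)
    {x : ℝ} (hx : x ∈ halfInterval a t) : 0 ≤ ∫ z in x..t, (p z - p q) * φ z :=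
  intervalIntegral.integral_nonneg hx.2 fun _ hz => sub_mul_nonneg_of_crossing hp htb hq hneg hpos
    ht ⟨hx.1.trans_le (EReal.coe_le_coe_iff.2 hz.1), hz.2⟩

/-- If `p` is not constant, the nonnegative integrand is strictly positive on a fixed interval `(c,
d)`. Its integral there serves as `η` for all `x` near `a`. -/
lemma exists_pos_le_integral_sub_mul {φ : ℝ → ℝ} {q : ℝ} (hp : MonotoneOn p (interval a b))
    (hφ : ContinuousOn φ (halfInterval a t)) (htb : (t : EReal) < b) (hq : q ∈ interval a t)
    (hneg : ∀ x ∈ interval a q, φ x < 0) (hpos : ∀ x, q < x → x < t → 0 < φ x) (ht : φ t = 0)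
    (hne : ∃ z ∈ interval a t, p z ≠ p q) :
    ∃ η, 0 < η ∧ ∀ᶠ x in atLeft a, η ≤ ∫ z in x..t, (p z - p q) * φ z := by
  have hat : a < (t : EReal) := hq.1.trans hq.2
  have hsub : interval a t ⊆ interval a b := interval_mono htb.le
  obtain ⟨c, d, hc, hcd, hdt, hcd0⟩ : ∃ c d : ℝ, a < (c : EReal) ∧ c < d ∧ d ≤ t ∧
      ∀ x ∈ Ioo c d, 0 < (p x - p q) * φ x := by
    obtain ⟨z, hz, hzq⟩ := hne
    have hzt : z < t := EReal.coe_lt_coe_iff.1 hz.2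
    rcases lt_or_ge z q with h | h
    · obtain ⟨c, hc⟩ := exists_real_btw hz.1
      refine ⟨c, z, hc.1, EReal.coe_lt_coe_iff.1 hc.2, hzt.le, fun x hx => ?_⟩
      have hxa : a < (x : EReal) := hc.1.trans (EReal.coe_lt_coe_iff.2 hx.1)
      have hxt : (x : EReal) < t := EReal.coe_lt_coe_iff.2 (hx.2.trans hzt)
      have h1 := hp (hsub ⟨hxa, hxt⟩) (hsub hz) hx.2.le
      have h2 := (hp (hsub hz) (hsub hq) h.le).lt_of_ne hzq
      exact mul_pos_of_neg_of_neg (by linarith)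
        (hneg x ⟨hxa, EReal.coe_lt_coe_iff.2 (hx.2.trans h)⟩)
    · refine ⟨z, t, hz.1, hzt, le_rfl, fun x hx => ?_⟩
      have h1 := hp (hsub hz) (hsub ⟨hz.1.trans (EReal.coe_lt_coe_iff.2 hx.1),
        EReal.coe_lt_coe_iff.2 hx.2⟩) hx.1.le
      have h2 := (hp (hsub hq) (hsub hz) h).lt_of_ne hzq.symm
      exact mul_pos (by linarith) (hpos x (h.trans_lt hx.1) hx.2)
  have hcJ : c ∈ halfInterval a t := ⟨hc, hcd.le.trans hdt⟩
  have hdJ : d ∈ halfInterval a t := ⟨hc.trans (EReal.coe_lt_coe_iff.2 hcd), hdt⟩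
  refine ⟨_, intervalIntegral.intervalIntegral_pos_of_pos_on
    (intervalIntegrable_sub_mul (c := p q) hp hφ htb hcJ hdJ) hcd0 hcd, ?_⟩
  filter_upwards [eventually_mem_interval hc] with x hx
  have hxc := (EReal.coe_lt_coe_iff.1 hx.2).le
  refine intervalIntegral.integral_mono_interval hxc hcd.le hdt ?_
    (intervalIntegrable_sub_mul hp hφ htb ⟨hx.1, hxc.trans hcJ.2⟩ ⟨hat, le_rfl⟩)
  refine (ae_restrict_iff' measurableSet_Ioc).2 (Eventually.of_forall fun z hz => ?_)
  exact sub_mul_nonneg_of_crossing hp htb hq hneg hpos ht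
    ⟨hx.1.trans (EReal.coe_lt_coe_iff.2 hz.1), hz.2⟩

/-- The conservation law for `f'² - (V - E) f²`. -/
lemma Mode.virial (F : Mode V a t E f g) (hV : ContinuousOn V (interval a b))
    (htb : (t : EReal) < b) (hd : ∀ x ∈ interval a b, HasDerivWithinAt V (p x) (Ioi x) x)
    {x : ℝ} (hx : x ∈ halfInterval a t)
    (hi : IntervalIntegrable (fun x => p x * f x ^ 2) volume x t) :
    g t ^ 2 = g x ^ 2 - (V x - E) * f x ^ 2 - ∫ z in x..t, p z * f z ^ 2 := by
  have hJb : halfInterval a t ⊆ interval a b := fun z hz =>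
    ⟨hz.1, (EReal.coe_le_coe_iff.2 hz.2).trans_lt htb⟩
  have hI : Icc x t ⊆ halfInterval a t := ordConnected_halfInterval.out hx ⟨F.lt, le_rfl⟩
  have key := intervalIntegral.integral_eq_sub_of_hasDeriv_right_of_le hx.2
    (f := fun z => g z ^ 2 - (V z - E) * f z ^ 2) (f' := fun z => -(p z * f z ^ 2))
    (((F.sol.cont.mono hI).pow 2).sub (((hV.mono (hI.trans hJb)).sub continuousOn_const).mul
      ((F.continuousOn.mono hI).pow 2))) (fun z hz => ?_) hi.neg
  · rw [intervalIntegral.integral_neg, F.zero] at key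
    linarith
  · have hz' : z ∈ interval a t := ⟨hx.1.trans (EReal.coe_lt_coe_iff.2 hz.1),
      EReal.coe_lt_coe_iff.2 hz.2⟩
    exact (((F.hasDerivAt₂ hz').hasDerivWithinAt.pow 2).sub
      (((hd z (hJb (interval_subset_halfInterval hz'))).sub_const E).mul
        ((F.hasDerivAt hz').hasDerivWithinAt.pow 2))).congr_deriv (by simp; ring)

namespace ModePair

/-- Because `h s = 0`, the expression `h (min z s)` extends `h` by zero beyond `s`. -/
lemma continuousOn_sq_sub (P : ModePair V a s t D E h k f g) :
    ContinuousOn (fun z => f z ^ 2 - h (min z s) ^ 2) (halfInterval a t) :=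
  (P.snd.continuousOn.pow 2).sub ((P.fst.continuousOn.comp (by fun_prop) fun z hz =>
    ⟨by rcases min_choice z s with e | e <;> rw [e]; exacts [hz.1, P.fst.lt],
      min_le_right _ _⟩).pow 2)

/-- The difference of the two virial identities. Any constant `m` may be subtracted from `V'`, since
both squares have total mass one; what remains of it are the masses on `(a, x)`, which vanish as `x
→ a`. -/
lemma sub_eq (P : ModePair V a s t D E h k f g)
    (hV : ContinuousOn V (interval a b)) (htb : (t : EReal) < b)
    (hd : ∀ x ∈ interval a b, HasDerivWithinAt V (p x) (Ioi x) x)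
    (hi : ∀ x ∈ halfInterval a t, IntervalIntegrable p volume x t) {x : ℝ} (m : ℝ)
    (hx : x ∈ interval a s) :
    k s ^ 2 - g t ^ 2 = (k x ^ 2 - (V x - D) * h x ^ 2) - (g x ^ 2 - (V x - E) * f x ^ 2) +
      (∫ z in x..t, (p z - m) * (f z ^ 2 - h (min z s) ^ 2)) +
      m * ((∫ z in interval a x, h z ^ 2) - ∫ z in interval a x, f z ^ 2) := by
  have htJ : t ∈ halfInterval a t := ⟨P.snd.lt, le_rfl⟩
  have hsJ : s ∈ halfInterval a s := ⟨P.fst.lt, le_rfl⟩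
  have hsJt : s ∈ halfInterval a t := interval_subset_halfInterval P.mem
  have hxJs := interval_subset_halfInterval hx
  have hxJ := interval_subset_halfInterval (P.interval_subset hx)
  have hsb : (s : EReal) < b := (EReal.coe_lt_coe_iff.2 P.lt).trans htb
  have hxs : x ≤ s := (EReal.coe_lt_coe_iff.1 hx.2).le
  set H : ℝ → ℝ := fun z => h (min z s) ^ 2 with hH
  have hHc : ContinuousOn H (halfInterval a t) := by
    have := (P.snd.continuousOn.pow 2).sub P.continuousOn_sq_sub
    refine this.congr fun z hz => ?_
    simp only [hH, Pi.sub_apply, Pi.pow_apply]; ring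
  have hip : ∀ x ∈ halfInterval a t, ∀ z ∈ halfInterval a t, ∀ φ : ℝ → ℝ,
      ContinuousOn φ (halfInterval a t) → IntervalIntegrable (fun w => p w * φ w) volume x z :=
    fun x hx z hz φ hφ => ((hi x hx).trans (hi z hz).symm).mul_continuousOn
      (hφ.mono (ordConnected_halfInterval.uIcc_subset hx hz))
  have hic : ∀ x ∈ halfInterval a t, ∀ z ∈ halfInterval a t, ∀ φ : ℝ → ℝ,
      ContinuousOn φ (halfInterval a t) → IntervalIntegrable φ volume x z :=
    fun x hx z hz φ hφ => intervalIntegrable_of_continuousOn ordConnected_halfInterval hφ hx hz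
  have hfc : ContinuousOn (fun z => f z ^ 2) (halfInterval a t) := P.snd.continuousOn.pow 2
  have e1 : ∀ z ∈ uIcc x s, H z = h z ^ 2 := fun z hz => by
    rw [uIcc_of_le hxs] at hz
    simp only [hH, min_eq_left hz.2]
  have e2 : ∀ z ∈ uIcc s t, H z = 0 := fun z hz => by
    rw [uIcc_of_le P.lt.le] at hz
    simp only [hH, min_eq_right hz.1, P.fst.zero]
    norm_num
  have e3 : ∫ z in x..t, p z * H z = ∫ z in x..s, p z * h z ^ 2 := by
    rw [← intervalIntegral.integral_add_adjacent_intervals (hip x hxJ s hsJt H hHc)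
      (hip s hsJt t htJ H hHc), intervalIntegral.integral_congr (g := fun z => p z * h z ^ 2)
      fun z hz => by simp only [e1 z hz],
      intervalIntegral.integral_congr (a := s) (g := fun z => 0) fun z hz => by
        simp only [e2 z hz, mul_zero]]
    simp
  have e4 : ∫ z in x..t, H z = ∫ z in x..s, h z ^ 2 := by
    rw [← intervalIntegral.integral_add_adjacent_intervals (hic x hxJ s hsJt H hHc)
      (hic s hsJt t htJ H hHc), intervalIntegral.integral_congr (g := fun z => h z ^ 2)
      fun z hz => by simp only [e1 z hz],
      intervalIntegral.integral_congr (a := s) (g := fun z => 0) fun z hz => by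
        simp only [e2 z hz]]
    simp
  have e5 : ∫ z in x..t, (p z - m) * (f z ^ 2 - H z) =
      (∫ z in x..t, p z * f z ^ 2) - (∫ z in x..t, p z * H z) -
        m * ((∫ z in x..t, f z ^ 2) - ∫ z in x..t, H z) := by
    rw [← intervalIntegral.integral_sub (hip x hxJ t htJ _ hfc) (hip x hxJ t htJ _ hHc),
      ← intervalIntegral.integral_sub (hic x hxJ t htJ _ hfc) (hic x hxJ t htJ _ hHc),
      ← intervalIntegral.integral_const_mul, ← intervalIntegral.integral_sub
        ((hip x hxJ t htJ _ hfc).sub (hip x hxJ t htJ _ hHc))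
        (((hic x hxJ t htJ _ hfc).sub (hic x hxJ t htJ _ hHc)).const_mul m)]
    refine intervalIntegral.integral_congr fun z _ => ?_
    ring
  have h1 := P.fst.virial hV hsb hd hxJs (((hip x hxJ s hsJt H hHc)).congr fun z hz => by
    simp only [e1 z (uIoc_subset_uIcc hz)])
  have h2 := P.snd.virial hV htb hd hxJ (hip x hxJ t htJ _ hfc)
  have h3 := setIntegral_interval_add P.snd.integrable hxJ htJ
  have h4 := setIntegral_interval_add P.fst.integrable hxJs hsJ
  rw [P.snd.norm] at h3
  rw [P.fst.norm] at h4
  rw [e5, e3, e4, h1, h2]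
  linear_combination m * (h4 - h3)

/-- `V` may be unbounded at `a`, so the two boundary terms are not estimated separately. With `r = f
/ h` and `w` the Wronskian divided by `h`, one has `f = r h` and `g = r k + w`; the boundary term of
`f` is then `r²` times that of `h`, up to terms tending to zero. Only one boundary term remains,
with the factor `1 - r²`. -/
lemma exists_remainder (P : ModePair V a s t D E h k f g)
    (hV : ContinuousOn V (interval a b)) (htb : (t : EReal) < b)
    (hd : ∀ x ∈ interval a b, HasDerivWithinAt V (p x) (Ioi x) x)
    (hi : ∀ x ∈ halfInterval a t, IntervalIntegrable p volume x t) (m : ℝ) :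
    ∃ e : ℝ → ℝ, Tendsto e (atLeft a) (𝓝 0) ∧ ∀ x ∈ interval a s, k s ^ 2 - g t ^ 2 =
      (1 - (f x / h x) ^ 2) * (k x ^ 2 - (V x - D) * h x ^ 2) +
      (∫ z in x..t, (p z - m) * (f z ^ 2 - h (min z s) ^ 2)) + e x := by
  set w : ℝ → ℝ := fun x => (h x * g x - k x * f x) / h x with hw
  refine ⟨fun x => -2 * (f x / h x * k x * w x) - w x ^ 2 + (D - E) * f x ^ 2 +
    m * ((∫ z in interval a x, h z ^ 2) - ∫ z in interval a x, f z ^ 2), ?_, fun x hx => ?_⟩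
  · have hw0 : Tendsto w (atLeft a) (𝓝 0) := P.tendsto_wronskian_div
    have h1 : Tendsto (fun x => f x / h x * k x * w x) (atLeft a) (𝓝 0) := by
      obtain ⟨q, hq, hlt, -⟩ := P.exists_crossing
      obtain ⟨L, hL, hb⟩ := P.bound
      have hl := hw0.abs.const_mul L
      rw [abs_zero, mul_zero] at hl
      refine squeeze_zero_norm' ?_ hl
      filter_upwards [hb, eventually_mem_interval hq.1] with x hx hxq
      have hxI : x ∈ interval a s := ⟨hxq.1, hxq.2.trans hq.2⟩
      have hh := P.fst.pos x hxI
      have hf := P.snd.pos x (P.interval_subset hxI)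
      have hr : f x / h x ≤ 1 := (div_le_one hh).2 (hlt x hxq).le
      rw [Real.norm_eq_abs, abs_mul, abs_mul, abs_of_pos (div_pos hf hh), abs_of_pos hx.1.1]
      refine mul_le_mul_of_nonneg_right ?_ (abs_nonneg _)
      calc f x / h x * k x ≤ 1 * L := mul_le_mul hr hx.1.2 hx.1.1.le zero_le_one
        _ = L := one_mul L
    have h2 := (((h1.const_mul (-2)).sub (hw0.pow 2)).add
      ((P.snd.tendsto.pow 2).const_mul (D - E))).add
      (((tendsto_setIntegral_interval_zero P.fst.lt P.fst.integrable).sub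
        (tendsto_setIntegral_interval_zero P.snd.lt P.snd.integrable)).const_mul m)
    simpa using h2
  · rw [P.sub_eq hV htb hd hi m hx]
    have hh := (P.fst.pos x hx).ne'
    have hg : g x = w x + f x / h x * k x := by
      simp only [hw]; field_simp; ring
    have hf : f x = f x / h x * h x := by field_simp
    beta_reduce
    generalize ∫ z in x..t, (p z - m) * (f z ^ 2 - h (min z s) ^ 2) = G
    set r := f x / h x
    rw [hg, hf]
    ring

end ModePair

end GroundState

/-! ### Comparison of the boundary derivatives. -/

namespace GroundState

variable {V p : ℝ → ℝ} {a b : EReal} {s t D E : ℝ} {h k f g : ℝ → ℝ}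

/-- If `g² - (V - E) f² ≤ -δ` near `a`, then `(g + δ / L) / f` is increasing there and stays bounded
towards `a`. But `g > 0` and `f → 0` make it tend to infinity. -/
lemma Mode.frequently_neg_lt_virial (F : Mode V a t E f g) {L : ℝ} (hL : 0 < L)
    (hb : ∀ᶠ x in atLeft a, 0 < g x ∧ g x ≤ L) {δ : ℝ} (hδ : 0 < δ) :
    ∃ᶠ x in atLeft a, -δ < g x ^ 2 - (V x - E) * f x ^ 2 := by
  intro hcon
  obtain ⟨x₀, hx₀, h₀⟩ := F.exists_forall (hb.and hcon)
  have hsub := interval_mono (a := a) hx₀.2.le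
  obtain ⟨x₁, hx₁⟩ := exists_real_btw hx₀.1
  have hd : ∀ x ∈ interval a x₀, HasDerivAt (fun x => (g x + δ / L) / f x)
      (((V x - E) * f x ^ 2 - (g x + δ / L) * g x) / f x ^ 2) x := fun x hx =>
    (((F.hasDerivAt₂ (hsub hx)).add_const (δ / L)).div (F.hasDerivAt (hsub hx))
      (F.pos x (hsub hx)).ne').congr_deriv (by ring)
  have hm : MonotoneOn (fun x => (g x + δ / L) / f x) (interval a x₀) := by
    refine monotoneOn_of_deriv_nonneg (convex_interval _ _)
      (fun x hx => (hd x hx).continuousAt.continuousWithinAt)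
      (fun x hx => (hd x (interior_subset hx)).differentiableAt.differentiableWithinAt)
      fun x hx => ?_
    have hx := interior_subset hx
    rw [(hd x hx).deriv]
    refine div_nonneg ?_ (sq_nonneg _)
    obtain ⟨⟨h1, h2⟩, h3⟩ := h₀ x hx
    have h4 : δ / L * g x ≤ δ := by
      rw [div_mul_eq_mul_div, div_le_iff₀ hL]
      exact mul_le_mul_of_nonneg_left h2 hδ.le
    linarith
  have := atLeft_neBot F.lt
  have hΦ : 0 < (g x₁ + δ / L) / f x₁ :=
    div_pos (add_pos (h₀ x₁ hx₁).1.1 (div_pos hδ hL)) (F.pos _ (hsub hx₁))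
  obtain ⟨x, hx, hxf⟩ := ((eventually_mem_interval hx₁.1).and (F.tendsto.eventually
    (gt_mem_nhds (div_pos (div_pos hδ hL) hΦ)))).exists
  have hxI : x ∈ interval a x₀ := ⟨hx.1, hx.2.trans hx₁.2⟩
  have h1 := hm hxI hx₁ (EReal.coe_lt_coe_iff.1 hx.2).le
  simp only at h1
  rw [div_le_iff₀ (F.pos x (hsub hxI))] at h1
  rw [lt_div_iff₀ hΦ] at hxf
  linarith [(h₀ x hxI).1.1]

/-- Gronwall: where `|V - E| ≤ K`, the function `(f² + g²) e^{-(1 + K) x}` decreases, so `f² + g²`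
stays away from zero at a finite endpoint. Since `f → 0`, the term `g²` carries this bound. It
supplies strictness when `V` is affine. -/
lemma Mode.exists_le_virial (F : Mode V a t E f g) (ha : a ≠ ⊥) {K : ℝ}
    (hK : ∀ᶠ x in atLeft a, |V x - E| ≤ K) :
    ∃ η, 0 < η ∧ ∀ᶠ x in atLeft a, η ≤ g x ^ 2 - (V x - E) * f x ^ 2 := by
  obtain ⟨x₀, hx₀, h₀⟩ := F.exists_forall hK
  have hsub := interval_mono (a := a) hx₀.2.le
  obtain ⟨x₁, hx₁⟩ := exists_real_btw hx₀.1
  obtain ⟨α, rfl⟩ : ∃ α : ℝ, (α : EReal) = a := by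
    induction a with
    | bot => exact absurd rfl ha
    | coe α => exact ⟨α, rfl⟩
    | top => exact absurd F.lt not_top_lt
  have hK0 : 0 ≤ K := (abs_nonneg _).trans (h₀ x₁ hx₁)
  have hd : ∀ x ∈ interval α x₀, HasDerivAt
      (fun x => (f x ^ 2 + g x ^ 2) * Real.exp (-((1 + K) * x)))
      ((2 * f x * g x * (1 + (V x - E)) - (1 + K) * (f x ^ 2 + g x ^ 2)) *
        Real.exp (-((1 + K) * x))) x := by
    intro x hx
    refine ((((F.hasDerivAt (hsub hx)).pow 2).add ((F.hasDerivAt₂ (hsub hx)).pow 2)).mul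
      (((hasDerivAt_id x).const_mul (1 + K)).neg.exp)).congr_deriv ?_
    simp
    ring
  have hanti : AntitoneOn (fun x => (f x ^ 2 + g x ^ 2) * Real.exp (-((1 + K) * x)))
      (interval α x₀) := by
    refine antitoneOn_of_deriv_nonpos (convex_interval _ _)
      (fun x hx => (hd x hx).continuousAt.continuousWithinAt)
      (fun x hx => (hd x (interior_subset hx)).differentiableAt.differentiableWithinAt)
      fun x hx => ?_
    have hx := interior_subset hx
    rw [(hd x hx).deriv]
    refine mul_nonpos_of_nonpos_of_nonneg ?_ (Real.exp_pos _).le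
    have h1 := abs_le.1 (h₀ x hx)
    nlinarith [mul_nonneg (by linarith : 0 ≤ 1 + K - (1 + (V x - E))) (sq_nonneg (f x + g x)),
      mul_nonneg (by linarith : 0 ≤ 1 + K + (1 + (V x - E))) (sq_nonneg (f x - g x))]
  set N := (f x₁ ^ 2 + g x₁ ^ 2) * Real.exp (-((1 + K) * x₁)) * Real.exp ((1 + K) * α) with hN
  have hf₁ := F.pos x₁ (hsub hx₁)
  have hNpos : 0 < N := by positivity
  have hNle : ∀ x ∈ interval α x₁, N ≤ f x ^ 2 + g x ^ 2 := by
    intro x hx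
    have h1 := hanti ⟨hx.1, hx.2.trans hx₁.2⟩ hx₁ (EReal.coe_lt_coe_iff.1 hx.2).le
    simp only at h1
    calc N ≤ (f x ^ 2 + g x ^ 2) * Real.exp (-((1 + K) * x)) * Real.exp ((1 + K) * α) :=
          mul_le_mul_of_nonneg_right h1 (Real.exp_pos _).le
      _ = (f x ^ 2 + g x ^ 2) * Real.exp (-((1 + K) * x) + (1 + K) * α) := by
          rw [Real.exp_add, mul_assoc]
      _ ≤ (f x ^ 2 + g x ^ 2) * 1 := by
          refine mul_le_mul_of_nonneg_left (Real.exp_le_one_iff.2 ?_) (by positivity)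
          have := EReal.coe_lt_coe_iff.1 hx.1
          nlinarith
      _ = _ := mul_one _
  refine ⟨N / 2, half_pos hNpos, ?_⟩
  have hf2 : Tendsto (fun x => (1 + K) * f x ^ 2) (atLeft α) (𝓝 0) := by
    simpa using (F.tendsto.pow 2).const_mul (1 + K)
  filter_upwards [eventually_mem_interval hx₁.1, hf2.eventually (gt_mem_nhds (half_pos hNpos))]
    with x hx hfx
  have h1 := hNle x hx
  have h2 := mul_le_mul_of_nonneg_right ((le_abs_self _).trans (h₀ x ⟨hx.1, hx.2.trans hx₁.2⟩))
    (sq_nonneg (f x))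
  linarith

namespace ModePair

lemma eventually_ratio (P : ModePair V a s t D E h k f g)
    {q : ℝ} (hq : q ∈ interval a s) (hlt : ∀ x ∈ interval a q, f x < h x) :
    ∃ κ, 0 < κ ∧ ∀ᶠ x in atLeft a, κ ≤ 1 - (f x / h x) ^ 2 ∧ 1 - (f x / h x) ^ 2 ≤ 1 := by
  obtain ⟨x₁, hx₁⟩ := exists_real_btw hq.1
  have hsub : interval a q ⊆ interval a s := interval_mono hq.2.le
  have hpos : ∀ x ∈ interval a q, 0 < f x / h x := fun x hx =>
    div_pos (P.snd.pos x (P.interval_subset (hsub hx))) (P.fst.pos x (hsub hx))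
  have h1 : f x₁ / h x₁ < 1 := (div_lt_one (P.fst.pos _ (hsub hx₁))).2 (hlt _ hx₁)
  refine ⟨1 - (f x₁ / h x₁) ^ 2, by nlinarith [hpos x₁ hx₁], ?_⟩
  filter_upwards [eventually_mem_interval hx₁.1] with x hx
  have hxq : x ∈ interval a q := ⟨hx.1, hx.2.trans hx₁.2⟩
  have h2 := P.strictMonoOn_ratio (hsub hxq) (hsub hx₁) (EReal.coe_lt_coe_iff.1 hx.2)
  simp only at h2
  have h3 := pow_le_pow_left₀ (hpos x hxq).le h2.le 2
  exact ⟨by linarith, by linarith [sq_nonneg (f x / h x)]⟩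

lemma sq_sub_sq_of_crossing (P : ModePair V a s t D E h k f g) {q : ℝ} (hq : q ∈ interval a s)
    (hlt : ∀ x ∈ interval a q, f x < h x) (hgt : ∀ x, q < x → x < s → h x < f x) :
    q ∈ interval a t ∧ (∀ x ∈ interval a q, f x ^ 2 - h (min x s) ^ 2 < 0) ∧
    (∀ x, q < x → x < t → 0 < f x ^ 2 - h (min x s) ^ 2) ∧ f t ^ 2 - h (min t s) ^ 2 = 0 := by
  refine ⟨P.interval_subset hq, fun x hx => ?_, fun x hqx hxt => ?_, ?_⟩
  · have hxs : x ∈ interval a s := ⟨hx.1, hx.2.trans hq.2⟩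
    rw [min_eq_left (EReal.coe_lt_coe_iff.1 hxs.2).le, sub_neg]
    exact pow_lt_pow_left₀ (hlt x hx) (P.snd.pos x (P.interval_subset hxs)).le two_ne_zero
  · have hxa : a < (x : EReal) := hq.1.trans (EReal.coe_lt_coe_iff.2 hqx)
    rcases lt_or_ge x s with hxs | hxs
    · rw [min_eq_left hxs.le, sub_pos]
      exact pow_lt_pow_left₀ (hgt x hqx hxs)
        (P.fst.pos x ⟨hxa, EReal.coe_lt_coe_iff.2 hxs⟩).le two_ne_zero
    · rw [min_eq_right hxs, P.fst.zero, zero_pow two_ne_zero, sub_zero]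
      exact pow_pos (P.snd.pos x ⟨hxa, EReal.coe_lt_coe_iff.2 hxt⟩) 2
  · rw [min_eq_right P.lt.le, P.fst.zero, P.snd.zero, sub_self]

lemma intervalIntegrable_of_monotoneOn (P : ModePair V a s t D E h k f g)
    (htb : (t : EReal) < b) (hp : MonotoneOn p (interval a b)) :
    ∀ x ∈ halfInterval a t, IntervalIntegrable p volume x t := fun x hx =>
  (hp.mono fun w hw => by
    have hw := (ordConnected_halfInterval.uIcc_subset hx ⟨P.snd.lt, le_rfl⟩) hw
    exact ⟨hw.1, (EReal.coe_le_coe_iff.2 hw.2).trans_lt htb⟩).intervalIntegrable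

/-- In the identity of `exists_remainder` the Chebyshev integral is nonnegative and the boundary
term exceeds `-δ` at points arbitrarily near `a`. Strictness comes from the integral if `V'` is not
constant, and from the boundary term at a finite endpoint if it is. -/
lemma sq_le_sq_of_monotoneOn (P : ModePair V a s t D E h k f g)
    (hV : ContinuousOn V (interval a b)) (htb : (t : EReal) < b)
    (hd : ∀ x ∈ interval a b, HasDerivWithinAt V (p x) (Ioi x) x)
    (hp : MonotoneOn p (interval a b)) : g t ^ 2 ≤ k s ^ 2 ∧
      ((¬ AffineBetween V a t ∨ a ≠ ⊥) → g t ^ 2 < k s ^ 2) := by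
  have hne := atLeft_neBot P.fst.lt
  obtain ⟨q, hq, hlt, hgt⟩ := P.exists_crossing
  obtain ⟨hqt, hneg, hpos, hzero⟩ := P.sq_sub_sq_of_crossing hq hlt hgt
  obtain ⟨e, he, heq⟩ := P.exists_remainder hV htb hd
    (P.intervalIntegrable_of_monotoneOn htb hp) (p q)
  obtain ⟨κ, hκ, hr⟩ := P.eventually_ratio hq hlt
  obtain ⟨L, hL, hb⟩ := P.bound
  set G : ℝ → ℝ := fun x => ∫ z in x..t, (p z - p q) * (f z ^ 2 - h (min z s) ^ 2) with hG
  have hG0 : ∀ᶠ x in atLeft a, 0 ≤ G x := (eventually_mem_interval P.snd.lt).mono fun x hx =>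
    integral_sub_mul_nonneg hp htb hqt hneg hpos hzero (interval_subset_halfInterval hx)
  have key : ∀ η, (∀ᶠ x in atLeft a, η ≤ G x) → η ≤ k s ^ 2 - g t ^ 2 := by
    intro η hη
    refine le_of_forall_pos_le_add fun δ hδ => ?_
    obtain ⟨x, h1, ⟨⟨h2, h3⟩, h4⟩, h5, h6⟩ := ((P.fst.frequently_neg_lt_virial hL
      (hb.mono fun x hx => hx.1) (half_pos hδ)).and_eventually ((hr.and hη).and
      ((he.eventually (lt_mem_nhds (neg_lt_zero.2 (half_pos hδ)))).and
        (eventually_mem_interval P.fst.lt)))).exists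
    have h7 := heq x h6
    have h8 := mul_nonneg (hκ.le.trans h2) (by linarith :
      0 ≤ (k x ^ 2 - (V x - D) * h x ^ 2) + δ / 2)
    have h9 := mul_le_mul_of_nonneg_right h3 (half_pos hδ).le
    simp only [hG] at h4
    linarith
  refine ⟨sub_nonneg.1 (key 0 hG0), fun hna => ?_⟩
  by_cases haff : ∃ z ∈ interval a t, p z ≠ p q
  · obtain ⟨η, hη, hGη⟩ := exists_pos_le_integral_sub_mul hp P.continuousOn_sq_sub htb hqt hneg
      hpos hzero haff
    linarith [key η hGη]
  push Not at haff
  have hsub : interval a t ⊆ interval a b := interval_mono htb.le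
  -- Here `V'` is constant, so `V` is affine on `(a, t)`; the hypothesis then leaves only finite
  -- `a`, where `V` is bounded near `a` and `Mode.exists_le_virial` applies.
  have hA := affineBetween_of_rightDeriv P.snd.lt (hV.mono hsub) fun x hx =>
    (haff x hx) ▸ hd x (hsub hx)
  have ha : a ≠ ⊥ := hna.resolve_left (not_not_intro hA)
  obtain ⟨K, hK⟩ : ∃ K, ∀ᶠ x in atLeft a, |V x - D| ≤ K := by
    obtain ⟨m, r, hA⟩ := hA
    induction a with
    | bot => exact absurd rfl ha
    | coe α =>
      refine ⟨|m| * (|α| + |t|) + |r - D|, (eventually_mem_interval P.snd.lt).mono fun x hx => ?_⟩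
      rw [hA x hx, add_sub_assoc]
      refine (abs_add_le _ _).trans (add_le_add_left ?_ _)
      rw [abs_mul]
      refine mul_le_mul_of_nonneg_left ?_ (abs_nonneg _)
      have h1 := EReal.coe_lt_coe_iff.1 hx.1
      have h2 := EReal.coe_lt_coe_iff.1 hx.2
      rw [abs_le]
      constructor <;> linarith [neg_abs_le α, le_abs_self t, abs_nonneg α, abs_nonneg t]
    | top => exact absurd P.snd.lt not_top_lt
  obtain ⟨η, hη, hQ⟩ := P.fst.exists_le_virial ha hK
  obtain ⟨x, ⟨⟨⟨h2, h3⟩, h4⟩, h5⟩, h1, h6⟩ := (((hr.and hG0).and hQ).and ((he.eventually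
    (lt_mem_nhds (neg_lt_zero.2 (mul_pos hκ hη)))).and (eventually_mem_interval P.fst.lt))).exists
  have h7 := heq x h6
  have h8 := mul_le_mul h2 h5 hη.le (hκ.le.trans h2)
  simp only [hG] at h4
  linarith

/-- With `V'` decreasing the Chebyshev integral changes sign. At `-∞` the boundary term also has the
favourable direction: it is at most `k²`, which tends to zero, because `V ≥ D` there. -/
lemma sq_le_sq_of_antitoneOn (P : ModePair V a s t D E h k f g)
    (hV : ContinuousOn V (interval a b)) (htb : (t : EReal) < b)
    (hd : ∀ x ∈ interval a b, HasDerivWithinAt V (p x) (Ioi x) x)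
    (hp : AntitoneOn p (interval a b)) (ha : a = ⊥) (hVD : ∀ᶠ x in atLeft a, D ≤ V x) :
    k s ^ 2 ≤ g t ^ 2 ∧ (¬ AffineBetween V a t → k s ^ 2 < g t ^ 2) := by
  have hne := atLeft_neBot P.fst.lt
  obtain ⟨q, hq, hlt, hgt⟩ := P.exists_crossing
  obtain ⟨hqt, hneg, hpos, hzero⟩ := P.sq_sub_sq_of_crossing hq hlt hgt
  have hp' : MonotoneOn (fun x => -p x) (interval a b) := hp.neg
  have hi : ∀ x ∈ halfInterval a t, IntervalIntegrable p volume x t := fun x hx => by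
    have e : p = -fun x => -p x := by funext z; simp
    rw [e]
    exact (P.intervalIntegrable_of_monotoneOn htb hp' x hx).neg
  obtain ⟨e, he, heq⟩ := P.exists_remainder hV htb hd hi (p q)
  obtain ⟨κ, hκ, hr⟩ := P.eventually_ratio hq hlt
  set G : ℝ → ℝ := fun x => ∫ z in x..t, (-p z - -p q) * (f z ^ 2 - h (min z s) ^ 2) with hG
  have hGn : ∀ x, ∫ z in x..t, (p z - p q) * (f z ^ 2 - h (min z s) ^ 2) = -G x := fun x => by
    rw [hG, ← intervalIntegral.integral_neg]
    exact intervalIntegral.integral_congr fun z _ => by ring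
  have hk : Tendsto (fun x => k x ^ 2) (atLeft a) (𝓝 0) := by
    simpa using (P.tendsto ha).1.pow 2
  have key : ∀ η, (∀ᶠ x in atLeft a, η ≤ G x) → η ≤ g t ^ 2 - k s ^ 2 := by
    intro η hη
    refine le_of_forall_pos_le_add fun δ hδ => ?_
    obtain ⟨x, ⟨⟨⟨h2, h3⟩, h4⟩, h5⟩, ⟨h1, h6⟩, h10⟩ := (((hr.and hη).and (hk.eventually
      (gt_mem_nhds (half_pos hδ)))).and (((he.eventually (gt_mem_nhds (half_pos hδ))).and
        (eventually_mem_interval P.fst.lt)).and hVD)).exists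
    have h7 := heq x h6
    rw [hGn] at h7
    have h8 : (1 - (f x / h x) ^ 2) * (k x ^ 2 - (V x - D) * h x ^ 2) ≤ 1 * k x ^ 2 := by
      have := mul_nonneg (sub_nonneg.2 h10) (sq_nonneg (h x))
      exact (mul_le_mul_of_nonneg_left (by linarith) (hκ.le.trans h2)).trans
        (mul_le_mul_of_nonneg_right h3 (sq_nonneg _))
    linarith
  refine ⟨sub_nonneg.1 (key 0 ((eventually_mem_interval P.snd.lt).mono fun x hx =>
    integral_sub_mul_nonneg hp' htb hqt hneg hpos hzero (interval_subset_halfInterval hx))),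
    fun hna => ?_⟩
  have haff : ∃ z ∈ interval a t, -p z ≠ -p q := by
    by_contra! hcon
    have hsub : interval a t ⊆ interval a b := interval_mono htb.le
    exact hna (affineBetween_of_rightDeriv P.snd.lt (hV.mono hsub) fun x hx =>
      (neg_injective (hcon x hx)) ▸ hd x (hsub hx))
  obtain ⟨η, hη, hGη⟩ := exists_pos_le_integral_sub_mul hp' P.continuousOn_sq_sub htb hqt hneg
    hpos hzero haff
  linarith [key η hGη]

end ModePair

end GroundState

/-! ### Finiteness, continuity at `b`, and the convexity statements. -/

namespace GroundState

variable {V : ℝ → ℝ} {a b : EReal}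

/-- For finite `a` the choice `r = a` makes the claim vacuous. The two kinds of left endpoint can
thus share one tightness argument. -/
lemma exists_forall_lt_le {t : EReal} (hat : a < t) (hbot : a = ⊥ → Tendsto V atBot atTop) (K : ℝ) :
    ∃ r : ℝ, ∀ x ∈ interval a t, x < r → K ≤ V x := by
  induction a with
  | bot =>
    obtain ⟨r, hr⟩ := eventually_atBot.1 ((hbot rfl).eventually_ge_atTop K)
    exact ⟨r, fun x _ hx => hr x hx.le⟩
  | coe α => exact ⟨α, fun x hx hxα => absurd (EReal.coe_lt_coe_iff.1 hx.1) hxα.not_gt⟩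
  | top => exact absurd hat not_top_lt

lemma exists_affine_le (hab : a < b) (hV : ConvexOn ℝ (interval a b) V) :
    ∃ c m : ℝ, ∀ x ∈ interval a b, V c + m * (x - c) ≤ V x := by
  obtain ⟨c, hc⟩ := exists_real_btw hab
  have hci : c ∈ interior (interval a b) := by rwa [(isOpen_interval a b).interior_eq]
  refine ⟨c, derivWithin V (Ioi c) c, fun x hx => ?_⟩
  rcases lt_trichotomy x c with h | h | h
  · have h1 := (hV.slope_le_leftDeriv_of_mem_interior hx hci h).trans
      (hV.leftDeriv_le_rightDeriv_of_mem_interior hci)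
    rw [slope_def_field, div_le_iff₀ (by linarith)] at h1
    linarith
  · rw [h, sub_self, mul_zero, add_zero]
  · have h1 := hV.rightDeriv_le_slope_of_mem_interior hci hx h
    rw [slope_def_field, le_div_iff₀ (by linarith)] at h1
    linarith

/-- A supporting line bounds `V` from below on bounded sets, up to and including `t = b`; far to the
left, when `a = -∞`, `V ≥ 0`. -/
lemma exists_lower_bound_of_convexOn (hV : ConvexOn ℝ (interval a b) V)
    (hbot : a = ⊥ → Tendsto V atBot atTop) {t : ℝ} (hat : a < (t : EReal)) (htb : (t : EReal) ≤ b) :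
    ∃ B, ∀ x ∈ interval a t, -B ≤ V x := by
  obtain ⟨c, m, hm⟩ := exists_affine_le (hat.trans_le htb) hV
  obtain ⟨r, hr⟩ := exists_forall_lt_le hat hbot 0
  refine ⟨|V c| + |m| * (|r| + |t| + |c|), fun x hx => ?_⟩
  have hnn : 0 ≤ |m| * (|r| + |t| + |c|) := by positivity
  rcases lt_or_ge x r with h | h
  · linarith [hr x hx h, abs_nonneg (V c)]
  have h1 := hm x (interval_mono htb hx)
  have h2 : |x - c| ≤ |r| + |t| + |c| := by
    have h3 := EReal.coe_lt_coe_iff.1 hx.2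
    rw [abs_le]
    constructor <;> linarith [neg_abs_le r, le_abs_self t, neg_abs_le c, le_abs_self c,
      abs_nonneg r, abs_nonneg t]
  have h4 := neg_abs_le (m * (x - c))
  rw [abs_mul] at h4
  linarith [mul_le_mul_of_nonneg_left h2 (abs_nonneg m), neg_abs_le (V c)]

lemma exists_lower_bound_of_continuousOn (hV : ContinuousOn V (interval ⊥ b))
    (hbot : Tendsto V atBot atTop) {t : ℝ} (htb : (t : EReal) < b) :
    ∃ B, ∀ x ∈ interval ⊥ t, -B ≤ V x := by
  obtain ⟨r, hr⟩ := exists_forall_lt_le (EReal.bot_lt_coe t) (fun _ => hbot) 0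
  obtain ⟨B, hB⟩ := isCompact_Icc.exists_bound_of_continuousOn (hV.mono fun x (hx : x ∈ Icc r t) =>
    ⟨EReal.bot_lt_coe x, (EReal.coe_le_coe_iff.2 hx.2).trans_lt htb⟩)
  refine ⟨|B|, fun x hx => ?_⟩
  rcases lt_or_ge x r with h | h
  · linarith [hr x hx h, abs_nonneg B]
  · have h1 := hB x ⟨h, (EReal.coe_lt_coe_iff.1 hx.2).le⟩
    linarith [neg_le_of_abs_le h1, le_abs_self B]

lemma groundEnergy_ne_bot_of_le {t : EReal} {B : ℝ} (hV : ContinuousOn V (interval a t))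
    (hB : ∀ x ∈ interval a t, -B ≤ V x) : groundEnergy V a t ≠ ⊥ := by
  refine ((EReal.bot_lt_coe (-B)).trans_le (le_groundEnergy hV fun φ hφ => ?_)).ne'
  have hms := measurableSet_interval a t
  rw [← integral_const_mul]
  refine setIntegral_mono_on (hφ.integrableOn_sq.const_mul _)
    (Integrable.add hφ.integrableOn_deriv_sq (hφ.integrableOn_mul_sq hms hV)) hms fun x hx => ?_
  linarith [mul_le_mul_of_nonneg_right (hB x hx) (sq_nonneg (φ x)), sq_nonneg (deriv φ x)]

lemma interior_finiteDomain_subset : interior (finiteDomain V a b) ⊆ interval a b := by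
  intro x hx
  obtain ⟨y, hy, hxy⟩ := ((eventually_nhdsWithin_of_eventually_nhds
    (mem_interior_iff_mem_nhds.1 hx)).and (self_mem_nhdsWithin (s := Ioi x))).exists
  exact ⟨(interior_subset hx).1, (EReal.coe_lt_coe_iff.2 hxy).trans_le hy.2.1⟩

lemma ordConnected_finiteDomain (hV : ContinuousOn V (interval a b)) :
    OrdConnected (finiteDomain V a b) := by
  refine ⟨fun x hx z hz y hy => ⟨hx.1.trans_le (EReal.coe_le_coe_iff.2 hy.1),
    (EReal.coe_le_coe_iff.2 hy.2).trans hz.2.1, ?_⟩⟩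
  exact ((bot_lt_iff_ne_bot.2 hz.2.2).trans_le
    (groundEnergy_anti_of_le hV (EReal.coe_le_coe_iff.2 hy.2) hz.2.1)).ne'

/-- An affine formula on `(a, t)` restricts to smaller `t`, so the excluded values of `t` form an
initial segment. -/
lemma ordConnected_nonaffine (hV : ContinuousOn V (interval a b)) :
    OrdConnected {t ∈ finiteDomain V a b | ¬ AffineBetween V a (t : EReal)} := by
  refine ⟨fun x hx z hz y hy => ⟨(ordConnected_finiteDomain hV).out hx.1 hz.1 hy, ?_⟩⟩
  rintro ⟨p, q, h⟩
  exact hx.2 ⟨p, q, fun w hw => h w (interval_subset_of_le hy.1 hw)⟩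

namespace Setting

lemma tendsto_atLeft (h : Setting V a b) (ha : a = ⊥) : Tendsto V (atLeft a) atTop := by
  rw [ha, atLeft_bot]; exact h.bot ha

lemma antitoneOn_lam (h : Setting V a b) : AntitoneOn (lam V a) (finiteDomain V a b) := by
  intro s hs t ht hst
  rw [← EReal.coe_le_coe_iff, GroundState.coe_lam h.cont hs, GroundState.coe_lam h.cont ht]
  exact groundEnergy_anti_of_le h.cont (EReal.coe_le_coe_iff.2 hst) ht.2.1

lemma differentiableOn_lam (h : Setting V a b) : DifferentiableOn ℝ (lam V a) (interval a b) :=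
  h.twice_differentiable.1.mono interval_subset_regularDomain

/-- At `b` only finiteness is available, since `V` need not be integrable there. Monotonicity gives
the lower half, and exhaustion by smaller intervals (`le_groundEnergy_of_forall_lt`) the upper half.
This carries convexity from the interior to `b`. -/
lemma continuousOn_lam (h : Setting V a b) : ContinuousOn (lam V a) (finiteDomain V a b) := by
  intro t ht
  by_cases htb : (t : EReal) = b
  · refine tendsto_order.2 ⟨fun r hr => ?_, fun r hr => ?_⟩
    · filter_upwards [self_mem_nhdsWithin] with s hs
      refine hr.trans_le (h.antitoneOn_lam hs ht (EReal.coe_le_coe_iff.1 ?_))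
      rw [htb]; exact hs.2.1
    · obtain ⟨s, hs, hsr⟩ : ∃ s ∈ interval a (t : EReal), groundEnergy V a (s : ℝ) < r := by
        by_contra! hcon
        have := le_groundEnergy_of_forall_lt ht.1 (h.cont.mono (interval_mono ht.2.1)) hcon
        rw [← GroundState.coe_lam h.cont ht, EReal.coe_le_coe_iff] at this
        linarith
      have hst := EReal.coe_lt_coe_iff.1 hs.2
      filter_upwards [self_mem_nhdsWithin, nhdsWithin_le_nhds (lt_mem_nhds hst)] with z hz hsz
      rw [← EReal.coe_lt_coe_iff, GroundState.coe_lam h.cont hz]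
      exact (groundEnergy_anti_of_le h.cont (EReal.coe_le_coe_iff.2 hsz.le) hz.2.1).trans_lt hsr
  · have hI : t ∈ interval a b := ⟨ht.1, ht.2.1.lt_of_ne htb⟩
    exact ((h.differentiableOn_lam t hI).differentiableAt
      ((isOpen_interval a b).mem_nhds hI)).continuousAt.continuousWithinAt

lemma eventually_deriv_bound (h : Setting V a b)
    {B : ℝ} (hB : ∀ᶠ x in atLeft a, B ≤ V x) {t E : ℝ} {f g : ℝ → ℝ}
    (F : Mode V a t E f g) : ∃ L, 0 < L ∧ ∀ᶠ x in atLeft a, 0 < g x ∧ g x ≤ L := by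
  have hp := F.eventually_deriv_pos (eventually_ge_or_le h.lt h.shape E)
  have key : ∃ L, 0 < L ∧ ∀ᶠ x in atLeft a, g x ≤ L := by
    by_cases ha : a = ⊥
    · refine F.eventually_deriv_le (B := 0) le_rfl ?_ fun _ => rfl
      simpa using (h.tendsto_atLeft ha).eventually_ge_atTop E
    · exact F.eventually_deriv_le (B := max 0 (E - B)) (le_max_left _ _)
        (hB.mono fun x hx => by linarith [le_max_right 0 (E - B)]) fun h => absurd h ha
  obtain ⟨L, hL, hb⟩ := key
  exact ⟨L, hL, hp.and hb⟩

lemma exists_modePair (h : Setting V a b)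
    {B : ℝ} (hB : ∀ᶠ x in atLeft a, B ≤ V x) {s t : ℝ} (hs : s ∈ interval a b)
    (ht : t ∈ interval a b) (hst : s < t) : ∃ u k f g,
    ModePair V a s t (lam V a s) (lam V a t) u k f g ∧
      deriv (lam V a) s = -(k s ^ 2) ∧ deriv (lam V a) t = -(g t ^ 2) := by
  obtain ⟨u, k, hu, huk⟩ := h.exists_mode hs
  obtain ⟨f, g, hf, hfg⟩ := h.exists_mode ht
  obtain ⟨L₁, hL₁, hb₁⟩ := h.eventually_deriv_bound hB hu
  obtain ⟨L₂, hL₂, hb₂⟩ := h.eventually_deriv_bound hB hf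
  refine ⟨u, k, f, g, ⟨hu, hf, hst, ?_, ⟨max L₁ L₂, lt_max_of_lt_left hL₁, ?_⟩, fun ha => ?_⟩,
    huk.deriv, hfg.deriv⟩
  · have htT := interval_subset_regularDomain (V := V) ht
    rw [← EReal.coe_lt_coe_iff, h.coe_lam htT, h.coe_lam (interval_subset_regularDomain hs)]
    exact h.groundEnergy_lt htT hs.1 hst
  · filter_upwards [hb₁, hb₂] with x h1 h2
    exact ⟨⟨h1.1, h1.2.trans (le_max_left _ _)⟩, h2.1, h2.2.trans (le_max_right _ _)⟩
  · have hE := fun E => (h.tendsto_atLeft ha).eventually_ge_atTop E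
    subst ha
    exact ⟨hu.tendsto_deriv_zero (hE _), hf.tendsto_deriv_zero (hE _)⟩

lemma deriv_lam_le_of_convexOn (h : Setting V a b)
    (hV : ConvexOn ℝ (interval a b) V) {s t : ℝ} (hs : s ∈ interval a b)
    (ht : t ∈ interval a b) (hst : s < t) : deriv (lam V a) s ≤ deriv (lam V a) t ∧
      ((¬ AffineBetween V a t ∨ a ≠ ⊥) → deriv (lam V a) s < deriv (lam V a) t) := by
  have hint := (isOpen_interval a b).interior_eq
  obtain ⟨B, hB⟩ := exists_lower_bound_of_convexOn hV h.bot ht.1 ht.2.le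
  obtain ⟨u, k, f, g, P, e₁, e₂⟩ :=
    h.exists_modePair ((eventually_mem_interval ht.1).mono hB) hs ht hst
  have hm := hV.monotoneOn_rightDeriv
  rw [hint] at hm
  have key := P.sq_le_sq_of_monotoneOn h.cont ht.2
    (fun x hx => hV.hasDerivWithinAt_rightDeriv_of_mem_interior (by rwa [hint])) hm
  rw [e₁, e₂]
  exact ⟨neg_le_neg key.1, fun hna => neg_lt_neg (key.2 hna)⟩

lemma deriv_lam_le_of_concaveOn (h : Setting V a b)
    (ha : a = ⊥) (hV : ConcaveOn ℝ (interval a b) V) {s t : ℝ}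
    (hs : s ∈ interval a b) (ht : t ∈ interval a b) (hst : s < t) :
    deriv (lam V a) t ≤ deriv (lam V a) s ∧
      (¬ AffineBetween V a t → deriv (lam V a) t < deriv (lam V a) s) := by
  have hint := (isOpen_interval a b).interior_eq
  have hE := fun E => (h.tendsto_atLeft ha).eventually_ge_atTop E
  obtain ⟨u, k, f, g, P, e₁, e₂⟩ := h.exists_modePair (hE 0) hs ht hst
  have hm := hV.neg.monotoneOn_rightDeriv
  rw [hint] at hm
  have key := P.sq_le_sq_of_antitoneOn h.cont ht.2
    (fun x hx => by
      simpa using (hV.neg.hasDerivWithinAt_rightDeriv_of_mem_interior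
        (by rwa [hint] : x ∈ interior (interval a b))).neg) hm.neg ha (hE _)
  rw [e₁, e₂]
  exact ⟨neg_le_neg key.1, fun hna => neg_lt_neg (key.2 hna)⟩

lemma convexOn_lam (h : Setting V a b) (hV : ConvexOn ℝ (interval a b) V) :
    ConvexOn ℝ (finiteDomain V a b) (lam V a) := by
  refine MonotoneOn.convexOn_of_deriv (ordConnected_finiteDomain h.cont).convex h.continuousOn_lam
    (h.differentiableOn_lam.mono interior_finiteDomain_subset) fun s hs t ht hst => ?_
  rcases hst.eq_or_lt with rfl | hst
  · exact le_rfl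
  · exact (h.deriv_lam_le_of_convexOn hV (interior_finiteDomain_subset hs)
      (interior_finiteDomain_subset ht) hst).1

lemma strictConvexOn_lam (h : Setting V a b) (hV : ConvexOn ℝ (interval a b) V) (ha : a ≠ ⊥) :
    StrictConvexOn ℝ (finiteDomain V a b) (lam V a) :=
  StrictMonoOn.strictConvexOn_of_deriv (ordConnected_finiteDomain h.cont).convex h.continuousOn_lam
    fun _ hs _ ht hst => (h.deriv_lam_le_of_convexOn hV (interior_finiteDomain_subset hs)
      (interior_finiteDomain_subset ht) hst).2 (Or.inr ha)

lemma strictConvexOn_lam_nonaffine (h : Setting V a b)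
    (hV : ConvexOn ℝ (interval a b) V) : StrictConvexOn ℝ
    {t ∈ finiteDomain V a b | ¬ AffineBetween V a (t : EReal)} (lam V a) := by
  refine StrictMonoOn.strictConvexOn_of_deriv (ordConnected_nonaffine h.cont).convex
    (h.continuousOn_lam.mono (sep_subset _ _)) fun s hs t ht hst => ?_
  exact (h.deriv_lam_le_of_convexOn hV
    (interior_finiteDomain_subset (interior_mono (sep_subset _ _) hs))
    (interior_finiteDomain_subset (interior_mono (sep_subset _ _) ht)) hst).2
    (Or.inl (interior_subset ht).2)

lemma concaveOn_lam (h : Setting V a b) (ha : a = ⊥) (hV : ConcaveOn ℝ (interval a b) V) :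
    ConcaveOn ℝ (finiteDomain V a b) (lam V a) := by
  refine AntitoneOn.concaveOn_of_deriv (ordConnected_finiteDomain h.cont).convex h.continuousOn_lam
    (h.differentiableOn_lam.mono interior_finiteDomain_subset) fun s hs t ht hst => ?_
  rcases hst.eq_or_lt with rfl | hst
  · exact le_rfl
  · exact (h.deriv_lam_le_of_concaveOn ha hV (interior_finiteDomain_subset hs)
      (interior_finiteDomain_subset ht) hst).1

lemma strictConcaveOn_lam_nonaffine (h : Setting V a b)
    (ha : a = ⊥) (hV : ConcaveOn ℝ (interval a b) V) :
    StrictConcaveOn ℝ {t ∈ finiteDomain V a b | ¬ AffineBetween V a (t : EReal)} (lam V a) := by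
  refine StrictAntiOn.strictConcaveOn_of_deriv (ordConnected_nonaffine h.cont).convex
    (h.continuousOn_lam.mono (sep_subset _ _)) fun s hs t ht hst => ?_
  exact (h.deriv_lam_le_of_concaveOn ha hV
    (interior_finiteDomain_subset (interior_mono (sep_subset _ _) hs))
    (interior_finiteDomain_subset (interior_mono (sep_subset _ _) ht)) hst).2
    (interior_subset ht).2

/-- The strict decrease `λ(s) > λ(t)` for `s < t` is what `exists_principal` needs to produce a
positive solution on `(a, t)` at the energy `λ(t)` itself. The point `t = b` is included without
integrability of `V` near `b`. -/
lemma exists_unique_minimizer (h : Setting V a b)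
    {t : ℝ} (hat : a < (t : EReal)) (htb : (t : EReal) ≤ b)
    (hbdd : BddBelow (V '' interval a (t : EReal))) : ∃ u, IsPositiveMinimizer V a t u ∧
      ∀ z, IsPositiveMinimizer V a t z → z =ᵐ[volume.restrict (interval a t)] u := by
  obtain ⟨B, hB⟩ := hbdd
  have hB' : ∀ x ∈ interval a (t : EReal), - -B ≤ V x := fun x hx => by
    rw [neg_neg]; exact hB (mem_image_of_mem V hx)
  have hVt := h.cont.mono (interval_mono htb)
  have hE := GroundState.coe_lam h.cont ⟨hat, htb, groundEnergy_ne_bot_of_le hVt hB'⟩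
  obtain ⟨f, g, hf, hpos, -⟩ := exists_principal (E := lam V a t) h.cont hat htb fun s hs => by
    rw [hE]
    exact h.strictAntiOn_groundEnergy ⟨hs.1, hs.2.le.trans htb⟩ ⟨hat, htb⟩ hs.2
  have hsub := interval_mono (a := a) htb
  exact PositiveSolution.exists_unique_minimizer ⟨hat, hVt, fun x hx => hf.hasDerivAt₁ (hsub hx),
    fun x hx => hf.hasDerivAt₂ (hsub hx), hpos⟩ hE.symm hB' (exists_forall_lt_le hat h.bot)

end Setting

end GroundState

theorem mainTheorem1 (a b : EReal) (hab : a < b) (V : ℝ → ℝ)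
    (hcont : ContinuousOn V (GroundState.interval a b))
    (hbot : a = ⊥ → Tendsto V atBot atTop)
    (hV : ConvexOn ℝ (GroundState.interval a b) V ∨
      (ConcaveOn ℝ (GroundState.interval a b) V ∧
        (a ≠ ⊥ → ∀ t ∈ Ioo a b, GroundState.groundEnergy V a t ≠ ⊥))) :
    -- `λ(t)` is a real number for `t ∈ (a, b)`, and at a finite `b` if `V` is convex or
    -- integrable near `b`
    (∀ t ∈ GroundState.interval a b, t ∈ GroundState.finiteDomain V a b) ∧
    (∀ t ∈ GroundState.regularDomain V a b, t ∈ GroundState.finiteDomain V a b) ∧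
    (ConvexOn ℝ (GroundState.interval a b) V →
      ∀ t : ℝ, a < (t : EReal) → (t : EReal) ≤ b → t ∈ GroundState.finiteDomain V a b) ∧
    (∀ t ∈ GroundState.finiteDomain V a b, GroundState.groundEnergy V a (t : EReal) ≠ ⊤) ∧
    -- `λ(t)` is attained by a unique positive minimizer
    (∀ t : ℝ, a < (t : EReal) → (t : EReal) ≤ b →
      BddBelow (V '' GroundState.interval a (t : EReal)) →
      ∃ u : ℝ → ℝ, GroundState.IsPositiveMinimizer V a t u ∧
        ∀ v : ℝ → ℝ, GroundState.IsPositiveMinimizer V a t v →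
          v =ᵐ[volume.restrict (GroundState.interval a (t : EReal))] u) ∧
    -- `λ` is twice differentiable
    DifferentiableOn ℝ (GroundState.lam V a) (GroundState.regularDomain V a b) ∧
    DifferentiableOn ℝ
      (derivWithin (GroundState.lam V a) (GroundState.regularDomain V a b))
      (GroundState.regularDomain V a b) ∧
    -- `λ` is strictly decreasing on `(a, b]`, and tends to infinity at `a`
    StrictAntiOn (GroundState.groundEnergy V a) (Ioc a b) ∧
    Tendsto (GroundState.groundEnergy V a) (𝓝[>] a) (𝓝 ⊤) ∧
    -- convexity
    (ConvexOn ℝ (GroundState.interval a b) V →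
      ConvexOn ℝ (GroundState.finiteDomain V a b) (GroundState.lam V a) ∧
      (a ≠ ⊥ → ¬ GroundState.AffineBetween V a b →
        StrictConvexOn ℝ (GroundState.finiteDomain V a b) (GroundState.lam V a)) ∧
      (a = ⊥ →
        StrictConvexOn ℝ
          {t ∈ GroundState.finiteDomain V a b | ¬ GroundState.AffineBetween V a (t : EReal)}
          (GroundState.lam V a))) ∧
    -- concavity
    (a = ⊥ → ConcaveOn ℝ (GroundState.interval a b) V →
      ConcaveOn ℝ (GroundState.finiteDomain V a b) (GroundState.lam V a) ∧
      StrictConcaveOn ℝ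
        {t ∈ GroundState.finiteDomain V a b | ¬ GroundState.AffineBetween V a (t : EReal)}
        (GroundState.lam V a)) := by
  -- A convex `V`, or any continuous `V` tending to infinity at `-∞`, is bounded below on `(a, t)`.
  -- In the remaining case, concave with `a` finite, finiteness is assumed.
  have hfin : ∀ t ∈ GroundState.interval a b, GroundState.groundEnergy V a (t : ℝ) ≠ ⊥ := by
    intro t ht
    have hVt := hcont.mono (GroundState.interval_mono ht.2.le)
    rcases hV with hV | ⟨-, hV⟩
    · obtain ⟨B, hB⟩ := GroundState.exists_lower_bound_of_convexOn hV hbot ht.1 ht.2.le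
      exact GroundState.groundEnergy_ne_bot_of_le hVt hB
    · by_cases ha : a = ⊥
      · subst ha
        obtain ⟨B, hB⟩ := GroundState.exists_lower_bound_of_continuousOn hcont (hbot rfl) ht.2
        exact GroundState.groundEnergy_ne_bot_of_le hVt hB
      · exact hV ha t ht
  have hreg : ∀ t ∈ GroundState.regularDomain V a b, t ∈ GroundState.finiteDomain V a b :=
    fun t ht => ⟨ht.1, GroundState.le_of_mem_regularDomain ht,
      GroundState.groundEnergy_ne_bot_of_mem_regularDomain hcont hfin ht⟩
  have h : GroundState.Setting V a b := ⟨hab, hcont, hbot, hV.imp_right And.left, hreg⟩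
  refine ⟨fun t ht => hreg t (GroundState.interval_subset_regularDomain ht), hreg,
    fun hV t hat htb => ⟨hat, htb, ?_⟩, fun t ht => GroundState.groundEnergy_ne_top ht.1
      (hcont.mono (GroundState.interval_mono ht.2.1)),
    fun t hat htb hbdd => h.exists_unique_minimizer hat htb hbdd, h.twice_differentiable.1,
    h.twice_differentiable.2, h.strictAntiOn_groundEnergy, h.tendsto_groundEnergy,
    fun hV => ⟨h.convexOn_lam hV, fun ha _ => h.strictConvexOn_lam hV ha,
      fun _ => h.strictConvexOn_lam_nonaffine hV⟩,
    fun ha hV => ⟨h.concaveOn_lam ha hV, h.strictConcaveOn_lam_nonaffine ha hV⟩⟩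
  obtain ⟨B, hB⟩ := GroundState.exists_lower_bound_of_convexOn hV hbot hat htb
  exact GroundState.groundEnergy_ne_bot_of_le
    (hcont.mono (GroundState.interval_mono htb)) hB
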